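/- **Theorem (higher-dimensional Kontsevich–Soibelman lemma).** *Setup.* Let $k$ be a field of characteristic $0$, $M$ a lattice of finite rank, $N=\mathrm{Hom}(M,\mathbb Z)$, $M_{\mathbb R}=M\otimes\mathbb R$. Let $P$ be a toric monoid (finitely generated, integral, saturated, with torsion-free group completion) with a homomorphism $r:P\to M$, let $\mathfrak m_P=P\setminus P^\times$, also regarded as an ideal of $k[P]$, and let $\widehat{k[P]}$ be the $\mathfrak m_P$-adic completion of $k[P]$. A *wall* is a triple $(\mathfrak d,v,f)$ with $\mathfrak d\subseteq M_{\mathbb R}$ a rational polyhedral cone of codimension one, $v\in M$ a primitive vector tangent to $\mathfrak d$ (its *direction*), and $f\in\widehat{k[P]}$ of the form $f=1+\sum_{p\in\mathfrak m_P}c_pz^p$, where every $p$ with $c_p\neq0$ has $r(p)=-av$ for some integer $a>0$. The wall is *incoming* if $\mathfrak d=\mathfrak d-\mathbb R_{\ge0}v$. A *scattering diagram* $\mathfrak D$ is a collection of walls (counted with multiplicity) such that for each $j\geq 0$ the collection $\mathfrak D_j$ of walls with $f\not\equiv1\bmod\mathfrak m_P^j$ is finite. Its singular locus $\mathrm{Sing}(\mathfrak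 D_j)$ is the union of the relative boundaries of the walls of $\mathfrak D_j$ and of the intersections of codimension at least two of pairs of walls of $\mathfrak D_j$. For $x\in M_{\mathbb R}$ put $f_{x,j}=\prod_{\mathfrak d\ni x}f_{\mathfrak d}\in k[P]/\mathfrak m_P^j$. Two diagrams $\mathfrak D,\mathfrak D'$ are *equivalent* if $f_{x,j}=f'_{x,j}$ for all $j$ and all $x\notin\mathrm{Sing}(\mathfrak D_j)\cup\mathrm{Sing}(\mathfrak D'_j)$. A path that crosses a wall of $\mathfrak D_j$ transversally, outside of $\mathrm{Sing}(\mathfrak D_j)$, defines the wall-crossing transformation $\exp(\log(f)\,\partial_n)$, where $n\in N$ is the primitive normal vector of the wall that is positive just before the crossing. It is an element of the tropical vertex group $\exp\big(\bigoplus_{p\in P\setminus\mathfrak m_P^j,\ r(p)\ne0}z^p\,(k\otimes r(p)^\perp)\big)$, which acts faithfully on $(k[P]/\mathfrak m_P^j)[M]$ by $z^p\partial_n(z^{p'}z^m)=\langle n,r(p')+m\rangle z^{p+p'}z^m$; thus the transformation is $z^pz^m\mapsto f^{\langle n,r(p)+m\rangle}z^pz^m$. The *path-ordered product* is the composition $\theta_s\circ\cdots\circ\theta_1$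 of the transformations of the walls crossed, in the order in which they are crossed. A *joint* of $\mathfrak D_j$ is a polyhedral subset of codimension two of $\mathrm{Sing}(\mathfrak D_j)$, maximal with the property that the collection of walls of $\mathfrak D_j$ containing a point of its relative interior is independent of the point. $\mathfrak D$ is *consistent* if for all $j$ the path-ordered product of $\mathfrak D_j$ along a small loop around any joint of $\mathfrak D_j$ is the identity. A *tropical hypersurface* in $L_{\mathbb R}$, for a lattice $L$ of rank $\ell$, is a finite fan $\mathcal T$ of strictly convex rational polyhedral cones whose support has pure dimension $\ell-1$, with a positive integer weight $w_\sigma$ on each cone $\sigma$ of dimension $\ell-1$, such that for each $\omega\in\mathcal T$ of dimension $\ell-2$ and a small loop around an interior point of $\omega$, crossing the cones $\sigma_1,\dots,\sigma_p$ of dimension $\ell-1$ containing $\omega$, $\sum_iw_{\sigma_i}n_i=0$, where $n_i$ is the primitive normal vector of $\sigma_i$ that is positive just before the crossing. A *widget* is given by a complete fan $\Sigma$ in $M_{\mathbb R}$, a ray $\mathbb R_{\ge0}m_0\in\Sigma$ with $m_0\in M$ primitive, a tropical hypersurface $\mathcal T$ in $(M/\mathbb Zm_0)_{\mathbb R}$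 whose maximal cones are codimension one cones of the quotient fan $\{\pi(\tau)\mid\tau\in\Sigma,\ m_0\in\tau\}$, where $\pi:M_{\mathbb R}\to M_{\mathbb R}/\mathbb Rm_0$ is the projection, and $f_0=1+\sum_{p\in\mathfrak m_P}c_pz^p\in\widehat{k[P]}$, where every $p$ with $c_p\ne0$ has $r(p)$ a positive multiple of $m_0$. It is the scattering diagram of all walls $(\mathfrak d_\sigma,-m_0,f_0^{w_\sigma})$, $\sigma$ a maximal cone of $\mathcal T$, with $\mathfrak d_\sigma\in\Sigma$ the unique codimension one cone that contains $m_0$ and satisfies $\pi(\mathfrak d_\sigma)=\sigma$. (These walls are incoming.) *Statement.* Let $\mathfrak D$ be the union, with multiplicities, of finitely many widgets. Then there is a consistent scattering diagram $\mathrm{Scatter}(\mathfrak D)$ containing $\mathfrak D$ such that $\mathrm{Scatter}(\mathfrak D)\setminus\mathfrak D$ consists only of non-incoming walls. Moreover, any two scattering diagrams with these properties are equivalent. -/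

import Mathlib

open scoped TensorProduct Topology

universe v

noncomputable section

namespace Scattering

/-! ### Lattices, rational cones, fans -/

section Lattice

variable {M : Type v} [AddCommGroup M]

/-- The real vector space `M_ℝ = ℝ ⊗ M`. -/
abbrev RealSpan (M : Type v) [AddCommGroup M] : Type v := ℝ ⊗[ℤ] M

/-- The dual lattice `N = Hom(M, ℤ)`. -/
abbrev DualLat (M : Type v) [AddCommGroup M] : Type v := Module.Dual ℤ M

/-- The canonical map `M → M_ℝ`. -/
def incl (m : M) : RealSpan M := (1 : ℝ) ⊗ₜ[ℤ] m

/-- An element of `N`, viewed as a linear functional on `M_ℝ`. -/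
def pair (n : DualLat M) : RealSpan M →ₗ[ℝ] ℝ :=
  (TensorProduct.AlgebraTensorModule.rid ℤ ℝ ℝ).toLinearMap ∘ₗ LinearMap.baseChange ℝ n

theorem pair_tmul (n : DualLat M) (c : ℝ) (m : M) : pair n (c ⊗ₜ[ℤ] m) = n m * c := by
  simp [pair]

/-- A primitive vector of a lattice (in particular it is nonzero). -/
def IsPrimitive {L : Type*} [AddCommGroup L] (m : L) : Prop :=
  ∀ (c : ℤ) (m' : L), m = c • m' → IsUnit c

/-- A rational polyhedral cone: generated by finitely many lattice vectors. -/
def IsRational (σ : PointedCone ℝ (RealSpan M)) : Prop :=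
  ∃ s : Set M, s.Finite ∧ σ = PointedCone.hull ℝ (incl '' s)

/-- The linear span of a cone. -/
def lin (σ : PointedCone ℝ (RealSpan M)) : Submodule ℝ (RealSpan M) :=
  Submodule.span ℝ (σ : Set (RealSpan M))

/-- The dimension of a cone. -/
def dim (σ : PointedCone ℝ (RealSpan M)) : ℕ := Module.finrank ℝ (lin σ)

/-- The dimension of `M_ℝ`. -/
def ambientDim (M : Type v) [AddCommGroup M] : ℕ := Module.finrank ℝ (RealSpan M)

/-- The relative interior of a cone: the points from which one can move a little
in every direction of the linear span. -/
def relInt (σ : PointedCone ℝ (RealSpan M)) : Set (RealSpan M) :=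
  {x | x ∈ σ ∧ ∀ y ∈ lin σ, ∃ ε : ℝ, 0 < ε ∧ x + ε • y ∈ σ}

/-- The relative boundary of a cone. -/
def relBdry (σ : PointedCone ℝ (RealSpan M)) : Set (RealSpan M) := (σ : Set (RealSpan M)) \ relInt σ

/-- A (finite) fan of strictly convex rational polyhedral cones. -/
structure Fan (M : Type v) [AddCommGroup M] where
  cones : Set (PointedCone ℝ (RealSpan M))
  finite : cones.Finite
  rational : ∀ σ ∈ cones, IsRational σ
  strictlyConvex : ∀ σ ∈ cones, σ.lineal = ⊥
  face_mem : ∀ σ ∈ cones, ∀ τ : PointedCone ℝ (RealSpan M), τ.IsFaceOf σ → τ ∈ cones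
  inter_face : ∀ σ ∈ cones, ∀ τ ∈ cones, (σ ⊓ τ).IsFaceOf σ

/-- A fan is complete if its cones cover `M_ℝ`. -/
def Fan.IsComplete (F : Fan M) : Prop := ∀ x : RealSpan M, ∃ σ ∈ F.cones, x ∈ σ

/-- The circular path with centre `x` and radius `ε` in the plane through `x` spanned by
`u` and `w`, traversed once for `t ∈ [0, 2π]`. -/
def circle (x u w : RealSpan M) (ε t : ℝ) : RealSpan M := x + ε • (Real.cos t • u + Real.sin t • w)

/-- The path `γ` crosses the codimension one cone `σ` at time `t`, from one side of the
hyperplane spanned by `σ` to the other, and `n ∈ N` is the primitive normal vector of `σ`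
that is positive on `γ` just before `t`. -/
structure CrossesAt (γ : ℝ → RealSpan M) (σ : PointedCone ℝ (RealSpan M)) (t : ℝ) (n : DualLat M) :
    Prop where
  mem : γ t ∈ σ
  primitive : IsPrimitive n
  normal : ∀ y ∈ σ, pair n y = 0
  before : ∃ δ : ℝ, 0 < δ ∧ ∀ s ∈ Set.Ioo (t - δ) t, 0 < pair n (γ s)
  after : ∃ δ : ℝ, 0 < δ ∧ ∀ s ∈ Set.Ioo t (t + δ), pair n (γ s) < 0

/-- A tropical hypersurface in `M_ℝ`: a fan whose support is of pure codimension one, with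
positive integer weights on its cones of codimension one, satisfying the balancing condition
`∑ wᵢ nᵢ = 0` for small loops around the interior points of the cones of codimension two.
(A small loop around an interior point of `ω` meets exactly the cones containing `ω`.)
The values of `weight` on other cones play no role. -/
structure TropicalHypersurface (M : Type v) [AddCommGroup M] extends Fan M where
  pure : ∀ σ ∈ cones, ∃ τ ∈ cones, σ ≤ τ ∧ dim τ + 1 = ambientDim M
  weight : PointedCone ℝ (RealSpan M) → ℕ
  weight_pos : ∀ σ ∈ cones, dim σ + 1 = ambientDim M → 0 < weight σ
  balanced : ∀ ω ∈ cones, dim ω + 2 = ambientDim M → ∀ x ∈ relInt ω, ∀ u w : RealSpan M,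
    IsCompl (lin ω) (Submodule.span ℝ {u, w}) →
    ∀ᶠ ε in 𝓝[>] (0 : ℝ), ∀ n : PointedCone ℝ (RealSpan M) → DualLat M,
      (∀ σ ∈ cones, dim σ + 1 = ambientDim M → ω ≤ σ →
        ∃ t, CrossesAt (circle x u w ε) σ t (n σ)) →
      ∑ᶠ σ ∈ {σ | σ ∈ cones ∧ dim σ + 1 = ambientDim M ∧ ω ≤ σ}, weight σ • n σ = 0

/-- The set of cones of codimension one of a tropical hypersurface. -/
def TropicalHypersurface.maxCones (T : TropicalHypersurface M) :
    Set (PointedCone ℝ (RealSpan M)) :=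
  {σ | σ ∈ T.cones ∧ dim σ + 1 = ambientDim M}

/-- The quotient lattice `M / ℤ m₀`. -/
abbrev QuotLattice (m₀ : M) : Type v := M ⧸ (Submodule.span ℤ {m₀} : Submodule ℤ M)

/-- The projection `π : M_ℝ → (M / ℤ m₀)_ℝ = M_ℝ / ℝ m₀`. -/
def proj (m₀ : M) : RealSpan M →ₗ[ℝ] RealSpan (QuotLattice m₀) :=
  LinearMap.baseChange ℝ (Submodule.mkQ (Submodule.span ℤ {m₀}))

/-- The ray generated by a lattice vector. -/
def ray (m : M) : PointedCone ℝ (RealSpan M) := PointedCone.hull ℝ {incl m}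

/-- The cones of codimension one of `Σ` that contain the ray of `m₀`. -/
def starCells (F : Fan M) (m₀ : M) : Set (PointedCone ℝ (RealSpan M)) :=
  {d | d ∈ F.cones ∧ dim d + 1 = ambientDim M ∧ ray m₀ ≤ d}

end Lattice

/-! ### Monoid rings, their completions, and wall-crossing automorphisms -/

section Algebra

/-- Toric monoids: finitely generated, integral, with torsion-free group completion, saturated. -/
structure IsToricMonoid (P : Type*) [AddCommMonoid P] : Prop where
  fg : AddMonoid.FG P
  cancel : ∀ a b c : P, a + b = a + c → b = c
  torsionFree : ∀ (j : ℕ) (a b : P), 0 < j → j • a = j • b → a = b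
  saturated : ∀ (j : ℕ) (a b c : P), 0 < j → j • a = j • b + c → ∃ d, a = b + d

variable (k : Type*) [Field k] {P : Type*} [AddCommMonoid P]

/-- The monomial `z^p` of `k[P]`. -/
def mono (p : P) : AddMonoidAlgebra k P := AddMonoidAlgebra.single p 1

variable (P) in
/-- The monomial ideal `𝔪_P` of `k[P]` generated by the non-invertible elements of `P`. -/
def mIdeal : Ideal (AddMonoidAlgebra k P) :=
  Ideal.span {f | ∃ p : P, ¬ IsAddUnit p ∧ f = mono k p}

variable (P) in
/-- The ring `k[P] / 𝔪_P^j`. -/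
abbrev Lvl (j : ℕ) : Type _ := AddMonoidAlgebra k P ⧸ (mIdeal k P ^ j)

variable (P) in
/-- The completion of `k[P]` with respect to `𝔪_P`. -/
abbrev Compl : Type _ := AdicCompletion (mIdeal k P) (AddMonoidAlgebra k P)

variable {k}

/-- Reduction of an invertible element of the completion modulo `𝔪_P^j`. -/
def red (j : ℕ) : (Compl k P)ˣ →* (Lvl k P j)ˣ :=
  Units.map (AdicCompletion.evalₐ (mIdeal k P) j : Compl k P →* Lvl k P j)

variable {M : Type v} [AddCommGroup M] (r : P →+ M)

/-- `f` is of the form `1 + ∑ c_p z^p`, the sum being over `p ∈ 𝔪_P` with `r(p)` a positive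
multiple of `v`, i.e. this holds modulo every power of `𝔪_P`. -/
def ExponentsAlong (f : Compl k P) (v : M) : Prop :=
  ∀ j : ℕ, AdicCompletion.evalₐ (mIdeal k P) j f - 1 ∈
    Submodule.span k {g : Lvl k P j | ∃ p : P, ¬ IsAddUnit p ∧ (∃ c : ℕ, 0 < c ∧ r p = c • v) ∧
      g = Ideal.Quotient.mk (mIdeal k P ^ j) (mono k p)}

theorem ExponentsAlong.pow {r : P →+ M} {f : Compl k P} {v : M} (hf : ExponentsAlong r f v)
    (a : ℕ) : ExponentsAlong r (f ^ a) v := by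
  have hone : ExponentsAlong r (1 : Compl k P) v := fun j => by simp
  have hmul : ∀ g h : Compl k P, ExponentsAlong r g v → ExponentsAlong r h v →
      ExponentsAlong r (g * h) v := by
    intro g h hg hh j
    set S := Submodule.span k {g : Lvl k P j | ∃ p : P, ¬ IsAddUnit p ∧
      (∃ c : ℕ, 0 < c ∧ r p = c • v) ∧ g = Ideal.Quotient.mk (mIdeal k P ^ j) (mono k p)} with hS
    have hSS : S * S ≤ S := by
      rw [hS, Submodule.span_mul_span, Submodule.span_le]
      rintro _ ⟨_, ⟨p, hp, ⟨c, hc, hpc⟩, rfl⟩, _, ⟨p', hp', ⟨c', hc', hpc'⟩, rfl⟩, rfl⟩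
      refine Submodule.subset_span ⟨p + p', fun hu => hp (isAddUnit_of_add_isAddUnit_left hu),
        ⟨c + c', by omega, by rw [map_add, hpc, hpc', add_smul]⟩, ?_⟩
      simp [← map_mul, mono, AddMonoidAlgebra.single_mul_single]
    have e : AdicCompletion.evalₐ (mIdeal k P) j (g * h) - 1 =
        (AdicCompletion.evalₐ (mIdeal k P) j g - 1) * (AdicCompletion.evalₐ (mIdeal k P) j h - 1)
        + (AdicCompletion.evalₐ (mIdeal k P) j g - 1)
        + (AdicCompletion.evalₐ (mIdeal k P) j h - 1) := by
      rw [map_mul]; ring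
    rw [e]
    exact S.add_mem (S.add_mem (hSS (Submodule.mul_mem_mul (hg j) (hh j))) (hg j)) (hh j)
  induction a with
  | zero => simpa using hone
  | succ a ih => rw [pow_succ]; exact hmul _ _ ih hf

/-- The homomorphism `m ↦ u ^ ⟨n, m⟩`. -/
def unitPow {R : Type*} [CommRing R] (u : Rˣ) (n : DualLat M) : Multiplicative M →* Rˣ where
  toFun m := u ^ (n m.toAdd)
  map_one' := by simp
  map_mul' a b := by simp [zpow_add]

/-- The homomorphism `k[P] → k[P]/𝔪_P^j`, `z^p ↦ u ^ ⟨n, r(p)⟩ z^p`. -/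
def crossAux {j : ℕ} (u : (Lvl k P j)ˣ) (n : DualLat M) : AddMonoidAlgebra k P →ₐ[k] Lvl k P j :=
  AddMonoidAlgebra.lift k (Lvl k P j) P
    { toFun := fun p => (u ^ (n (r p.toAdd)) : (Lvl k P j)ˣ) *
        Ideal.Quotient.mk (mIdeal k P ^ j) (mono k p.toAdd)
      map_one' := by
        have : mono k (0 : P) = 1 := rfl
        simp [this]
      map_mul' := fun a b => by
        have : mono k (a.toAdd + b.toAdd) = mono k a.toAdd * mono k b.toAdd := by
          simp [mono, AddMonoidAlgebra.single_mul_single]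
        simp only [toAdd_mul, this, map_add, zpow_add, Units.val_mul, map_mul]
        ring }

theorem crossAux_mono {j : ℕ} (u : (Lvl k P j)ˣ) (n : DualLat M) (p : P) :
    crossAux r u n (mono k p) = (u ^ (n (r p)) : (Lvl k P j)ˣ) *
      Ideal.Quotient.mk (mIdeal k P ^ j) (mono k p) := by
  simp [crossAux, mono, AddMonoidAlgebra.lift_single]

theorem crossAux_eq_zero {j : ℕ} (u : (Lvl k P j)ˣ) (n : DualLat M) (a : AddMonoidAlgebra k P)
    (ha : a ∈ mIdeal k P ^ j) : (crossAux r u n : AddMonoidAlgebra k P →+* Lvl k P j) a = 0 := by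
  set φ : AddMonoidAlgebra k P →+* Lvl k P j := (crossAux r u n : AddMonoidAlgebra k P →+* Lvl k P j) with hφ
  set q := Ideal.Quotient.mk (mIdeal k P ^ j) with hq
  have h1 : Ideal.map φ (mIdeal k P) ≤ Ideal.map q (mIdeal k P) := by
    rw [Ideal.map_le_iff_le_comap]
    refine Ideal.span_le.2 ?_
    rintro _ ⟨p, hp, rfl⟩
    have : φ (mono k p) = (u ^ (n (r p)) : (Lvl k P j)ˣ) * q (mono k p) := crossAux_mono r u n p
    rw [SetLike.mem_coe, Ideal.mem_comap, this]
    exact Ideal.mul_mem_left _ _ (Ideal.mem_map_of_mem _ (Ideal.subset_span ⟨p, hp, rfl⟩))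
  have h2 : φ a ∈ Ideal.map φ (mIdeal k P) ^ j := by
    rw [← Ideal.map_pow]; exact Ideal.mem_map_of_mem _ ha
  have h3 : φ a ∈ Ideal.map q (mIdeal k P) ^ j := Ideal.pow_right_mono h1 j h2
  rw [← Ideal.map_pow, hq, Ideal.map_quotient_self] at h3
  exact h3

/-- The wall-crossing automorphism of `k[P]/𝔪_P^j`, `z^p ↦ u ^ ⟨n, r(p)⟩ z^p`. -/
def crossBase {j : ℕ} (u : (Lvl k P j)ˣ) (n : DualLat M) : Lvl k P j →+* Lvl k P j :=
  Ideal.Quotient.lift (mIdeal k P ^ j) (crossAux r u n : AddMonoidAlgebra k P →+* Lvl k P j)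
    (crossAux_eq_zero r u n)

/-- The wall-crossing transformation attached to `u` and `n`, as an element of the tropical vertex
group modulo `𝔪_P^j`.

The group `exp(⨁_{r(p) ≠ 0} z^p (k ⊗ r(p)^⊥))` (product given by the Baker-Campbell-Hausdorff
formula) is realised through its faithful action on `(k[P]/𝔪_P^j)[M]`, in which
`z^p ∂_n` acts by `z^{p'} z^m ↦ ⟨n, r(p') + m⟩ z^{p+p'} z^m`.  (Its action on
`k[P]/𝔪_P^j` alone is not faithful if `r(P)` does not span `M_ℝ`.)  So
`exp (log u ∂_n)` acts by `z^p z^m ↦ u ^ ⟨n, r(p) + m⟩ z^p z^m`. -/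
def wallCross {j : ℕ} (u : (Lvl k P j)ˣ) (n : DualLat M) :
    AddMonoidAlgebra (Lvl k P j) M →+* AddMonoidAlgebra (Lvl k P j) M :=
  AddMonoidAlgebra.liftNCRingHom
    ((algebraMap (Lvl k P j) (AddMonoidAlgebra (Lvl k P j) M)).comp (crossBase r u n))
    { toFun := fun m => AddMonoidAlgebra.single m.toAdd ((unitPow u n m : (Lvl k P j)ˣ) : Lvl k P j)
      map_one' := by
        have : (unitPow u n : Multiplicative M →* (Lvl k P j)ˣ) 1 = 1 := map_one _
        rw [this]; rfl
      map_mul' := fun a b => by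
        simp [AddMonoidAlgebra.single_mul_single] }
    (fun _ _ => mul_comm (G := AddMonoidAlgebra (Lvl k P j) M) _ _)

theorem wallCross_single {j : ℕ} (u : (Lvl k P j)ˣ) (n : DualLat M) (p : P) (m : M) :
    wallCross r u n
        (AddMonoidAlgebra.single m (Ideal.Quotient.mk (mIdeal k P ^ j) (mono k p))) =
      AddMonoidAlgebra.single m (((u ^ (n (r p + m)) : (Lvl k P j)ˣ) : Lvl k P j) *
        Ideal.Quotient.mk (mIdeal k P ^ j) (mono k p)) := by
  have : crossBase r u n (Ideal.Quotient.mk (mIdeal k P ^ j) (mono k p)) =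
      (u ^ (n (r p)) : (Lvl k P j)ˣ) * Ideal.Quotient.mk (mIdeal k P ^ j) (mono k p) :=
    crossAux_mono r u n p
  simp only [wallCross]
  erw [AddMonoidAlgebra.liftNCRingHom_single]
  simp only [RingHom.comp_apply, this]
  simp only [AddMonoidAlgebra.coe_algebraMap, unitPow, MonoidHom.coe_mk, OneHom.coe_mk,
    Function.comp_apply, Algebra.algebraMap_self, RingHom.id_apply,
    AddMonoidAlgebra.single_mul_single, zero_add, toAdd_ofAdd, map_add, zpow_add, Units.val_mul]
  congr 1
  ring

end Algebra

/-! ### Scattering diagrams -/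

section Diagrams

variable {k : Type*} [Field k] {P : Type*} [AddCommMonoid P] {M : Type v} [AddCommGroup M]

/-- A wall in `M_ℝ`: a rational polyhedral cone of codimension one, a primitive vector tangent to
it (its direction), and an attached function `1 + ∑ c_p z^p`, `p ∈ 𝔪_P`, with each `r(p)` a negative
multiple of the direction.  Such a series is automatically invertible in the completion of `k[P]`,
so the function is recorded as a unit. -/
structure Wall (k : Type*) [Field k] {P : Type*} [AddCommMonoid P] {M : Type v} [AddCommGroup M]
    (r : P →+ M) where
  cone : PointedCone ℝ (RealSpan M)
  rational : IsRational cone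
  codim_one : dim cone + 1 = ambientDim M
  direction : M
  primitive : IsPrimitive direction
  tangent : incl direction ∈ lin cone
  func : (Compl k P)ˣ
  exponents : ExponentsAlong r (func : Compl k P) (-direction)

variable {r : P →+ M}

/-- A wall `𝔡` with direction `v` is incoming if `𝔡 = 𝔡 - ℝ_{≥ 0} v`. -/
def Wall.IsIncoming (d : Wall k r) : Prop :=
  (d.cone : Set (RealSpan M)) =
    {y | ∃ x ∈ d.cone, ∃ c : ℝ, 0 ≤ c ∧ y = x - c • incl d.direction}

/-- A scattering diagram over the completion of `k[P]`: a family of walls (the same wall may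
occur several times), only finitely many of which are nontrivial modulo each `𝔪_P^j`. -/
structure ScatteringDiagram (k : Type*) [Field k] {P : Type*} [AddCommMonoid P] {M : Type v}
    [AddCommGroup M] (r : P →+ M) where
  ι : Type v
  wall : ι → Wall k r
  finite : ∀ j : ℕ, {i | red j (wall i).func ≠ 1}.Finite

namespace ScatteringDiagram

variable (D : ScatteringDiagram k r) (j : ℕ)

/-- The (finite) set of walls of `D` that are nontrivial modulo `𝔪_P^j`. -/
def active : Set D.ι := {i | red j (D.wall i).func ≠ 1}

/-- The support of `D` modulo `𝔪_P^j`. -/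
def supp : Set (RealSpan M) := {x | ∃ i ∈ D.active j, x ∈ (D.wall i).cone}

/-- The singular locus of `D` modulo `𝔪_P^j`: the union of the relative boundaries of the walls and
of the pairwise intersections of walls that have codimension at least two. -/
def sing : Set (RealSpan M) :=
  {x | (∃ i ∈ D.active j, x ∈ relBdry (D.wall i).cone) ∨
    ∃ i ∈ D.active j, ∃ i' ∈ D.active j,
      dim ((D.wall i).cone ⊓ (D.wall i').cone) + 2 ≤ ambientDim M ∧
      x ∈ (D.wall i).cone ⊓ (D.wall i').cone}

/-- The function `f_x` modulo `𝔪_P^j`: the product of the functions of the walls containing `x`.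
(All but finitely many factors are `1`.) -/
def funcAt (x : RealSpan M) : (Lvl k P j)ˣ :=
  ∏ᶠ i ∈ {i | x ∈ (D.wall i).cone}, red j (D.wall i).func

/-- Two scattering diagrams are equivalent if, to every order, `f_x = f'_x` for all `x` outside
of the singular loci. -/
def Equivalent (D D' : ScatteringDiagram k r) : Prop :=
  ∀ (j : ℕ) (x : RealSpan M), x ∉ D.sing j → x ∉ D'.sing j → D.funcAt j x = D'.funcAt j x

/-- `L` is the list of all pairs `(t, n)`, in increasing order of `t`, such that `γ : [a, b] → M_ℝ`
crosses the support of `D` modulo `𝔪_P^j` at time `t`, and `n` is the primitive normal vector of the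
walls crossed at time `t`, positive on `γ` just before `t`.  The path `γ` avoids the singular
locus, is transversal to the walls, and its end points are not on the walls. -/
structure IsCrossingList (γ : ℝ → RealSpan M) (a b : ℝ) (L : List (ℝ × DualLat M)) : Prop where
  avoids : ∀ t ∈ Set.Icc a b, γ t ∉ D.sing j
  sorted : L.Pairwise (fun p q => p.1 < q.1)
  mem_iff : ∀ t ∈ Set.Icc a b, γ t ∈ D.supp j ↔ ∃ n, (t, n) ∈ L
  interior : ∀ p ∈ L, p.1 ∈ Set.Ioo a b
  crosses : ∀ p ∈ L, ∀ i ∈ D.active j, γ p.1 ∈ (D.wall i).cone →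
    CrossesAt γ (D.wall i).cone p.1 p.2

/-- The path-ordered product `θ_s ∘ ⋯ ∘ θ_1` along a path with crossing list `L`, modulo `𝔪_P^j`.
The wall-crossing transformations of the walls crossed at the same time `t` commute and
compose to the one defined by the product `f_{γ(t)}` of their functions. -/
def pathProduct (γ : ℝ → RealSpan M) (L : List (ℝ × DualLat M)) :
    AddMonoidAlgebra (Lvl k P j) M →+* AddMonoidAlgebra (Lvl k P j) M :=
  (L.map fun p => wallCross r (D.funcAt j (γ p.1)) p.2).reverse.prod

/-- `𝔧` is (a piece of) a joint of `D` modulo `𝔪_P^j`: a rational cone of codimension two in the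
singular locus such that the set of walls containing a point of its relative interior does not
depend on the point.  Maximality is not imposed, as it does not matter for consistency: a small
loop around a piece of a joint is a small loop around the joint. -/
structure IsJoint (𝔧 : PointedCone ℝ (RealSpan M)) : Prop where
  rational : IsRational 𝔧
  codim_two : dim 𝔧 + 2 = ambientDim M
  le_sing : (𝔧 : Set (RealSpan M)) ⊆ D.sing j
  const : ∀ x ∈ relInt 𝔧, ∀ y ∈ relInt 𝔧, ∀ i ∈ D.active j,
    x ∈ (D.wall i).cone ↔ y ∈ (D.wall i).cone

/-- `D` is consistent if, to every order, the path-ordered product along small loops around each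
joint is the identity.  The loops are the small circles, in all planes transversal to the joint
and with all starting directions, around the points of the relative interior of the joint. -/
def IsConsistent : Prop :=
  ∀ (j : ℕ) (𝔧 : PointedCone ℝ (RealSpan M)), D.IsJoint j 𝔧 → ∀ x ∈ relInt 𝔧,
    ∀ u w : RealSpan M, IsCompl (lin 𝔧) (Submodule.span ℝ {u, w}) →
      ∀ᶠ ε in 𝓝[>] (0 : ℝ), ∀ L : List (ℝ × DualLat M),
        D.IsCrossingList j (circle x u w ε) 0 (2 * Real.pi) L →
          D.pathProduct j (circle x u w ε) L = RingHom.id _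

/-- `S` is a consistent scattering diagram containing `D` (walls being counted with
multiplicity) such that all walls of `S` not belonging to `D` are non-incoming. -/
def IsScatter (D S : ScatteringDiagram k r) : Prop :=
  S.IsConsistent ∧ ∃ e : D.ι ↪ S.ι, (∀ i, S.wall (e i) = D.wall i) ∧
    ∀ i, i ∉ Set.range e → ¬ (S.wall i).IsIncoming

end ScatteringDiagram

/-! ### Widgets -/

/-- The data defining a widget: a complete fan `Σ`, a ray of `Σ` with primitive generator `m₀`, a
tropical hypersurface in `(M / ℤ m₀)_ℝ` whose maximal cones are cones of codimension one of the
quotient fan `{π(σ) | σ ∈ Σ, ℝ_{≥ 0} m₀ ⊆ σ}`, and a function `f₀ = 1 + ∑ c_p z^p`, `p ∈ 𝔪_P`, with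
each `r(p)` a positive multiple of `m₀`. -/
structure Widget (k : Type*) [Field k] {P : Type*} [AddCommMonoid P] {M : Type v}
    [AddCommGroup M] (r : P →+ M) where
  fan : Fan M
  complete : fan.IsComplete
  m₀ : M
  primitive : IsPrimitive m₀
  ray_mem : ray m₀ ∈ fan.cones
  hyp : TropicalHypersurface (QuotLattice m₀)
  cells : ∀ σ ∈ hyp.maxCones, ∃ d ∈ starCells fan m₀, d.map (proj m₀) = σ
  func : (Compl k P)ˣ
  exponents : ExponentsAlong r (func : Compl k P) m₀

variable (W : Widget k r)

/-- The cones `𝔡_σ` of codimension one of `Σ`, containing the ray of `m₀`, with `π(𝔡_σ) = σ` a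
maximal cone of the tropical hypersurface. -/
def Widget.Index : Type v :=
  {d : PointedCone ℝ (RealSpan M) // d ∈ starCells W.fan W.m₀ ∧
    d.map (proj W.m₀) ∈ W.hyp.maxCones}

theorem Widget.finite_index : Finite W.Index :=
  (W.fan.finite.subset fun _ h => h.1.1).to_subtype

/-- The wall `(𝔡_σ, f₀ ^ w_σ)` of a widget; its direction is `-m₀`. -/
def Widget.wall (i : W.Index) : Wall k r where
  cone := i.1
  rational := W.fan.rational _ i.2.1.1
  codim_one := i.2.1.2.1
  direction := -W.m₀
  primitive := fun c m' h => W.primitive c (-m') (by rw [smul_neg, ← h, neg_neg])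
  tangent := by
    have h : incl W.m₀ ∈ lin i.1 := Submodule.subset_span
      (i.2.1.2.2 (Submodule.subset_span (Set.mem_singleton _)))
    have : incl (-W.m₀) = -incl W.m₀ := by simp [incl, TensorProduct.tmul_neg]
    rw [this]
    exact Submodule.neg_mem _ h
  func := W.func ^ W.hyp.weight (i.1.map (proj W.m₀))
  exponents := by
    rw [neg_neg, Units.val_pow_eq_pow_val]
    exact W.exponents.pow _

/-- The widgets `W₁, …, W_q` together form a scattering diagram. -/
def widgetUnion {q : ℕ} (W : Fin q → Widget k r) : ScatteringDiagram k r where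
  ι := Σ a : Fin q, (W a).Index
  wall i := (W i.1).wall i.2
  finite j := by
    have : ∀ a, Finite (W a).Index := fun a => (W a).finite_index
    exact Set.toFinite _

end Diagrams

end Scattering

end

/-!
# Consistent completions of unions of widgets

All statements are reduced to finite rational hyperplane arrangements `A` in `M_ℝ`: the cones of
finitely many walls are unions of cells of a suitable `A` (`exists_adapted_family`), and a path or a
loop is only seen through the hyperplanes it crosses. Elements of the tropical vertex group are
recorded by their logarithms (`Tw`), i.e. by additive maps `M → 𝔪`; a wall at a point `y` of the
hyperplane `n = 0` contributes the element `d ↦ ⟨n, d⟩ log f_y`. To order `j`, a *potential* is an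
assignment of group elements to the chambers of `A` that changes by these elements across each wall.
A diagram with potentials to all orders is consistent, since the path-ordered product along a
path is the quotient of the values at its ends (`isConsistent_of_potential`).

**Existence.** Potentials are constructed by induction on `j`. A potential modulo `𝔪^j` is lifted
arbitrarily to `𝔪^(j+1)`; the crossing conditions then fail by *defects* `∑ e_p z^p`, where `e_p` is
a homomorphism `M → k` attached to each wall `y ∈ {n = 0}`, which vanishes at `m = r p`. The last
step of the filtration is central, so each exponent `p` can be treated separately: one looks for a
function `φ` on the chambers, with `φ(m) = 0`, such that `e_p + φ' - φ` is a multiple of `n` on each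
hyperplane `n = 0`. A candidate is the sum of all defects met by the ray `x + ℝ_{≥0} m`
(`raySum`). It cancels the defects on the hyperplanes transversal to `m` (`raySum_cross`). On a
hyperplane parallel to `m` it moves the defect to its value far away in the direction `m`, up
to multiples of `n` (`raySum_parallel`). This needs a local identity at each intersection of
hyperplanes on the ray, which holds since there are two ways around that intersection, and since
the total defect of a path is determined by its ends (`IsLift.defect_pencil`,
`IsLift.transports_unique`); here it is essential that the derivations of the tropical vertex group
are divergence free (`coef_mul_of_mem_grp`). Far away in the direction `m`, only walls
containing that direction are left. The lift itself solves the problem there, except for the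
contributions of wall functions to `z^p`; a non-incoming wall has none, and those of a widget are
the jumps of a piecewise linear function, as the tropical hypersurface is balanced
(`TropicalHypersurface.exists_potential`, `IsStage.exists_farPotential`). The remaining multiples
`c · n` of the normal vectors are the coefficients of new walls, the closed cells of the
arrangement with the functions `1 + c z^p`. The coefficient `c` is zero when `m` points into the
cell, which means that all the new walls are non-incoming (`IsLift.exists_correction`,
`exists_wall`).

**Uniqueness.** Let two completions agree modulo `𝔪^j`. The difference of the coefficients of `z^p`
modulo `𝔪^(j+1)` is a function on the walls parallel to `m = r p`. Small loops around
the intersections of hyperplanes show that it is constant along lines in the direction `m`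
(`coefDiff_pencil`). Far away in the direction `m`, only incoming walls have functions
involving `z^p` (`Wall.isIncoming_of_far`), and these are common to both completions. So the
difference vanishes.
-/

set_option linter.unusedSectionVars false

noncomputable section

namespace Scattering

/-! ### Covectors, signs and rational hyperplane arrangements -/

section Covectors

variable {M : Type v} [AddCommGroup M]

@[simp] theorem pair_incl (n : DualLat M) (m : M) : pair n (incl m) = n m := by
  simp [incl, pair_tmul]

@[simp] theorem pair_neg (n : DualLat M) (x : RealSpan M) : pair (-n) x = -pair n x := by
  simp [pair, LinearMap.baseChange_neg]

@[simp] theorem pair_zero (x : RealSpan M) : pair (0 : DualLat M) x = 0 := by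
  simp [pair]

theorem pair_sub (n n' : DualLat M) (x : RealSpan M) : pair (n - n') x = pair n x - pair n' x := by
  simp [pair, LinearMap.baseChange_sub]

theorem pair_add (n n' : DualLat M) (x : RealSpan M) : pair (n + n') x = pair n x + pair n' x := by
  simp [pair, LinearMap.baseChange_add]

theorem pair_smul (a : ℤ) (n : DualLat M) (x : RealSpan M) : pair (a • n) x = a * pair n x := by
  induction x using TensorProduct.induction_on with
  | zero => simp
  | tmul c m => simp [pair_tmul, mul_assoc]
  | add x y hx hy => simp [hx, hy, mul_add]

theorem pair_nsmul (a : ℕ) (n : DualLat M) (x : RealSpan M) : pair (a • n) x = a * pair n x := by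
  have := pair_smul (a : ℤ) n x
  simpa using this

@[simp] theorem incl_neg (m : M) : incl (-m) = -incl m := by simp [incl, TensorProduct.tmul_neg]

theorem incl_nsmul (c : ℕ) (m : M) : incl (c • m) = (c : ℝ) • incl m := by
  simp [incl, TensorProduct.smul_tmul']

theorem incl_zsmul (c : ℤ) (m : M) : incl (c • m) = (c : ℝ) • incl m := by
  simp [incl, TensorProduct.smul_tmul']

theorem incl_add (m m' : M) : incl (m + m') = incl m + incl m' := by
  simp [incl, TensorProduct.tmul_add]

theorem IsPrimitive.ne_zero {L : Type*} [AddCommGroup L] {m : L} (h : IsPrimitive m) : m ≠ 0 := by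
  rintro rfl
  have := h 0 0 (by simp)
  simp at this

theorem IsPrimitive.neg {L : Type*} [AddCommGroup L] {m : L} (h : IsPrimitive m) :
    IsPrimitive (-m) := fun c m' e => h c (-m') (by rw [smul_neg, ← e, neg_neg])

theorem IsPrimitive.eq_or_eq_neg {L : Type*} [AddCommGroup L] [IsAddTorsionFree L] {n n' : L}
    (h : IsPrimitive n) (h' : IsPrimitive n') {a b : ℤ} (ha : a ≠ 0) (e : a • n = b • n') :
    n' = n ∨ n' = -n := by
  obtain ⟨g, a', b', hg, hco, rfl, rfl⟩ : ∃ g a' b' : ℤ, g ≠ 0 ∧ IsCoprime a' b' ∧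
      a = g * a' ∧ b = g * b' := by
    obtain ⟨a', b', h1, h2, h3⟩ := extract_gcd a b
    refine ⟨gcd a b, a', b', ?_, (gcd_isUnit_iff a' b').1 h3, h1, h2⟩
    simp [ha]
  have e' : a' • n = b' • n' := by
    have h3 : g • (a' • n) = g • (b' • n') := by rw [smul_smul, smul_smul, e]
    exact (smul_right_injective L hg) h3
  obtain ⟨u, w, huw⟩ := hco
  have h1 : n = b' • (u • n' + w • n) := by
    calc n = (u * a' + w * b') • n := by rw [huw, one_smul]
      _ = u • (a' • n) + w • b' • n := by rw [add_smul, mul_smul, mul_smul]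
      _ = _ := by rw [e', smul_add, smul_comm u b', smul_comm w b']
  have h2 : n' = a' • (u • n' + w • n) := by
    calc n' = (u * a' + w * b') • n' := by rw [huw, one_smul]
      _ = u • a' • n' + w • (b' • n') := by rw [add_smul, mul_smul, mul_smul]
      _ = _ := by rw [← e', smul_add, smul_comm u a', smul_comm w a']
  have hb := Int.isUnit_iff.1 (h _ _ h1)
  have ha := Int.isUnit_iff.1 (h' _ _ h2)
  rcases hb with rfl | rfl <;> rcases ha with rfl | rfl <;> simp at e' <;> simp [e']

instance : IsAddTorsionFree (DualLat M) :=
  ⟨fun c hc f g h => LinearMap.ext fun d => by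
    have := LinearMap.congr_fun h d
    simpa [hc] using this⟩

variable [Module.Free ℤ M] [Module.Finite ℤ M]

theorem exists_pair_ne_zero {x : RealSpan M} (hx : x ≠ 0) : ∃ n : DualLat M, pair n x ≠ 0 := by
  by_contra! h
  let b := Module.Free.chooseBasis ℤ M
  apply hx
  apply (b.baseChange ℝ).ext_elem
  intro i
  have h1 : ∀ y : RealSpan M, (b.baseChange ℝ).repr y i = pair (b.coord i) y := by
    intro y
    induction y using TensorProduct.induction_on with
    | zero => simp
    | tmul c m => simp [pair_tmul]
    | add x y hx hy => simp [hx, hy]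
  rw [h1, h]; simp

theorem eq_of_pair_eq {x y : RealSpan M} (h : ∀ n : DualLat M, pair n x = pair n y) : x = y := by
  by_contra hne
  obtain ⟨n, hn⟩ := exists_pair_ne_zero (sub_ne_zero.2 hne)
  exact hn (by rw [map_sub, h, sub_self])

instance : Module.Finite ℝ (RealSpan M) := inferInstance

theorem exists_primitive {L : Type*} [AddCommGroup L] [Module.Free ℤ L] [Module.Finite ℤ L]
    {x : L} (hx : x ≠ 0) : ∃ (a : ℕ) (y : L), 0 < a ∧ IsPrimitive y ∧ x = a • y := by
  let b := Module.Free.chooseBasis ℤ L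
  let s : L → ℕ := fun x => ∑ i, (b.repr x i).natAbs
  have hs : ∀ (c : ℤ) y, s (c • y) = c.natAbs * s y := by
    intro c y; simp [s, Int.natAbs_mul, Finset.mul_sum]
  have hs0 : ∀ y, y ≠ 0 → 0 < s y := by
    intro y hy
    by_contra h0
    have : s y = 0 := by omega
    apply hy; apply b.ext_elem
    intro i
    have := Finset.sum_eq_zero_iff.1 this i (Finset.mem_univ _)
    simpa using this
  induction hN : s x using Nat.strong_induction_on generalizing x with
  | _ N ih =>
    by_cases hp : IsPrimitive x
    · exact ⟨1, x, one_pos, hp, by simp⟩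
    · unfold IsPrimitive at hp
      push Not at hp
      obtain ⟨c, y, hxy, hc⟩ := hp
      have hy : y ≠ 0 := by rintro rfl; simp [hxy] at hx
      have hc0 : c ≠ 0 := by rintro rfl; simp [hxy] at hx
      have hc2 : 2 ≤ c.natAbs := by
        rw [Int.isUnit_iff_natAbs_eq] at hc
        have := Int.natAbs_pos.2 hc0
        omega
      have hlt : s y < N := by
        rw [← hN, hxy, hs]
        have := hs0 y hy
        nlinarith
      obtain ⟨a, z, ha, hz, rfl⟩ := ih _ hlt hy rfl
      rcases Int.natAbs_eq c with h | h
      · refine ⟨c.natAbs * a, z, by positivity, hz, ?_⟩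
        rw [hxy, mul_smul, ← natCast_zsmul (a • z) c.natAbs, ← h]
      · refine ⟨c.natAbs * a, -z, by positivity, hz.neg, ?_⟩
        rw [hxy, mul_smul, smul_neg, smul_neg, ← natCast_zsmul (a • z) c.natAbs, ← neg_smul, ← h]

theorem exists_pos_of_ne_zero {n : DualLat M} (hn : n ≠ 0) : ∃ m : M, 0 < n m := by
  obtain ⟨m, hm⟩ : ∃ m, n m ≠ 0 := by
    by_contra! h
    exact hn (LinearMap.ext h)
  rcases lt_or_gt_of_ne hm with h | h
  · exact ⟨-m, by simpa using h⟩
  · exact ⟨m, h⟩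

/-- Two primitive covectors with the same kernel in `M_ℝ` agree up to sign. -/
theorem IsPrimitive.eq_or_eq_neg_of_ker {n n' : DualLat M} (h : IsPrimitive n)
    (h' : IsPrimitive n') (hk : ∀ x : RealSpan M, pair n x = 0 → pair n' x = 0) :
    n' = n ∨ n' = -n := by
  obtain ⟨m, hm⟩ := exists_pos_of_ne_zero h.ne_zero
  have key : (n m) • n' = (n' m) • n := by
    ext d
    have := hk (incl (n m • d - n d • m)) (by simp; ring)
    rw [pair_incl] at this
    have h3 : n' (n m • d - n d • m) = 0 := by exact_mod_cast this
    simp at h3 ⊢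
    linarith
  have h4 : n' m ≠ 0 := by
    intro h0
    rw [h0, zero_smul] at key
    exact h'.ne_zero ((smul_eq_zero.1 key).resolve_left hm.ne')
  exact h.eq_or_eq_neg h' h4 key.symm

theorem pair_ne_zero_of_ne {n : DualLat M} (hn : n ≠ 0) : ∃ x : RealSpan M, 0 < pair n x := by
  obtain ⟨m, hm⟩ := exists_pos_of_ne_zero hn
  exact ⟨incl m, by simpa using hm⟩

end Covectors

section Arrangements

variable {M : Type v} [AddCommGroup M]

/-- A finite rational hyperplane arrangement: a finite set of primitive covectors, closed under
negation, so that each hyperplane is represented by its two primitive normal vectors. -/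
structure IsArr (A : Finset (DualLat M)) : Prop where
  prim : ∀ n ∈ A, IsPrimitive n
  neg : ∀ n ∈ A, -n ∈ A

/-- A point on no hyperplane of the arrangement. -/
def Gen (A : Finset (DualLat M)) (x : RealSpan M) : Prop := ∀ n ∈ A, pair n x ≠ 0

/-- Two points with the same signs, i.e. in the same relatively open cell of the arrangement. -/
def SameSigns (A : Finset (DualLat M)) (x y : RealSpan M) : Prop :=
  ∀ n ∈ A, SignType.sign (pair n x) = SignType.sign (pair n y)

/-- The open cell of `x` has the cell of `y` in its closure. -/
def Near (A : Finset (DualLat M)) (y x : RealSpan M) : Prop :=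
  ∀ n ∈ A, pair n y ≠ 0 → SignType.sign (pair n x) = SignType.sign (pair n y)

/-- The point `y` lies on the hyperplane `n = 0` and on no other one of the arrangement. -/
def OnWall (A : Finset (DualLat M)) (n : DualLat M) (y : RealSpan M) : Prop :=
  pair n y = 0 ∧ ∀ n' ∈ A, pair n' y = 0 → n' = n ∨ n' = -n

/-- The point `y` lies on the hyperplane `n = 0` only, and `x`, `x'` lie in the two adjacent
chambers, with `n` positive at `x` and negative at `x'`. -/
structure IsCross (A : Finset (DualLat M)) (n : DualLat M) (x y x' : RealSpan M) : Prop where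
  zero : pair n y = 0
  pos : 0 < pair n x
  neg : pair n x' < 0
  other : ∀ n' ∈ A, n' ≠ n → n' ≠ -n → pair n' y ≠ 0 ∧
    SignType.sign (pair n' x) = SignType.sign (pair n' y) ∧
    SignType.sign (pair n' x') = SignType.sign (pair n' y)

variable {A B : Finset (DualLat M)} {n : DualLat M} {x y z x' y' : RealSpan M}

theorem sign_eq_iff_pos {a b : ℝ} (h : SignType.sign a = SignType.sign b) : 0 < a ↔ 0 < b := by
  rw [← sign_eq_one_iff, ← sign_eq_one_iff, h]

theorem sign_eq_iff_neg {a b : ℝ} (h : SignType.sign a = SignType.sign b) : a < 0 ↔ b < 0 := by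
  rw [← sign_eq_neg_one_iff, ← sign_eq_neg_one_iff, h]

theorem sign_eq_iff_zero {a b : ℝ} (h : SignType.sign a = SignType.sign b) : a = 0 ↔ b = 0 := by
  rw [← sign_eq_zero_iff, ← sign_eq_zero_iff (a := b), h]

theorem SameSigns.refl (A : Finset (DualLat M)) (x) : SameSigns A x x := fun _ _ => rfl
theorem SameSigns.symm (h : SameSigns A x y) : SameSigns A y x := fun n hn => (h n hn).symm
theorem SameSigns.trans (h : SameSigns A x y) (h' : SameSigns A y z) : SameSigns A x z :=
  fun n hn => (h n hn).trans (h' n hn)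
theorem SameSigns.mono (hAB : A ⊆ B) (h : SameSigns B x y) : SameSigns A x y :=
  fun n hn => h n (hAB hn)
theorem SameSigns.gen (h : SameSigns A x y) (hx : Gen A x) : Gen A y :=
  fun n hn h0 => hx n hn ((sign_eq_iff_zero (h n hn)).2 h0)
theorem SameSigns.near (h : SameSigns A x y) : Near A x y := fun n hn _ => (h n hn).symm
theorem Near.trans (h : Near A z y) (h' : Near A y x) : Near A z x := fun n hn h0 => by
  have h1 := h n hn h0
  rw [← h1]
  exact h' n hn (fun h2 => h0 ((sign_eq_iff_zero h1).1 h2))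
theorem Gen.mono (hAB : A ⊆ B) (h : Gen B x) : Gen A x := fun n hn => h n (hAB hn)
theorem Near.sameSigns (hx : Gen A x) (h : Near A x y) : SameSigns A x y :=
  fun n hn => (h n hn (hx n hn)).symm

theorem OnWall.mono (hAB : A ⊆ B) (h : OnWall B n y) : OnWall A n y :=
  ⟨h.1, fun n' hn' => h.2 n' (hAB hn')⟩

theorem OnWall.neg (h : OnWall A n y) : OnWall A (-n) y :=
  ⟨by simp [h.1], fun n' hn' h0 => by rw [neg_neg]; exact (h.2 n' hn' h0).symm⟩

theorem OnWall.congr (hn : n ∈ A) (h : OnWall A n y) (hs : SameSigns A y y') : OnWall A n y' :=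
  ⟨(sign_eq_iff_zero (hs n hn)).1 h.1,
    fun n' hn' h0 => h.2 n' hn' ((sign_eq_iff_zero (hs n' hn')).2 h0)⟩

theorem IsCross.mono (hAB : A ⊆ B) (h : IsCross B n x y x') : IsCross A n x y x' :=
  ⟨h.zero, h.pos, h.neg, fun n' hn' => h.other n' (hAB hn')⟩

theorem IsCross.onWall (h : IsCross A n x y x') : OnWall A n y :=
  ⟨h.zero, fun n' hn' h0 => by
    by_contra! hne
    exact (h.other n' hn' hne.1 hne.2).1 h0⟩

theorem IsCross.symm (h : IsCross A n x y x') : IsCross A (-n) x' y x :=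
  ⟨by simp [h.zero], by simpa using h.neg, by simpa using h.pos, fun n' hn' h1 h2 => by
    rw [neg_neg] at h2
    exact ⟨(h.other n' hn' h2 h1).1, (h.other n' hn' h2 h1).2.2, (h.other n' hn' h2 h1).2.1⟩⟩

theorem IsCross.gen_left (h : IsCross A n x y x') : Gen A x := by
  intro n' hn' h0
  by_cases h1 : n' = n
  · subst h1; exact h.pos.ne' h0
  by_cases h2 : n' = -n
  · subst h2; have := h.pos; simp at h0; linarith
  · exact (h.other n' hn' h1 h2).1 ((sign_eq_iff_zero (h.other n' hn' h1 h2).2.1).1 h0)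

theorem IsCross.gen_right (h : IsCross A n x y x') : Gen A x' := h.symm.gen_left

theorem IsCross.near_left (h : IsCross A n x y x') : Near A y x := by
  intro n' hn' h0
  by_cases h1 : n' = n
  · subst h1; exact absurd h.zero h0
  by_cases h2 : n' = -n
  · subst h2; exact absurd h.zero (by simpa using h0)
  · exact (h.other n' hn' h1 h2).2.1

theorem IsCross.near_right (h : IsCross A n x y x') : Near A y x' := h.symm.near_left

theorem IsCross.of_near (hy : OnWall A n y) (hx : Near A y x) (hx' : Near A y x')
    (h0 : 0 < pair n x) (h1 : pair n x' < 0) : IsCross A n x y x' :=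
  ⟨hy.1, h0, h1, fun n' hn' h2 h3 => by
    have h4 : pair n' y ≠ 0 := fun h5 => by
      rcases hy.2 n' hn' h5 with h | h
      exacts [h2 h, h3 h]
    exact ⟨h4, hx n' hn' h4, hx' n' hn' h4⟩⟩

/-- Replacing the three points by points of the same cells. -/
theorem sameSigns_of_near_onWall (hn : IsPrimitive n) (hy : OnWall A n y) (hx : Near A y x)
    (hx' : Near A y x') (h : SignType.sign (pair n x) = SignType.sign (pair n x')) :
    SameSigns A x x' := by
  intro n' hn'
  by_cases h0 : pair n' y = 0
  · rcases hy.2 n' hn' h0 with rfl | rfl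
    · exact h
    · simp [h, Left.sign_neg]
  · rw [hx n' hn' h0, hx' n' hn' h0]

theorem IsCross.sameSigns_left (hn : IsPrimitive n) (h : IsCross A n x y x') {z z' : RealSpan M}
    (h' : IsCross A n z y z') : SameSigns A x z :=
  sameSigns_of_near_onWall hn h.onWall h.near_left h'.near_left
    (by rw [sign_pos h.pos, sign_pos h'.pos])

theorem IsCross.sameSigns_right (hn : IsPrimitive n) (h : IsCross A n x y x') {z z' : RealSpan M}
    (h' : IsCross A n z y z') : SameSigns A x' z' :=
  h.symm.sameSigns_left hn.neg h'.symm

theorem IsCross.congr (hn : n ∈ A) (h : IsCross A n x y x') (hs : SameSigns A y y') :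
    IsCross A n x y' x' :=
  IsCross.of_near (h.onWall.congr hn hs) (hs.symm.near.trans h.near_left)
    (hs.symm.near.trans h.near_right) h.pos h.neg

theorem sign_add_small (a b : ℝ) (ha : a ≠ 0) :
    ∀ᶠ ε in 𝓝[>] (0 : ℝ), SignType.sign (a + ε * b) = SignType.sign a := by
  have hc : Filter.Tendsto (fun ε : ℝ => a + ε * b) (𝓝[>] 0) (𝓝 a) := by
    have : Filter.Tendsto (fun ε : ℝ => a + ε * b) (𝓝 0) (𝓝 (a + 0 * b)) := by
      apply Continuous.tendsto; fun_prop
    simpa using this.mono_left nhdsWithin_le_nhds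
  rcases lt_or_gt_of_ne ha with h | h
  · filter_upwards [hc.eventually_lt_const h] with ε hε
    rw [sign_neg h, sign_neg hε]
  · filter_upwards [hc.eventually_const_lt h] with ε hε
    rw [sign_pos h, sign_pos hε]

theorem eventually_near (A : Finset (DualLat M)) (y u : RealSpan M) :
    ∀ᶠ ε in 𝓝[>] (0 : ℝ), Near A y (y + ε • u) := by
  unfold Near
  rw [Filter.eventually_all_finset]
  intro n _
  by_cases h0 : pair n y = 0
  · simp [h0]
  · filter_upwards [sign_add_small (pair n y) (pair n u) h0] with ε hε _
    simpa using hε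

theorem eventually_cross (hy : OnWall A n y) {u : RealSpan M} (hu : 0 < pair n u) :
    ∀ᶠ ε in 𝓝[>] (0 : ℝ), IsCross A n (y + ε • u) y (y - ε • u) := by
  filter_upwards [eventually_near A y u, eventually_near A y (-u), self_mem_nhdsWithin]
    with ε h1 h2 (h3 : 0 < ε)
  refine IsCross.of_near hy h1 (by simpa [sub_eq_add_neg] using h2) ?_ ?_
  · simp [hy.1]; positivity
  · simp [hy.1]; positivity

variable [Module.Free ℤ M] [Module.Finite ℤ M]

theorem OnWall.exists_cross (hn : IsPrimitive n) (hy : OnWall A n y) :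
    ∃ x x', IsCross A n x y x' := by
  obtain ⟨u, hu⟩ := pair_ne_zero_of_ne hn.ne_zero
  obtain ⟨ε, hε⟩ := (eventually_cross hy hu).exists
  exact ⟨_, _, hε⟩

theorem exists_gen (hA : IsArr A) : ∃ x, Gen A x := by
  obtain ⟨u, hu⟩ := Module.Dual.exists_forall_ne_zero_of_forall_exists
    (fun n : A => (pair n.1 : Module.Dual ℝ (RealSpan M)))
    (fun n => (pair_ne_zero_of_ne (hA.prim n.1 n.2).ne_zero).imp fun _ h => h.ne')
  exact ⟨u, fun n hn => hu ⟨n, hn⟩⟩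

theorem exists_gen_near (hA : IsArr A) (y : RealSpan M) : ∃ x, Gen A x ∧ Near A y x := by
  obtain ⟨u, hu⟩ := exists_gen hA
  obtain ⟨ε, hε, (hpos : 0 < ε)⟩ := ((eventually_near A y u).and self_mem_nhdsWithin).exists
  refine ⟨_, fun n hn h0 => ?_, hε⟩
  by_cases h1 : pair n y = 0
  · simp [h1, hu n hn, hpos.ne'] at h0
  · exact h1 ((sign_eq_iff_zero (hε n hn h1)).1 h0)

/-- A lattice vector on no hyperplane of the arrangement. -/
theorem exists_lattice_gen (hA : IsArr A) : ∃ m : M, Gen A (incl m) := by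
  classical
  let f : A → Module.Dual ℚ (ℚ ⊗[ℤ] M) := fun n =>
    (TensorProduct.AlgebraTensorModule.rid ℤ ℚ ℚ).toLinearMap ∘ₗ LinearMap.baseChange ℚ n.1
  have hf : ∀ (n : A) (c : ℚ) (m : M), f n (c ⊗ₜ m) = n.1 m * c := by
    intro n c m; simp [f]
  obtain ⟨x, hx⟩ := Module.Dual.exists_forall_ne_zero_of_forall_exists f (fun n => by
    obtain ⟨m, hm⟩ := exists_pos_of_ne_zero (hA.prim n.1 n.2).ne_zero
    refine ⟨(1 : ℚ) ⊗ₜ m, ?_⟩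
    rw [hf]; simpa using hm.ne')
  obtain ⟨c, m, hc, hm⟩ : ∃ (c : ℤ) (m : M), c ≠ 0 ∧ (c : ℚ) • x = (1 : ℚ) ⊗ₜ m := by
    clear hx
    induction x using TensorProduct.induction_on with
    | zero => exact ⟨1, 0, one_ne_zero, by simp⟩
    | tmul q m =>
      refine ⟨q.den, q.num • m, by simp, ?_⟩
      rw [TensorProduct.tmul_smul, TensorProduct.smul_tmul', TensorProduct.smul_tmul']
      congr 1
      simp [Rat.den_mul_eq_num]
    | add x y hx hy =>
      obtain ⟨c, m, hc, hm⟩ := hx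
      obtain ⟨c', m', hc', hm'⟩ := hy
      refine ⟨c * c', c' • m + c • m', mul_ne_zero hc hc', ?_⟩
      rw [TensorProduct.tmul_add, TensorProduct.tmul_smul, TensorProduct.tmul_smul, ← hm, ← hm']
      push_cast
      rw [smul_add, ← Int.cast_smul_eq_zsmul ℚ c', ← Int.cast_smul_eq_zsmul ℚ c, smul_smul,
        smul_smul, mul_comm (c' : ℚ)]
  refine ⟨m, fun n hn h0 => hx ⟨n, hn⟩ ?_⟩
  have h1 : f ⟨n, hn⟩ ((c : ℚ) • x) = n m := by rw [hm, hf]; simp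
  rw [pair_incl] at h0
  have h2 : (n m : ℚ) = 0 := by exact_mod_cast h0
  rw [h2, map_smul] at h1
  exact (smul_eq_zero.1 h1).resolve_left (by exact_mod_cast hc)

end Arrangements

/-! ### Rational cones by inequalities -/

section Cones

variable {M : Type v} [AddCommGroup M] {A B : Finset (DualLat M)} {n : DualLat M}
  {x y z x' y' : RealSpan M} {σ τ : PointedCone ℝ (RealSpan M)}

/-- The cone `σ` is cut out by inequalities `n ≥ 0` with `n` in the arrangement `A`. -/
def Adapted (A : Finset (DualLat M)) (σ : PointedCone ℝ (RealSpan M)) : Prop :=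
  ∃ F ⊆ A, ∀ x, x ∈ σ ↔ ∀ n ∈ F, 0 ≤ pair n x

theorem Adapted.mono (hAB : A ⊆ B) (h : Adapted A σ) : Adapted B σ := by
  obtain ⟨F, hF, h⟩ := h
  exact ⟨F, hF.trans hAB, h⟩

theorem nonneg_of_sign_eq {a b : ℝ} (h : SignType.sign a = SignType.sign b) (ha : 0 ≤ a) :
    0 ≤ b := by
  rw [← sign_nonneg_iff] at ha ⊢
  rwa [← h]

theorem Adapted.mem_of_near (h : Adapted A σ) (hn : Near A y x) (hx : x ∈ σ) : y ∈ σ := by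
  obtain ⟨F, hF, h⟩ := h
  rw [h] at hx ⊢
  intro n hn'
  by_cases h0 : pair n y = 0
  · exact h0.ge
  · exact nonneg_of_sign_eq (hn n (hF hn') h0) (hx n hn')

theorem Adapted.mem_congr (h : Adapted A σ) (hs : SameSigns A x y) : x ∈ σ ↔ y ∈ σ :=
  ⟨h.mem_of_near hs.symm.near, h.mem_of_near hs.near⟩

theorem zero_of_mem_lin {f : RealSpan M →ₗ[ℝ] ℝ} (h : ∀ x ∈ σ, f x = 0) (hx : x ∈ lin σ) :
    f x = 0 := by
  have : lin σ ≤ LinearMap.ker f := Submodule.span_le.2 fun y hy => h y hy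
  exact this hx

theorem mem_lin (hx : x ∈ σ) : x ∈ lin σ := Submodule.subset_span hx

theorem zero_of_mem_relInt (hy : y ∈ relInt σ) {f : RealSpan M →ₗ[ℝ] ℝ} (hf : ∀ x ∈ σ, 0 ≤ f x)
    (h0 : f y = 0) (hx : x ∈ σ) : f x = 0 := by
  obtain ⟨ε, hε, h⟩ := hy.2 (-x) (neg_mem (mem_lin hx))
  have h1 := hf _ h
  have h2 := hf _ hx
  simp [h0] at h1
  nlinarith

theorem mem_relInt_iff {F : Finset (DualLat M)} (h : ∀ x, x ∈ σ ↔ ∀ n ∈ F, 0 ≤ pair n x) :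
    y ∈ relInt σ ↔ y ∈ σ ∧ ∀ n ∈ F, pair n y = 0 → ∀ x ∈ σ, pair n x = 0 := by
  constructor
  · intro hy
    exact ⟨hy.1, fun n hn h0 x hx => zero_of_mem_relInt hy (fun z hz => (h z).1 hz n hn) h0 hx⟩
  · rintro ⟨hy, h0⟩
    refine ⟨hy, fun u hu => ?_⟩
    obtain ⟨ε, hε, (hpos : 0 < ε)⟩ := ((eventually_near F y u).and self_mem_nhdsWithin).exists
    refine ⟨ε, hpos, (h _).2 fun n hn => ?_⟩
    by_cases h1 : pair n y = 0
    · rw [map_add, map_smul, h1, zero_of_mem_lin (h0 n hn h1) hu]; simp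
    · exact nonneg_of_sign_eq (hε n hn h1).symm ((h y).1 hy n hn)

/-- The cone cut out by a finite set of inequalities. -/
def ineqCone (F : Finset (DualLat M)) : PointedCone ℝ (RealSpan M) where
  carrier := {x | ∀ n ∈ F, 0 ≤ pair n x}
  add_mem' := fun hx hy n hn => by rw [map_add]; exact add_nonneg (hx n hn) (hy n hn)
  zero_mem' := fun n _ => by simp
  smul_mem' := fun c x hx n hn => by
    have : pair n (c • x) = c * pair n x := map_smul (pair n) (c : ℝ) x
    rw [this]
    exact mul_nonneg c.2 (hx n hn)

theorem mem_ineqCone {F : Finset (DualLat M)} : x ∈ ineqCone F ↔ ∀ n ∈ F, 0 ≤ pair n x := Iff.rfl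

theorem smul_mem_cone (c : ℝ) (hc : 0 ≤ c) (hx : x ∈ σ) : c • x ∈ σ :=
    Submodule.smul_mem σ (⟨c, hc⟩ : {c : ℝ // 0 ≤ c}) hx

theorem nnreal_smul_def (c : {c : ℝ // 0 ≤ c}) (x : RealSpan M) : c • x = (c : ℝ) • x := rfl

/-- The closed cell of the arrangement `A` whose relative interior contains `z`. -/
def cell (A : Finset (DualLat M)) (z : RealSpan M) : PointedCone ℝ (RealSpan M) :=
  ineqCone (A.filter fun n => 0 ≤ pair n z)

theorem mem_cell : x ∈ cell A z ↔ ∀ n ∈ A, 0 ≤ pair n z → 0 ≤ pair n x := by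
  simp [cell, mem_ineqCone]

theorem self_mem_cell : z ∈ cell A z := mem_cell.2 fun _ _ h => h

theorem adapted_cell (A : Finset (DualLat M)) (z : RealSpan M) : Adapted A (cell A z) :=
  ⟨A.filter fun n => 0 ≤ pair n z, Finset.filter_subset _ _, fun _ => Iff.rfl⟩

theorem zero_of_mem_cell (hA : IsArr A) (hx : x ∈ cell A z) (hn : n ∈ A) (h0 : pair n z = 0) :
    pair n x = 0 := by
  have h1 := mem_cell.1 hx n hn h0.ge
  have h2 := mem_cell.1 hx (-n) (hA.neg n hn) (by simp [h0])
  simp at h2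
  linarith

theorem mem_cell_of_near (hx : ∀ n ∈ A, pair n z = 0 → pair n x = 0)
    (hn : Near A z x) : x ∈ cell A z := mem_cell.2 fun n hn' h0 => by
  by_cases h1 : pair n z = 0
  · exact (hx n hn' h1).ge
  · exact nonneg_of_sign_eq (hn n hn' h1).symm h0

theorem mem_lin_cell (hA : IsArr A) :
    x ∈ lin (cell A z) ↔ ∀ n ∈ A, pair n z = 0 → pair n x = 0 := by
  constructor
  · intro hx n hn h0
    exact zero_of_mem_lin (fun y hy => zero_of_mem_cell hA hy hn h0) hx
  · intro h
    obtain ⟨ε, hε, (hpos : 0 < ε)⟩ := ((eventually_near A z x).and self_mem_nhdsWithin).exists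
    have h1 : z + ε • x ∈ cell A z :=
      mem_cell_of_near (fun n hn h0 => by simp [h0, h n hn h0]) hε
    have h2 : x = ε⁻¹ • ((z + ε • x) - z) := by
      rw [add_sub_cancel_left, smul_smul, inv_mul_cancel₀ hpos.ne', one_smul]
    rw [h2]
    exact Submodule.smul_mem _ _ (Submodule.sub_mem _ (mem_lin h1) (mem_lin self_mem_cell))

theorem mem_relInt_cell (hA : IsArr A) : x ∈ relInt (cell A z) ↔ SameSigns A z x := by
  rw [mem_relInt_iff (F := A.filter fun n => 0 ≤ pair n z) (fun _ => Iff.rfl)]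
  constructor
  · rintro ⟨hx, h0⟩ n hn
    have hp : ∀ n ∈ A, 0 < pair n z → 0 < pair n x := by
      intro n hn h1
      refine lt_of_le_of_ne (mem_cell.1 hx n hn h1.le) fun h2 => ?_
      have := h0 n (by simp [hn, h1.le]) h2.symm z self_mem_cell
      linarith
    rcases lt_trichotomy (pair n z) 0 with h | h | h
    · have := hp (-n) (hA.neg n hn) (by simpa using h)
      rw [sign_neg h, sign_neg (by simpa using this)]
    · rw [h, zero_of_mem_cell hA hx hn h]
    · rw [sign_pos h, sign_pos (hp n hn h)]
  · intro hs
    refine ⟨mem_cell.2 fun n hn h => nonneg_of_sign_eq (hs n hn) h, ?_⟩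
    intro n hn h0 y hy
    rw [Finset.mem_filter] at hn
    exact zero_of_mem_cell hA hy hn.1 ((sign_eq_iff_zero (hs n hn.1)).2 h0)

theorem ker_pair_finrank [Module.Free ℤ M] [Module.Finite ℤ M] (hn : n ≠ 0) :
    Module.finrank ℝ (LinearMap.ker (pair n)) + 1 = ambientDim M := by
  have h := LinearMap.finrank_range_add_finrank_ker (pair n)
  obtain ⟨x, hx⟩ := pair_ne_zero_of_ne hn
  have h1 : LinearMap.range (pair n) = ⊤ := by
    rw [LinearMap.range_eq_top]
    exact LinearMap.surjective_iff_ne_zero.2 (fun h0 => by simp [h0] at hx)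
  rw [h1, finrank_top, Module.finrank_self] at h
  unfold ambientDim; omega

theorem lin_eq_ker [Module.Free ℤ M] [Module.Finite ℤ M] (hn : n ≠ 0)
    (h : ∀ x ∈ σ, pair n x = 0) (hd : dim σ + 1 = ambientDim M) :
    lin σ = LinearMap.ker (pair n) := by
  apply Submodule.eq_of_le_of_finrank_eq
  · exact Submodule.span_le.2 fun y hy => h y hy
  · have := ker_pair_finrank hn
    unfold dim at hd; omega

theorem dim_of_lin_eq_ker [Module.Free ℤ M] [Module.Finite ℤ M] (hn : n ≠ 0)
    (h : lin σ = LinearMap.ker (pair n)) : dim σ + 1 = ambientDim M := by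
  rw [dim, h, ker_pair_finrank hn]

/-- A cone of codimension one that is adapted to `A` lies in a hyperplane of `A`. -/
theorem Adapted.exists_normal [Module.Free ℤ M] [Module.Finite ℤ M] (h : Adapted A σ)
    (hd : dim σ + 1 = ambientDim M) : ∃ n ∈ A, ∀ x ∈ σ, pair n x = 0 := by
  classical
  obtain ⟨F, hF, h⟩ := h
  by_contra! hcon
  choose! g hg using hcon
  have hpos : ∀ n ∈ F, 0 < pair n (g n) := fun n hn =>
    lt_of_le_of_ne ((h _).1 (hg n (hF hn)).1 n hn) (hg n (hF hn)).2.symm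
  let s := ∑ n ∈ F, g n
  have hs : ∀ n ∈ F, 0 < pair n s := by
    intro n hn
    rw [map_sum]
    exact Finset.sum_pos' (fun i hi => (h _).1 (hg i (hF hi)).1 n hn) ⟨n, hn, hpos n hn⟩
  have htop : lin σ = ⊤ := by
    rw [eq_top_iff]
    intro u _
    obtain ⟨ε, hε, (hε0 : 0 < ε)⟩ := ((eventually_near F s u).and self_mem_nhdsWithin).exists
    have h1 : s + ε • u ∈ σ := (h _).2 fun n hn =>
      nonneg_of_sign_eq (hε n hn (hs n hn).ne').symm (hs n hn).le
    have h2 : s ∈ σ := (h _).2 fun n hn => (hs n hn).le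
    have h3 : u = ε⁻¹ • ((s + ε • u) - s) := by
      rw [add_sub_cancel_left, smul_smul, inv_mul_cancel₀ hε0.ne', one_smul]
    rw [h3]
    exact Submodule.smul_mem _ _ (Submodule.sub_mem _ (mem_lin h1) (mem_lin h2))
  rw [dim, htop, finrank_top] at hd
  unfold ambientDim at hd; omega

/-! ### The double description of rational cones -/

/-- Fourier-Motzkin elimination: the sum of a cone cut out by rational inequalities and a rational
ray is again cut out by rational inequalities. -/
theorem exists_ineq_add_ray (F : Finset (DualLat M)) (g : M) : ∃ F' : Finset (DualLat M),
    ∀ x, (∃ t : ℝ, 0 ≤ t ∧ x - t • incl g ∈ ineqCone F) ↔ x ∈ ineqCone F' := by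
  classical
  refine ⟨(F.filter fun n => 0 ≤ n g) ∪
    ((F.filter fun n => 0 < n g) ×ˢ (F.filter fun n => n g < 0)).image
      (fun q => (-(q.2 g)) • q.1 + (q.1 g) • q.2), fun x => ?_⟩
  simp only [mem_ineqCone, Finset.mem_union, Finset.mem_filter, Finset.mem_image,
    Finset.mem_product, map_sub, map_smul, pair_incl, smul_eq_mul, sub_nonneg]
  constructor
  · rintro ⟨t, ht, h⟩ n (⟨hn, h0⟩ | ⟨⟨a, b⟩, ⟨⟨ha, ha'⟩, hb, hb'⟩, rfl⟩)
    · exact le_trans (mul_nonneg ht (by exact_mod_cast h0)) (h n hn)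
    · simp only [pair_add, pair_smul]
      have h1 := h a ha
      have h2 := h b hb
      have h3 : (0 : ℝ) < a g := by exact_mod_cast ha'
      have h4 : (b g : ℝ) < 0 := by exact_mod_cast hb'
      push_cast
      nlinarith
  · intro h
    by_cases hne : (F.filter fun n => n g < 0).Nonempty
    · obtain ⟨b, hb, hmax⟩ := Finset.exists_max_image _ (fun n => pair n x / n g) hne
      rw [Finset.mem_filter] at hb
      have hbg : (b g : ℝ) < 0 := by exact_mod_cast hb.2
      refine ⟨max 0 (pair b x / b g), le_max_left _ _, fun n hn => ?_⟩
      rcases lt_trichotomy (n g) 0 with hg | hg | hg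
      · have hng : (n g : ℝ) < 0 := by exact_mod_cast hg
        have h1 := hmax n (by simp [hn, hg])
        have h2 : pair n x / n g ≤ max 0 (pair b x / b g) := h1.trans (le_max_right _ _)
        rwa [div_le_iff_of_neg hng] at h2
      · simpa [hg] using h n (Or.inl ⟨hn, hg.ge⟩)
      · have hng : (0 : ℝ) < n g := by exact_mod_cast hg
        rw [← le_div_iff₀ hng, max_le_iff]
        refine ⟨div_nonneg (h n (Or.inl ⟨hn, hg.le⟩)) hng.le, ?_⟩
        have h1 := h _ (Or.inr ⟨(n, b), ⟨⟨hn, hg⟩, hb⟩, rfl⟩)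
        simp only [pair_add, pair_smul] at h1
        push_cast at h1
        rw [div_le_iff_of_neg hbg, div_mul_eq_mul_div, div_le_iff₀ hng]
        linarith
    · refine ⟨0, le_rfl, fun n hn => ?_⟩
      have : 0 ≤ n g := by
        by_contra hlt
        exact hne ⟨n, by simp [hn]; omega⟩
      simpa using h n (Or.inl ⟨hn, this⟩)

theorem exists_ineq_hull [Module.Free ℤ M] [Module.Finite ℤ M] {s : Set M} (hs : s.Finite) :
    ∃ F : Finset (DualLat M), PointedCone.hull ℝ (incl '' s) = ineqCone F := by
  classical
  induction s, hs using Set.Finite.induction_on with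
  | empty =>
    let b := Module.Free.chooseBasis ℤ M
    refine ⟨Finset.univ.image (fun i => b.coord i) ∪ Finset.univ.image (fun i => -b.coord i), ?_⟩
    ext x
    simp only [Set.image_empty, PointedCone.hull, Submodule.span_empty, Submodule.mem_bot,
      mem_ineqCone]
    constructor
    · rintro rfl; simp
    · intro h
      apply eq_of_pair_eq
      intro n
      have hc : ∀ i, pair (b.coord i) x = 0 := fun i => by
        have h1 := h (b.coord i) (by simp)
        have h2 := h (-b.coord i) (by simp)
        rw [pair_neg] at h2; linarith
      have hn : n = ∑ i, n (b i) • b.coord i := by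
        apply b.ext; intro j
        simp
      rw [hn]
      have hsum : ∀ (t : Finset (Module.Free.ChooseBasisIndex ℤ M)),
          pair (∑ i ∈ t, n (b i) • b.coord i) x = 0 := by
        intro t
        induction t using Finset.induction_on with
        | empty => simp
        | insert i t hi ih => rw [Finset.sum_insert hi, pair_add, pair_smul, hc, ih]; simp
      rw [hsum]; simp
  | @insert g s _ _ ih =>
    obtain ⟨F, hF⟩ := ih
    obtain ⟨F', hF'⟩ := exists_ineq_add_ray F g
    refine ⟨F', ?_⟩
    ext x
    rw [← hF' x, ← hF, Set.image_insert_eq, PointedCone.hull, Submodule.mem_span_insert]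
    constructor
    · rintro ⟨t, y, hy, rfl⟩
      exact ⟨t, t.2, by rw [nnreal_smul_def, add_sub_cancel_left]; exact hy⟩
    · rintro ⟨t, ht, hy⟩
      exact ⟨⟨t, ht⟩, _, hy, by rw [nnreal_smul_def]; simp⟩

/-- The finite set of primitive covectors, closed under negation, spanned by the members of `F`. -/
theorem exists_isArr [Module.Free ℤ M] [Module.Finite ℤ M] (F : Finset (DualLat M)) :
    ∃ A : Finset (DualLat M), IsArr A ∧
      ∀ n ∈ F, n ≠ 0 → ∃ a : ℕ, 0 < a ∧ ∃ n' ∈ A, n = a • n' := by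
  classical
  have h : ∀ n : DualLat M, ∃ n' : DualLat M, n ≠ 0 → IsPrimitive n' ∧
      ∃ a : ℕ, 0 < a ∧ n = a • n' := by
    intro n
    by_cases hn : n = 0
    · exact ⟨0, fun h => absurd hn h⟩
    · obtain ⟨a, n', ha, hp, e⟩ := exists_primitive hn
      exact ⟨n', fun _ => ⟨hp, a, ha, e⟩⟩
  choose f hf using h
  refine ⟨(F.filter (· ≠ 0)).image f ∪ (F.filter (· ≠ 0)).image (fun n => -f n), ⟨?_, ?_⟩, ?_⟩
  · intro n hn
    simp only [Finset.mem_union, Finset.mem_image, Finset.mem_filter] at hn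
    rcases hn with ⟨n, hn, rfl⟩ | ⟨n, hn, rfl⟩
    · exact (hf n hn.2).1
    · exact (hf n hn.2).1.neg
  · intro n hn
    simp only [Finset.mem_union, Finset.mem_image, Finset.mem_filter] at hn ⊢
    rcases hn with ⟨n, hn, rfl⟩ | ⟨n, hn, rfl⟩
    · exact Or.inr ⟨n, hn, rfl⟩
    · exact Or.inl ⟨n, hn, by simp⟩
  · intro n hn h0
    obtain ⟨a, ha, e⟩ := (hf n h0).2
    exact ⟨a, ha, f n, by
      simp only [Finset.mem_union, Finset.mem_image, Finset.mem_filter]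
      exact Or.inl ⟨n, ⟨hn, h0⟩, rfl⟩, e⟩

theorem IsArr.union [DecidableEq (DualLat M)] (hA : IsArr A) (hB : IsArr B) : IsArr (A ∪ B) :=
  ⟨fun n hn => (Finset.mem_union.1 hn).elim (hA.prim n) (hB.prim n), fun n hn =>
    (Finset.mem_union.1 hn).elim (fun h => Finset.mem_union_left _ (hA.neg n h))
      (fun h => Finset.mem_union_right _ (hB.neg n h))⟩

theorem isArr_empty : IsArr (∅ : Finset (DualLat M)) := ⟨by simp, by simp⟩

theorem IsRational.exists_adapted [Module.Free ℤ M] [Module.Finite ℤ M] (h : IsRational σ) :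
    ∃ A, IsArr A ∧ Adapted A σ := by
  classical
  obtain ⟨s, hs, rfl⟩ := h
  obtain ⟨F, hF⟩ := exists_ineq_hull hs
  obtain ⟨A, hA, h⟩ := exists_isArr F
  refine ⟨A, hA, A.filter (fun n' => ∃ n ∈ F, ∃ a : ℕ, 0 < a ∧ n = a • n'),
    Finset.filter_subset _ _,
    fun x => ?_⟩
  rw [hF, mem_ineqCone]
  constructor
  · intro hx n' hn'
    obtain ⟨_, n, hn, a, ha, rfl⟩ := Finset.mem_filter.1 hn'
    have := hx _ hn
    rw [pair_nsmul] at this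
    exact nonneg_of_mul_nonneg_right this (by exact_mod_cast ha)
  · intro hx n hn
    by_cases h0 : n = 0
    · simp [h0]
    · obtain ⟨a, ha, n', hn', e⟩ := h n hn h0
      have := hx n' (Finset.mem_filter.2 ⟨hn', n, hn, a, ha, e⟩)
      rw [e, pair_nsmul]
      positivity

/-- An arrangement to which all members of a finite family of rational cones are adapted. -/
theorem exists_adapted_family [Module.Free ℤ M] [Module.Finite ℤ M]
    {S : Set (PointedCone ℝ (RealSpan M))} (hS : S.Finite) (h : ∀ σ ∈ S, IsRational σ) :
    ∃ A, IsArr A ∧ ∀ σ ∈ S, Adapted A σ := by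
  classical
  induction S, hS using Set.Finite.induction_on with
  | empty => exact ⟨∅, isArr_empty, by simp⟩
  | @insert σ S _ _ ih =>
    obtain ⟨A, hA, h1⟩ := ih fun τ hτ => h τ (Set.mem_insert_of_mem _ hτ)
    obtain ⟨B, hB, h2⟩ := (h σ (Set.mem_insert _ _)).exists_adapted
    refine ⟨A ∪ B, hA.union hB, ?_⟩
    rintro τ (rfl | hτ)
    · exact h2.mono Finset.subset_union_right
    · exact (h1 τ hτ).mono Finset.subset_union_left

/-- The generators of the intersection with a half space are the old ones in the half space and, for
each pair of old ones on different sides, the positive combination on the bounding hyperplane. -/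
theorem isRational_inter_halfspace (hσ : IsRational σ) (n : DualLat M) : ∃ τ, IsRational τ ∧
    ∀ x, x ∈ τ ↔ x ∈ σ ∧ 0 ≤ pair n x := by
  obtain ⟨s, hs, rfl⟩ := hσ
  let sp := {g ∈ s | 0 ≤ n g}
  let sm := {g ∈ s | n g < 0}
  let s' : Set M := sp ∪ (fun q : M × M => (n q.1) • q.2 + (-(n q.2)) • q.1) '' (sp ×ˢ sm)
  have hs' : s'.Finite := (hs.subset fun g hg => hg.1).union
    (((hs.subset fun g hg => hg.1).prod (hs.subset fun g hg => hg.1)).image _)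
  set T := PointedCone.hull ℝ (incl '' s') with hT
  refine ⟨T, ⟨s', hs', rfl⟩, fun x => ?_⟩
  have hpT : PointedCone.hull ℝ (incl '' sp) ≤ T :=
    Submodule.span_mono (Set.image_mono Set.subset_union_left)
  -- the combination on the hyperplane, for arbitrary elements of the two parts of the cone
  have key : ∀ p ∈ PointedCone.hull ℝ (incl '' sp), ∀ q ∈ PointedCone.hull ℝ (incl '' sm),
      pair n p • q + (-pair n q) • p ∈ T ∧ 0 ≤ pair n p := by
    intro p hp q hq
    induction hp using Submodule.span_induction with
    | zero => simp
    | add p p' _ _ h h' =>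
      refine ⟨?_, by rw [map_add]; exact add_nonneg h.2 h'.2⟩
      have := T.add_mem h.1 h'.1
      convert this using 1
      rw [map_add, add_smul, smul_add]; abel
    | smul c p _ h =>
      rw [nnreal_smul_def, map_smul]
      refine ⟨?_, mul_nonneg c.2 h.2⟩
      have := smul_mem_cone c.1 c.2 h.1
      convert this using 1
      rw [smul_add, smul_smul, smul_eq_mul, smul_smul, smul_smul]; congr 1; rw [mul_comm]
    | mem p hp =>
      obtain ⟨g, hg, rfl⟩ := hp
      refine ⟨?_, by rw [pair_incl]; exact_mod_cast hg.2⟩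
      induction hq using Submodule.span_induction with
      | zero => simp
      | add q q' _ _ h h' =>
        have := T.add_mem h h'
        convert this using 1
        rw [map_add, neg_add, add_smul, smul_add]; abel
      | smul c q _ h =>
        have := smul_mem_cone c.1 c.2 h
        convert this using 1
        rw [nnreal_smul_def, map_smul, smul_add, smul_eq_mul, ← mul_neg, mul_smul, smul_comm]
      | mem q hq =>
        obtain ⟨g', hg', rfl⟩ := hq
        refine Submodule.subset_span ⟨(n g) • g' + (-(n g')) • g,
          Or.inr ⟨(g, g'), ⟨hg, hg'⟩, rfl⟩, ?_⟩
        rw [incl_add, incl_zsmul, incl_zsmul, pair_incl, pair_incl]; push_cast; rfl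
  have hsm : ∀ q ∈ PointedCone.hull ℝ (incl '' sm), q = 0 ∨ pair n q < 0 := by
    intro q hq
    induction hq using Submodule.span_induction with
    | zero => simp
    | add q q' _ _ h h' =>
      rcases h with rfl | h <;> rcases h' with rfl | h'
      · simp
      · rw [zero_add]; exact Or.inr h'
      · rw [add_zero]; exact Or.inr h
      · right; rw [map_add]; linarith
    | smul c q _ h =>
      rcases h with rfl | h
      · simp
      · rcases eq_or_lt_of_le c.2 with h0 | h0
        · left; rw [nnreal_smul_def, ← h0, zero_smul]
        · right; rw [nnreal_smul_def, map_smul, smul_eq_mul]; exact mul_neg_of_pos_of_neg h0 h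
    | mem q hq =>
      obtain ⟨g, hg, rfl⟩ := hq
      right; rw [pair_incl]; exact_mod_cast hg.2
  have hsplit : incl '' s = incl '' sp ∪ incl '' sm := by
    rw [← Set.image_union]
    congr 1
    ext g; simp only [sp, sm, Set.mem_union, Set.mem_ofPred_eq]
    constructor
    · intro h; rcases le_or_gt 0 (n g) with h1 | h1
      exacts [Or.inl ⟨h, h1⟩, Or.inr ⟨h, h1⟩]
    · rintro (h | h) <;> exact h.1
  constructor
  · intro hx
    induction hx using Submodule.span_induction with
    | zero => simp
    | add p q _ _ hp hq => exact ⟨add_mem hp.1 hq.1, by rw [map_add]; exact add_nonneg hp.2 hq.2⟩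
    | smul c p _ hp =>
      exact ⟨Submodule.smul_mem _ c hp.1, by
        rw [nnreal_smul_def, map_smul]; exact mul_nonneg c.2 hp.2⟩
    | mem p hp =>
      obtain ⟨g, hg | ⟨⟨a, b⟩, ⟨ha, hb⟩, rfl⟩, rfl⟩ := hp
      · exact ⟨Submodule.subset_span ⟨g, hg.1, rfl⟩, by rw [pair_incl]; exact_mod_cast hg.2⟩
      · have ha2 : (0 : ℝ) ≤ n a := by exact_mod_cast ha.2
        have hb2 : (n b : ℝ) < 0 := by exact_mod_cast hb.2
        simp only [incl_add, incl_zsmul]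
        refine ⟨add_mem (smul_mem_cone _ ha2 (Submodule.subset_span ⟨b, hb.1, rfl⟩))
          (smul_mem_cone _ (by push_cast; linarith) (Submodule.subset_span ⟨a, ha.1, rfl⟩)), ?_⟩
        simp only [map_add, map_smul, pair_incl, smul_eq_mul]
        push_cast; nlinarith
  · rintro ⟨hx, h0⟩
    rw [PointedCone.hull, hsplit, Submodule.span_union, Submodule.mem_sup] at hx
    obtain ⟨p, hp, q, hq, rfl⟩ := hx
    obtain ⟨h1, h2⟩ := key p hp q hq
    rw [map_add] at h0
    rcases eq_or_lt_of_le h2 with h3 | h3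
    · rcases hsm q hq with rfl | h4
      · rw [add_zero]; exact hpT hp
      · linarith
    · have e : p + q = (pair n p)⁻¹ • (pair n p • q + (-pair n q) • p) +
          ((pair n p)⁻¹ * (pair n p + pair n q)) • p := by
        rw [smul_add, smul_smul, smul_smul, inv_mul_cancel₀ h3.ne', one_smul, add_assoc, ← add_smul]
        rw [mul_add, inv_mul_cancel₀ h3.ne']
        ring_nf; rw [one_smul, add_comm]
      rw [e]
      exact T.add_mem (smul_mem_cone _ (by positivity) h1)
        (smul_mem_cone _ (mul_nonneg (by positivity) h0) (hpT hp))

theorem isRational_ineqCone [Module.Free ℤ M] [Module.Finite ℤ M] (F : Finset (DualLat M)) :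
    IsRational (ineqCone F) := by
  classical
  induction F using Finset.induction_on with
  | empty =>
    let b := Module.Free.chooseBasis ℤ M
    refine ⟨Set.range b ∪ Set.range (fun i => -b i),
      (Set.finite_range _).union (Set.finite_range _), ?_⟩
    symm
    rw [eq_top_iff.2 (show ⊤ ≤ ineqCone (∅ : Finset (DualLat M))
      from fun x _ => by simp [mem_ineqCone]),
      eq_top_iff]
    intro x _
    have hx := (b.baseChange ℝ).sum_repr x
    rw [← hx]
    refine Submodule.sum_mem _ fun i _ => ?_
    have hb : b.baseChange ℝ i = incl (b i) := by simp [incl]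
    rw [hb]
    rcases le_total 0 (((b.baseChange ℝ).repr x) i) with h | h
    · exact smul_mem_cone _ h (Submodule.subset_span ⟨b i, by simp, rfl⟩)
    · have := smul_mem_cone (-(((b.baseChange ℝ).repr x) i)) (by linarith)
        (Submodule.subset_span ⟨-b i, Or.inr ⟨i, rfl⟩, rfl⟩ :
          incl (-b i) ∈ PointedCone.hull ℝ (incl '' (Set.range b ∪ Set.range (fun i => -b i))))
      simpa using this
  | insert n F _ ih =>
    obtain ⟨τ, hτ, h⟩ := isRational_inter_halfspace ih n
    have : ineqCone (insert n F) = τ := by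
      ext x
      rw [h, mem_ineqCone, mem_ineqCone]
      simp [and_comm]
    rwa [this]

end Cones

/-! ### Generic segments -/

section Segments

variable {M : Type v} [AddCommGroup M] {A B : Finset (DualLat M)} {n : DualLat M}
  {x y z x' y' : RealSpan M}

/-- The segment from `x` to `z` meets the hyperplanes of the arrangement one at a time. -/
def GenPos (A : Finset (DualLat M)) (x z : RealSpan M) : Prop :=
  ∀ n ∈ A, ∀ n' ∈ A, n' ≠ n → n' ≠ -n → pair n x * pair n' z - pair n' x * pair n z ≠ 0

theorem sign_segment {a b s : ℝ} (hs : s ∈ Set.Ioo (0 : ℝ) 1)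
    (h : SignType.sign a = SignType.sign b) :
        SignType.sign (a + s * (b - a)) = SignType.sign a := by
  obtain ⟨h0, h1⟩ := hs
  rcases lt_trichotomy a 0 with ha | ha | ha
  · have hb := (sign_eq_iff_neg h).1 ha
    rw [sign_neg ha, sign_neg]; nlinarith
  · have hb := (sign_eq_iff_zero h).1 ha
    simp [ha, hb]
  · have hb := (sign_eq_iff_pos h).1 ha
    rw [sign_pos ha, sign_pos]; nlinarith

/-- Induction along a generic segment with end point `z`: the segment is traversed backwards, and
each step crosses a single hyperplane. -/
theorem segment_induction (hA : IsArr A) (P : RealSpan M → Prop) (hz : Gen A z)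
    (base : ∀ y, SameSigns A y z → P y)
    (step : ∀ n ∈ A, ∀ y b c, IsCross A n y b c → (∃ s ∈ Set.Ioo (0 : ℝ) 1, b = y + s • (z - y)) →
      (∃ s ∈ Set.Ioo (0 : ℝ) 1, c = y + s • (z - y)) → pair n z < 0 → P c → P y)
    (hx : Gen A x) (hgp : GenPos A x z) : P x := by
  classical
  induction hN : (A.filter fun n => 0 < pair n x ∧ pair n z < 0).card using
    Nat.strong_induction_on generalizing x with
  | _ N ih =>
    by_cases hne : (A.filter fun n => 0 < pair n x ∧ pair n z < 0).Nonempty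
    -- the first hyperplane on the way from `x` to `z` is met at the time `t`, in the point `b`
    · obtain ⟨n, hn, hmin⟩ := Finset.exists_min_image _
        (fun n => pair n x / (pair n x - pair n z)) hne
      rw [Finset.mem_filter] at hn
      obtain ⟨hnA, hnx, hnz⟩ := hn
      set t := pair n x / (pair n x - pair n z) with ht
      have hd : 0 < pair n x - pair n z := by linarith
      have ht0 : 0 < t := by positivity
      have ht1 : t < 1 := by rw [ht, div_lt_one hd]; linarith
      set b := x + t • (z - x) with hb
      have hpb : ∀ n', pair n' b = pair n' x + t * (pair n' z - pair n' x) := by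
        intro n'; simp [hb]
      have hnb : pair n b = 0 := by
        rw [hpb, ht]; field_simp; ring
      have hother : ∀ n' ∈ A, n' ≠ n → n' ≠ -n → pair n' b ≠ 0 := by
        intro n' hn' h1 h2 h0
        apply hgp n hnA n' hn' h1 h2
        rw [hpb, ht] at h0
        field_simp at h0
        linarith
      have hpos : ∀ n' ∈ A, n' ≠ n → n' ≠ -n → 0 < pair n' x → 0 < pair n' b := by
        intro n' hn' h1 h2 h0
        by_contra hle
        have hlt : pair n' b < 0 := lt_of_le_of_ne (not_lt.1 hle) (hother n' hn' h1 h2)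
        rw [hpb] at hlt
        have hz' : pair n' z < 0 := by nlinarith
        have h3 := hmin n' (by simp [hn', h0, hz'])
        rw [le_div_iff₀ (by linarith)] at h3
        have h4 : t * (pair n' x - pair n' z) ≤ pair n' x := h3
        linarith
      have hsign : ∀ n' ∈ A, n' ≠ n → n' ≠ -n →
          SignType.sign (pair n' x) = SignType.sign (pair n' b) := by
        intro n' hn' h1 h2
        rcases lt_or_gt_of_ne (hx n' hn') with h | h
        · have := hpos (-n') (hA.neg n' hn') (fun h' => h2 (by rw [← h', neg_neg]))
            (fun h' => h1 (neg_injective h')) (by simpa using h)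
          rw [sign_neg h, sign_neg (by simpa using this)]
        · rw [sign_pos h, sign_pos (hpos n' hn' h1 h2 h)]
      obtain ⟨ε, ⟨hε, hε1⟩, (hε0 : 0 < ε)⟩ := ((eventually_near A b (z - x)).and
        (Ioo_mem_nhdsGT (show (0 : ℝ) < 1 - t by linarith)) |>.and self_mem_nhdsWithin).exists
      -- a point shortly after the crossing
      set c := b + ε • (z - x) with hc
      have hnc : pair n c < 0 := by
        rw [hc, map_add, hnb, map_smul, map_sub, smul_eq_mul]; nlinarith
      have hcx : c = x + (t + ε) • (z - x) := by rw [hc, hb, add_smul, add_assoc]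
      have hcross : IsCross A n x b c := by
        refine ⟨hnb, hnx, hnc, fun n' hn' h1 h2 => ⟨hother n' hn' h1 h2, hsign n' hn' h1 h2,
          hε n' hn' (hother n' hn' h1 h2)⟩⟩
      refine step n hnA x b c hcross ⟨t, ⟨ht0, ht1⟩, rfl⟩
        ⟨t + ε, ⟨by linarith, by have := hε1.2; linarith⟩, hcx⟩ hnz ?_
      refine ih _ ?_ hcross.gen_right ?_ rfl
      · rw [← hN]
        apply Finset.card_lt_card
        rw [Finset.ssubset_iff_of_subset]
        · exact ⟨n, by simp [hnA, hnx, hnz], by simp [hnc.le]⟩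
        · intro n' hn'
          rw [Finset.mem_filter] at hn' ⊢
          refine ⟨hn'.1, ?_, hn'.2.2⟩
          have h1 : n' ≠ n := by rintro rfl; linarith [hn'.2.1]
          have h2 : n' ≠ -n := by
            rintro rfl; have := hn'.2.2; simp at this; linarith
          have := hε n' hn'.1 (hother n' hn'.1 h1 h2)
          exact (sign_eq_iff_pos (hsign n' hn'.1 h1 h2)).2 ((sign_eq_iff_pos this).1 hn'.2.1)
      · intro a ha a' ha' h1 h2
        have := hgp a ha a' ha' h1 h2
        have e : pair a c * pair a' z - pair a' c * pair a z =
            (1 - (t + ε)) * (pair a x * pair a' z - pair a' x * pair a z) := by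
          rw [hcx]; simp; ring
        rw [e]
        exact mul_ne_zero (by have := hε1.2; linarith) this
    · apply base
      have key : ∀ n ∈ A, 0 < pair n x → 0 < pair n z := by
        intro n hn h0
        by_contra hle
        exact hne ⟨n, by simp [hn, h0, lt_of_le_of_ne (not_lt.1 hle) (hz n hn)]⟩
      intro n hn
      rcases lt_or_gt_of_ne (hx n hn) with h | h
      · have := key (-n) (hA.neg n hn) (by simpa using h)
        rw [sign_neg h, sign_neg (by simpa using this)]
      · rw [sign_pos h, sign_pos (key n hn h)]

variable [Module.Free ℤ M] [Module.Finite ℤ M]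

/-- The segment is in general position after a small displacement of its end point. -/
theorem exists_genPos (hA : IsArr A) (hx : Gen A x) (hz : Gen A z) :
    ∃ z', SameSigns A z z' ∧ GenPos A x z' := by
  classical
  let f : {q : A × A // q.2.1 ≠ q.1.1 ∧ q.2.1 ≠ -q.1.1} → Module.Dual ℝ (RealSpan M) :=
    fun q => pair q.1.1.1 x • pair q.1.2.1 - pair q.1.2.1 x • pair q.1.1.1
  obtain ⟨u, hu⟩ := Module.Dual.exists_forall_ne_zero_of_forall_exists f (by
    rintro ⟨⟨⟨n, hn⟩, ⟨n', hn'⟩⟩, h1, h2⟩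
    by_contra! h0
    have h3 : ∀ w, pair n x * pair n' w = pair n' x * pair n w := fun w => by
      have := h0 w
      simp [f] at this; linarith
    rcases (hA.prim n hn).eq_or_eq_neg_of_ker (hA.prim n' hn') (fun w hw => by
      have := h3 w
      rw [hw, mul_zero] at this
      exact (mul_eq_zero.1 this).resolve_left (hx n hn)) with h | h
    exacts [h1 h, h2 h])
  have hev : ∀ᶠ ε in 𝓝[>] (0 : ℝ), ∀ q, f q (z + ε • u) ≠ 0 := by
    rw [Filter.eventually_all]
    intro q
    by_cases h0 : f q z = 0
    · filter_upwards [self_mem_nhdsWithin] with ε (hε : 0 < ε)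
      simp [h0, hu q, hε.ne']
    · filter_upwards [sign_add_small (f q z) (f q u) h0] with ε hε h1
      rw [map_add, map_smul, smul_eq_mul] at h1
      exact h0 ((sign_eq_iff_zero hε).1 h1)
  obtain ⟨ε, hε, h2⟩ := (hev.and (eventually_near A z u)).exists
  refine ⟨z + ε • u, h2.sameSigns hz, fun n hn n' hn' h1 h2 => ?_⟩
  have := hε ⟨⟨⟨n, hn⟩, ⟨n', hn'⟩⟩, h1, h2⟩
  simpa [f] using this

/-- A transitive relation between generic points that relates points of the same chamber and of
adjacent chambers relates all generic points.  Only walls in the closed convex cell spanned by the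
end points have to be considered. -/
theorem connect (hA : IsArr A) {Q : RealSpan M → RealSpan M → Prop}
    (hss : ∀ x y, Gen A x → SameSigns A x y → Q x y) (htrans : ∀ x y z, Q x y → Q y z → Q x z)
    (hx : Gen A x) (hx' : Gen A x')
    (hcross : ∀ n ∈ A, ∀ a b c, IsCross A n a b c → (∀ n' ∈ A, SignType.sign (pair n' x) =
      SignType.sign (pair n' x') → SignType.sign (pair n' b) = SignType.sign (pair n' x)) → Q a c) :
    Q x x' := by
  obtain ⟨z, hz, hgp⟩ := exists_genPos hA hx hx'
  have hzg := hz.gen hx'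
  refine segment_induction hA (fun y => Gen A y → (∀ n' ∈ A, SignType.sign (pair n' x) =
      SignType.sign (pair n' x') → SignType.sign (pair n' y) = SignType.sign (pair n' x)) → Q y x')
    hzg ?_ ?_ hx hgp hx (fun n' _ _ => rfl)
  · intro y hy hg _
    exact hss _ _ hg (hy.trans hz.symm)
  · rintro n hn y b c hc ⟨s, hs, hb⟩ ⟨s', hs', hc'⟩ _ ih hg hy
    have hseg : ∀ w, (∃ s ∈ Set.Ioo (0 : ℝ) 1, w = y + s • (z - y)) → ∀ n' ∈ A,
        SignType.sign (pair n' x) = SignType.sign (pair n' x') →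
        SignType.sign (pair n' w) = SignType.sign (pair n' x) := by
      rintro w ⟨s, hs, rfl⟩ n' hn' h
      rw [← hy n' hn' h, map_add, map_smul, map_sub, smul_eq_mul]
      exact sign_segment hs (by rw [hy n' hn' h, h, hz n' hn'])
    exact htrans _ _ _ (hcross n hn y b c hc (hseg b ⟨s, hs, hb⟩))
      (ih hc.gen_right (hseg c ⟨s', hs', hc'⟩))

end Segments

/-! ### Coefficients in the quotients `k[P] / 𝔪^j` -/

section Coefficients

variable {P : Type*} [AddCommMonoid P]

/-- The monomials of `𝔪_P ^ j`: the sums of `j` non-units and an arbitrary element. -/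
def ordSet (P : Type*) [AddCommMonoid P] : ℕ → Set P
  | 0 => Set.univ
  | j + 1 => {p | ∃ a b, ¬ IsAddUnit a ∧ b ∈ ordSet P j ∧ p = a + b}

theorem ordSet_add {j : ℕ} {p : P} (hp : p ∈ ordSet P j) (q : P) : p + q ∈ ordSet P j := by
  induction j generalizing p with
  | zero => trivial
  | succ j ih =>
    obtain ⟨a, b, ha, hb, rfl⟩ := hp
    exact ⟨a, b + q, ha, ih hb, add_assoc _ _ _⟩

theorem ordSet_succ_subset (j : ℕ) : ordSet P (j + 1) ⊆ ordSet P j := by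
  rintro p ⟨a, b, _, hb, rfl⟩
  rw [add_comm]; exact ordSet_add hb a

theorem not_isAddUnit_of_mem_ordSet {j : ℕ} {p : P} (hp : p ∈ ordSet P (j + 1)) :
    ¬ IsAddUnit p := by
  obtain ⟨a, b, ha, _, rfl⟩ := hp
  exact fun h => ha (isAddUnit_of_add_isAddUnit_left h)

variable {k : Type*} [Field k]

theorem mono_add (p q : P) : mono k (p + q) = mono k p * mono k q := by
  simp [mono, AddMonoidAlgebra.single_mul_single]

theorem mono_mem_pow {j : ℕ} {p : P} (hp : p ∈ ordSet P j) : mono k p ∈ mIdeal k P ^ j := by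
  induction j generalizing p with
  | zero => simp
  | succ j ih =>
    obtain ⟨a, b, ha, hb, rfl⟩ := hp
    rw [pow_succ', mono_add]
    exact Ideal.mul_mem_mul (Ideal.subset_span ⟨a, ha, rfl⟩) (ih hb)

theorem mem_span_mono (f : AddMonoidAlgebra k P) :
    f ∈ Submodule.span k (mono k '' {p | f.coeff p ≠ 0}) := by
  rw [← AddMonoidAlgebra.sum_coeff_single f]
  refine Submodule.sum_mem _ fun p hp => ?_
  have : AddMonoidAlgebra.single p (f.coeff p) = f.coeff p • mono k p := by simp [mono]
  rw [AddMonoidAlgebra.sum_coeff_single, this]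
  exact Submodule.smul_mem _ _ (Submodule.subset_span ⟨p, by simpa using hp, rfl⟩)

theorem coeff_mul_mem {f g : AddMonoidAlgebra k P} {p : P} (h : (f * g).coeff p ≠ 0) :
    ∃ a b, f.coeff a ≠ 0 ∧ g.coeff b ≠ 0 ∧ p = a + b := by
  classical
  have := AddMonoidAlgebra.support_coeff_mul_subset (x := f) (y := g) (Finsupp.mem_support_iff.2 h)
  obtain ⟨a, ha, b, hb, e⟩ := Finset.mem_add.1 this
  exact ⟨a, b, by simpa using ha, by simpa using hb, e.symm⟩

theorem mem_mIdeal_pow {j : ℕ} {f : AddMonoidAlgebra k P} :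
    f ∈ mIdeal k P ^ j ↔ ∀ p, f.coeff p ≠ 0 → p ∈ ordSet P j := by
  let I : ℕ → Ideal (AddMonoidAlgebra k P) := fun j =>
    { carrier := {f | ∀ p, f.coeff p ≠ 0 → p ∈ ordSet P j}
      add_mem' := fun {f g} hf hg p hp => by
        by_cases h : f.coeff p = 0
        · exact hg p (by simpa [h] using hp)
        · exact hf p h
      zero_mem' := fun p hp => by simp at hp
      smul_mem' := fun c f hf p hp => by
        obtain ⟨a, b, _, hb, rfl⟩ := coeff_mul_mem hp
        rw [add_comm]; exact ordSet_add (hf b hb) a }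
  constructor
  · have h1 : mIdeal k P ≤ I 1 := by
      refine Ideal.span_le.2 ?_
      rintro _ ⟨p, hp, rfl⟩ q hq
      obtain rfl : p = q := by
        by_contra hne
        simp [mono, hne] at hq
      exact ⟨p, 0, hp, trivial, by simp⟩
    have h2 : ∀ j, mIdeal k P ^ j ≤ I j := by
      intro j
      induction j with
      | zero => exact fun f _ p _ => trivial
      | succ j ih =>
        rw [pow_succ']
        refine Ideal.mul_le.2 fun f hf g hg p hp => ?_
        obtain ⟨a, b, ha, hb, rfl⟩ := coeff_mul_mem hp
        exact ⟨a, b, not_isAddUnit_of_mem_ordSet (h1 hf a ha), ih hg b hb, rfl⟩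
    exact fun h => h2 j h
  · intro h
    have h1 : Submodule.span k (mono k '' {p | f.coeff p ≠ 0}) ≤
        (mIdeal k P ^ j).restrictScalars k := by
      rw [Submodule.span_le]
      rintro _ ⟨p, hp, rfl⟩
      exact mono_mem_pow (h p hp)
    exact h1 (mem_span_mono f)

/-- The monomial `z^p` of `k[P] / 𝔪^j`. -/
def zmon (k : Type*) [Field k] {P : Type*} [AddCommMonoid P] (j : ℕ) (p : P) : Lvl k P j :=
  Ideal.Quotient.mk (mIdeal k P ^ j) (mono k p)

theorem zmon_add (j : ℕ) (p q : P) : zmon k j (p + q) = zmon k j p * zmon k j q := by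
  simp [zmon, mono_add]

@[simp] theorem zmon_zero (j : ℕ) : zmon k j (0 : P) = 1 := rfl

theorem zmon_eq_zero {j : ℕ} {p : P} (hp : p ∈ ordSet P j) : zmon k j p = 0 :=
  Ideal.Quotient.eq_zero_iff_mem.2 (mono_mem_pow hp)

open Classical in
/-- The restriction of a finitely supported function to a set. -/
def filterLin (k : Type*) [Field k] {P : Type*} (s : Set P) : (P →₀ k) →ₗ[k] P →₀ k where
  toFun f := f.filter (fun p => p ∈ s)
  map_add' _ _ := Finsupp.filter_add
  map_smul' _ _ := Finsupp.filter_smul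

open Classical in
theorem filterLin_apply (s : Set P) (f : P →₀ k) (p : P) :
    filterLin k s f p = if p ∈ s then f p else 0 := Finsupp.filter_apply _ _ _

/-- The coefficients of an element of `k[P] / 𝔪^j` at the monomials outside of `𝔪^j`, extended
by zero. -/
def coefs (k : Type*) [Field k] (P : Type*) [AddCommMonoid P] (j : ℕ) :
    Lvl k P j →ₗ[k] P →₀ k :=
  (Submodule.liftQ ((mIdeal k P ^ j).restrictScalars k)
    ((filterLin k (ordSet P j)ᶜ) ∘ₗ (AddMonoidAlgebra.coeffLinearEquiv k).toLinearMap) (by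
      intro f hf
      rw [LinearMap.mem_ker]
      ext p
      rw [LinearMap.comp_apply, filterLin_apply]
      split_ifs with hp
      · by_contra h0
        exact hp (mem_mIdeal_pow.1 hf p h0)
      · rfl)) ∘ₗ
  (Submodule.Quotient.restrictScalarsEquiv k (mIdeal k P ^ j)).symm.toLinearMap

theorem coefs_mk (j : ℕ) (f : AddMonoidAlgebra k P) : coefs k P j (Ideal.Quotient.mk _ f) =
    filterLin k (ordSet P j)ᶜ f.coeff := rfl

/-- The coefficient of `z^p`; it is zero by convention if `z^p` lies in `𝔪^j`. -/
def coef (k : Type*) [Field k] {P : Type*} [AddCommMonoid P] (j : ℕ) (p : P) : Lvl k P j →ₗ[k] k :=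
  Finsupp.lapply p ∘ₗ coefs k P j

theorem coef_mk {j : ℕ} {p : P} (hp : p ∉ ordSet P j) (f : AddMonoidAlgebra k P) :
    coef k j p (Ideal.Quotient.mk _ f) = f.coeff p := by
  rw [coef, LinearMap.comp_apply, coefs_mk, Finsupp.lapply_apply, filterLin_apply,
    if_pos (show p ∈ (ordSet P j)ᶜ from hp)]

theorem coef_of_mem {j : ℕ} {p : P} (hp : p ∈ ordSet P j) (x : Lvl k P j) : coef k j p x = 0 := by
  obtain ⟨f, rfl⟩ := Ideal.Quotient.mk_surjective x
  rw [coef, LinearMap.comp_apply, coefs_mk, Finsupp.lapply_apply, filterLin_apply,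
    if_neg (by simpa using hp)]

open Classical in
theorem coef_zmon {j : ℕ} {p : P} (hp : p ∉ ordSet P j) (q : P) :
    coef k j p (zmon k j q) = if q = p then 1 else 0 := by
  rw [zmon, coef_mk hp]
  simp [mono, Finsupp.single_apply]

theorem eq_of_coef {j : ℕ} {x y : Lvl k P j} (h : ∀ p ∉ ordSet P j, coef k j p x = coef k j p y) :
    x = y := by
  rw [← sub_eq_zero]
  have h' : ∀ p ∉ ordSet P j, coef k j p (x - y) = 0 :=
      fun p hp => by rw [map_sub, h p hp, sub_self]
  obtain ⟨f, hf⟩ := Ideal.Quotient.mk_surjective (x - y)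
  rw [← hf] at h' ⊢
  refine Ideal.Quotient.eq_zero_iff_mem.2 (mem_mIdeal_pow.2 fun p hp => ?_)
  by_contra h0
  exact hp (by rw [← coef_mk h0]; exact h' p h0)

theorem span_zmon (j : ℕ) : Submodule.span k (Set.range (zmon k j (P := P))) = ⊤ := by
  rw [eq_top_iff]
  rintro x -
  obtain ⟨f, rfl⟩ := Ideal.Quotient.mk_surjective x
  have h := Submodule.mem_map_of_mem (f := (Ideal.Quotient.mkₐ k (mIdeal k P ^ j)).toLinearMap)
    (mem_span_mono f)
  rw [Submodule.map_span] at h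
  refine Submodule.span_mono ?_ h
  rintro _ ⟨_, ⟨p, _, rfl⟩, rfl⟩
  exact ⟨p, rfl⟩

/-- Linear maps out of `k[P] / 𝔪^j` are determined by their values on monomials. -/
theorem lvl_hom_ext {j : ℕ} {W : Type*} [AddCommGroup W] [Module k W] {f g : Lvl k P j →ₗ[k] W}
    (h : ∀ p, f (zmon k j p) = g (zmon k j p)) : f = g :=
  LinearMap.ext_on_range (span_zmon j) h

theorem coef_finite {j : ℕ} (x : Lvl k P j) : {p | coef k j p x ≠ 0}.Finite :=
  (coefs k P j x).hasFiniteSupport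

/-- An element is the sum of its terms. -/
theorem eq_sum_coef {j : ℕ} (x : Lvl k P j) (s : Finset P) (hs : ∀ p, coef k j p x ≠ 0 → p ∈ s) :
    x = ∑ p ∈ s, coef k j p x • zmon k j p := by
  classical
  refine eq_of_coef fun p hp => ?_
  rw [map_sum]
  simp only [map_smul, coef_zmon hp, smul_eq_mul, mul_ite, mul_one, mul_zero]
  rw [Finset.sum_ite_eq' s p]
  split_ifs with h
  · rfl
  · by_contra h0; exact h (hs p h0)

/-- The ideal of `k[P] / 𝔪^j` generated by `𝔪`. -/
def aug (k : Type*) [Field k] (P : Type*) [AddCommMonoid P] (j : ℕ) : Ideal (Lvl k P j) :=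
  Ideal.map (Ideal.Quotient.mk (mIdeal k P ^ j)) (mIdeal k P)

theorem mem_aug {j : ℕ} {x : Lvl k P j} : x ∈ aug k P j ↔ ∃ f ∈ mIdeal k P,
    Ideal.Quotient.mk (mIdeal k P ^ j) f = x :=
  Ideal.mem_map_iff_of_surjective _ Ideal.Quotient.mk_surjective

theorem aug_pow (j : ℕ) : aug k P j ^ j = ⊥ := by
  rw [aug, ← Ideal.map_pow, Ideal.map_quotient_self]

theorem pow_eq_zero_of_mem_aug {j : ℕ} {x : Lvl k P j} (hx : x ∈ aug k P j) : x ^ j = 0 := by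
  have := Ideal.pow_mem_pow hx j
  rwa [aug_pow] at this

theorem isNilpotent_of_mem_aug {j : ℕ} {x : Lvl k P j} (hx : x ∈ aug k P j) : IsNilpotent x :=
  ⟨j, pow_eq_zero_of_mem_aug hx⟩

theorem zmon_mem_aug {j : ℕ} {p : P} (hp : ¬ IsAddUnit p) : zmon k j p ∈ aug k P j :=
  Ideal.mem_map_of_mem _ (Ideal.subset_span ⟨p, hp, rfl⟩)

/-- Two linear maps that agree on the monomials `z^p`, `p` not a unit, agree on the ideal `𝔪`. -/
theorem aug_hom_ext {j : ℕ} {W : Type*} [AddCommGroup W] [Module k W] {f g : Lvl k P j →ₗ[k] W}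
    (h : ∀ p, ¬ IsAddUnit p → f (zmon k j p) = g (zmon k j p)) {x : Lvl k P j}
    (hx : x ∈ aug k P j) : f x = g x := by
  obtain ⟨a, ha, rfl⟩ := mem_aug.1 hx
  have h1 := Submodule.mem_map_of_mem (f := (Ideal.Quotient.mkₐ k (mIdeal k P ^ j)).toLinearMap)
    (mem_span_mono a)
  rw [Submodule.map_span] at h1
  have h2 : Set.EqOn f g ((Ideal.Quotient.mkₐ k (mIdeal k P ^ j)).toLinearMap ''
      (mono k '' {p | a.coeff p ≠ 0})) := by
    rintro _ ⟨_, ⟨p, hp, rfl⟩, rfl⟩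
    refine h p ?_
    have h3 := mem_mIdeal_pow (j := 1).1 (by rwa [pow_one]) p hp
    exact not_isAddUnit_of_mem_ordSet h3
  exact LinearMap.eqOn_span h2 h1

/-- The reduction map `k[P] / 𝔪^(j+1) → k[P] / 𝔪^j`. -/
def lvlMap (k : Type*) [Field k] (P : Type*) [AddCommMonoid P] (j : ℕ) :
    Lvl k P (j + 1) →ₐ[k] Lvl k P j :=
  Ideal.Quotient.factorₐ k (Ideal.pow_le_pow_right (Nat.le_succ j))

@[simp] theorem lvlMap_mk (j : ℕ) (f : AddMonoidAlgebra k P) :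
    lvlMap k P j (Ideal.Quotient.mk _ f) = Ideal.Quotient.mk _ f := rfl

@[simp] theorem lvlMap_zmon (j : ℕ) (p : P) : lvlMap k P j (zmon k (j + 1) p) = zmon k j p := rfl

theorem lvlMap_mem_aug {j : ℕ} {x : Lvl k P (j + 1)} (hx : x ∈ aug k P (j + 1)) :
    lvlMap k P j x ∈ aug k P j := by
  obtain ⟨f, hf, rfl⟩ := mem_aug.1 hx
  exact mem_aug.2 ⟨f, hf, rfl⟩

theorem coef_lvlMap {j : ℕ} {p : P} (hp : p ∉ ordSet P j) (x : Lvl k P (j + 1)) :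
    coef k j p (lvlMap k P j x) = coef k (j + 1) p x := by
  obtain ⟨f, rfl⟩ := Ideal.Quotient.mk_surjective x
  rw [lvlMap_mk, coef_mk hp, coef_mk fun h => hp (ordSet_succ_subset j h)]

theorem coef_eq_zero_of_lvlMap {j : ℕ} {p : P} (hp : p ∉ ordSet P j) {x : Lvl k P (j + 1)}
    (hx : lvlMap k P j x = 0) : coef k (j + 1) p x = 0 := by
  rw [← coef_lvlMap hp, hx, map_zero]

theorem lvlMap_eq_zero {j : ℕ} {x : Lvl k P (j + 1)} :
    lvlMap k P j x = 0 ↔ ∃ f ∈ mIdeal k P ^ j, Ideal.Quotient.mk _ f = x := by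
  obtain ⟨f, rfl⟩ := Ideal.Quotient.mk_surjective x
  rw [lvlMap_mk, Ideal.Quotient.eq_zero_iff_mem]
  constructor
  · exact fun h => ⟨f, h, rfl⟩
  · rintro ⟨g, hg, e⟩
    rw [Ideal.Quotient.eq] at e
    have := Ideal.sub_mem _ hg (Ideal.pow_le_pow_right (Nat.le_succ j) e)
    simpa using this

theorem mul_eq_zero_of_lvlMap {j : ℕ} {x y : Lvl k P (j + 1)} (hx : lvlMap k P j x = 0)
    (hy : y ∈ aug k P (j + 1)) : x * y = 0 := by
  obtain ⟨f, hf, rfl⟩ := lvlMap_eq_zero.1 hx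
  obtain ⟨g, hg, rfl⟩ := mem_aug.1 hy
  rw [← map_mul, Ideal.Quotient.eq_zero_iff_mem, pow_succ]
  exact Ideal.mul_mem_mul hf hg

theorem mem_aug_of_lvlMap {j : ℕ} (hj : j ≠ 0) {x : Lvl k P (j + 1)} (hx : lvlMap k P j x = 0) :
    x ∈ aug k P (j + 1) := by
  obtain ⟨f, hf, rfl⟩ := lvlMap_eq_zero.1 hx
  exact mem_aug.2 ⟨f, Ideal.pow_le_self hj hf, rfl⟩

theorem lvlMap_zmon_eq_zero {j : ℕ} {p : P} (hp : p ∈ ordSet P j) :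
    lvlMap k P j (zmon k (j + 1) p) = 0 := by
  rw [lvlMap_zmon, zmon_eq_zero hp]

/-- The restriction of an element of `k[P] / 𝔪^j` to a set of monomials. -/
def mask (k : Type*) [Field k] {P : Type*} [AddCommMonoid P] (j : ℕ) (s : Set P) :
    Lvl k P j →ₗ[k] Lvl k P j :=
  (Ideal.Quotient.mkₐ k (mIdeal k P ^ j)).toLinearMap ∘ₗ
    (AddMonoidAlgebra.coeffLinearEquiv k).symm.toLinearMap ∘ₗ filterLin k s ∘ₗ coefs k P j

open Classical in
theorem mask_zmon (j : ℕ) (s : Set P) (p : P) :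
    mask k j s (zmon k j p) = if p ∈ s then zmon k j p else 0 := by
  by_cases hp : p ∈ ordSet P j
  · rw [zmon_eq_zero hp]; simp
  · have h2 : filterLin k (ordSet P j)ᶜ (mono k p).coeff = Finsupp.single p 1 := by
      ext q
      rw [filterLin_apply]
      by_cases hq : p = q
      · subst hq; simp [mono, hp]
      · simp [mono, hq]
    simp only [mask, LinearMap.coe_comp, Function.comp_apply]
    rw [zmon, coefs_mk, h2]
    split_ifs with hs
    · have : filterLin k s (Finsupp.single p (1 : k)) = Finsupp.single p 1 :=
        Finsupp.filter_single_of_pos _ hs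
      rw [this]; rfl
    · have : filterLin k s (Finsupp.single p (1 : k)) = 0 :=
        Finsupp.filter_single_of_neg _ hs
      rw [this]; simp

theorem coef_mask {j : ℕ} {s : Set P} {p : P} (hp : p ∈ s) (x : Lvl k P j) :
    coef k j p (mask k j s x) = coef k j p x := by
  classical
  by_cases hpj : p ∈ ordSet P j
  · rw [coef_of_mem hpj, coef_of_mem hpj]
  have : coef k j p ∘ₗ mask k j s = coef k j p := lvl_hom_ext fun q => by
    rw [LinearMap.comp_apply, mask_zmon]
    split_ifs with hq
    · rfl
    · rw [map_zero, coef_zmon hpj, if_neg]; rintro rfl; exact hq hp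
  exact LinearMap.congr_fun this x

/-- Masking commutes with multiplication by a monomial, up to a shift. -/
theorem mask_mul_zmon (j : ℕ) {s t : Set P} (q : P) (h : ∀ p, p + q ∈ s ↔ p ∈ t) (x : Lvl k P j) :
    mask k j s (x * zmon k j q) = mask k j t x * zmon k j q := by
  classical
  have : mask k j s ∘ₗ LinearMap.mulRight k (zmon k j q) =
      LinearMap.mulRight k (zmon k j q) ∘ₗ mask k j t := lvl_hom_ext fun p => by
    simp only [LinearMap.comp_apply, LinearMap.mulRight_apply]
    rw [← zmon_add, mask_zmon, mask_zmon]
    simp only [h]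
    split_ifs
    · rw [zmon_add]
    · simp
  exact LinearMap.congr_fun this x

end Coefficients

/-! ### Exponentials and logarithms of unipotent elements -/

section ExpLog

variable {k : Type*} [Field k] [CharZero k] {P : Type*} [AddCommMonoid P] {j : ℕ}

theorem rat_smul_mem (T : Submodule k (Lvl k P j)) (q : ℚ) {x : Lvl k P j} (hx : x ∈ T) :
    q • x ∈ T := by
  have : q • x = (algebraMap ℚ k q) • x := by rw [algebraMap_smul]
  rw [this]
  exact T.smul_mem _ hx

/-- The exponential of an element of `𝔪`. -/
abbrev ex (x : Lvl k P j) : Lvl k P j := IsNilpotent.exp x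

theorem ex_sub_mem (T : Submodule k (Lvl k P j)) {x : Lvl k P j} (hx : x ∈ aug k P j)
    (h : ∀ i ≥ 2, x ^ i ∈ T) : ex x - (1 + x) ∈ T := by
  have h0 : x ^ (j + 2) = 0 := by rw [pow_add, pow_eq_zero_of_mem_aug hx, zero_mul]
  have e : ex x = 1 + x + ∑ i ∈ Finset.range j, ((i + 2).factorial : ℚ)⁻¹ • x ^ (i + 2) := by
    rw [ex, IsNilpotent.exp_eq_sum h0, Finset.sum_range_succ', Finset.sum_range_succ']
    simp; ring
  rw [e, add_sub_cancel_left]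
  exact T.sum_mem fun i _ => rat_smul_mem T _ (h _ (by omega))

theorem ex_sub_one_mem (T : Submodule k (Lvl k P j)) {x : Lvl k P j} (hx : x ∈ aug k P j)
    (h : ∀ i ≥ 1, x ^ i ∈ T) : ex x - 1 ∈ T := by
  have h1 := ex_sub_mem T hx fun i hi => h i (by omega)
  have h2 := h 1 le_rfl
  rw [pow_one] at h2
  have := T.add_mem h1 h2
  convert this using 1; ring

theorem ex_add {x y : Lvl k P j} (hx : x ∈ aug k P j) (hy : y ∈ aug k P j) :
    ex (x + y) = ex x * ex y :=
  IsNilpotent.exp_add_of_commute (Commute.all _ _) (isNilpotent_of_mem_aug hx)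
    (isNilpotent_of_mem_aug hy)

@[simp] theorem ex_zero : ex (0 : Lvl k P j) = 1 := IsNilpotent.exp_zero

theorem ex_sub_one_mem_aug {x : Lvl k P j} (hx : x ∈ aug k P j) : ex x - 1 ∈ aug k P j :=
  ex_sub_one_mem ((aug k P j).restrictScalars k)
    hx fun i hi => Ideal.pow_mem_of_mem _ hx i (by omega)

theorem ex_eq_one {x : Lvl k P j} (hx : x ∈ aug k P j) (h : ex x = 1) : x = 0 := by
  have h1 : ∃ y ∈ aug k P j, ex x - (1 + x) = x * y := by
    have := ex_sub_mem ((Submodule.map (LinearMap.mulLeft k x)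
      ((aug k P j).restrictScalars k))) hx (fun i hi => by
        obtain ⟨i, rfl⟩ := Nat.exists_eq_add_of_le hi
        exact ⟨x ^ (1 + i), Ideal.pow_mem_of_mem _ hx _ (by omega), by
          simp only [LinearMap.mulLeft_apply]; ring⟩)
    obtain ⟨y, hy, e⟩ := this
    exact ⟨y, hy, e.symm⟩
  obtain ⟨y, hy, e⟩ := h1
  rw [h] at e
  have h2 : x * (1 + y) = 0 := by linear_combination -e
  have h3 : IsUnit (1 + y) := (isNilpotent_of_mem_aug hy).isUnit_one_add
  exact (h3.mul_left_eq_zero).1 h2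

theorem ex_injective {x y : Lvl k P j} (hx : x ∈ aug k P j) (hy : y ∈ aug k P j)
    (h : ex x = ex y) : x = y := by
  have h1 : ex (x - y) = 1 := by
    rw [sub_eq_add_neg, ex_add hx (neg_mem hy), h, ← ex_add hy (neg_mem hy)]; simp
  exact sub_eq_zero.1 (ex_eq_one (Ideal.sub_mem _ hx hy) h1)

/-- Every element of `1 + T` is an exponential of an element of `T`, if `T ⊆ 𝔪` is closed under
products. The logarithm is found by successive approximation. -/
theorem exists_log (T : Submodule k (Lvl k P j)) (hT : ∀ x ∈ T, ∀ y ∈ T, x * y ∈ T)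
    (hTa : ∀ x ∈ T, x ∈ aug k P j) {f : Lvl k P j} (hf : f - 1 ∈ T) : ∃ x ∈ T, ex x = f := by
  have key : ∀ d i, 1 ≤ i → j ≤ i + d → ∀ f : Lvl k P j, f - 1 ∈ T → f - 1 ∈ aug k P j ^ i →
      ∃ x ∈ T, ex x = f := by
    intro d
    induction d with
    | zero =>
      intro i _ hi f _ h2
      have h3 := Ideal.pow_le_pow_right (show j ≤ i by omega) h2
      rw [aug_pow] at h3
      exact ⟨0, T.zero_mem, by rw [ex_zero]; exact (sub_eq_zero.1 h3).symm⟩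
    | succ d ih =>
      intro i hi1 hi f h1 h2
      set s := f - 1 with hs
      let U : Submodule k (Lvl k P j) := T ⊓ (aug k P j ^ (i + 1)).restrictScalars k
      have hs2 : ∀ t ≥ 2, s ^ t ∈ U := by
        intro t ht
        obtain ⟨t, rfl⟩ := Nat.exists_eq_add_of_le ht
        refine ⟨?_, ?_⟩
        · have : ∀ t, s ^ (t + 1) ∈ T := by
            intro t
            induction t with
            | zero => simpa using h1
            | succ t ih' => rw [pow_succ]; exact hT _ ih' _ h1
          have := this (1 + t)
          rwa [show 1 + t + 1 = 2 + t by ring] at this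
        · have h3 := Ideal.pow_mem_pow h2 (2 + t)
          exact Ideal.pow_le_pow_right (by nlinarith) ((pow_mul (aug k P j) i (2 + t)).ge h3)
      have hsa : s ∈ aug k P j := hTa s h1
      have h4 := ex_sub_mem U (neg_mem hsa) (fun t ht => by
        have e : (-s) ^ t = (-1) ^ t * s ^ t := neg_pow s t
        rw [e]
        rcases neg_one_pow_eq_or (Lvl k P j) t with h | h <;> rw [h]
        · rw [one_mul]; exact hs2 t ht
        · rw [neg_one_mul]; exact U.neg_mem (hs2 t ht))
      set e := ex (-s) - (1 + -s) with he
      have h5 : f * ex (-s) - 1 ∈ U := by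
        have : f * ex (-s) - 1 = -s ^ 2 + e + s * e := by
          have : f = 1 + s := by rw [hs]; ring
          rw [this, he]; ring
        rw [this]
        refine U.add_mem (U.add_mem (U.neg_mem (hs2 2 le_rfl)) h4) ⟨hT _ h1 _ h4.1, ?_⟩
        exact Ideal.mul_mem_left _ _ h4.2
      obtain ⟨y, hy, hye⟩ := ih (i + 1) (by omega) (by omega) _ h5.1 h5.2
      refine ⟨s + y, T.add_mem h1 hy, ?_⟩
      have h6 : ex s * ex (-s) = 1 := by rw [← ex_add hsa (neg_mem hsa)]; simp
      rw [ex_add hsa (hTa y hy), hye]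
      linear_combination f * h6
  exact key j 1 le_rfl (by omega) f hf ((pow_one (aug k P j)).ge (hTa _ hf))

/-- The logarithm of an element of `1 + 𝔪`. -/
def lg (f : Lvl k P j) : Lvl k P j :=
  open Classical in if h : ∃ x ∈ aug k P j, ex x = f then h.choose else 0

theorem lg_mem (f : Lvl k P j) : lg f ∈ aug k P j := by
  unfold lg
  split_ifs with h
  exacts [h.choose_spec.1, Ideal.zero_mem _]

theorem lg_ex {x : Lvl k P j} (hx : x ∈ aug k P j) : lg (ex x) = x := by
  have h : ∃ y ∈ aug k P j, ex y = ex x := ⟨x, hx, rfl⟩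
  unfold lg
  rw [dif_pos h]
  exact ex_injective h.choose_spec.1 hx h.choose_spec.2

theorem ex_lg {f : Lvl k P j} (hf : f - 1 ∈ aug k P j) : ex (lg f) = f := by
  obtain ⟨x, hx, rfl⟩ := exists_log ((aug k P j).restrictScalars k)
    (fun x hx y _ => Ideal.mul_mem_right _ _ hx) (fun _ h => h) hf
  rw [lg_ex hx]

@[simp] theorem lg_one : lg (1 : Lvl k P j) = 0 := by
  rw [← ex_zero, lg_ex (Ideal.zero_mem _)]

theorem lg_mul {f g : Lvl k P j} (hf : f - 1 ∈ aug k P j) (hg : g - 1 ∈ aug k P j) :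
    lg (f * g) = lg f + lg g := by
  rw [← ex_lg hf, ← ex_lg hg, ← ex_add (lg_mem _) (lg_mem _),
    lg_ex (Ideal.add_mem _ (lg_mem _) (lg_mem _)),
    ex_lg hf, ex_lg hg]

theorem mul_sub_one_mem {f g : Lvl k P j} (hf : f - 1 ∈ aug k P j) (hg : g - 1 ∈ aug k P j) :
    f * g - 1 ∈ aug k P j := by
  have : f * g - 1 = (f - 1) * g + (g - 1) := by ring
  rw [this]
  exact Ideal.add_mem _ (Ideal.mul_mem_right _ _ hf) hg

theorem lg_pow {f : Lvl k P j} (hf : f - 1 ∈ aug k P j) (a : ℕ) : lg (f ^ a) = a • lg f := by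
  have h : ∀ a, f ^ a - 1 ∈ aug k P j := by
    intro a
    induction a with
    | zero => simp
    | succ a ih => rw [pow_succ]; exact mul_sub_one_mem ih hf
  induction a with
  | zero => simp
  | succ a ih => rw [pow_succ, lg_mul (h a) hf, ih, succ_nsmul]

theorem lvlMap_ex {x : Lvl k P (j + 1)} (hx : x ∈ aug k P (j + 1)) :
    lvlMap k P j (ex x) = ex (lvlMap k P j x) :=
  IsNilpotent.map_exp (isNilpotent_of_mem_aug hx) (lvlMap k P j).toRingHom

theorem lvlMap_lg {f : Lvl k P (j + 1)} (hf : f - 1 ∈ aug k P (j + 1)) :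
    lvlMap k P j (lg f) = lg (lvlMap k P j f) := by
  rw [← ex_lg hf, lg_ex (lg_mem _), lvlMap_ex (lg_mem _), lg_ex (lvlMap_mem_aug (lg_mem _))]

theorem ex_zsmul {x : Lvl k P j} (hx : x ∈ aug k P j)
    {u : (Lvl k P j)ˣ} (hu : (u : Lvl k P j) = ex x)
    (a : ℤ) : ((u ^ a : (Lvl k P j)ˣ) : Lvl k P j) = ex (a • x) := by
  have hmem : ∀ a : ℤ, a • x ∈ aug k P j := fun a => zsmul_mem hx a
  have h0 : ∀ a : ℕ, ((u ^ a : (Lvl k P j)ˣ) : Lvl k P j) = ex ((a : ℤ) • x) := by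
    intro a
    induction a with
    | zero => simp
    | succ a ih =>
      rw [pow_succ, Units.val_mul, ih, hu, ← ex_add (hmem _) hx]
      congr 1
      rw [Nat.cast_succ, add_smul, one_smul]
  rcases Int.eq_nat_or_neg a with ⟨b, rfl | rfl⟩
  · rw [zpow_natCast, h0]
  · rw [zpow_neg, zpow_natCast, ← mul_one (((u ^ b)⁻¹ : (Lvl k P j)ˣ) : Lvl k P j),
      Units.inv_mul_eq_iff_eq_mul, h0,
      ← ex_add (hmem _) (hmem _), neg_smul, add_neg_cancel, ex_zero]

end ExpLog

/-! ### The tropical vertex group in logarithmic coordinates -/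

section Twisted

variable {k : Type*} [Field k] {P : Type*} [AddCommMonoid P] {M : Type v} [AddCommGroup M]

theorem aug_le {j : ℕ} {T : Submodule k (Lvl k P j)} (h : ∀ p, ¬ IsAddUnit p → zmon k j p ∈ T)
    {x : Lvl k P j} (hx : x ∈ aug k P j) : x ∈ T := by
  have := aug_hom_ext (f := T.mkQ) (g := 0) (fun p hp => by
    rw [LinearMap.zero_apply, Submodule.mkQ_apply, Submodule.Quotient.mk_eq_zero]; exact h p hp) hx
  rwa [LinearMap.zero_apply, Submodule.mkQ_apply, Submodule.Quotient.mk_eq_zero] at this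

/-- Unipotent automorphisms of `(k[P]/𝔪^j)[M]` of the form `z^p z^m ↦ exp (log (r p + m)) z^p z^m`,
recorded by the additive map `log : M → 𝔪`. -/
@[ext] structure Tw (k : Type*) [Field k] {P : Type*} [AddCommMonoid P] {M : Type v}
    [AddCommGroup M] (r : P →+ M) (j : ℕ) where
  log : M →+ Lvl k P j
  mem : ∀ d, log d ∈ aug k P j

variable [CharZero k] {r : P →+ M} {j : ℕ}

namespace Tw

/-- The action of `a` on `k[P]`, with values in `k[P]/𝔪^j`. -/
def baseAux (a : Tw k r j) : AddMonoidAlgebra k P →ₐ[k] Lvl k P j :=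
  AddMonoidAlgebra.lift k (Lvl k P j) P
    { toFun := fun p => ex (a.log (r p.toAdd)) * zmon k j p.toAdd
      map_one' := by simp
      map_mul' := fun p q => by
        simp only [toAdd_mul, map_add, ex_add (a.mem _) (a.mem _), zmon_add]
        ring }

theorem baseAux_mono (a : Tw k r j) (p : P) :
    a.baseAux (mono k p) = ex (a.log (r p)) * zmon k j p := by
  simp [baseAux, mono, AddMonoidAlgebra.lift_single]

/-- The action of `a` on `k[P]/𝔪^j`: `z^p ↦ exp (log (r p)) z^p`. -/
def base (a : Tw k r j) : Lvl k P j →ₐ[k] Lvl k P j :=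
  Ideal.Quotient.liftₐ (mIdeal k P ^ j) a.baseAux (by
    intro f hf
    have h : Submodule.span k (mono k '' {p | f.coeff p ≠ 0})
        ≤ LinearMap.ker a.baseAux.toLinearMap := by
      rw [Submodule.span_le]
      rintro _ ⟨p, hp, rfl⟩
      have := baseAux_mono a p
      rw [zmon_eq_zero (mem_mIdeal_pow.1 hf p hp), mul_zero] at this
      exact this
    exact h (mem_span_mono f))

theorem base_zmon (a : Tw k r j) (p : P) : a.base (zmon k j p) = ex (a.log (r p)) * zmon k j p :=
  baseAux_mono a p

theorem base_mem_aug (a : Tw k r j) {x : Lvl k P j} (hx : x ∈ aug k P j) :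
    a.base x ∈ aug k P j := by
  refine aug_le (T := ((aug k P j).restrictScalars k).comap a.base.toLinearMap) (fun p hp => ?_) hx
  have := base_zmon a p
  change a.base (zmon k j p) ∈ aug k P j
  rw [this]
  exact Ideal.mul_mem_left _ _ (zmon_mem_aug hp)

theorem base_ex (a : Tw k r j) {x : Lvl k P j} (hx : x ∈ aug k P j) :
    a.base (ex x) = ex (a.base x) :=
  IsNilpotent.map_exp (isNilpotent_of_mem_aug hx) a.base.toRingHom

instance : One (Tw k r j) := ⟨⟨0, fun _ => Ideal.zero_mem _⟩⟩
instance : Mul (Tw k r j) :=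
  ⟨fun a b => ⟨a.log + (a.base : Lvl k P j →+ Lvl k P j).comp b.log, fun d =>
    Ideal.add_mem _ (a.mem d) (a.base_mem_aug (b.mem d))⟩⟩

@[simp] theorem one_log (d : M) : (1 : Tw k r j).log d = 0 := rfl
theorem mul_log (a b : Tw k r j) (d : M) : (a * b).log d = a.log d + a.base (b.log d) := rfl

theorem base_hom_ext {f g : Lvl k P j →ₐ[k] Lvl k P j} (h : ∀ p, f (zmon k j p) = g (zmon k j p)) :
    f = g := AlgHom.toLinearMap_injective (lvl_hom_ext h)

theorem base_one : (1 : Tw k r j).base = AlgHom.id k _ := base_hom_ext fun p => by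
  rw [base_zmon]; simp

theorem base_mul (a b : Tw k r j) : (a * b).base = a.base.comp b.base := base_hom_ext fun p => by
  rw [base_zmon, mul_log, AlgHom.comp_apply, base_zmon, map_mul, base_zmon, base_ex _ (b.mem _),
    ex_add (a.mem _) (a.base_mem_aug (b.mem _))]
  ring

theorem ext_log {a b : Tw k r j} (h : ∀ d, a.log d = b.log d) : a = b :=
  Tw.ext (AddMonoidHom.ext h)

instance : Monoid (Tw k r j) where
  mul_assoc a b c := ext_log fun d => by
    rw [mul_log, mul_log, mul_log, mul_log, base_mul, AlgHom.comp_apply, map_add, add_assoc]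
  one_mul a := ext_log fun d => by rw [mul_log, base_one]; simp
  mul_one a := ext_log fun d => by rw [mul_log]; simp

/-- The reduction map. -/
def red (a : Tw k r (j + 1)) : Tw k r j :=
  ⟨(lvlMap k P j : Lvl k P (j + 1) →+ Lvl k P j).comp a.log, fun d => lvlMap_mem_aug (a.mem d)⟩

theorem red_log (a : Tw k r (j + 1)) (d : M) : a.red.log d = lvlMap k P j (a.log d) := rfl

theorem lvlMap_base (a : Tw k r (j + 1)) (x : Lvl k P (j + 1)) :
    lvlMap k P j (a.base x) = a.red.base (lvlMap k P j x) := by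
  have : (lvlMap k P j).comp a.base = a.red.base.comp (lvlMap k P j) := by
    apply AlgHom.toLinearMap_injective
    refine lvl_hom_ext fun p => ?_
    change lvlMap k P j (a.base (zmon k (j + 1) p)) = a.red.base (lvlMap k P j (zmon k (j + 1) p))
    rw [base_zmon, map_mul, lvlMap_ex (a.mem _), lvlMap_zmon, base_zmon]
    rfl
  exact AlgHom.congr_fun this x

theorem red_mul (a b : Tw k r (j + 1)) : (a * b).red = a.red * b.red := ext_log fun d => by
  rw [red_log, mul_log, mul_log, map_add, lvlMap_base, red_log, red_log]

theorem red_eq {a b : Tw k r (j + 1)} (h : a.red = b.red) (d : M) :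
    lvlMap k P j (b.log d - a.log d) = 0 := by
  rw [map_sub, ← red_log, ← red_log, h, sub_self]

theorem red_eq_iff {a b : Tw k r (j + 1)} :
    a.red = b.red ↔ ∀ d, lvlMap k P j (b.log d - a.log d) = 0 :=
  ⟨red_eq, fun h => ext_log fun d => by
    have := h d
    rw [map_sub, sub_eq_zero] at this
    rw [red_log, red_log, this]⟩

theorem ex_eq_of_lvlMap {c : Lvl k P (j + 1)} (hc : c ∈ aug k P (j + 1))
    (hc0 : lvlMap k P j c = 0) : ex c = 1 + c := by
  have h : ∀ i ≥ 2, c ^ i ∈ (⊥ : Submodule k (Lvl k P (j + 1))) := by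
    intro i hi
    obtain ⟨i, rfl⟩ := Nat.exists_eq_add_of_le hi
    have : c ^ 2 = 0 := by rw [pow_two]; exact mul_eq_zero_of_lvlMap hc0 hc
    have e : c ^ (2 + i) = 0 := by rw [pow_add, this, zero_mul]
    exact (Submodule.mem_bot _).2 e
  exact sub_eq_zero.1 ((Submodule.mem_bot _).1 (ex_sub_mem ⊥ hc h))

theorem mul_ex_of_lvlMap {c x : Lvl k P (j + 1)} (hc0 : lvlMap k P j c = 0)
    (hx : x ∈ aug k P (j + 1)) : ex x * c = c := by
  have := mul_eq_zero_of_lvlMap hc0 (ex_sub_one_mem_aug hx)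
  linear_combination this

/-- The action is trivial on the last step of the filtration. -/
theorem base_of_lvlMap (a : Tw k r (j + 1)) {c : Lvl k P (j + 1)} (hc0 : lvlMap k P j c = 0) :
    a.base c = c := by
  have hs : c = ∑ p ∈ (coef_finite c).toFinset, coef k (j + 1) p c • zmon k (j + 1) p :=
    eq_sum_coef c _ fun p hp => by simpa using hp
  have h : ∀ p ∈ (coef_finite c).toFinset, a.base (zmon k (j + 1) p) = zmon k (j + 1) p := by
    intro p hp
    have hpj : p ∈ ordSet P j := by
      by_contra h0
      simp only [Set.Finite.mem_toFinset, Set.mem_ofPred_eq] at hp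
      exact hp (coef_eq_zero_of_lvlMap h0 hc0)
    rw [base_zmon]
    exact mul_ex_of_lvlMap (lvlMap_zmon_eq_zero hpj) (a.mem _)
  rw [hs, map_sum]
  exact Finset.sum_congr rfl fun p hp => by rw [map_smul, h p hp]

/-- The action on `𝔪` does not depend on the last step of the filtration of the
automorphism. -/
theorem base_congr {a b : Tw k r (j + 1)} (h : a.red = b.red) {x : Lvl k P (j + 1)}
    (hx : x ∈ aug k P (j + 1)) : a.base x = b.base x := by
  refine aug_hom_ext (f := a.base.toLinearMap) (g := b.base.toLinearMap) (fun p hp => ?_) hx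
  change a.base (zmon k (j + 1) p) = b.base (zmon k (j + 1) p)
  rw [base_zmon, base_zmon]
  have h1 := red_eq h (r p)
  have h2 : b.log (r p) = a.log (r p) + (b.log (r p) - a.log (r p)) := by ring
  have h3 : b.log (r p) - a.log (r p) ∈ aug k P (j + 1) := Ideal.sub_mem _ (b.mem _) (a.mem _)
  rw [h2, ex_add (a.mem _) h3, ex_eq_of_lvlMap h3 h1]
  have h4 := mul_eq_zero_of_lvlMap h1 (zmon_mem_aug (k := k) (j := j + 1) hp)
  linear_combination -(ex (a.log (r p))) * h4

theorem diff_mul {a a' b b' : Tw k r (j + 1)} (ha : a.red = a'.red) (hb : b.red = b'.red) (d : M) :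
    (a' * b').log d - (a * b).log d = (a'.log d - a.log d) + (b'.log d - b.log d) := by
  rw [mul_log, mul_log, ← base_congr ha (b'.mem d)]
  have := base_of_lvlMap a (red_eq hb d)
  rw [map_sub] at this
  linear_combination this

/-- The automorphism with logarithm `d ↦ ν d • ℓ`, i.e. the exponential of `ℓ ∂_ν` if `ℓ` is
killed by `∂_ν`. -/
def elem (r : P →+ M) (ν : M →+ k) (ℓ : Lvl k P j) (hℓ : ℓ ∈ aug k P j) : Tw k r j :=
  ⟨⟨⟨fun d => ν d • ℓ, by simp⟩, fun d d' => by simp [add_smul]⟩, fun d =>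
    ((aug k P j).restrictScalars k).smul_mem _ hℓ⟩

theorem elem_log (ν : M →+ k) (ℓ : Lvl k P j) (hℓ : ℓ ∈ aug k P j) (d : M) :
    (elem r ν ℓ hℓ).log d = ν d • ℓ := rfl

/-- The series in the monomials `z^q`, `q ∈ 𝔪`, with `r q ≠ 0` and `∂_ν z^q = 0`. -/
def slab (r : P →+ M) (j : ℕ) (ν : M →+ k) : Submodule k (Lvl k P j) :=
  Submodule.span k {x | ∃ q, ¬ IsAddUnit q ∧ r q ≠ 0 ∧ ν (r q) = 0 ∧ x = zmon k j q}

theorem slab_le_aug (ν : M →+ k) {x : Lvl k P j} (hx : x ∈ slab r j ν) : x ∈ aug k P j := by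
  have : slab r j ν ≤ (aug k P j).restrictScalars k := by
    rw [slab, Submodule.span_le]
    rintro _ ⟨q, hq, _, _, rfl⟩
    exact zmon_mem_aug hq
  exact this hx

theorem base_elem_of_mem_slab (ν : M →+ k) {ℓ ℓ' : Lvl k P j} (hℓ : ℓ ∈ aug k P j)
    (hℓ' : ℓ' ∈ slab r j ν) : (elem r ν ℓ hℓ).base ℓ' = ℓ' := by
  have : slab r j ν ≤ LinearMap.eqLocus (elem r ν ℓ hℓ).base.toLinearMap LinearMap.id := by
    rw [slab, Submodule.span_le]
    rintro _ ⟨q, _, _, h0, rfl⟩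
    change (elem r ν ℓ hℓ).base (zmon k j q) = zmon k j q
    rw [base_zmon, elem_log, h0]; simp
  exact this hℓ'

theorem elem_mul_elem (ν : M →+ k) {ℓ ℓ' : Lvl k P j} (hℓ : ℓ ∈ slab r j ν)
    (hℓ' : ℓ' ∈ slab r j ν) :
    elem r ν ℓ (slab_le_aug ν hℓ) * elem r ν ℓ' (slab_le_aug ν hℓ') =
      elem r ν (ℓ + ℓ') (slab_le_aug ν (Submodule.add_mem _ hℓ hℓ')) := ext_log fun d => by
  rw [mul_log, elem_log, elem_log, elem_log, map_smul, base_elem_of_mem_slab ν _ hℓ', smul_add]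

/-- The subgroup of the tropical vertex group generated by the exponentials of the derivations
`ℓ ∂_ν` that kill `Λ`. -/
def grp (k : Type*) [Field k] [CharZero k] {P : Type*} [AddCommMonoid P] {M : Type v}
    [AddCommGroup M] (r : P →+ M) (j : ℕ) (Λ : AddSubgroup M) : Submonoid (Tw k r j) :=
  Submonoid.closure {a | ∃ (ν : M →+ k) (ℓ : Lvl k P j) (hℓ : ℓ ∈ slab r j ν),
    (∀ d ∈ Λ, ν d = 0) ∧ a = elem r ν ℓ (slab_le_aug ν hℓ)}

theorem elem_mem_grp {Λ : AddSubgroup M} {ν : M →+ k} {ℓ : Lvl k P j} (hℓ : ℓ ∈ slab r j ν)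
    (h : ∀ d ∈ Λ, ν d = 0) : elem r ν ℓ (slab_le_aug ν hℓ) ∈ grp k r j Λ :=
  Submonoid.subset_closure ⟨ν, ℓ, hℓ, h, rfl⟩

theorem grp_mono {Λ Λ' : AddSubgroup M} (h : Λ ≤ Λ') : grp k r j Λ' ≤ grp k r j Λ := by
  refine Submonoid.closure_mono ?_
  rintro a ⟨ν, ℓ, hℓ, h0, rfl⟩
  exact ⟨ν, ℓ, hℓ, fun d hd => h0 d (h hd), rfl⟩

theorem exists_inv_of_mem_grp {Λ : AddSubgroup M} {a : Tw k r j} (ha : a ∈ grp k r j Λ) :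
    ∃ b ∈ grp k r j Λ, a * b = 1 ∧ b * a = 1 := by
  induction ha using Submonoid.closure_induction with
  | one => exact ⟨1, one_mem _, by simp, by simp⟩
  | mul a b _ _ iha ihb =>
    obtain ⟨a', ha', h1, h2⟩ := iha
    obtain ⟨b', hb', h3, h4⟩ := ihb
    refine ⟨b' * a', mul_mem hb' ha', ?_, ?_⟩
    · rw [mul_assoc, ← mul_assoc b, h3, one_mul, h1]
    · rw [mul_assoc, ← mul_assoc a', h2, one_mul, h4]
  | mem a ha =>
    obtain ⟨ν, ℓ, hℓ, h0, rfl⟩ := ha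
    have hn := Submodule.neg_mem _ hℓ
    refine ⟨_, elem_mem_grp hn h0, ?_, ?_⟩
    · rw [elem_mul_elem ν hℓ hn]; exact ext_log fun d => by rw [elem_log]; simp
    · rw [elem_mul_elem ν hn hℓ]; exact ext_log fun d => by rw [elem_log]; simp

theorem log_eq_zero_of_mem_grp {Λ : AddSubgroup M} {a : Tw k r j} (ha : a ∈ grp k r j Λ) {d : M}
    (hd : d ∈ Λ) : a.log d = 0 := by
  induction ha using Submonoid.closure_induction with
  | one => rfl
  | mul a b _ _ iha ihb => rw [mul_log, iha, ihb]; simp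
  | mem a ha =>
    obtain ⟨ν, ℓ, hℓ, h0, rfl⟩ := ha
    rw [elem_log, h0 d hd, zero_smul]

/-- Elements of the tropical vertex group preserve the projection to the monomials with exponents
in `Λ`: it is generated by derivations `z^q ∂_ν` with `ν (r q) = 0`, which are divergence free. -/
theorem mask_ex_of_mem_grp {Λ : AddSubgroup M} {a : Tw k r j} (ha : a ∈ grp k r j Λ) (d : M) :
    mask k j {p | d + r p ∈ Λ} (ex (a.log d)) = mask k j {p | d + r p ∈ Λ} 1 := by
  classical
  induction ha using Submonoid.closure_induction generalizing d with
  | one => simp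
  | mul a b _ _ iha ihb =>
    rw [mul_log, ex_add (a.mem d) (a.base_mem_aug (b.mem d)), ← base_ex _ (b.mem d), ← ihb]
    have : mask k j {p | d + r p ∈ Λ} ∘ₗ LinearMap.mulLeft k (ex (a.log d)) ∘ₗ a.base.toLinearMap =
        mask k j {p | d + r p ∈ Λ} := lvl_hom_ext fun q => by
      have hs : ∀ p, p + q ∈ {p | d + r p ∈ Λ} ↔ p ∈ {p | (d + r q) + r p ∈ Λ} := fun p => by
        simp only [Set.mem_ofPred_eq, map_add]
        rw [show d + (r p + r q) = d + r q + r p by abel]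
      change mask k j {p | d + r p ∈ Λ} (ex (a.log d) * a.base (zmon k j q)) =
        mask k j {p | d + r p ∈ Λ} (zmon k j q)
      rw [base_zmon, ← mul_assoc, ← ex_add (a.mem _) (a.mem _), ← map_add,
        mask_mul_zmon j q hs, iha, ← mask_mul_zmon j q hs, one_mul]
    exact LinearMap.congr_fun this _
  | mem a ha =>
    obtain ⟨ν, ℓ, hℓ, h0, rfl⟩ := ha
    rw [elem_log]
    by_cases hd : ν d = 0
    · rw [hd]; simp
    let T : Submodule k (Lvl k P j) := Submodule.span k {x | ∃ q, ν (r q) = 0 ∧ x = zmon k j q}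
    have hTT : T * T ≤ T := by
      rw [Submodule.span_mul_span, Submodule.span_le]
      rintro _ ⟨_, ⟨q, hq, rfl⟩, _, ⟨q', hq', rfl⟩, rfl⟩
      exact Submodule.subset_span ⟨q + q', by simp [hq, hq'], by simp [zmon_add]⟩
    have hsT : slab r j ν ≤ T := by
      refine Submodule.span_mono ?_
      rintro x ⟨q, _, _, h, e⟩
      exact ⟨q, h, e⟩
    have hx : ν d • ℓ ∈ T := T.smul_mem _ (hsT hℓ)
    have hp : ∀ i ≥ 1, (ν d • ℓ) ^ i ∈ T := by
      intro i hi
      obtain ⟨i, rfl⟩ := Nat.exists_eq_add_of_le' hi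
      induction i with
      | zero => simpa using hx
      | succ i ih => rw [pow_succ]; exact hTT (Submodule.mul_mem_mul (ih (by omega)) hx)
    have h1 := ex_sub_one_mem T ((elem r ν ℓ (slab_le_aug ν hℓ)).mem d) hp
    have h2 : T ≤ LinearMap.ker (mask k j {p | d + r p ∈ Λ}) := by
      rw [Submodule.span_le]
      rintro _ ⟨q, hq, rfl⟩
      rw [SetLike.mem_coe, LinearMap.mem_ker, mask_zmon, if_neg]
      intro hmem
      have := h0 _ hmem
      rw [map_add, hq, add_zero] at this
      exact hd this
    have h3 := h2 h1
    rw [LinearMap.mem_ker, map_sub, sub_eq_zero] at h3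
    exact h3

/-- Taking the coefficient of `z^p` with `r p ∈ Λ` is additive on products in `grp Λ`. -/
theorem coef_mul_of_mem_grp {Λ : AddSubgroup M} {a : Tw k r j} (ha : a ∈ grp k r j Λ)
    (b : Tw k r j) {p : P} (hp : r p ∈ Λ) (d : M) :
    coef k j p ((a * b).log d) = coef k j p (a.log d) + coef k j p (b.log d) := by
  rw [mul_log, map_add]
  congr 1
  have : mask k j {p | r p ∈ Λ} ∘ₗ a.base.toLinearMap = mask k j {p | r p ∈ Λ} :=
    lvl_hom_ext fun q => by
      have hs : ∀ p, p + q ∈ {p | r p ∈ Λ} ↔ p ∈ {p | r q + r p ∈ Λ} := fun p => by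
        simp [add_comm]
      change mask k j {p | r p ∈ Λ} (a.base (zmon k j q)) = mask k j {p | r p ∈ Λ} (zmon k j q)
      rw [base_zmon, mask_mul_zmon j q hs, mask_ex_of_mem_grp ha, ← mask_mul_zmon j q hs, one_mul]
  have h1 := LinearMap.congr_fun this (b.log d)
  rw [← coef_mask (s := {p | r p ∈ Λ}) hp, ← coef_mask (s := {p | r p ∈ Λ}) hp (b.log d)]
  exact congrArg _ h1

theorem coef_of_mem_slab {ν : M →+ k} {x : Lvl k P j} (hx : x ∈ slab r j ν) {p : P}
    (h : r p = 0 ∨ ν (r p) ≠ 0) : coef k j p x = 0 := by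
  classical
  by_cases hpj : p ∈ ordSet P j
  · exact coef_of_mem hpj x
  have : slab r j ν ≤ LinearMap.ker (coef k j p) := by
    rw [slab, Submodule.span_le]
    rintro _ ⟨q, _, h1, h2, rfl⟩
    rw [SetLike.mem_coe, LinearMap.mem_ker, coef_zmon hpj, if_neg]
    rintro rfl
    rcases h with h | h
    exacts [h1 h, h h2]
  exact this hx

theorem coef_eq_zero_of_mem_grp {Λ : AddSubgroup M} {a : Tw k r j} (ha : a ∈ grp k r j Λ) {p : P}
    (hp : r p = 0) (d : M) : coef k j p (a.log d) = 0 := by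
  induction ha using Submonoid.closure_induction with
  | one => simp
  | mul a b ha' _ iha ihb =>
    rw [coef_mul_of_mem_grp ha' b (by rw [hp]; exact Λ.zero_mem), iha, ihb, add_zero]
  | mem a ha =>
    obtain ⟨ν, ℓ, hℓ, h0, rfl⟩ := ha
    rw [elem_log, map_smul, coef_of_mem_slab hℓ (Or.inl hp), smul_zero]

theorem coef_diff_eq_zero {Λ Λ' : AddSubgroup M} {a b : Tw k r (j + 1)} (ha : a ∈ grp k r (j + 1) Λ)
    (hb : b ∈ grp k r (j + 1) Λ') (h : a.red = b.red) (p : P) :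
    coef k (j + 1) p (b.log (r p) - a.log (r p)) = 0 := by
  have ha' := grp_mono bot_le ha
  have hb' := grp_mono bot_le hb
  set d := -r p with hd
  have h1 := red_eq h d
  have h3 : b.log d - a.log d ∈ aug k P (j + 1) := Ideal.sub_mem _ (b.mem _) (a.mem _)
  have e : ex (b.log d) = ex (a.log d) + (b.log d - a.log d) := by
    have h2 : b.log d = a.log d + (b.log d - a.log d) := by ring
    conv_lhs => rw [h2]
    rw [ex_add (a.mem _) h3, ex_eq_of_lvlMap h3 h1, mul_add, mul_ex_of_lvlMap h1 (a.mem _), mul_one]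
  have h4 := mask_ex_of_mem_grp hb' d
  rw [e, map_add, mask_ex_of_mem_grp ha' d, add_eq_left] at h4
  have h5 := coef_mask (s := {p | d + r p ∈ (⊥ : AddSubgroup M)}) (p := p) (by simp [hd])
    (b.log d - a.log d)
  rw [h4, map_zero] at h5
  have h6 : b.log (r p) - a.log (r p) = -(b.log d - a.log d) := by
    rw [hd, map_neg, map_neg]; ring
  rw [h6, map_neg, ← h5, neg_zero]

theorem exists_lift_slab {ν : M →+ k} {x : Lvl k P j} (hx : x ∈ slab r j ν) :
    ∃ y ∈ slab r (j + 1) ν, lvlMap k P j y = x := by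
  have : slab r j ν = (slab r (j + 1) ν).map (lvlMap k P j).toLinearMap := by
    rw [slab, slab, Submodule.map_span]
    congr 1
    ext x; constructor
    · rintro ⟨q, h1, h2, h3, rfl⟩
      exact ⟨_, ⟨q, h1, h2, h3, rfl⟩, rfl⟩
    · rintro ⟨_, ⟨q, h1, h2, h3, rfl⟩, rfl⟩
      exact ⟨q, h1, h2, h3, rfl⟩
  rw [this] at hx
  obtain ⟨y, hy, e⟩ := hx
  exact ⟨y, hy, e⟩

theorem lvlMap_mem_slab {ν : M →+ k} {x : Lvl k P (j + 1)} (hx : x ∈ slab r (j + 1) ν) :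
    lvlMap k P j x ∈ slab r j ν := by
  have : slab r (j + 1) ν ≤ (slab r j ν).comap (lvlMap k P j).toLinearMap := by
    rw [slab, Submodule.span_le]
    rintro _ ⟨q, h1, h2, h3, rfl⟩
    exact Submodule.subset_span ⟨q, h1, h2, h3, rfl⟩
  exact this hx

theorem red_elem (ν : M →+ k) {ℓ : Lvl k P (j + 1)} (hℓ : ℓ ∈ aug k P (j + 1)) :
    (elem r ν ℓ hℓ).red = elem r ν (lvlMap k P j ℓ) (lvlMap_mem_aug hℓ) := ext_log fun d => by
  rw [red_log, elem_log, elem_log, map_smul]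

theorem exists_lift_grp {Λ : AddSubgroup M} {a : Tw k r j} (ha : a ∈ grp k r j Λ) :
    ∃ b ∈ grp k r (j + 1) Λ, b.red = a := by
  induction ha using Submonoid.closure_induction with
  | one => exact ⟨1, one_mem _, ext_log fun d => by rw [red_log]; simp⟩
  | mul a b _ _ iha ihb =>
    obtain ⟨a', ha', rfl⟩ := iha
    obtain ⟨b', hb', rfl⟩ := ihb
    exact ⟨a' * b', mul_mem ha' hb', red_mul _ _⟩
  | mem a ha =>
    obtain ⟨ν, ℓ, hℓ, h0, rfl⟩ := ha
    obtain ⟨y, hy, rfl⟩ := exists_lift_slab hℓ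
    exact ⟨_, elem_mem_grp hy h0, red_elem _ _⟩

theorem red_mem_grp {Λ : AddSubgroup M} {a : Tw k r (j + 1)} (ha : a ∈ grp k r (j + 1) Λ) :
    a.red ∈ grp k r j Λ := by
  induction ha using Submonoid.closure_induction with
  | one =>
    have : (1 : Tw k r (j + 1)).red = 1 := ext_log fun d => by rw [red_log]; simp
    rw [this]; exact one_mem _
  | mul a b _ _ iha ihb => rw [red_mul]; exact mul_mem iha ihb
  | mem a ha =>
    obtain ⟨ν, ℓ, hℓ, h0, rfl⟩ := ha
    rw [red_elem]
    exact elem_mem_grp (lvlMap_mem_slab hℓ) h0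

/-- Multiplication by central elements in the last step of the filtration. -/
theorem exists_add_central (hj : j ≠ 0) {a : Tw k r (j + 1)} (ha : a ∈ grp k r (j + 1) ⊥)
    (s : Finset P) (φ : P → M →+ k) (h : ∀ p ∈ s, p ∈ ordSet P j ∧ r p ≠ 0 ∧ φ p (r p) = 0) :
    ∃ b ∈ grp k r (j + 1) ⊥, ∀ d, b.log d = a.log d + ∑ p ∈ s, φ p d • zmon k (j + 1) p := by
  classical
  induction s using Finset.induction_on with
  | empty => exact ⟨a, ha, by simp⟩
  | insert p s hp ih =>
    obtain ⟨b, hb, e⟩ := ih fun q hq => h q (Finset.mem_insert_of_mem hq)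
    obtain ⟨h1, h2, h3⟩ := h p (Finset.mem_insert_self _ _)
    obtain ⟨i, rfl⟩ := Nat.exists_eq_succ_of_ne_zero hj
    have hm : zmon k (i + 1 + 1) p ∈ slab r (i + 1 + 1) (φ p) :=
      Submodule.subset_span ⟨p, not_isAddUnit_of_mem_ordSet h1, h2, h3, rfl⟩
    refine ⟨b * _, mul_mem hb (elem_mem_grp hm (by simp)), fun d => ?_⟩
    rw [mul_log, elem_log, base_of_lvlMap, e, Finset.sum_insert hp]
    · ring
    · rw [map_smul, lvlMap_zmon_eq_zero h1, smul_zero]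

/-! ### The action on `(k[P]/𝔪^j)[M]` -/

/-- The ring endomorphism `θ` is the action of `a`. -/
def Acts (θ : AddMonoidAlgebra (Lvl k P j) M →+* AddMonoidAlgebra (Lvl k P j) M) (a : Tw k r j) :
    Prop :=
  ∀ d x, θ (AddMonoidAlgebra.single d x) = AddMonoidAlgebra.single d (ex (a.log d) * a.base x)

theorem acts_one : Acts (RingHom.id (AddMonoidAlgebra (Lvl k P j) M)) (1 : Tw k r j) :=
    fun d x => by
  rw [base_one]; simp

theorem Acts.mul {θ θ' : AddMonoidAlgebra (Lvl k P j) M →+* AddMonoidAlgebra (Lvl k P j) M}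
    {a b : Tw k r j} (h : Acts θ a) (h' : Acts θ' b) : Acts (θ * θ') (a * b) := fun d x => by
  rw [RingHom.mul_def, RingHom.comp_apply, h', h, base_mul, mul_log, ex_add (a.mem _)
    (a.base_mem_aug (b.mem _)), map_mul, base_ex _ (b.mem _), AlgHom.comp_apply, mul_assoc]

theorem Acts.unique {θ θ' : AddMonoidAlgebra (Lvl k P j) M →+* AddMonoidAlgebra (Lvl k P j) M}
    {a : Tw k r j} (h : Acts θ a) (h' : Acts θ' a) : θ = θ' := by
  have : θ.toAddMonoidHom = θ'.toAddMonoidHom :=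
    AddMonoidAlgebra.addMonoidHom_ext fun d x => (h d x).trans (h' d x).symm
  exact RingHom.ext fun x => DFunLike.congr_fun this x

theorem Acts.eq_one {a : Tw k r j} (h : Acts (RingHom.id (AddMonoidAlgebra (Lvl k P j) M)) a) :
    a = 1 :=
  ext_log fun d => by
    have := h d 1
    rw [RingHom.id_apply, AddMonoidAlgebra.single_right_inj, map_one, mul_one] at this
    exact ex_eq_one (a.mem d) this.symm

/-- An element of `N` as a homomorphism `M → k`. -/
def nu (k : Type*) [Field k] {M : Type v} [AddCommGroup M] (n : DualLat M) : M →+ k :=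
  (Int.castAddHom k).comp n.toAddMonoidHom

@[simp] theorem nu_apply (n : DualLat M) (d : M) : nu k n d = (n d : k) := rfl

theorem nu_eq_zero {n : DualLat M} {d : M} : nu k n d = 0 ↔ n d = 0 := by
  rw [nu_apply, Int.cast_eq_zero]

theorem acts_wallCross {u : (Lvl k P j)ˣ} (hu : (u : Lvl k P j) - 1 ∈ aug k P j) (n : DualLat M) :
    Acts (wallCross r u n) (elem r (nu k n) (lg (u : Lvl k P j)) (lg_mem _)) := by
  have hx := lg_mem (u : Lvl k P j)
  have hux := (ex_lg hu).symm
  set a := elem r (nu k n) (lg (u : Lvl k P j)) hx with ha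
  have hpow : ∀ d, ((u ^ (n d) : (Lvl k P j)ˣ) : Lvl k P j) = ex (a.log d) := fun d => by
    rw [ex_zsmul hx hux, ha, elem_log, nu_apply, Int.cast_smul_eq_zsmul]
  have hbase : ∀ x, crossBase r u n x = a.base x := by
    intro x
    obtain ⟨f, rfl⟩ := Ideal.Quotient.mk_surjective x
    have : crossAux r u n = a.baseAux := by
      refine AddMonoidAlgebra.algHom_ext (fun p => ?_) (Subsingleton.elim _ _)
      exact (crossAux_mono r u n p).trans (by rw [hpow]; exact (baseAux_mono a p).symm)
    exact AlgHom.congr_fun this f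
  intro d x
  simp only [wallCross]
  erw [AddMonoidAlgebra.liftNCRingHom_single]
  simp only [RingHom.comp_apply, hbase]
  simp only [AddMonoidAlgebra.coe_algebraMap, unitPow, MonoidHom.coe_mk, OneHom.coe_mk,
    Function.comp_apply, Algebra.algebraMap_self, RingHom.id_apply,
    AddMonoidAlgebra.single_mul_single, zero_add, toAdd_ofAdd, hpow]
  rw [mul_comm]

end Tw

end Twisted

/-! ### Transport along a fixed direction -/

section Transport

variable {M : Type v} [AddCommGroup M]

/-- The point where the line through `x` in the direction `m` meets the hyperplane `n = 0`. -/
def foot (m : M) (n : DualLat M) (x : RealSpan M) : RealSpan M :=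
  x - (pair n x / (n m : ℝ)) • incl m

/-- `A'` contains the normal vectors of the hyperplanes that contain `m` and the intersection
of two hyperplanes of `A`. -/
def ClosedAlong (A A' : Finset (DualLat M)) (m : M) : Prop :=
  ∀ n ∈ A, ∀ n' ∈ A, n m • n' - n' m • n = 0 ∨
    ∃ a : ℕ, 0 < a ∧ ∃ n₀ ∈ A', n m • n' - n' m • n = a • n₀

/-- The direction `m` is contained in a hyperplane through `z` of the arrangement only if this is
the hyperplane `n = 0`, and the other hyperplanes through `z` all have the same intersection with
it. -/
structure IsPencil (A : Finset (DualLat M)) (m : M) (n : DualLat M) (z : RealSpan M) : Prop where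
  zero : pair n z = 0
  unique : ∀ n' ∈ A, pair n' z = 0 → n' m = 0 → n' = n ∨ n' = -n
  coplanar : ∀ n' ∈ A, ∀ n'' ∈ A, pair n' z = 0 → pair n'' z = 0 →
    ∃ c : ℤ, n' m • n'' - n'' m • n' = c • n

variable {A A' : Finset (DualLat M)} {m : M} {n n' : DualLat M} {x y x' : RealSpan M}

theorem pair_foot (x : RealSpan M) :
    pair n' (foot m n x) = pair n' x - pair n x / (n m : ℝ) * (n' m : ℝ) := by
  simp [foot]

theorem pair_foot_self (h : n m ≠ 0) (x : RealSpan M) : pair n (foot m n x) = 0 := by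
  have : (n m : ℝ) ≠ 0 := by exact_mod_cast h
  rw [pair_foot]; field_simp; ring

theorem foot_of_zero (h : pair n x = 0) : foot m n x = x := by simp [foot, h]

theorem foot_add_smul (h : n m ≠ 0) (t : ℝ) : foot m n (x + t • incl m) = foot m n x := by
  have : (n m : ℝ) ≠ 0 := by exact_mod_cast h
  simp only [foot, map_add, map_smul, pair_incl, smul_eq_mul]
  rw [add_div, mul_div_cancel_right₀ _ this, add_smul]
  abel

theorem foot_add (u : RealSpan M) : foot m n (x + u) = foot m n x + foot m n u := by
  simp only [foot, map_add, add_div, add_smul]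
  abel

theorem foot_smul (t : ℝ) : foot m n (t • x) = t • foot m n x := by
  simp only [foot, map_smul, smul_sub, smul_smul, smul_eq_mul, mul_div_assoc]

theorem mul_pair_foot (h : n m ≠ 0) (x : RealSpan M) :
    (n m : ℝ) * pair n' (foot m n x) = pair (n m • n' - n' m • n) x := by
  have : (n m : ℝ) ≠ 0 := by exact_mod_cast h
  rw [pair_foot, pair_sub, pair_smul, pair_smul]; field_simp

/-- The cell of a foot only depends on the signs of the hyperplanes containing `m`. -/
theorem foot_sameSigns (hcl : ClosedAlong A A' m) (hn : n ∈ A) (h : n m ≠ 0)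
    (hs : ∀ n₀ ∈ A', n₀ m = 0 → SignType.sign (pair n₀ x) = SignType.sign (pair n₀ x')) :
    SameSigns A (foot m n x) (foot m n x') := by
  intro n' hn'
  have h0 : (n m : ℝ) ≠ 0 := by exact_mod_cast h
  have h1 : SignType.sign ((n m : ℝ) * pair n' (foot m n x)) =
      SignType.sign ((n m : ℝ) * pair n' (foot m n x')) := by
    rw [mul_pair_foot h, mul_pair_foot h]
    rcases hcl n hn n' hn' with h2 | ⟨a, ha, n₀, hn₀, h2⟩
    · rw [h2]; simp
    · have h3 : n₀ m = 0 := by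
        have := LinearMap.congr_fun h2 m
        simp only [LinearMap.sub_apply, LinearMap.smul_apply, smul_eq_mul] at this
        rw [mul_comm (n' m), sub_self] at this
        have := (smul_eq_zero.1 this.symm)
        exact this.resolve_left ha.ne'
      rw [h2, pair_nsmul, pair_nsmul, sign_mul, sign_mul, hs n₀ hn₀ h3]
  rw [sign_mul, sign_mul] at h1
  have h2 : SignType.sign (n m : ℝ) ≠ 0 := by rwa [Ne, sign_eq_zero_iff]
  exact mul_left_cancel₀ h2 h1

theorem foot_onWall (hA : IsArr A) (hcl : ClosedAlong A A' m) (hn : n ∈ A) (h : n m ≠ 0)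
    (hx : Gen A' x) : OnWall A n (foot m n x) := by
  refine ⟨pair_foot_self h x, fun n' hn' h0 => ?_⟩
  have h1 := mul_pair_foot (n' := n') h x
  rw [h0, mul_zero] at h1
  rcases hcl n hn n' hn' with h2 | ⟨a, ha, n₀, hn₀, h2⟩
  · rw [sub_eq_zero] at h2
    by_cases h3 : n' m = 0
    · rw [h3, zero_smul] at h2
      exact absurd ((smul_eq_zero.1 h2).resolve_left h) (hA.prim n' hn').ne_zero
    · exact (hA.prim n hn).eq_or_eq_neg (hA.prim n' hn') h3 h2.symm
  · rw [h2, pair_nsmul] at h1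
    have : (a : ℝ) ≠ 0 := by exact_mod_cast ha.ne'
    exact absurd ((mul_eq_zero.1 h1.symm).resolve_left this) (hx n₀ hn₀)

variable {B : Type*} [AddCommGroup B]

/-- The sum of the defects `e` over the hyperplanes met by the ray from `x` in the direction `m`,
the normal vectors being positive at `x`. -/
def raySum (A : Finset (DualLat M)) (m : M) (e : DualLat M → RealSpan M → B) (x : RealSpan M) : B :=
  open Classical in ∑ n ∈ A.filter fun n => n m < 0 ∧ 0 < pair n x, e n (foot m n x)

variable {e : DualLat M → RealSpan M → B}

theorem raySum_congr' (hA : IsArr A) (hcl : ClosedAlong A A' m) (hx : Gen A' x)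
    (he : ∀ n ∈ A, ∀ y y', OnWall A n y → SameSigns A y y' → e n y = e n y')
    (h1 : ∀ n ∈ A, n m < 0 → (0 < pair n x ↔ 0 < pair n x'))
    (h2 : ∀ n ∈ A', n m = 0 → SignType.sign (pair n x) = SignType.sign (pair n x')) :
    raySum A m e x = raySum A m e x' := by
  classical
  unfold raySum
  refine Finset.sum_congr (Finset.filter_congr fun n hn => ?_) fun n hn => ?_
  · by_cases h0 : n m < 0
    · rw [h1 n hn h0]
    · simp [h0]
  · rw [Finset.mem_filter] at hn
    exact he n hn.1 _ _ (foot_onWall hA hcl hn.1 hn.2.1.ne hx)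
      (foot_sameSigns hcl hn.1 hn.2.1.ne h2)

theorem raySum_congr (hA : IsArr A) (hsub : A ⊆ A') (hcl : ClosedAlong A A' m) (hx : Gen A' x)
    (he : ∀ n ∈ A, ∀ y y', OnWall A n y → SameSigns A y y' → e n y = e n y')
    (h : SameSigns A' x x') : raySum A m e x = raySum A m e x' :=
  raySum_congr' hA hcl hx he (fun n hn _ => sign_eq_iff_pos (h n (hsub hn))) fun n hn _ => h n hn

/-- The ray sum jumps by `e` across the hyperplanes transversal to `m`. -/
theorem raySum_cross (hA : IsArr A) (hA' : IsArr A') (hsub : A ⊆ A') (hcl : ClosedAlong A A' m)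
    (he : ∀ n ∈ A, ∀ y y', OnWall A n y → SameSigns A y y' → e n y = e n y')
    (hneg : ∀ n ∈ A, ∀ y, OnWall A n y → e (-n) y = -e n y)
    (hout : ∀ n ∈ A', n ∉ A → ∀ y, OnWall A' n y → e n y = 0) (hn : n ∈ A') (hm : n m ≠ 0)
    (hc : IsCross A' n x y x') :
    e n y + raySum A m e x' - raySum A m e x = 0 := by
  classical
  -- replacing `n` by `-n` exchanges `x` and `x'`
  wlog hneg' : n m < 0 generalizing n x x'
  · have hm' : (-n) m < 0 := by
      have := lt_of_le_of_ne (not_lt.1 hneg') hm.symm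
      simpa using this
    have h1 := this (hA'.neg n hn) (by simpa using hm) hc.symm hm'
    have h2 : e (-n) y = -e n y := by
      by_cases hnA : n ∈ A
      · exact hneg n hnA y (hc.onWall.mono hsub)
      · rw [hout n hn hnA y hc.onWall, hout (-n) (hA'.neg n hn) (fun h => hnA (by
          have := hA.neg _ h; rwa [neg_neg] at this)) y hc.onWall.neg, neg_zero]
    rw [h2] at h1
    rw [← neg_eq_zero, ← h1]; abel
  have hsame : ∀ n' ∈ A', n' m = 0 → SignType.sign (pair n' x) = SignType.sign (pair n' y) ∧
      SignType.sign (pair n' x') = SignType.sign (pair n' y) := by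
    intro n' hn' h0
    exact (hc.other n' hn' (by rintro rfl; exact hm h0)
      (by rintro rfl; exact hm (by simpa using h0))).2
  -- if `n` belongs to `A`, it is the one hyperplane met by the ray from `x`, but not from `x'`
  by_cases hnA : n ∈ A
  · have hset : A.filter (fun n' => n' m < 0 ∧ 0 < pair n' x) =
        insert n (A.filter (fun n' => n' m < 0 ∧ 0 < pair n' x')) := by
      ext n'
      simp only [Finset.mem_filter, Finset.mem_insert]
      constructor
      · rintro ⟨h1, h2, h3⟩
        by_cases h4 : n' = n
        · exact Or.inl h4
        · refine Or.inr ⟨h1, h2, ?_⟩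
          have h5 : n' ≠ -n := by rintro rfl; simp at h2; omega
          have h6 := (hc.other n' (hsub h1) h4 h5).2
          rwa [sign_eq_iff_pos (h6.2.trans h6.1.symm)]
      · rintro (rfl | ⟨h1, h2, h3⟩)
        · exact ⟨hnA, hneg', hc.pos⟩
        · refine ⟨h1, h2, ?_⟩
          have h4 : n' ≠ n := by rintro rfl; linarith [hc.neg]
          have h5 : n' ≠ -n := by rintro rfl; simp at h2; omega
          have h6 := (hc.other n' (hsub h1) h4 h5).2
          rwa [sign_eq_iff_pos (h6.1.trans h6.2.symm)]
    have h1 : e n (foot m n x) = e n y := by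
      refine he n hnA _ _ (foot_onWall hA hcl hnA hm hc.gen_left) ?_
      have := foot_sameSigns hcl hnA hm (x := x) (x' := y) fun n₀ h2 h3 => (hsame n₀ h2 h3).1
      rwa [foot_of_zero hc.zero] at this
    have h2 : ∀ n' ∈ A.filter (fun n' => n' m < 0 ∧ 0 < pair n' x'),
        e n' (foot m n' x) = e n' (foot m n' x') := by
      intro n' hn'
      rw [Finset.mem_filter] at hn'
      exact he n' hn'.1 _ _ (foot_onWall hA hcl hn'.1 hn'.2.1.ne hc.gen_left)
        (foot_sameSigns hcl hn'.1 hn'.2.1.ne fun n₀ h2 h3 =>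
          (hsame n₀ h2 h3).1.trans (hsame n₀ h2 h3).2.symm)
    unfold raySum
    rw [hset, Finset.sum_insert (by simp [hc.neg.le]), h1, Finset.sum_congr rfl h2]
    abel
  · have h1 : raySum A m e x = raySum A m e x' := by
      refine raySum_congr' hA hcl hc.gen_left he (fun n' hn' _ => ?_) fun n' hn' h0 =>
        (hsame n' hn' h0).1.trans (hsame n' hn' h0).2.symm
      have h4 : n' ≠ n := by rintro rfl; exact hnA hn'
      have h5 : n' ≠ -n := by
        rintro rfl; have := hA.neg _ hn'; rw [neg_neg] at this; exact hnA this
      have h6 := (hc.other n' (hsub hn') h4 h5).2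
      exact sign_eq_iff_pos (h6.1.trans h6.2.symm)
    rw [h1, hout n hn hnA y hc.onWall]; abel

/-- A function that is locally constant outside of a finite set is the sum of its jumps. -/
theorem sum_jumps {f : ℝ → B} {a : ℝ} (Θ : Finset ℝ) (hpos : ∀ θ ∈ Θ, a < θ) {T : ℝ} (haT : a ≤ T)
    (hT : ∀ θ ∈ Θ, θ < T)
    (hf : ∀ s t, a ≤ s → s ≤ t → t ≤ T → (∀ θ ∈ Θ, ¬ (s ≤ θ ∧ θ ≤ t)) → f s = f t) :
    ∀ᶠ ε in 𝓝[>] (0 : ℝ), ∑ θ ∈ Θ, (f (θ - ε) - f (θ + ε)) = f a - f T := by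
  classical
  induction Θ using Finset.induction_on_max generalizing T with
  | empty =>
    filter_upwards with ε
    rw [hf a T le_rfl haT le_rfl (by simp)]; simp
  | insert θ₀ Θ hmax ih =>
    have hnot : θ₀ ∉ Θ := fun h => lt_irrefl _ (hmax _ h)
    have h0 : a < θ₀ := hpos _ (Finset.mem_insert_self _ _)
    obtain ⟨S, ⟨hS1, hS2⟩, hS3⟩ : ∃ S, (a ≤ S ∧ S < θ₀) ∧ ∀ θ ∈ Θ, θ < S := by
      have h1 : ∀ᶠ S in 𝓝[<] θ₀, ∀ θ ∈ Θ, θ < S := by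
        rw [Filter.eventually_all_finset]
        intro θ hθ
        filter_upwards [Ioo_mem_nhdsLT (hmax θ hθ)] with S hS using hS.1
      have h2 : ∀ᶠ S in 𝓝[<] θ₀, a ≤ S ∧ S < θ₀ := by
        filter_upwards [Ioo_mem_nhdsLT h0] with S hS using ⟨hS.1.le, hS.2⟩
      exact (h2.and h1).exists
    have h1 := ih (T := S) (fun θ hθ => hpos _ (Finset.mem_insert_of_mem hθ)) hS1 hS3
      (fun s t h1 h2 h3 h4 => hf s t h1 h2 (h3.trans (hS2.le.trans
        (hT _ (Finset.mem_insert_self _ _)).le)) (fun θ hθ => by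
          rcases Finset.mem_insert.1 hθ with rfl | hθ
          · rintro ⟨_, h6⟩; linarith
          · exact h4 θ hθ))
    have hT0 := hT _ (Finset.mem_insert_self _ _)
    filter_upwards [h1, Ioo_mem_nhdsGT (show 0 < θ₀ - S by linarith),
      Ioo_mem_nhdsGT (show 0 < T - θ₀ by linarith)] with ε h2 h3 h4
    have h3' := h3.1
    have h3'' := h3.2
    have h4' := h4.2
    rw [Finset.sum_insert hnot, h2]
    have e1 : f S = f (θ₀ - ε) := hf _ _ hS1 (by linarith) (by linarith) fun θ hθ => by
      rcases Finset.mem_insert.1 hθ with rfl | hθ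
      · rintro ⟨_, h6⟩; linarith
      · rintro ⟨h6, _⟩; linarith [hS3 θ hθ]
    have e2 : f (θ₀ + ε) = f T := hf _ _ (by linarith) (by linarith) le_rfl fun θ hθ => by
      rcases Finset.mem_insert.1 hθ with rfl | hθ
      · rintro ⟨h6, _⟩; linarith
      · rintro ⟨h6, _⟩; linarith [hS3 θ hθ]
    rw [e1, e2]; abel

/-- Along a hyperplane that contains `m`, the defect of the ray sum is the value of `e` far away,
up to elements of `S`, provided this is so at each intersection of hyperplanes met by the ray. -/
theorem raySum_parallel [Module.Free ℤ M] [Module.Finite ℤ M]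
    (hA : IsArr A) (hA' : IsArr A') (hsub : A ⊆ A') (hcl : ClosedAlong A A' m)
    (he : ∀ n ∈ A, ∀ y y', OnWall A n y → SameSigns A y y' → e n y = e n y')
    (hout : ∀ n ∈ A', n ∉ A → ∀ y, OnWall A n y → Gen A y → e n y = 0)
    (hn : n ∈ A') (hm : n m = 0) (hc : IsCross A' n x y x') (S : AddSubgroup B) {u : RealSpan M}
    (hu : 0 < pair n u)
    (hJ : ∀ z, IsPencil A m n z → ∀ᶠ ε in 𝓝[>] (0 : ℝ),
      e n (z - ε • incl m) - e n (z + ε • incl m) +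
        ∑ n' ∈ open Classical in A.filter fun n' => n' m < 0 ∧ pair n' z = 0,
          (e n' (z - ε • foot m n' u) - e n' (z + ε • foot m n' u)) ∈ S)
    {T : ℝ} (hT0 : 0 ≤ T) (hT : ∀ n' ∈ A, n' m < 0 → pair n' y + T * n' m < 0) :
    e n y + raySum A m e x' - raySum A m e x - e n (y + T • incl m) ∈ S := by
  classical
  -- the ray from `y` meets the hyperplanes of `Cr`, at the times `τ`
  set Cr := A.filter fun n' => n' m < 0 ∧ 0 < pair n' y with hCr
  let τ : DualLat M → ℝ := fun n' => -(pair n' y / (n' m : ℝ))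
  set Θ := Cr.image τ with hΘ
  let f : ℝ → B := fun t => e n (y + t • incl m)
  have hy := hc.onWall
  have hyA : ∀ n' ∈ A, n' m ≠ 0 → pair n' y ≠ 0 := by
    intro n' hn' h0 h1
    rcases hy.2 n' (hsub hn') h1 with rfl | rfl
    · exact h0 hm
    · exact h0 (by simp [hm])
  have hfoot : ∀ n', foot m n' y = y + τ n' • incl m := by
    intro n'; simp [foot, τ, sub_eq_add_neg]
  have hτ : ∀ n', n' m ≠ 0 → ∀ t : ℝ, pair n' (y + t • incl m) = (n' m : ℝ) * (t - τ n') := by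
    intro n' h0 t
    have : (n' m : ℝ) ≠ 0 := by exact_mod_cast h0
    simp only [map_add, map_smul, pair_incl, smul_eq_mul, τ]; field_simp; ring
  have hneg' : ∀ {n' : DualLat M}, n' m < 0 → (n' m : ℝ) < 0 := fun h => by exact_mod_cast h
  have hτpos : ∀ n', n' m < 0 → (0 < pair n' y ↔ 0 < τ n') := by
    intro n' h0
    have h1 := hτ n' h0.ne 0
    rw [zero_smul, add_zero, zero_sub] at h1
    rw [h1]
    have := hneg' h0
    constructor <;> intro h2 <;> nlinarith
  have hΘpos : ∀ θ ∈ Θ, 0 < θ := by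
    intro θ hθ
    obtain ⟨n', hn', rfl⟩ := Finset.mem_image.1 hθ
    rw [hCr, Finset.mem_filter] at hn'
    exact (hτpos n' hn'.2.1).1 hn'.2.2
  have hΘT : ∀ θ ∈ Θ, θ < T := by
    intro θ hθ
    obtain ⟨n', hn', rfl⟩ := Finset.mem_image.1 hθ
    rw [hCr, Finset.mem_filter] at hn'
    have h1 := hT n' hn'.1 hn'.2.1
    have h2 := hτ n' hn'.2.1.ne T
    have h3 := hneg' hn'.2.1
    simp only [map_add, map_smul, pair_incl, smul_eq_mul] at h2
    rw [h2] at h1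
    nlinarith
  -- the function `f` only jumps at the times in `Θ`
  have hzero : ∀ n' ∈ A, n' m ≠ 0 → ∀ t, 0 ≤ t → pair n' (y + t • incl m) = 0 → t ∈ Θ := by
    intro n' hn' h0 t ht h1
    wlog hlt : n' m < 0 generalizing n'
    · refine this (-n') (hA.neg n' hn') (by simpa using h0) (by rw [pair_neg, h1, neg_zero]) ?_
      have := lt_of_le_of_ne (not_lt.1 hlt) h0.symm
      simpa using this
    have h2 := hτ n' h0 t
    rw [h1] at h2
    have h3 : t = τ n' := by
      have := (mul_eq_zero.1 h2.symm).resolve_left (by exact_mod_cast h0)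
      linarith
    have h4 : 0 < τ n' := by
      refine lt_of_le_of_ne (h3 ▸ ht) (fun h5 => hyA n' hn' h0 ?_)
      rw [← h1, h3, ← h5]; simp
    rw [h3, hΘ]
    exact Finset.mem_image_of_mem _
      (by rw [hCr, Finset.mem_filter]; exact ⟨hn', hlt, (hτpos n' hlt).2 h4⟩)
  have hf : ∀ s t, 0 ≤ s → s ≤ t → t ≤ T → (∀ θ ∈ Θ, ¬ (s ≤ θ ∧ θ ≤ t)) → f s = f t := by
    intro s t hs hst _ hno
    have hw : ∀ t, 0 ≤ t → t ∉ Θ → OnWall A n (y + t • incl m) := by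
      intro t ht htΘ
      refine ⟨by simp [hy.1, hm], fun n' hn' h0 => ?_⟩
      by_cases h1 : n' m = 0
      · exact hy.2 n' (hsub hn') (by simpa [h1] using h0)
      · exact absurd (hzero n' hn' h1 t ht h0) htΘ
    have hsΘ : s ∉ Θ := fun h => hno s h ⟨le_rfl, hst⟩
    have htΘ : t ∉ Θ := fun h => hno t h ⟨hst, le_rfl⟩
    by_cases hnA : n ∈ A
    · refine he n hnA _ _ (hw s hs hsΘ) fun n' hn' => ?_
      by_cases h1 : n' m = 0
      · simp [h1]
      · have hne : ∀ w, s ≤ w → w ≤ t → w - τ n' ≠ 0 := by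
          intro w h2 h3 h4
          have : pair n' (y + w • incl m) = 0 := by rw [hτ n' h1, h4, mul_zero]
          exact hno w (hzero n' hn' h1 w (hs.trans h2) this) ⟨h2, h3⟩
        rw [hτ n' h1, hτ n' h1, sign_mul, sign_mul]
        congr 1
        rcases lt_or_gt_of_ne (hne s le_rfl hst) with h2 | h2
        · have h3 : t - τ n' < 0 := by
            by_contra h4
            exact hne (τ n') (by linarith) (by linarith) (sub_self _)
          rw [sign_neg h2, sign_neg h3]
        · rw [sign_pos h2, sign_pos (by linarith)]
    · have hg : ∀ t, 0 ≤ t → t ∉ Θ → f t = 0 := by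
        intro t ht htΘ
        have h1 := hw t ht htΘ
        refine hout n hn hnA _ h1 fun n' hn' h0 => ?_
        rcases h1.2 n' hn' h0 with rfl | rfl
        · exact hnA hn'
        · exact hnA (by have := hA.neg _ hn'; rwa [neg_neg] at this)
      rw [hg s hs hsΘ, hg t (hs.trans hst) htΘ]
  have hjump := sum_jumps Θ hΘpos hT0 hΘT hf
  have hpencil : ∀ θ : ℝ, IsPencil A m n (y + θ • incl m) := by
    intro θ
    refine ⟨by simp [hy.1, hm], fun n' hn' h0 h1 => hy.2 n' (hsub hn') (by simpa [h1] using h0), ?_⟩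
    intro n' hn' n'' hn'' h1 h2
    rcases hcl n' hn' n'' hn'' with h3 | ⟨a, ha, n₀, hn₀, h3⟩
    · exact ⟨0, by rw [h3, zero_smul]⟩
    · have h4 : pair (n' m • n'' - n'' m • n') y = 0 := by
        have e1 : pair (n' m • n'' - n'' m • n') (y + θ • incl m) = 0 := by
          rw [pair_sub, pair_smul, pair_smul, h1, h2]; simp
        have e2 : pair (n' m • n'' - n'' m • n') (incl m) = 0 := by
          rw [pair_sub, pair_smul, pair_smul, pair_incl, pair_incl]; ring
        rwa [map_add, map_smul, e2, smul_zero, add_zero] at e1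
      rw [h3, pair_nsmul] at h4
      have h5 := (mul_eq_zero.1 h4).resolve_left (by exact_mod_cast ha.ne')
      rcases hy.2 n₀ hn₀ h5 with rfl | rfl
      · exact ⟨a, by rw [h3, natCast_zsmul]⟩
      · exact ⟨-a, by rw [h3, neg_smul, natCast_zsmul, smul_neg]⟩
  have hJ' := (Filter.eventually_all_finset (l := 𝓝[>] (0 : ℝ)) Θ).2 fun θ (_ : θ ∈ Θ) =>
    hJ _ (hpencil θ)
  have hcr := eventually_cross hy hu
  -- `x` and `x'` are replaced by `y + ε u` and `y - ε u`
  obtain ⟨ε, ⟨⟨h1, h2⟩, h3⟩⟩ := ((hjump.and hJ').and hcr).exists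
  have hprim := hA'.prim n hn
  have ex : raySum A m e x = raySum A m e (y + ε • u) :=
    raySum_congr hA hsub hcl hc.gen_left he (hc.sameSigns_left hprim h3)
  have ex' : raySum A m e x' = raySum A m e (y - ε • u) :=
    raySum_congr hA hsub hcl hc.gen_right he (hc.sameSigns_right hprim h3)
  have hset : ∀ w, Near A' y w → A.filter (fun n' => n' m < 0 ∧ 0 < pair n' w) = Cr := by
    intro w hw
    rw [hCr]
    refine Finset.filter_congr fun n' hn' => ?_
    by_cases h0 : n' m < 0
    · rw [sign_eq_iff_pos (hw n' (hsub hn') (hyA n' hn' h0.ne))]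
    · simp [h0]
  -- the hyperplanes are grouped by the points in which they meet the ray
  have hgroup : ∀ g : DualLat M → B, ∑ n' ∈ Cr, g n' =
      ∑ θ ∈ Θ, ∑ n' ∈ A.filter (fun n' => n' m < 0 ∧ pair n' (y + θ • incl m) = 0), g n' := by
    intro g
    rw [hΘ, ← Finset.sum_fiberwise_of_maps_to (g := τ)
      (fun n' hn' => Finset.mem_image_of_mem _ hn')]
    refine Finset.sum_congr rfl fun θ hθ => Finset.sum_congr ?_ fun _ _ => rfl
    have hθ0 : 0 < θ := hΘpos θ hθ
    ext n'
    simp only [hCr, Finset.mem_filter]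
    constructor
    · rintro ⟨⟨h4, h5, h6⟩, h7⟩
      refine ⟨h4, h5, ?_⟩
      rw [hτ n' h5.ne, h7, sub_self, mul_zero]
    · rintro ⟨h4, h5, h6⟩
      rw [hτ n' h5.ne] at h6
      have h7 := (mul_eq_zero.1 h6).resolve_left (by exact_mod_cast h5.ne)
      have h8 : τ n' = θ := by linarith
      exact ⟨⟨h4, h5, (hτpos n' h5).2 (h8 ▸ hθ0)⟩, h8⟩
  have key : e n y + raySum A m e x' - raySum A m e x - e n (y + T • incl m) =
      ∑ θ ∈ Θ, (e n (y + θ • incl m - ε • incl m) - e n (y + θ • incl m + ε • incl m) +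
        ∑ n' ∈ A.filter fun n' => n' m < 0 ∧ pair n' (y + θ • incl m) = 0,
          (e n' (y + θ • incl m - ε • foot m n' u) - e n' (y + θ • incl m + ε • foot m n' u))) := by
    rw [Finset.sum_add_distrib]
    have e1 : ∑ θ ∈ Θ, (e n (y + θ • incl m - ε • incl m) - e n (y + θ • incl m + ε • incl m)) =
        e n y - e n (y + T • incl m) := by
      have : f 0 = e n y := by simp [f]
      rw [← this, ← h1]
      refine Finset.sum_congr rfl fun θ _ => ?_
      simp only [f, sub_smul, add_smul, add_sub_assoc, add_assoc]
    have e2 : ∀ θ ∈ Θ, ∑ n' ∈ A.filter (fun n' => n' m < 0 ∧ pair n' (y + θ • incl m) = 0),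
          (e n' (y + θ • incl m - ε • foot m n' u) - e n' (y + θ • incl m + ε • foot m n' u)) =
        ∑ n' ∈ A.filter (fun n' => n' m < 0 ∧ pair n' (y + θ • incl m) = 0),
          (e n' (foot m n' (y - ε • u)) - e n' (foot m n' (y + ε • u))) := by
      intro θ _
      refine Finset.sum_congr rfl fun n' hn' => ?_
      rw [Finset.mem_filter] at hn'
      have h4 : foot m n' y = y + θ • incl m := by
        have := foot_add_smul hn'.2.1.ne θ (x := y)
        rw [foot_of_zero hn'.2.2] at this
        exact this.symm
      have h5 : y - ε • u = y + (-ε) • u := by rw [neg_smul, sub_eq_add_neg]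
      rw [h5, foot_add, foot_add, foot_smul, foot_smul, h4, neg_smul, ← sub_eq_add_neg]
    rw [e1, Finset.sum_congr rfl e2, ← hgroup, ex, ex']
    unfold raySum
    rw [hset _ h3.near_left, hset _ h3.near_right, Finset.sum_sub_distrib]
    abel
  rw [key]
  exact S.sum_mem fun θ hθ => h2 θ hθ

theorem raySum_eq_zero (h : ∀ n ∈ A, n m < 0 → pair n x ≤ 0) : raySum A m e x = 0 := by
  classical
  unfold raySum
  rw [Finset.filter_eq_empty_iff.2, Finset.sum_empty]
  rintro n hn ⟨h1, h2⟩
  exact absurd h2 (not_lt.2 (h n hn h1))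

/-- A multiple of `m` by which every point in the cell of `y` is moved to the star of `m`. -/
def farTime (A : Finset (DualLat M)) (x : RealSpan M) : ℝ := 1 + ∑ n ∈ A, |pair n x|

theorem farTime_pos : 0 < farTime A x := by
  have : 0 ≤ ∑ n ∈ A, |pair n x| := Finset.sum_nonneg fun _ _ => abs_nonneg _
  unfold farTime; linarith

theorem abs_lt_farTime (hn : n ∈ A) : |pair n x| < farTime A x := by
  have := Finset.single_le_sum (f := fun n => |pair n x|) (fun _ _ => abs_nonneg _) hn
  unfold farTime; linarith

/-- Far away in the direction `m`, the signs are those of `m`, except for the hyperplanes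
containing `m`. -/
theorem sign_far (hn : n ∈ A) (hm : n m ≠ 0) {T : ℝ} (hT : farTime A x ≤ T) :
    SignType.sign (pair n (x + T • incl m)) = SignType.sign (n m : ℝ) := by
  have h1 := (abs_lt_farTime (x := x) hn).trans_le hT
  rw [abs_lt] at h1
  have h2 := (farTime_pos (A := A) (x := x)).trans_le hT
  simp only [map_add, map_smul, pair_incl, smul_eq_mul]
  rcases lt_or_gt_of_ne hm with h | h
  · have : (n m : ℝ) ≤ -1 := by exact_mod_cast (by omega : n m ≤ -1)
    rw [sign_neg (show (n m : ℝ) < 0 by linarith), sign_neg (by nlinarith)]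
  · have : (1 : ℝ) ≤ n m := by exact_mod_cast (by omega : 1 ≤ n m)
    rw [sign_pos (show (0 : ℝ) < n m by linarith), sign_pos (by nlinarith)]

/-- Every arrangement is contained in one that satisfies `ClosedAlong` for finitely many given
directions. -/
theorem exists_closedAlong [Module.Free ℤ M] [Module.Finite ℤ M] (hA : IsArr A) (s : Finset M) :
    ∃ A', IsArr A' ∧ A ⊆ A' ∧ ∀ m ∈ s, ClosedAlong A A' m := by
  classical
  let F : Finset (DualLat M) := (s ×ˢ A ×ˢ A).image
    fun q => q.2.1 q.1 • q.2.2 - q.2.2 q.1 • q.2.1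
  obtain ⟨B, hB, h⟩ := exists_isArr F
  refine ⟨A ∪ B, hA.union hB, Finset.subset_union_left, fun m hm n hn n' hn' => ?_⟩
  by_cases h0 : n m • n' - n' m • n = 0
  · exact Or.inl h0
  · obtain ⟨a, ha, n₀, hn₀, e⟩ :=
        h _ (Finset.mem_image.2 ⟨(m, n, n'), by simp [hm, hn, hn'], rfl⟩) h0
    exact Or.inr ⟨a, ha, n₀, Finset.mem_union_right _ hn₀, e⟩

end Transport

/-! ### Small circles -/

section Circles

variable {M : Type v} [AddCommGroup M] {σ : PointedCone ℝ (RealSpan M)} {n : DualLat M}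
  {z u w : RealSpan M} {ε : ℝ}

/-- The time at which a circle in the plane of `u` and `w` crosses the hyperplane `n = 0` in the
half plane of `u`. -/
def crossTime (n : DualLat M) (u w : RealSpan M) : ℝ := Real.arctan (-(pair n u / pair n w))

theorem cos_crossTime_pos : 0 < Real.cos (crossTime n u w) := Real.cos_arctan_pos _

theorem sin_crossTime : Real.sin (crossTime n u w) =
    -(pair n u / pair n w) * Real.cos (crossTime n u w) := by
  have h := Real.tan_arctan (-(pair n u / pair n w))
  rw [Real.tan_eq_sin_div_cos] at h
  have h1 := cos_crossTime_pos (n := n) (u := u) (w := w)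
  unfold crossTime at *
  rw [div_eq_iff h1.ne'] at h
  exact h

theorem circle_crossTime : circle z u w ε (crossTime n u w) =
    z + (ε * Real.cos (crossTime n u w)) • (u - (pair n u / pair n w) • w) := by
  unfold circle
  rw [sin_crossTime]
  module

theorem circle_add_pi (t : ℝ) : circle z u w ε (t + Real.pi) = circle z u w (-ε) t := by
  simp only [circle, Real.cos_add_pi, Real.sin_add_pi]
  module

theorem circle_crossTime_add_pi : circle z u w ε (crossTime n u w + Real.pi) =
    z - (ε * Real.cos (crossTime n u w)) • (u - (pair n u / pair n w) • w) := by
  rw [circle_add_pi, circle_crossTime]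
  module

theorem pair_circle (hz : pair n z = 0) (hw : pair n w ≠ 0) (s : ℝ) :
    pair n (circle z u w ε s) =
      ε * (pair n w / Real.cos (crossTime n u w)) * Real.sin (s - crossTime n u w) := by
  have h := cos_crossTime_pos (n := n) (u := u) (w := w)
  rw [Real.sin_sub, sin_crossTime]
  simp only [circle, map_add, map_smul, smul_eq_mul, hz]
  field_simp
  ring

theorem crossesAt_crossTime (hε : 0 < ε) (hz : pair n z = 0) (hw : pair n w < 0)
    (hn : IsPrimitive n) (hσ : ∀ y ∈ σ, pair n y = 0)
    (h : z + (ε * Real.cos (crossTime n u w)) • (u - (pair n u / pair n w) • w) ∈ σ) :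
    CrossesAt (circle z u w ε) σ (crossTime n u w) n := by
  have hc := cos_crossTime_pos (n := n) (u := u) (w := w)
  have h1 : ε * (pair n w / Real.cos (crossTime n u w)) < 0 :=
    mul_neg_of_pos_of_neg hε (div_neg_of_neg_of_pos hw hc)
  refine ⟨by rw [circle_crossTime]; exact h, hn, hσ, ⟨Real.pi, Real.pi_pos, fun s hs => ?_⟩,
    ⟨Real.pi, Real.pi_pos, fun s hs => ?_⟩⟩
  · rw [pair_circle hz hw.ne]
    exact mul_pos_of_neg_of_neg h1 (Real.sin_neg_of_neg_of_neg_pi_lt (by linarith [hs.2])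
      (by linarith [hs.1]))
  · rw [pair_circle hz hw.ne]
    exact mul_neg_of_neg_of_pos h1 (Real.sin_pos_of_pos_of_lt_pi (by linarith [hs.1])
      (by linarith [hs.2]))

theorem crossesAt_crossTime_add_pi (hε : 0 < ε) (hz : pair n z = 0) (hw : pair n w < 0)
    (hn : IsPrimitive n) (hσ : ∀ y ∈ σ, pair n y = 0)
    (h : z - (ε * Real.cos (crossTime n u w)) • (u - (pair n u / pair n w) • w) ∈ σ) :
    CrossesAt (circle z u w ε) σ (crossTime n u w + Real.pi) (-n) := by
  have hc := cos_crossTime_pos (n := n) (u := u) (w := w)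
  have h1 : ε * (pair n w / Real.cos (crossTime n u w)) < 0 :=
    mul_neg_of_pos_of_neg hε (div_neg_of_neg_of_pos hw hc)
  refine ⟨by rw [circle_crossTime_add_pi]; exact h, hn.neg,
    fun y hy => by rw [pair_neg, hσ y hy, neg_zero],
    ⟨Real.pi, Real.pi_pos, fun s hs => ?_⟩, ⟨Real.pi, Real.pi_pos, fun s hs => ?_⟩⟩
  · rw [pair_neg, pair_circle hz hw.ne, neg_pos]
    exact mul_neg_of_neg_of_pos h1 (Real.sin_pos_of_pos_of_lt_pi (by linarith [hs.1])
      (by linarith [hs.2]))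
  · rw [pair_neg, pair_circle hz hw.ne, neg_lt_zero]
    have h3 : Real.sin (s - crossTime n u w) = -Real.sin (s - (crossTime n u w + Real.pi)) := by
      rw [← sub_sub, Real.sin_sub_pi, neg_neg]
    rw [h3]
    exact mul_pos_of_neg_of_neg h1 (neg_neg_of_pos (Real.sin_pos_of_pos_of_lt_pi
      (by linarith [hs.1]) (by linarith [hs.2])))

/-- The cone `σ` contains `z` and the points near `z` in the direction `f`. -/
def HasDir (σ : PointedCone ℝ (RealSpan M)) (z f : RealSpan M) : Prop :=
  z ∈ σ ∧ ∃ ε : ℝ, 0 < ε ∧ z + ε • f ∈ σ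

theorem HasDir.of_le {f : RealSpan M} (hz : z ∈ σ) {a b : ℝ} (ha : 0 ≤ a) (hab : a ≤ b)
    (h : z + b • f ∈ σ) : z + a • f ∈ σ := by
  rcases eq_or_lt_of_le (ha.trans hab) with hb | hb
  · have : a = 0 := by linarith
    rw [this]; simpa using hz
  · have e : z + a • f = (1 - a / b) • z + (a / b) • (z + b • f) := by
      rw [smul_add, smul_smul, div_mul_cancel₀ _ hb.ne', sub_smul, one_smul]; abel
    rw [e]
    exact σ.add_mem (smul_mem_cone _ (by rw [sub_nonneg, div_le_one hb]; exact hab) hz)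
      (smul_mem_cone _ (by positivity) h)

theorem HasDir.eventually {f : RealSpan M} (h : HasDir σ z f) {c : ℝ} (hc : 0 < c) :
    ∀ᶠ ε in 𝓝[>] (0 : ℝ), z + (ε * c) • f ∈ σ := by
  obtain ⟨hz, b, hb, h⟩ := h
  filter_upwards [Ioo_mem_nhdsGT (show 0 < b / c by positivity)] with ε hε
  refine HasDir.of_le hz (mul_pos hε.1 hc).le ?_ h
  have := hε.2
  rw [lt_div_iff₀ hc] at this
  exact this.le

theorem eventually_hasDir_iff {A : Finset (DualLat M)} (hσ : Adapted A σ) (z f : RealSpan M) :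
    ∀ᶠ ε in 𝓝[>] (0 : ℝ), (z + ε • f ∈ σ ↔ HasDir σ z f) := by
  by_cases hz : z ∈ σ
  · by_cases h : HasDir σ z f
    · filter_upwards [h.eventually one_pos] with ε hε
      rw [mul_one] at hε
      exact ⟨fun _ => h, fun _ => hε⟩
    · filter_upwards [self_mem_nhdsWithin] with ε (hε : 0 < ε)
      exact ⟨fun h1 => ⟨hz, ε, hε, h1⟩, fun h1 => absurd h1 h⟩
  · filter_upwards [eventually_near A z f] with ε hε
    exact ⟨fun h => absurd (hσ.mem_of_near hε h) hz, fun h => absurd h.1 hz⟩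

theorem HasDir.of_nonneg {F : Finset (DualLat M)} (h : ∀ x, x ∈ σ ↔ ∀ n ∈ F, 0 ≤ pair n x)
    (hz : z ∈ σ) {f : RealSpan M} (hf : ∀ n ∈ F, pair n z = 0 → 0 ≤ pair n f) : HasDir σ z f := by
  refine ⟨hz, ?_⟩
  obtain ⟨ε, h1, h2 : 0 < ε⟩ := ((eventually_near F z f).and self_mem_nhdsWithin).exists
  refine ⟨ε, h2, (h _).2 fun n hn => ?_⟩
  by_cases h0 : pair n z = 0
  · rw [map_add, h0, zero_add, map_smul, smul_eq_mul]
    exact mul_nonneg h2.le (hf n hn h0)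
  · exact nonneg_of_sign_eq (h1 n hn h0).symm ((h z).1 hz n hn)

theorem HasDir.of_mem_relInt (h : z ∈ relInt σ) {f : RealSpan M} (hf : f ∈ lin σ) : HasDir σ z f :=
  ⟨h.1, h.2 f hf⟩

end Circles

/-! ### Tropical hypersurfaces -/

section Tropical

variable {M : Type v} [AddCommGroup M]

theorem mul_pair_of_coplanar {m : M} {n n' n'' : DualLat M} {c : ℤ}
    (h : n' m • n'' - n'' m • n' = c • n) (x : RealSpan M) :
    (n' m : ℝ) * pair n'' x - n'' m * pair n' x = c * pair n x := by
  rw [← pair_smul c, ← h, pair_sub, pair_smul, pair_smul]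

/-- In a pencil, the points of a hyperplane other than `n = 0` near the centre are on no other
hyperplane. -/
theorem IsPencil.eq_or_eq_neg {A : Finset (DualLat M)} (hA : IsArr A) {m : M} {n n' n'' : DualLat M}
    {z u : RealSpan M} (hz : IsPencil A m n z) (hu : 0 < pair n u) (hn' : n' ∈ A) (hn'' : n'' ∈ A)
    (h' : pair n' z = 0) (h'' : pair n'' z = 0) (hm' : n' m ≠ 0)
    (h : pair n'' (foot m n' u) = 0) : n'' = n' ∨ n'' = -n' := by
  obtain ⟨c, hc⟩ := hz.coplanar n' hn' n'' hn'' h' h''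
  have h1 := mul_pair_foot (n' := n'') hm' u
  rw [h, hc, mul_zero, pair_smul] at h1
  have h2 : c = 0 := by
    have := (mul_eq_zero.1 h1.symm).resolve_right hu.ne'
    exact_mod_cast this
  rw [h2, zero_smul, sub_eq_zero] at hc
  by_cases h3 : n'' m = 0
  · rw [h3, zero_smul] at hc
    exact absurd ((smul_eq_zero.1 hc).resolve_left hm') (hA.prim n'' hn'').ne_zero
  · exact (hA.prim n' hn').eq_or_eq_neg (hA.prim n'' hn'') h3 hc.symm

variable (F : Fan M)

/-- Every point of the support of a fan lies in the relative interior of a cone, which is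
contained in all cones through the point. -/
theorem Fan.exists_min {A : Finset (DualLat M)} (hF : ∀ σ ∈ F.cones, Adapted A σ)
    {σ : PointedCone ℝ (RealSpan M)} (hσ : σ ∈ F.cones) {z : RealSpan M} (hz : z ∈ σ) :
    ∃ ω ∈ F.cones, z ∈ relInt ω ∧ ∀ τ ∈ F.cones, z ∈ τ → ω.IsFaceOf τ := by
  obtain ⟨ω, ⟨hω, hzω⟩, hmin⟩ := (F.finite.subset (s := F.cones) (t := {τ | τ ∈ F.cones ∧ z ∈ τ})
    (fun _ h => h.1)).exists_minimal ⟨σ, hσ, hz⟩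
  have hle : ∀ τ ∈ F.cones, z ∈ τ → ω ≤ τ := by
    intro τ hτ hzτ
    have h1 := F.face_mem ω hω _ (F.inter_face ω hω τ hτ)
    have h2 := hmin (y := ω ⊓ τ) ⟨h1, hzω, hzτ⟩ inf_le_left
    exact h2.trans inf_le_right
  refine ⟨ω, hω, ?_, fun τ hτ hzτ => ?_⟩
  · obtain ⟨G, hG, hG'⟩ := hF ω hω
    rw [mem_relInt_iff hG']
    refine ⟨hzω, fun n hn h0 x hx => ?_⟩
    let ρ : PointedCone ℝ (RealSpan M) :=
      { carrier := {x | x ∈ ω ∧ pair n x = 0}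
        add_mem' := fun ha hb => ⟨ω.add_mem ha.1 hb.1, by rw [map_add, ha.2, hb.2, add_zero]⟩
        zero_mem' := ⟨ω.zero_mem, map_zero _⟩
        smul_mem' := fun c x hx => ⟨Submodule.smul_mem _ c hx.1, by
          rw [nnreal_smul_def, map_smul, hx.2, smul_zero]⟩ }
    have hρ : ρ.IsFaceOf ω := by
      refine ⟨fun x hx => hx.1, fun {x y a} hx hy ha h => ⟨hx, ?_⟩⟩
      have h1 : pair n (a • x + y) = 0 := h.2
      have h2 := (hG' x).1 hx n hn
      have h3 := (hG' y).1 hy n hn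
      rw [map_add, map_smul, smul_eq_mul] at h1
      nlinarith
    have h1 := hmin (y := ρ) ⟨F.face_mem ω hω ρ hρ, hzω, h0⟩ hρ.le
    exact (h1 hx).2
  · have := F.inter_face τ hτ ω hω
    rwa [inf_eq_right.2 (hle τ hτ hzτ)] at this

theorem lin_le_of_isFaceOf {σ ω : PointedCone ℝ (RealSpan M)} (h : ω.IsFaceOf σ) {z : RealSpan M}
    (hz : z ∈ relInt σ) (hzω : z ∈ ω) : lin σ ≤ lin ω := by
  refine Submodule.span_le.2 fun y hy => ?_
  obtain ⟨ε, hε, h1⟩ := hz.2 (-y) (neg_mem (mem_lin hy))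
  have : ε • y + (z + ε • -y) ∈ ω := by
    rw [smul_neg]; simpa using hzω
  exact mem_lin (h.mem_of_smul_add_mem hy h1 hε this)

variable (T : TropicalHypersurface M)

theorem TropicalHypersurface.finite_maxCones : T.maxCones.Finite :=
  T.finite.subset fun _ h => h.1

/-- The weight of the hypersurface at a point: the sum of the weights of the maximal cones
containing the point. -/
def TropicalHypersurface.weightAt (x : RealSpan M) : ℕ :=
  open Classical in ∑ σ ∈ T.finite_maxCones.toFinset, if x ∈ σ then T.weight σ else 0

variable [Module.Free ℤ M] [Module.Finite ℤ M]

open Classical in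
/-- The balancing condition, in the form in which it is met along a line in the generic
direction `m`. -/
theorem TropicalHypersurface.balanced_pencil {A : Finset (DualLat M)} (hA : IsArr A)
    (hT : ∀ σ ∈ T.cones, Adapted A σ) {m : M} (hm : Gen A (incl m)) {n : DualLat M}
    (hn : n m = 0) {z u : RealSpan M} (hu : 0 < pair n u) (hz : IsPencil A m n z) :
    ∀ᶠ ε in 𝓝[>] (0 : ℝ),
      ∑ n' ∈ A.filter fun n' => n' m < 0 ∧ pair n' z = 0,
        (((T.weightAt (z - ε • foot m n' u) : ℤ) • n' -
          (T.weightAt (z + ε • foot m n' u) : ℤ) • n') : DualLat M) = 0 := by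
  have hm0 : ∀ n' ∈ A, n' m ≠ 0 := fun n' hn' h => hm n' hn' (by rw [pair_incl, h, Int.cast_zero])
  set Mx := T.finite_maxCones.toFinset with hMx
  have hMx' : ∀ σ ∈ Mx, σ ∈ T.maxCones := fun σ h => T.finite_maxCones.mem_toFinset.1 h
  set Sz := A.filter fun n' => n' m < 0 ∧ pair n' z = 0 with hSz
  have hev : ∀ᶠ ε in 𝓝[>] (0 : ℝ), ∀ σ ∈ Mx, ∀ n' ∈ Sz,
      (z + ε • foot m n' u ∈ σ ↔ HasDir σ z (foot m n' u)) ∧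
      (z - ε • foot m n' u ∈ σ ↔ HasDir σ z (-foot m n' u)) := by
    rw [Filter.eventually_all_finset]
    intro σ hσ
    rw [Filter.eventually_all_finset]
    intro n' _
    have h1 := eventually_hasDir_iff (hT σ (hMx' σ hσ).1) z (foot m n' u)
    have h2 := eventually_hasDir_iff (hT σ (hMx' σ hσ).1) z (-foot m n' u)
    filter_upwards [h1, h2] with ε h3 h4
    rw [smul_neg, ← sub_eq_add_neg] at h4
    exact ⟨h3, h4⟩
  -- the sum is the weighted sum of the contributions `D σ` of the maximal cones
  let D : PointedCone ℝ (RealSpan M) → DualLat M := fun σ => ∑ n' ∈ Sz,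
    ((if HasDir σ z (-foot m n' u) then n' else 0) - (if HasDir σ z (foot m n' u) then n' else 0))
  suffices hD : ∑ σ ∈ Mx, T.weight σ • D σ = 0 by
    filter_upwards [hev] with ε hε
    rw [← hD]
    simp only [TropicalHypersurface.weightAt, ← hMx, Nat.cast_sum, Finset.sum_smul, D,
      Finset.smul_sum, ← Finset.sum_sub_distrib]
    rw [Finset.sum_comm]
    refine Finset.sum_congr rfl fun σ hσ => Finset.sum_congr rfl fun n' hn' => ?_
    simp only [(hε σ hσ n' hn').1, (hε σ hσ n' hn').2, smul_sub]
    split_ifs <;> simp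
  have hnormal : ∀ σ ∈ Mx, ∃ n' ∈ A, n' m < 0 ∧ (∀ x ∈ σ, pair n' x = 0) ∧
      lin σ = LinearMap.ker (pair n') := by
    intro σ hσ
    obtain ⟨n', hn', h⟩ := (hT σ (hMx' σ hσ).1).exists_normal (hMx' σ hσ).2
    rcases lt_or_gt_of_ne (hm0 n' hn') with h0 | h0
    · exact ⟨n', hn', h0, h, lin_eq_ker (hA.prim n' hn').ne_zero h (hMx' σ hσ).2⟩
    · have h' : ∀ x ∈ σ, pair (-n') x = 0 := fun x hx => by rw [pair_neg, h x hx, neg_zero]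
      exact ⟨-n', hA.neg n' hn', by simpa using h0, h',
        lin_eq_ker (hA.prim _ (hA.neg n' hn')).ne_zero h' (hMx' σ hσ).2⟩
  choose! ν hνA hνm hν hνlin using hnormal
  have hfoot0 : ∀ σ ∈ Mx, pair (ν σ) (foot m (ν σ) u) = 0 := fun σ hσ =>
    pair_foot_self (hνm σ hσ).ne u
  have honly : ∀ σ ∈ Mx, ∀ n' ∈ Sz, n' ≠ ν σ →
      ¬ HasDir σ z (foot m n' u) ∧ ¬ HasDir σ z (-foot m n' u) := by
    intro σ hσ n' hn' hne
    rw [hSz, Finset.mem_filter] at hn'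
    have key : ∀ f, HasDir σ z f → pair (ν σ) f = 0 := by
      rintro f ⟨h1, ε, h2, h3⟩
      have := hν σ hσ _ h3
      rw [map_add, hν σ hσ _ h1, map_smul, zero_add, smul_eq_mul] at this
      exact (mul_eq_zero.1 this).resolve_left h2.ne'
    have key' : z ∈ σ → pair (ν σ) (foot m n' u) ≠ 0 := by
      intro hzσ h
      rcases hz.eq_or_eq_neg hA hu hn'.1 (hνA σ hσ) hn'.2.2 (hν σ hσ z hzσ) hn'.2.1.ne h with h | h
      · exact hne h.symm
      · have h1 := hνm σ hσ
        have h2 := hn'.2.1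
        rw [h, LinearMap.neg_apply] at h1
        omega
    refine ⟨fun h => key' h.1 (key _ h), fun h => key' h.1 ?_⟩
    have := key _ h
    rwa [map_neg, neg_eq_zero] at this
  have hDσ : ∀ σ ∈ Mx, z ∈ σ → D σ =
      (if HasDir σ z (-foot m (ν σ) u) then ν σ else 0) -
        (if HasDir σ z (foot m (ν σ) u) then ν σ else 0) := by
    intro σ hσ hzσ
    have : ν σ ∈ Sz := by
      rw [hSz, Finset.mem_filter]; exact ⟨hνA σ hσ, hνm σ hσ, hν σ hσ z hzσ⟩
    refine Finset.sum_eq_single_of_mem _ this fun n' hn' hne => ?_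
    rw [if_neg (honly σ hσ n' hn' hne).1, if_neg (honly σ hσ n' hn' hne).2, sub_zero]
  have hD0 : ∀ σ ∈ Mx, z ∉ σ → D σ = 0 := by
    intro σ hσ hzσ
    refine Finset.sum_eq_zero fun n' _ => ?_
    rw [if_neg fun h => hzσ h.1, if_neg fun h => hzσ h.1, sub_zero]
  -- a cone with `z` in its relative interior contributes the same to both sides
  by_cases hB : ∃ σ ∈ Mx, z ∈ σ ∧ z ∉ relInt σ
  swap
  · push Not at hB
    refine Finset.sum_eq_zero fun σ hσ => ?_
    by_cases hzσ : z ∈ σ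
    · have h1 := hB σ hσ hzσ
      have h2 : foot m (ν σ) u ∈ lin σ := by
        rw [hνlin σ hσ, LinearMap.mem_ker]; exact hfoot0 σ hσ
      rw [hDσ σ hσ hzσ, if_pos (HasDir.of_mem_relInt h1 (neg_mem h2)),
        if_pos (HasDir.of_mem_relInt h1 h2), sub_self, smul_zero]
    · rw [hD0 σ hσ hzσ, smul_zero]
  obtain ⟨σ₁, hσ₁, hzσ₁, hrel⟩ := hB
  -- the minimal cone through `z` has codimension two
  obtain ⟨ω, hω, hzω, hmin⟩ := T.toFan.exists_min hT (hMx' σ₁ hσ₁).1 hzσ₁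
  obtain ⟨n₂, hn₂A, hn₂z, hn₂σ, y₂, hy₂, hn₂y⟩ : ∃ n₂ ∈ A, pair n₂ z = 0 ∧
      (∀ x ∈ σ₁, 0 ≤ pair n₂ x) ∧ ∃ y ∈ σ₁, pair n₂ y ≠ 0 := by
    obtain ⟨G, hG, hG'⟩ := hT σ₁ (hMx' σ₁ hσ₁).1
    rw [mem_relInt_iff hG'] at hrel
    push Not at hrel
    obtain ⟨n₂, h1, h2, y, h3, h4⟩ := hrel hzσ₁
    exact ⟨n₂, hG h1, h2, fun x hx => (hG' x).1 hx n₂ h1, y, h3, h4⟩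
  set n₁ := ν σ₁ with hn₁
  have hn₁A := hνA σ₁ hσ₁
  have hn₁z := hν σ₁ hσ₁ z hzσ₁
  have hne : ¬ (n₂ = n₁ ∨ n₂ = -n₁) := by
    rintro (h | h)
    · exact hn₂y (by rw [h]; exact hν σ₁ hσ₁ _ hy₂)
    · exact hn₂y (by rw [h, pair_neg, hν σ₁ hσ₁ _ hy₂, neg_zero])
  have hωσ₁ := (hmin σ₁ (hMx' σ₁ hσ₁).1 hzσ₁).le
  have hω₁ : ∀ x ∈ lin ω, pair n₁ x = 0 := fun x hx =>
    zero_of_mem_lin (fun y hy => hν σ₁ hσ₁ _ (hωσ₁ hy)) hx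
  have hω₂ : ∀ x ∈ lin ω, pair n₂ x = 0 := fun x hx =>
    zero_of_mem_lin (fun y hy => zero_of_mem_relInt hzω (fun y hy => hn₂σ y (hωσ₁ hy)) hn₂z hy) hx
  obtain ⟨c, hc⟩ := hz.coplanar n₁ hn₁A n₂ hn₂A hn₁z hn₂z
  have hc0 : c ≠ 0 := by
    rintro rfl
    rw [zero_smul, sub_eq_zero] at hc
    exact hne ((hA.prim n₁ hn₁A).eq_or_eq_neg (hA.prim n₂ hn₂A) (hm0 n₂ hn₂A) hc.symm)
  have hωn : ∀ x ∈ lin ω, pair n x = 0 := by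
    intro x hx
    have := mul_pair_of_coplanar hc x
    rw [hω₁ x hx, hω₂ x hx, mul_zero, mul_zero, sub_zero] at this
    exact (mul_eq_zero.1 this.symm).resolve_left (by exact_mod_cast hc0)
  have hn₁m : (n₁ m : ℝ) ≠ 0 := by exact_mod_cast (hνm σ₁ hσ₁).ne
  have hωlin : ∀ x, pair n₁ x = 0 → pair n x = 0 → x ∈ lin ω := by
    intro x h1 h2
    have h3 : ∀ n' ∈ A, pair n' z = 0 → pair n' x = 0 := by
      intro n' hn' h0
      obtain ⟨c', hc'⟩ := hz.coplanar n₁ hn₁A n' hn' hn₁z h0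
      have := mul_pair_of_coplanar hc' x
      rw [h1, h2, mul_zero, mul_zero, sub_zero] at this
      exact (mul_eq_zero.1 this).resolve_left hn₁m
    obtain ⟨G, hG, hG'⟩ := hT ω hω
    obtain ⟨hz', ε, hε, h⟩ := HasDir.of_nonneg hG' hzω.1 (f := x) fun n' hn' h0 =>
      (h3 n' (hG hn') h0).ge
    have h4 : ε • x ∈ lin ω := by
      have := sub_mem (mem_lin h) (mem_lin hz')
      rwa [add_sub_cancel_left] at this
    have h5 := Submodule.smul_mem (lin ω) ε⁻¹ h4
    rwa [smul_smul, inv_mul_cancel₀ hε.ne', one_smul] at h5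
  have hcompl : IsCompl (lin ω) (Submodule.span ℝ {u, incl m}) := by
    have hnm : pair n (incl m) = 0 := by rw [pair_incl, hn, Int.cast_zero]
    refine ⟨Submodule.disjoint_def.2 fun x hx hx' => ?_,
      codisjoint_iff.2 (eq_top_iff.2 fun x _ => ?_)⟩
    · obtain ⟨a, b, rfl⟩ := Submodule.mem_span_pair.1 hx'
      have h1 := hωn _ hx
      rw [map_add, map_smul, map_smul, hnm, smul_zero, add_zero, smul_eq_mul] at h1
      have ha := (mul_eq_zero.1 h1).resolve_right hu.ne'
      have h2 := hω₁ _ hx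
      rw [ha, zero_smul, zero_add, map_smul, pair_incl, smul_eq_mul] at h2
      have hb := (mul_eq_zero.1 h2).resolve_right hn₁m
      rw [ha, hb]; simp
    · set a := pair n x / pair n u with ha
      set b := pair n₁ (x - a • u) / n₁ m with hb
      refine Submodule.mem_sup.2 ⟨x - a • u - b • incl m, hωlin _ ?_ ?_, a • u + b • incl m,
        Submodule.mem_span_pair.2 ⟨a, b, rfl⟩, by abel⟩
      · rw [map_sub, map_smul, pair_incl, smul_eq_mul, hb, div_mul_cancel₀ _ hn₁m, sub_self]
      · rw [map_sub, map_sub, map_smul, map_smul, hnm, smul_zero, sub_zero, smul_eq_mul, ha,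
          div_mul_cancel₀ _ hu.ne', sub_self]
  have hdim : dim ω + 2 = ambientDim M := by
    have h1 := Submodule.finrank_add_eq_of_isCompl hcompl
    have h2 : LinearIndependent ℝ ![u, incl m] := by
      rw [LinearIndependent.pair_iff]
      intro a b h
      have hnm : pair n (incl m) = 0 := by rw [pair_incl, hn, Int.cast_zero]
      have h1 := congrArg (pair n) h
      rw [map_add, map_smul, map_smul, hnm, smul_zero, add_zero, smul_eq_mul, map_zero] at h1
      have ha := (mul_eq_zero.1 h1).resolve_right hu.ne'
      have h2 := congrArg (pair n₁) h
      rw [ha, zero_smul, zero_add, map_smul, pair_incl, smul_eq_mul, map_zero] at h2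
      exact ⟨ha, (mul_eq_zero.1 h2).resolve_right hn₁m⟩
    have h3 := finrank_span_eq_card h2
    rw [Matrix.range_cons, Matrix.range_cons, Matrix.range_empty, Set.union_empty,
      Set.singleton_union, Fintype.card_fin] at h3
    rw [h3] at h1
    exact h1
  have hbal := T.balanced ω hω hdim z hzω u (incl m) hcompl
  -- each cone through `z` contains one of the two half lines in its hyperplane
  have hone : ∀ σ ∈ Mx, z ∈ σ → (HasDir σ z (-foot m (ν σ) u) ↔ ¬ HasDir σ z (foot m (ν σ) u)) := by
    intro σ hσ hzσ
    have hνz := hν σ hσ z hzσ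
    obtain ⟨G, hG, hG'⟩ := hT σ (hMx' σ hσ).1
    have hnr : z ∉ relInt σ := by
      intro h
      have h1 := lin_le_of_isFaceOf (hmin σ (hMx' σ hσ).1 hzσ) h hzω.1
      rw [hνlin σ hσ] at h1
      have e1 := (hA.prim _ (hνA σ hσ)).eq_or_eq_neg_of_ker (hA.prim _ hn₁A)
          fun x hx => hω₁ x (h1 hx)
      have e2 := (hA.prim _ (hνA σ hσ)).eq_or_eq_neg_of_ker (hA.prim _ hn₂A)
          fun x hx => hω₂ x (h1 hx)
      apply hne
      rcases e1 with e1 | e1 <;> rcases e2 with e2 | e2 <;> rw [hn₁, e1, e2] <;> simp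
    constructor
    · rintro ⟨_, a, ha, h1⟩ ⟨_, b, hb, h2⟩
      rw [mem_relInt_iff hG'] at hnr
      push Not at hnr
      obtain ⟨n', h3, h4, y, h5, h6⟩ := hnr hzσ
      have h7 := (hG' _).1 h1 n' h3
      have h8 := (hG' _).1 h2 n' h3
      rw [map_add, h4, map_smul, zero_add, smul_eq_mul] at h7 h8
      rw [map_neg] at h7
      have h9 : pair n' (foot m (ν σ) u) = 0 := by nlinarith
      rcases hz.eq_or_eq_neg hA hu (hνA σ hσ) (hG h3) hνz h4 (hνm σ hσ).ne h9 with h | h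
      · exact h6 (by rw [h]; exact hν σ hσ _ h5)
      · exact h6 (by rw [h, pair_neg, hν σ hσ _ h5, neg_zero])
    · intro h1
      by_contra h2
      have hex : ∀ f, ¬ HasDir σ z f → ∃ n' ∈ G, pair n' z = 0 ∧ pair n' f < 0 := by
        intro f hf
        by_contra! hcon
        exact hf (HasDir.of_nonneg hG' hzσ hcon)
      obtain ⟨na, ha, haz, haf⟩ := hex _ h1
      obtain ⟨nb, hb, hbz, hbf⟩ := hex _ h2
      rw [map_neg, neg_lt_zero] at hbf
      obtain ⟨ca, hca⟩ := hz.coplanar _ (hνA σ hσ) na (hG ha) hνz haz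
      obtain ⟨cb, hcb⟩ := hz.coplanar _ (hνA σ hσ) nb (hG hb) hνz hbz
      have hnm : (ν σ m : ℝ) < 0 := by exact_mod_cast hνm σ hσ
      have hnf : pair n (foot m (ν σ) u) = pair n u := by rw [pair_foot, hn]; simp
      have ha1 := mul_pair_of_coplanar hca (foot m (ν σ) u)
      have hb1 := mul_pair_of_coplanar hcb (foot m (ν σ) u)
      rw [hfoot0 σ hσ, mul_zero, sub_zero, hnf] at ha1 hb1
      have hca0 : (0 : ℝ) < ca := by
        by_contra h
        have := mul_pos_of_neg_of_neg hnm haf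
        nlinarith
      have hcb0 : (cb : ℝ) < 0 := by
        by_contra h
        have := mul_neg_of_neg_of_pos hnm hbf
        nlinarith
      have hzero : ∀ y ∈ σ, pair n y = 0 := by
        intro y hy
        have ha2 := mul_pair_of_coplanar hca y
        have hb2 := mul_pair_of_coplanar hcb y
        rw [hν σ hσ y hy, mul_zero, sub_zero] at ha2 hb2
        have ha3 := mul_nonpos_of_nonpos_of_nonneg hnm.le ((hG' y).1 hy na ha)
        have hb3 := mul_nonpos_of_nonpos_of_nonneg hnm.le ((hG' y).1 hy nb hb)
        rw [ha2] at ha3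
        rw [hb2] at hb3
        nlinarith
      have h3 : foot m (ν σ) u ∈ lin σ := by
        rw [hνlin σ hσ, LinearMap.mem_ker]; exact hfoot0 σ hσ
      have h4 := zero_of_mem_lin hzero h3
      rw [hnf] at h4
      exact hu.ne' h4
  -- the normal vector of `σ` that is positive just before the circle crosses `σ`
  let N : PointedCone ℝ (RealSpan M) → DualLat M := fun σ =>
    if HasDir σ z (foot m (ν σ) u) then ν σ else -ν σ
  have hDN : ∀ σ ∈ Mx, z ∈ σ → D σ = -N σ := by
    intro σ hσ hzσ
    rw [hDσ σ hσ hzσ]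
    simp only [hone σ hσ hzσ, N]
    by_cases h : HasDir σ z (foot m (ν σ) u)
    · rw [if_neg (not_not.2 h), if_pos h, if_pos h, zero_sub]
    · rw [if_pos h, if_neg h, if_neg h, sub_zero, neg_neg]
  have hcross : ∀ᶠ ε in 𝓝[>] (0 : ℝ), ∀ σ ∈ Mx, z ∈ σ →
      ∃ t, CrossesAt (circle z u (incl m) ε) σ t (N σ) := by
    rw [Filter.eventually_all_finset]
    intro σ hσ
    rw [Filter.eventually_imp_distrib_left]
    intro hzσ
    have hw : pair (ν σ) (incl m) < 0 := by rw [pair_incl]; exact_mod_cast hνm σ hσ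
    have hff : foot m (ν σ) u = u - (pair (ν σ) u / pair (ν σ) (incl m)) • incl m := by
      rw [pair_incl]; rfl
    by_cases h : HasDir σ z (foot m (ν σ) u)
    · have hN : N σ = ν σ := if_pos h
      rw [hN]
      filter_upwards [h.eventually (cos_crossTime_pos (n := ν σ) (u := u) (w := incl m)),
        self_mem_nhdsWithin] with ε h1 (h2 : 0 < ε)
      exact ⟨_, crossesAt_crossTime h2 (hν σ hσ z hzσ) hw (hA.prim _ (hνA σ hσ)) (hν σ hσ)
        (hff ▸ h1)⟩
    · have hN : N σ = -ν σ := if_neg h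
      rw [hN]
      filter_upwards [((hone σ hσ hzσ).2 h).eventually
        (cos_crossTime_pos (n := ν σ) (u := u) (w := incl m)), self_mem_nhdsWithin] with ε h1
        (h2 : 0 < ε)
      rw [smul_neg, ← sub_eq_add_neg] at h1
      exact ⟨_, crossesAt_crossTime_add_pi h2 (hν σ hσ z hzσ) hw (hA.prim _ (hνA σ hσ)) (hν σ hσ)
        (hff ▸ h1)⟩
  obtain ⟨ε, h1, h2⟩ := (hbal.and hcross).exists
  have h3 := h1 N fun σ hσ hd hle => h2 σ (T.finite_maxCones.mem_toFinset.2 ⟨hσ, hd⟩) (hle hzω.1)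
  have h4 : {σ | σ ∈ T.cones ∧ dim σ + 1 = ambientDim M ∧ ω ≤ σ} =
      ((Mx.filter fun σ => z ∈ σ : Finset _) : Set (PointedCone ℝ (RealSpan M))) := by
    ext σ
    simp only [Set.mem_ofPred_eq, Finset.coe_filter, hMx, Set.Finite.mem_toFinset]
    constructor
    · rintro ⟨h5, h6, h7⟩
      exact ⟨⟨h5, h6⟩, h7 hzω.1⟩
    · rintro ⟨h5, h6⟩
      exact ⟨h5.1, h5.2, (hmin σ h5.1 h6).le⟩
  rw [h4, finsum_mem_coe_finset] at h3
  have h5 : ∑ σ ∈ Mx, T.weight σ • D σ = ∑ σ ∈ Mx.filter (fun σ => z ∈ σ), -(T.weight σ • N σ) := by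
    rw [Finset.sum_filter]
    refine Finset.sum_congr rfl fun σ hσ => ?_
    split_ifs with h
    · rw [hDN σ hσ h, smul_neg]
    · rw [hD0 σ hσ h, smul_zero]
  rw [h5, Finset.sum_neg_distrib, h3, neg_zero]

/-- A tropical hypersurface is the corner locus of a piecewise linear function: the slopes `Ψ` of
this function on the chambers of a sufficiently fine arrangement. Up to sign, the
slope at `x` is the sum of the weighted normal vectors of the cones met by the ray from `x` in a
generic direction. -/
theorem TropicalHypersurface.exists_potential : ∃ A : Finset (DualLat M), IsArr A ∧
    (∀ σ ∈ T.maxCones, Adapted A σ) ∧ ∃ Ψ : RealSpan M → DualLat M,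
      (∀ x x', Gen A x → SameSigns A x x' → Ψ x = Ψ x') ∧
      ∀ n ∈ A, ∀ x y x', IsCross A n x y x' → Ψ x' = Ψ x + T.weightAt y • n := by
  classical
  obtain ⟨A, hA, hT⟩ := exists_adapted_family T.finite T.rational
  obtain ⟨m, hm⟩ := exists_lattice_gen hA
  obtain ⟨A', hA', hsub, hcl⟩ := exists_closedAlong hA {m}
  replace hcl := hcl m (Finset.mem_singleton_self m)
  have hm0 : ∀ n' ∈ A, n' m ≠ 0 := fun n' hn' h => hm n' hn' (by rw [pair_incl, h, Int.cast_zero])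
  let e : DualLat M → RealSpan M → DualLat M :=
    fun n y => if n ∈ A then (T.weightAt y : ℤ) • n else 0
  have he : ∀ n ∈ A, ∀ y y', OnWall A n y → SameSigns A y y' → e n y = e n y' := by
    intro n hn y y' _ h
    have : T.weightAt y = T.weightAt y' := Finset.sum_congr rfl fun σ hσ => by
      have := (hT σ (T.finite_maxCones.mem_toFinset.1 hσ).1).mem_congr h
      simp only [this]
    simp only [e, if_pos hn, this]
  have hneg : ∀ n ∈ A, ∀ y, OnWall A n y → e (-n) y = -e n y := by
    intro n hn y _
    simp only [e, if_pos hn, if_pos (hA.neg n hn), smul_neg]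
  have hout : ∀ n ∈ A', n ∉ A → ∀ y, e n y = 0 := fun n _ hn y => if_neg hn
  have hwt : ∀ n ∈ A', n ∉ A → ∀ x y x', IsCross A' n x y x' → T.weightAt y = 0 := by
    intro n hn hnA x y x' hc
    refine Finset.sum_eq_zero fun σ hσ => if_neg fun hy => ?_
    have hσ' := T.finite_maxCones.mem_toFinset.1 hσ
    obtain ⟨n', hn', h⟩ := (hT σ hσ'.1).exists_normal hσ'.2
    rcases hc.onWall.2 n' (hsub hn') (h y hy) with rfl | rfl
    · exact hnA hn'
    · exact hnA (by have := hA.neg _ hn'; rwa [neg_neg] at this)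
  refine ⟨A', hA', fun σ hσ => (hT σ hσ.1).mono hsub, fun x => -raySum A m e x, ?_, ?_⟩
  · intro x x' hx h
    simp only [raySum_congr hA hsub hcl hx he h]
  · intro n hn x y x' hc
    have key : e n y + raySum A m e x' - raySum A m e x = 0 := by
      by_cases hnm : n m = 0
      · have hnA : n ∉ A := fun h => hm0 n h hnm
        obtain ⟨u, hu⟩ := pair_ne_zero_of_ne (hA'.prim n hn).ne_zero
        have h1 := raySum_parallel hA hA' hsub hcl he (fun n hn hnA y _ _ => hout n hn hnA y)
            hn hnm hc
          ⊥ hu (fun z hz => by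
            filter_upwards [T.balanced_pencil hA hT hm hnm hu hz] with ε hε
            rw [AddSubgroup.mem_bot, hout n hn hnA, hout n hn hnA, sub_zero, zero_add, ← hε]
            refine Finset.sum_congr rfl fun n' hn' => ?_
            rw [Finset.mem_filter] at hn'
            simp only [e, if_pos hn'.1])
          (farTime_pos (A := A) (x := y)).le (fun n' hn' h0 => by
            have h2 := sign_far hn' h0.ne (le_refl (farTime A y))
            have h3 : (n' m : ℝ) < 0 := by exact_mod_cast h0
            have h4 := (sign_eq_iff_neg h2).2 h3
            simpa using h4)
        rw [AddSubgroup.mem_bot, hout n hn hnA (y + _), sub_zero] at h1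
        exact h1
      · exact raySum_cross hA hA' hsub hcl he hneg (fun n hn hnA y _ => hout n hn hnA y) hn hnm hc
    have h2 : e n y = T.weightAt y • n := by
      by_cases hnA : n ∈ A
      · simp only [e, if_pos hnA, natCast_zsmul]
      · simp only [e, if_neg hnA, hwt n hn hnA x y x' hc, zero_smul]
    rw [h2] at key
    rw [sub_eq_zero] at key
    change -raySum A m e x' = -raySum A m e x + _
    rw [← key]; abel

end Tropical

/-! ### Widgets -/

section QuotientLattice

variable {M : Type v} [AddCommGroup M] [Module.Free ℤ M] [Module.Finite ℤ M] {m₀ : M}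

theorem isAddTorsionFree_of_free : IsAddTorsionFree M :=
  ⟨fun c hc x y h => by
    apply (Module.Free.chooseBasis ℤ M).ext_elem
    intro i
    have := congrArg (fun z => (Module.Free.chooseBasis ℤ M).repr z i) h
    simpa [hc] using this⟩

theorem free_quotLattice (h : IsPrimitive m₀) : Module.Free ℤ (QuotLattice m₀) := by
  have : Module.IsTorsionFree ℤ (QuotLattice m₀) := by
    refine Module.IsTorsionFree.of_smul_eq_zero fun c x hcx => ?_
    obtain ⟨x, rfl⟩ := Submodule.mkQ_surjective _ x
    rw [or_iff_not_imp_left]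
    intro hc
    rw [← map_smul, Submodule.mkQ_apply, Submodule.Quotient.mk_eq_zero,
      Submodule.mem_span_singleton] at hcx
    obtain ⟨d, hd⟩ := hcx
    rw [Submodule.mkQ_apply, Submodule.Quotient.mk_eq_zero, Submodule.mem_span_singleton]
    by_cases hx : x = 0
    · exact ⟨0, by simp [hx]⟩
    obtain ⟨a, y, ha, hy, rfl⟩ := exists_primitive hx
    have e : (c * a) • y = d • m₀ := by rw [hd, mul_smul, natCast_zsmul]
    have : IsAddTorsionFree M := isAddTorsionFree_of_free
    rcases hy.eq_or_eq_neg h (mul_ne_zero hc (by exact_mod_cast ha.ne')) e with h1 | h1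
    · exact ⟨a, by rw [h1, natCast_zsmul]⟩
    · exact ⟨-a, by rw [h1, neg_smul, natCast_zsmul, smul_neg, neg_neg]⟩
  exact Module.free_of_finite_type_torsion_free'


theorem pair_proj (n : DualLat (QuotLattice m₀)) (x : RealSpan M) :
    pair n (proj m₀ x) = pair (n.comp (Submodule.mkQ _)) x := by
  induction x using TensorProduct.induction_on with
  | zero => simp
  | tmul c m => simp [proj, pair_tmul]
  | add x y hx hy => rw [map_add, map_add, map_add, hx, hy]

theorem proj_incl : proj m₀ (incl m₀) = 0 := by
  have : (Submodule.Quotient.mk m₀ : QuotLattice m₀) = 0 :=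
    (Submodule.Quotient.mk_eq_zero _).2 (Submodule.mem_span_singleton_self m₀)
  simp [proj, incl, this]

theorem exists_smul_of_proj_eq_zero {x : RealSpan M} (h : proj m₀ x = 0) :
    ∃ c : ℝ, x = c • incl m₀ := by
  set f := (Submodule.span ℤ {m₀}).subtype with hf
  set g := (Submodule.span ℤ {m₀}).mkQ with hg
  have hfg : Function.Exact f g := by
    rw [LinearMap.exact_iff, hf, hg, Submodule.ker_mkQ, Submodule.range_subtype]
  have h1 := lTensor_exact ℝ hfg (Submodule.mkQ_surjective _)
  obtain ⟨t, rfl⟩ := (h1 x).1 h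
  induction t using TensorProduct.induction_on with
  | zero => exact ⟨0, by simp⟩
  | tmul c m =>
    obtain ⟨a, ha⟩ := Submodule.mem_span_singleton.1 m.2
    refine ⟨c * a, ?_⟩
    have : f m = a • m₀ := ha.symm
    rw [LinearMap.lTensor_tmul, this, incl, TensorProduct.smul_tmul', smul_eq_mul, mul_one,
      TensorProduct.tmul_smul, TensorProduct.smul_tmul', zsmul_eq_mul, mul_comm]
  | add a b iha ihb =>
    have hmem : ∀ t, proj m₀ (LinearMap.lTensor ℝ f t) = 0 := fun t => (h1 _).2 ⟨t, rfl⟩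
    obtain ⟨c, hc⟩ := iha (hmem a)
    obtain ⟨d, hd⟩ := ihb (hmem b)
    exact ⟨c + d, by rw [map_add, hc, hd, add_smul]⟩

end QuotientLattice

section WidgetPotential

variable {k : Type*} [Field k] {P : Type*} [AddCommMonoid P] {M : Type v} [AddCommGroup M]
  {r : P →+ M} (W : Widget k r)

instance : Finite W.Index := W.finite_index

instance : Fintype W.Index := Fintype.ofFinite _

/-- The image in `(M / ℤ m₀)_ℝ` of a cone of the widget, as a maximal cone of the tropical
hypersurface. -/
def Widget.toMax (i : W.Index) : W.hyp.maxCones := ⟨_, i.2.2⟩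

/-- The weight of the cone of a widget. -/
def Widget.weight (i : W.Index) : ℕ := W.hyp.weight (i.1.map (proj W.m₀))

/-- The sum of the weights of the cones of the widget through a point. -/
def Widget.weightAt (y : RealSpan M) : ℕ :=
  open Classical in ∑ i : W.Index, if y ∈ i.1 then W.weight i else 0

variable [Module.Free ℤ M] [Module.Finite ℤ M]

theorem Widget.incl_mem (i : W.Index) : incl W.m₀ ∈ i.1 :=
  i.2.1.2.2 (Submodule.subset_span (Set.mem_singleton _))

theorem Widget.exists_add_mem {i : W.Index} {y : RealSpan M}
    (h : proj W.m₀ y ∈ i.1.map (proj W.m₀)) : ∃ c : ℝ, ∀ T, c ≤ T → y + T • incl W.m₀ ∈ i.1 := by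
  obtain ⟨d, hd, e⟩ := PointedCone.mem_map.1 h
  obtain ⟨c, hc⟩ := exists_smul_of_proj_eq_zero (m₀ := W.m₀) (x := d - y)
    (by rw [map_sub, sub_eq_zero]; exact e)
  refine ⟨c, fun T hT => ?_⟩
  have : y + T • incl W.m₀ = d + (T - c) • incl W.m₀ := by
    rw [sub_smul, ← hc]; abel
  rw [this]
  exact i.1.add_mem hd (smul_mem_cone _ (by linarith) (W.incl_mem i))

theorem Widget.toMax_injective : Function.Injective W.toMax := by
  have key : ∀ i i' : W.Index, W.toMax i = W.toMax i' → i.1 ≤ i'.1 := by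
    intro i i' h d hd
    have h1 : proj W.m₀ d ∈ i'.1.map (proj W.m₀) := by
      have : i.1.map (proj W.m₀) = i'.1.map (proj W.m₀) := congrArg Subtype.val h
      rw [← this]
      exact PointedCone.mem_map.2 ⟨d, hd, rfl⟩
    obtain ⟨c, hc⟩ := W.exists_add_mem h1
    have hm : |c| • incl W.m₀ ∈ i.1 := smul_mem_cone _ (abs_nonneg c) (W.incl_mem i)
    have h2 := W.fan.inter_face i.1 i.2.1.1 i'.1 i'.2.1.1
    have h3 := h2.mem_of_add_mem_left hd hm ⟨i.1.add_mem hd hm, hc _ (le_abs_self c)⟩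
    exact h3.2
  intro i i' h
  exact Subtype.ext (le_antisymm (key i i' h) (key i' i h.symm))

theorem Widget.toMax_bijective : Function.Bijective W.toMax := by
  refine ⟨W.toMax_injective, fun σ => ?_⟩
  obtain ⟨d, hd, e⟩ := W.cells σ.1 σ.2
  exact ⟨⟨d, hd, by rw [e]; exact σ.2⟩, Subtype.ext e⟩

/-- Far away in the direction of `m₀`, the cones of the widget are the preimages of the maximal
cones of the tropical hypersurface. -/
theorem Widget.weightAt_eq {A : Finset (DualLat M)} (hA : ∀ i : W.Index, Adapted A i.1)
    {y : RealSpan M} (hy : ∀ n ∈ A, n W.m₀ ≠ 0 →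
      SignType.sign (pair n y) = SignType.sign (n W.m₀ : ℝ)) :
    W.weightAt y = W.hyp.weightAt (proj W.m₀ y) := by
  classical
  unfold Widget.weightAt TropicalHypersurface.weightAt
  refine Finset.sum_bij (fun i _ => (W.toMax i).1) (fun i _ => by simp)
    (fun i _ i' _ h => W.toMax_injective (Subtype.ext h)) (fun σ hσ => ?_) fun i _ => ?_
  · obtain ⟨i, hi⟩ := W.toMax_bijective.2 ⟨σ, W.hyp.finite_maxCones.mem_toFinset.1 hσ⟩
    exact ⟨i, Finset.mem_univ _, congrArg Subtype.val hi⟩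
  · have : y ∈ i.1 ↔ proj W.m₀ y ∈ (W.toMax i).1 := by
      refine ⟨fun h => PointedCone.mem_map.2 ⟨y, h, rfl⟩, fun h => ?_⟩
      obtain ⟨c, hc⟩ := W.exists_add_mem h
      refine ((hA i).mem_congr fun n hn => ?_).2 (hc |c| (le_abs_self c))
      simp only [map_add, map_smul, pair_incl, smul_eq_mul]
      by_cases h0 : n W.m₀ = 0
      · simp [h0]
      · have h1 := hy n hn h0
        have hc0 := abs_nonneg c
        rcases lt_or_gt_of_ne h0 with h2 | h2
        · have h3 : (n W.m₀ : ℝ) < 0 := by exact_mod_cast h2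
          have h4 := (sign_eq_iff_neg h1).2 h3
          rw [sign_neg h4, sign_neg (by nlinarith)]
        · have h3 : (0 : ℝ) < n W.m₀ := by exact_mod_cast h2
          have h4 := (sign_eq_iff_pos h1).2 h3
          rw [sign_pos h4, sign_pos (by nlinarith)]
    simp only [this]
    rfl

/-- The slopes of the piecewise linear function defined by the tropical hypersurface of a widget. -/
theorem Widget.exists_potential : ∃ A : Finset (DualLat M), IsArr A ∧ (∀ n ∈ A, n W.m₀ = 0) ∧
    ∃ Ψ : RealSpan M → DualLat M, (∀ x, Ψ x W.m₀ = 0) ∧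
      (∀ x x', Gen A x → SameSigns A x x' → Ψ x = Ψ x') ∧
      (∀ n ∈ A, ∀ x y x', IsCross A n x y x' →
        Ψ x' = Ψ x + W.hyp.weightAt (proj W.m₀ y) • n) ∧
      ∀ y, W.hyp.weightAt (proj W.m₀ y) ≠ 0 → ∃ n ∈ A, pair n y = 0 := by
  classical
  have := free_quotLattice W.primitive
  obtain ⟨A, hA, hT, Ψ, h1, h2⟩ := W.hyp.exists_potential
  -- covectors of the quotient lattice as covectors of `M`
  let c : DualLat (QuotLattice W.m₀) → DualLat M := fun n => n.comp (Submodule.mkQ _)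
  have hcinj : Function.Injective c := fun n n' h => LinearMap.ext fun x => by
    obtain ⟨x, rfl⟩ := Submodule.mkQ_surjective _ x
    exact LinearMap.congr_fun h x
  have hcneg : ∀ n, c (-n) = -c n := fun n => rfl
  have hc0 : ∀ n, c n W.m₀ = 0 := fun n => by
    have : (Submodule.Quotient.mk W.m₀ : QuotLattice W.m₀) = 0 :=
      (Submodule.Quotient.mk_eq_zero _).2 (Submodule.mem_span_singleton_self _)
    simp [c, this]
  have hcross : ∀ n ∈ A, ∀ x y x', IsCross (A.image c) (c n) x y x' →
      IsCross A n (proj W.m₀ x) (proj W.m₀ y) (proj W.m₀ x') := by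
    intro n hn x y x' h
    refine ⟨by rw [pair_proj]; exact h.zero, by rw [pair_proj]; exact h.pos,
      by rw [pair_proj]; exact h.neg, fun n' hn' h1 h2 => ?_⟩
    simp only [pair_proj]
    exact h.other (c n') (Finset.mem_image_of_mem _ hn') (fun h => h1 (hcinj h))
      (fun h => h2 (hcinj (by rw [h, hcneg])))
  have hprim : ∀ n ∈ A, IsPrimitive (c n) := by
    intro n hn a n' h
    have ha : a ≠ 0 := by
      rintro rfl
      rw [zero_smul] at h
      exact (hA.prim n hn).ne_zero (hcinj (by rw [h]; rfl))
    have h3 : n' W.m₀ = 0 := by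
      have := LinearMap.congr_fun h W.m₀
      rw [hc0, LinearMap.smul_apply] at this
      exact (smul_eq_zero.1 this.symm).resolve_left ha
    let n'' : DualLat (QuotLattice W.m₀) := Submodule.liftQ _ n' (by
      rw [Submodule.span_le, Set.singleton_subset_iff]; exact h3)
    refine hA.prim n hn a n'' (hcinj ?_)
    rw [h]; rfl
  refine ⟨A.image c, ⟨?_, ?_⟩, ?_, fun x => c (Ψ (proj W.m₀ x)),
    fun x => hc0 _, ?_, ?_, ?_⟩
  · intro n hn
    obtain ⟨n', hn', rfl⟩ := Finset.mem_image.1 hn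
    exact hprim n' hn'
  · intro n hn
    obtain ⟨n', hn', rfl⟩ := Finset.mem_image.1 hn
    exact Finset.mem_image.2 ⟨-n', hA.neg n' hn', rfl⟩
  · intro n hn
    obtain ⟨n', -, rfl⟩ := Finset.mem_image.1 hn
    exact hc0 n'
  · intro x x' hx h
    refine congrArg c (h1 _ _ (fun n hn => ?_) fun n hn => ?_)
    · rw [pair_proj]; exact hx _ (Finset.mem_image_of_mem _ hn)
    · rw [pair_proj, pair_proj]; exact h _ (Finset.mem_image_of_mem _ hn)
  · intro n hn x y x' h
    obtain ⟨n', hn', rfl⟩ := Finset.mem_image.1 hn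
    change c _ = c _ + _
    rw [h2 n' hn' _ _ _ (hcross n' hn' _ _ _ h)]
    rfl
  · intro y hy
    obtain ⟨σ, hσ, h3⟩ := Finset.exists_ne_zero_of_sum_ne_zero hy
    have h4 : proj W.m₀ y ∈ σ := by
      by_contra h; exact h3 (if_neg h)
    have hσ' := W.hyp.finite_maxCones.mem_toFinset.1 hσ
    obtain ⟨n, hn, h5⟩ := (hT σ hσ').exists_normal hσ'.2
    exact ⟨c n, Finset.mem_image_of_mem _ hn, by rw [← pair_proj]; exact h5 _ h4⟩

end WidgetPotential

/-! ### Logarithms of wall functions -/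

section WallLogs

variable {k : Type*} [Field k] {P : Type*} [AddCommMonoid P] {M : Type v} [AddCommGroup M]

theorem lvlMap_evalₐ (j : ℕ) (x : Compl k P) :
    lvlMap k P j (AdicCompletion.evalₐ (mIdeal k P) (j + 1) x) =
      AdicCompletion.evalₐ (mIdeal k P) j x := by
  obtain ⟨f, rfl⟩ := AdicCompletion.mk_surjective _ _ x
  rw [AdicCompletion.evalₐ_mk, AdicCompletion.evalₐ_mk, lvlMap_mk]
  exact AdicCompletion.Ideal.mk_eq_mk _ (Nat.le_succ j) f

theorem lvlMap_red (j : ℕ) (u : (Compl k P)ˣ) :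
    lvlMap k P j (red (j + 1) u : (Lvl k P (j + 1))ˣ) = (red j u : (Lvl k P j)ˣ) :=
  lvlMap_evalₐ j (u : Compl k P)

theorem lvlMap_red_eq_one {j : ℕ} {u : (Compl k P)ˣ} (h : red (j + 1) u = 1) : red j u = 1 := by
  apply Units.ext
  rw [← lvlMap_red, h, Units.val_one, map_one, Units.val_one]

/-- The span of the monomials `z^p`, `p ∈ 𝔪`, with `r p` a positive multiple of `v`. -/
def dirSub (k : Type*) [Field k] {P : Type*} [AddCommMonoid P] {M : Type v} [AddCommGroup M]
    (r : P →+ M) (j : ℕ) (v : M) : Submodule k (Lvl k P j) :=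
  Submodule.span k {g : Lvl k P j | ∃ p : P, ¬ IsAddUnit p ∧ (∃ c : ℕ, 0 < c ∧ r p = c • v) ∧
    g = Ideal.Quotient.mk (mIdeal k P ^ j) (mono k p)}

variable {r : P →+ M} {j : ℕ} {v : M}

theorem mul_mem_dirSub {x y : Lvl k P j} (hx : x ∈ dirSub k r j v) (hy : y ∈ dirSub k r j v) :
    x * y ∈ dirSub k r j v := by
  have : dirSub k r j v * dirSub k r j v ≤ dirSub k r j v := by
    unfold dirSub
    rw [Submodule.span_mul_span, Submodule.span_le]
    rintro _ ⟨_, ⟨p, hp, ⟨c, hc, e⟩, rfl⟩, _, ⟨p', hp', ⟨c', hc', e'⟩, rfl⟩, rfl⟩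
    refine Submodule.subset_span ⟨p + p', fun hu => hp (isAddUnit_of_add_isAddUnit_left hu),
      ⟨c + c', by omega, by rw [map_add, e, e', add_smul]⟩, ?_⟩
    rw [mono_add, map_mul]
  exact this (Submodule.mul_mem_mul hx hy)

theorem dirSub_le_aug {x : Lvl k P j} (hx : x ∈ dirSub k r j v) : x ∈ aug k P j := by
  have : dirSub k r j v ≤ (aug k P j).restrictScalars k := by
    unfold dirSub
    rw [Submodule.span_le]
    rintro _ ⟨q, hq, _, rfl⟩
    exact zmon_mem_aug hq
  exact this hx

theorem coef_of_mem_dirSub {x : Lvl k P j} (hx : x ∈ dirSub k r j v) {p : P}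
    (h : ¬ ∃ c : ℕ, 0 < c ∧ r p = c • v) : coef k j p x = 0 := by
  classical
  by_cases hpj : p ∈ ordSet P j
  · exact coef_of_mem hpj x
  have : dirSub k r j v ≤ LinearMap.ker (coef k j p) := by
    unfold dirSub
    rw [Submodule.span_le]
    rintro _ ⟨q, _, h1, rfl⟩
    rw [SetLike.mem_coe, LinearMap.mem_ker]
    refine (coef_zmon hpj q).trans (if_neg ?_)
    rintro rfl
    exact h h1
  exact this hx

variable [CharZero k]

theorem lg_mem_dirSub {f : Lvl k P j} (hf : f - 1 ∈ dirSub k r j v) : lg f ∈ dirSub k r j v := by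
  obtain ⟨x, hx, rfl⟩ := exists_log (dirSub k r j v) (fun x hx y hy => mul_mem_dirSub hx hy)
    (fun _ h => dirSub_le_aug h) hf
  rwa [lg_ex (dirSub_le_aug hx)]

theorem lg_red_mem {u : (Compl k P)ˣ} (h : ExponentsAlong r (u : Compl k P) v) (j : ℕ) :
    lg (red j u : Lvl k P j) ∈ dirSub k r j v := lg_mem_dirSub (h j)

theorem red_sub_one_mem {u : (Compl k P)ˣ} (h : ExponentsAlong r (u : Compl k P) v) (j : ℕ) :
    (red j u : Lvl k P j) - 1 ∈ aug k P j := dirSub_le_aug (h j)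

theorem lvlMap_lg_red {u : (Compl k P)ˣ} (h : ExponentsAlong r (u : Compl k P) v) (j : ℕ) :
    lvlMap k P j (lg (red (j + 1) u : Lvl k P (j + 1))) = lg (red j u : Lvl k P j) := by
  rw [lvlMap_lg (red_sub_one_mem h _), lvlMap_red]

theorem dirSub_le_slab [IsAddTorsionFree M] (hv : v ≠ 0) {ν : M →+ k} (h : ν v = 0) :
    dirSub k r j v ≤ Tw.slab r j ν := by
  unfold dirSub
  refine Submodule.span_mono ?_
  rintro _ ⟨q, hq, ⟨c, hc, e⟩, rfl⟩
  refine ⟨q, hq, ?_, ?_, rfl⟩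
  · rw [e]; exact fun h0 => hv ((smul_eq_zero.1 h0).resolve_left hc.ne')
  · rw [e, map_nsmul, h, smul_zero]

/-- The logarithm of the function of a wall, at the points of the wall. -/
def wallLog (j : ℕ) (w : Wall k r) (y : RealSpan M) : Lvl k P j :=
  open Classical in if y ∈ w.cone then lg (red j w.func : Lvl k P j) else 0

theorem wallLog_mem_aug (w : Wall k r) (y : RealSpan M) : wallLog j w y ∈ aug k P j := by
  unfold wallLog
  split_ifs
  exacts [lg_mem _, Ideal.zero_mem _]

theorem lvlMap_wallLog (w : Wall k r) (y : RealSpan M) :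
    lvlMap k P j (wallLog (j + 1) w y) = wallLog j w y := by
  unfold wallLog
  split_ifs
  exacts [lvlMap_lg_red w.exponents j, map_zero _]

theorem wallLog_congr {A : Finset (DualLat M)} {w : Wall k r} (h : Adapted A w.cone)
    {y y' : RealSpan M} (hs : SameSigns A y y') : wallLog j w y = wallLog j w y' := by
  have e := h.mem_congr hs
  unfold wallLog
  by_cases hy : y ∈ w.cone
  · rw [if_pos hy, if_pos (e.1 hy)]
  · rw [if_neg hy, if_neg (fun h => hy (e.2 h))]

theorem Wall.incl_neg_mem_of_isIncoming {w : Wall k r} (h : w.IsIncoming) :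
    incl (-w.direction) ∈ w.cone := by
  have : incl (-w.direction) ∈ (w.cone : Set (RealSpan M)) := by
    rw [h]
    exact ⟨0, w.cone.zero_mem, 1, zero_le_one, by rw [incl_neg, one_smul, zero_sub]⟩
  exact this

theorem Wall.isIncoming_of_mem {w : Wall k r} (h : incl (-w.direction) ∈ w.cone) :
    w.IsIncoming := by
  refine Set.Subset.antisymm (fun y hy => ⟨y, hy, 0, le_rfl, by simp⟩) ?_
  rintro _ ⟨x, hx, c, hc, rfl⟩
  have : x - c • incl w.direction = x + c • incl (-w.direction) := by
    rw [incl_neg, smul_neg, sub_eq_add_neg]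
  rw [this]
  exact w.cone.add_mem hx (smul_mem_cone _ hc h)

variable [Module.Free ℤ M] [Module.Finite ℤ M]

/-- The normal vector of a wall kills its direction. -/
theorem Wall.pair_direction {A : Finset (DualLat M)} {w : Wall k r} (h : Adapted A w.cone)
    {n : DualLat M} {y : RealSpan M} (hy : OnWall A n y) (hyw : y ∈ w.cone) :
    (∀ x ∈ w.cone, pair n x = 0) ∧ n w.direction = 0 := by
  obtain ⟨n', hn', h1⟩ := h.exists_normal w.codim_one
  have h2 : ∀ x ∈ w.cone, pair n x = 0 := by
    rcases hy.2 n' hn' (h1 y hyw) with rfl | rfl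
    · exact h1
    · intro x hx; simpa using h1 x hx
  refine ⟨h2, ?_⟩
  have := zero_of_mem_lin h2 w.tangent
  rw [pair_incl] at this
  exact_mod_cast this

theorem wallLog_mem_slab {A : Finset (DualLat M)} {w : Wall k r} (h : Adapted A w.cone)
    {n : DualLat M} {y : RealSpan M} (hy : OnWall A n y) :
    wallLog j w y ∈ Tw.slab r j (Tw.nu k n) := by
  have : IsAddTorsionFree M := isAddTorsionFree_of_free
  unfold wallLog
  split_ifs with hyw
  · have h1 := (w.pair_direction h hy hyw).2
    exact dirSub_le_slab (neg_ne_zero.2 w.primitive.ne_zero)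
      (Tw.nu_eq_zero.2 (by rw [map_neg, h1, neg_zero])) (lg_red_mem w.exponents j)
  · exact Submodule.zero_mem _

/-- A wall containing points far away in the direction of `m`, with a monomial `z^p`, `r p = m`,
in its function, is incoming. -/
theorem Wall.isIncoming_of_far {A : Finset (DualLat M)} {w : Wall k r} (h : Adapted A w.cone)
    {y : RealSpan M} {p : P} (hy : ∀ n ∈ A, n (r p) ≠ 0 →
      SignType.sign (pair n y) = SignType.sign (n (r p) : ℝ))
    (hp : coef k j p (wallLog j w y) ≠ 0) : w.IsIncoming := by
  by_cases hyw : y ∈ w.cone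
  · rw [wallLog, if_pos hyw] at hp
    obtain ⟨c, hc, e⟩ : ∃ c : ℕ, 0 < c ∧ r p = c • -w.direction := by
      by_contra h0
      exact hp (coef_of_mem_dirSub (lg_red_mem w.exponents j) h0)
    obtain ⟨F, hF, hF'⟩ := h
    refine w.isIncoming_of_mem ((hF' _).2 fun n hn => ?_)
    have h1 : 0 ≤ pair n (incl (r p)) := by
      rw [pair_incl]
      by_cases h0 : n (r p) = 0
      · rw [h0, Int.cast_zero]
      · exact nonneg_of_sign_eq (hy n (hF hn) h0) ((hF' y).1 hyw n hn)
    rw [e, incl_nsmul, map_smul, smul_eq_mul] at h1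
    have hc' : (0 : ℝ) < c := by exact_mod_cast hc
    exact nonneg_of_mul_nonneg_right h1 hc'
  · rw [wallLog, if_neg hyw, map_zero] at hp
    exact absurd rfl hp

end WallLogs

/-! ### Walls with one monomial -/


section MonomialWalls

variable {k : Type*} [Field k] {P : Type*} [AddCommMonoid P] {M : Type v} [AddCommGroup M]

/-- The unit `1 + c z^p` of the completion, for `p ∈ 𝔪`. -/
theorem exists_unit (c : k) {p : P} (hp : ¬ IsAddUnit p) : ∃ u : (Compl k P)ˣ, ∀ j,
    (red j u : Lvl k P j) = 1 + c • zmon k j p := by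
  set x : AddMonoidAlgebra k P := c • mono k p with hx
  have hxI : x ∈ mIdeal k P := by
    have h : mono k p ∈ mIdeal k P := Ideal.subset_span ⟨p, hp, rfl⟩
    exact ((mIdeal k P).restrictScalars k).smul_mem c h
  have hxj : ∀ j, Ideal.Quotient.mk (mIdeal k P ^ j) x = c • zmon k j p := fun j => rfl
  let s : ℕ → AddMonoidAlgebra k P := fun n => ∑ i ∈ Finset.range n, (-x) ^ i
  let S : AdicCompletion.AdicCauchySequence (mIdeal k P) (AddMonoidAlgebra k P) :=
    AdicCompletion.AdicCauchySequence.mk _ _ s fun n => by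
      rw [SModEq.sub_mem]
      have : s n - s (n + 1) = -(-x) ^ n := by
        simp only [s, Finset.sum_range_succ]; ring
      rw [this, smul_eq_mul, Ideal.mul_top]
      exact neg_mem (Ideal.pow_mem_pow (neg_mem hxI) n)
  let a : Compl k P := 1 + AdicCompletion.of _ _ x
  let b : Compl k P := AdicCompletion.mk _ _ S
  have ha : ∀ j, AdicCompletion.evalₐ (mIdeal k P) j a = Ideal.Quotient.mk _ (1 + x) := fun j => by
    simp only [a, map_add, map_one, AdicCompletion.evalₐ_of]
  have hb : ∀ j, AdicCompletion.evalₐ (mIdeal k P) j b = Ideal.Quotient.mk _ (s j) := fun j =>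
    AdicCompletion.evalₐ_mk _ j S
  have hab : a * b = 1 := AdicCompletion.ext_evalₐ fun j => by
    rw [map_mul, ha, hb, ← map_mul, map_one]
    have h1 : (1 + x) * s j = 1 - (-x) ^ j := by
      have := mul_neg_geom_sum (-x) j
      rw [sub_neg_eq_add] at this
      exact this
    rw [h1, map_sub, map_one, Ideal.Quotient.eq_zero_iff_mem.2 (Ideal.pow_mem_pow (neg_mem hxI) j),
      sub_zero]
  refine ⟨⟨a, b, hab, by rw [mul_comm, hab]⟩, fun j => ?_⟩
  refine (ha j).trans ?_
  rw [map_add, map_one, hxj]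

variable [CharZero k] {r : P →+ M} [Module.Free ℤ M] [Module.Finite ℤ M]

/-- A closed cell of an arrangement, contained in a hyperplane `n = 0`, with the function
`1 + c z^p`, where `⟨n, r p⟩ = 0`. -/
theorem exists_wall {A : Finset (DualLat M)} (hA : IsArr A) {n : DualLat M} (hn : n ∈ A)
    {y : RealSpan M} (hy : OnWall A n y) (c : k) {p : P} {j : ℕ} (hpj : p ∈ ordSet P j) (hj : j ≠ 0)
    (hp0 : r p ≠ 0) (hnp : n (r p) = 0) :
    ∃ w : Wall k r, w.cone = cell A y ∧ red j w.func = 1 ∧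
      lg (red (j + 1) w.func : Lvl k P (j + 1)) = c • zmon k (j + 1) p ∧
      (w.IsIncoming → incl (r p) ∈ cell A y) := by
  have hpu : ¬ IsAddUnit p := by
    obtain ⟨i, rfl⟩ := Nat.exists_eq_succ_of_ne_zero hj
    exact not_isAddUnit_of_mem_ordSet hpj
  obtain ⟨a, v, ha, hv, e⟩ := exists_primitive hp0
  obtain ⟨u, hu⟩ := exists_unit c hpu
  have hnv : n v = 0 := by
    rw [e, map_nsmul] at hnp
    exact (smul_eq_zero.1 hnp).resolve_left ha.ne'
  have hlin : lin (cell A y) = LinearMap.ker (pair n) := by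
    ext x
    rw [mem_lin_cell hA, LinearMap.mem_ker]
    refine ⟨fun h => h n hn hy.1, fun h n' hn' h0 => ?_⟩
    rcases hy.2 n' hn' h0 with rfl | rfl
    · exact h
    · rw [pair_neg, h, neg_zero]
  let w : Wall k r :=
    { cone := cell A y
      rational := isRational_ineqCone _
      codim_one := dim_of_lin_eq_ker (hA.prim n hn).ne_zero hlin
      direction := -v
      primitive := hv.neg
      tangent := by rw [hlin, LinearMap.mem_ker, pair_incl, map_neg, hnv]; simp
      func := u
      exponents := by
        rw [neg_neg]
        intro i
        have h1 : AdicCompletion.evalₐ (mIdeal k P) i (u : Compl k P) = 1 + c • zmon k i p := hu i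
        rw [h1, add_sub_cancel_left]
        exact Submodule.smul_mem _ _ (Submodule.subset_span ⟨p, hpu, ⟨a, ha, e⟩, rfl⟩) }
  refine ⟨w, rfl, ?_, ?_, fun h => ?_⟩
  · apply Units.ext
    rw [hu j, zmon_eq_zero hpj, smul_zero, add_zero, Units.val_one]
  · have h1 : lvlMap k P j (c • zmon k (j + 1) p) = 0 := by
      rw [map_smul, lvlMap_zmon_eq_zero hpj, smul_zero]
    have h2 : c • zmon k (j + 1) p ∈ aug k P (j + 1) := mem_aug_of_lvlMap hj h1
    have h3 : (red (j + 1) u : Lvl k P (j + 1)) = ex (c • zmon k (j + 1) p) := by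
      rw [hu, Tw.ex_eq_of_lvlMap h2 h1]
    change lg (red (j + 1) u : Lvl k P (j + 1)) = _
    rw [h3, lg_ex h2]
  · have h1 := Wall.incl_neg_mem_of_isIncoming h
    rw [show -w.direction = v from neg_neg v] at h1
    rw [e, incl_nsmul]
    exact smul_mem_cone _ (Nat.cast_nonneg a) h1

end MonomialWalls

/-! ### Obstructions to lifting a potential -/

section Defects

variable {k : Type*} [Field k] [CharZero k] {P : Type*} [AddCommMonoid P] {M : Type v}
  [AddCommGroup M] {r : P →+ M} {j : ℕ}

namespace Tw

/-- The coefficient of `z^p` in the difference of the logarithms of `b` and `a`. -/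
def dcoef (p : P) (a b : Tw k r j) : M →+ k :=
  ((coef k j p : Lvl k P j →ₗ[k] k) : Lvl k P j →+ k).comp (b.log - a.log)

theorem dcoef_apply (p : P) (a b : Tw k r j) (d : M) :
    dcoef p a b d = coef k j p (b.log d - a.log d) := rfl

@[simp] theorem dcoef_self (p : P) (a : Tw k r j) : dcoef p a a = 0 := by
  ext d; rw [dcoef_apply, sub_self, map_zero]; rfl

theorem dcoef_add (p : P) (a b c : Tw k r j) : dcoef p a b + dcoef p b c = dcoef p a c := by
  ext d
  rw [AddMonoidHom.add_apply, dcoef_apply, dcoef_apply, dcoef_apply, ← map_add]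
  congr 1; ring

theorem dcoef_mul (p : P) {a a' b b' : Tw k r (j + 1)} (ha : a.red = a'.red) (hb : b.red = b'.red) :
    dcoef p (a * b) (a' * b') = dcoef p a a' + dcoef p b b' := by
  ext d
  rw [AddMonoidHom.add_apply, dcoef_apply, dcoef_apply, dcoef_apply, ← map_add, diff_mul ha hb]

theorem dcoef_of_map_eq_zero {p : P} (hp : r p = 0) {Λ Λ' : AddSubgroup M} {a b : Tw k r j}
    (ha : a ∈ grp k r j Λ) (hb : b ∈ grp k r j Λ') : dcoef p a b = 0 := by
  ext d
  rw [dcoef_apply, map_sub, coef_eq_zero_of_mem_grp ha hp, coef_eq_zero_of_mem_grp hb hp, sub_zero]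
  rfl

theorem dcoef_apply_map {p : P} {Λ Λ' : AddSubgroup M} {a b : Tw k r (j + 1)}
    (ha : a ∈ grp k r (j + 1) Λ) (hb : b ∈ grp k r (j + 1) Λ') (h : a.red = b.red) :
    dcoef p a b (r p) = 0 := coef_diff_eq_zero ha hb h p

theorem dcoef_apply_of_mem {p : P} {Λ : AddSubgroup M} {a b : Tw k r j}
    (ha : a ∈ grp k r j Λ) (hb : b ∈ grp k r j Λ) {d : M} (hd : d ∈ Λ) : dcoef p a b d = 0 := by
  rw [dcoef_apply, log_eq_zero_of_mem_grp ha hd, log_eq_zero_of_mem_grp hb hd, sub_zero, map_zero]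

theorem mul_right_cancel_of_mem_grp {Λ : AddSubgroup M} {a b c : Tw k r j} (hc : c ∈ grp k r j Λ)
    (h : a * c = b * c) : a = b := by
  obtain ⟨c', _, h1, _⟩ := exists_inv_of_mem_grp hc
  rw [← mul_one a, ← h1, ← mul_assoc, h, mul_assoc, h1, mul_one]

end Tw

open Tw

/-- The element of the tropical vertex group of a point `y` on the hyperplane `n = 0`. -/
abbrev crossing (ℓ : RealSpan M → aug k P j) (n : DualLat M) (y : RealSpan M) : Tw k r j :=
  elem r (nu k n) (ℓ y).1 (ℓ y).2

/-- `F` assigns group elements to the chambers of the arrangement `A`; up to the last step of the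
filtration, they change by the wall crossings `ℓ` when crossing a hyperplane. -/
structure IsLift (A : Finset (DualLat M)) (ℓ : RealSpan M → aug k P (j + 1))
    (F : RealSpan M → Tw k r (j + 1)) : Prop where
  arr : IsArr A
  mem : ∀ x, F x ∈ grp k r (j + 1) ⊥
  congr : ∀ x x', Gen A x → SameSigns A x x' → F x = F x'
  slab : ∀ n ∈ A, ∀ y, OnWall A n y → (ℓ y).1 ∈ slab r (j + 1) (nu k n)
  congr_log : ∀ y y', SameSigns A y y' → ℓ y = ℓ y'
  cross : ∀ n ∈ A, ∀ x y x', IsCross A n x y x' → (F x').red = (crossing ℓ n y * F x).red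

open Classical in
/-- The coefficient of `z^p` in the difference between the two sides of the crossing condition. -/
def defect (A : Finset (DualLat M)) (ℓ : RealSpan M → aug k P (j + 1))
    (F : RealSpan M → Tw k r (j + 1)) (p : P) (n : DualLat M) (y : RealSpan M) : M →+ k :=
  if h : n ∈ A ∧ ∃ q : RealSpan M × RealSpan M, IsCross A n q.1 y q.2 then
    dcoef p (crossing ℓ n y * F h.2.choose.1) (F h.2.choose.2) else 0

/-- Transport from `x` to `x'` by elements of the group that kill `Λ`, with the total defect `σ`. -/
def Transports (F : RealSpan M → Tw k r (j + 1)) (p : P) (Λ : AddSubgroup M) (x x' : RealSpan M)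
    (σ : M →+ k) : Prop :=
  ∃ a ∈ grp k r (j + 1) Λ, (a * F x).red = (F x').red ∧ dcoef p (a * F x) (F x') = σ

variable {A : Finset (DualLat M)} {ℓ : RealSpan M → aug k P (j + 1)}
  {F : RealSpan M → Tw k r (j + 1)} {p : P} {n : DualLat M} {x y z x' : RealSpan M}

theorem defect_out (hn : n ∉ A) : defect A ℓ F p n y = 0 := dif_neg fun h => hn h.1

theorem IsLift.defect_eq (H : IsLift A ℓ F) (hn : n ∈ A) (hc : IsCross A n x y x') :
    defect A ℓ F p n y = dcoef p (crossing ℓ n y * F x) (F x') := by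
  have h : n ∈ A ∧ ∃ q : RealSpan M × RealSpan M, IsCross A n q.1 y q.2 := ⟨hn, (x, x'), hc⟩
  have hc' := h.2.choose_spec
  have hp := H.arr.prim n hn
  rw [defect, dif_pos h, H.congr _ _ hc'.gen_left (hc'.sameSigns_left hp hc),
    H.congr _ _ hc'.gen_right (hc'.sameSigns_right hp hc)]

theorem IsLift.defect_congr [Module.Free ℤ M] [Module.Finite ℤ M] (H : IsLift A ℓ F) (hn : n ∈ A)
    (y y' : RealSpan M) (hy : OnWall A n y) (hs : SameSigns A y y') :
    defect A ℓ F p n y = defect A ℓ F p n y' := by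
  obtain ⟨x, x', hc⟩ := hy.exists_cross (H.arr.prim n hn)
  rw [H.defect_eq hn hc, H.defect_eq hn (hc.congr hn hs)]
  have e : (crossing ℓ n y : Tw k r (j + 1)) = crossing ℓ n y' :=
    ext_log fun d => by rw [elem_log, elem_log, H.congr_log y y' hs]
  rw [e]

theorem IsLift.crossing_mem (H : IsLift A ℓ F) (hn : n ∈ A) (hy : OnWall A n y)
    {Λ : AddSubgroup M} (hΛ : ∀ d ∈ Λ, n d = 0) : crossing ℓ n y ∈ grp k r (j + 1) Λ :=
  elem_mem_grp (H.slab n hn y hy) fun d hd => nu_eq_zero.2 (hΛ d hd)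

theorem IsLift.crossing_neg_mul (H : IsLift A ℓ F) (hn : n ∈ A) (hy : OnWall A n y) :
    (crossing ℓ (-n) y : Tw k r (j + 1)) * crossing ℓ n y = 1 := by
  have hs := H.slab n hn y hy
  have h0 := base_elem_of_mem_slab (r := r) (nu k (-n)) (ℓ := (ℓ y).1) (ℓ' := (ℓ y).1) (ℓ y).2
    (H.slab (-n) (H.arr.neg n hn) y hy.neg)
  refine ext_log fun d => ?_
  rw [mul_log, elem_log, elem_log, map_smul, h0, nu_apply, nu_apply, LinearMap.neg_apply,
    Int.cast_neg, neg_smul, neg_add_cancel]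
  rfl

theorem IsLift.defect_neg [Module.Free ℤ M] [Module.Finite ℤ M] (H : IsLift A ℓ F) (hn : n ∈ A)
    (y : RealSpan M) (hy : OnWall A n y) : defect A ℓ F p (-n) y = -defect A ℓ F p n y := by
  obtain ⟨x, x', hc⟩ := hy.exists_cross (H.arr.prim n hn)
  rw [H.defect_eq hn hc, H.defect_eq (H.arr.neg n hn) hc.symm]
  have h1 := dcoef_mul p (rfl : (crossing ℓ (-n) y : Tw k r (j + 1)).red = _)
    (H.cross n hn x y x' hc).symm
  rw [← mul_assoc, H.crossing_neg_mul hn hy, one_mul, dcoef_self, zero_add] at h1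
  have h2 := dcoef_add p (crossing ℓ (-n) y * F x') (F x) (crossing ℓ (-n) y * F x')
  rw [dcoef_self] at h2
  rw [← h1]
  exact eq_neg_of_add_eq_zero_left h2

theorem IsLift.defect_of_map_eq_zero (H : IsLift A ℓ F) (hp : r p = 0) (n : DualLat M)
    (y : RealSpan M) : defect A ℓ F p n y = 0 := by
  unfold defect
  split_ifs with h
  · have hy := h.2.choose_spec.onWall
    exact dcoef_of_map_eq_zero hp (mul_mem (H.crossing_mem h.1 hy (by simp)) (H.mem _)) (H.mem _)
  · rfl

theorem IsLift.defect_apply_map (H : IsLift A ℓ F) (n : DualLat M) (y : RealSpan M) :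
    defect A ℓ F p n y (r p) = 0 := by
  unfold defect
  split_ifs with h
  · have hc := h.2.choose_spec
    exact dcoef_apply_map (mul_mem (H.crossing_mem h.1 hc.onWall (by simp)) (H.mem _)) (H.mem _)
      (H.cross n h.1 _ _ _ hc).symm
  · rfl

theorem Transports.trans {Λ : AddSubgroup M} {σ τ : M →+ k} (h : Transports F p Λ x y σ)
    (h' : Transports F p Λ y z τ) : Transports F p Λ x z (σ + τ) := by
  obtain ⟨a, ha, h1, rfl⟩ := h
  obtain ⟨b, hb, h2, rfl⟩ := h'
  refine ⟨b * a, mul_mem hb ha, ?_, ?_⟩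
  · rw [mul_assoc, red_mul, h1, ← red_mul, h2]
  · have := dcoef_mul p (rfl : b.red = b.red) h1
    rw [dcoef_self, zero_add] at this
    rw [← this, mul_assoc, dcoef_add]

theorem IsLift.transports_of_sameSigns (H : IsLift A ℓ F) (Λ : AddSubgroup M) (hx : Gen A x)
    (h : SameSigns A x x') : Transports F p Λ x x' 0 :=
  ⟨1, one_mem _, by rw [one_mul, H.congr x x' hx h], by rw [one_mul, H.congr x x' hx h, dcoef_self]⟩

theorem IsLift.transports_of_cross (H : IsLift A ℓ F) {Λ : AddSubgroup M} (hn : n ∈ A)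
    (hΛ : ∀ d ∈ Λ, n d = 0) (hc : IsCross A n x y x') :
    Transports F p Λ x x' (defect A ℓ F p n y) :=
  ⟨_, H.crossing_mem hn hc.onWall hΛ, (H.cross n hn x y x' hc).symm, (H.defect_eq hn hc).symm⟩

/-- The total defect is determined by the end points up to homomorphisms that kill `Λ` and `r p`. -/
theorem IsLift.transports_unique (H : IsLift A ℓ F) {Λ : AddSubgroup M} {σ τ : M →+ k}
    (h : Transports F p Λ x x' σ) (h' : Transports F p Λ x x' τ) :
    (∀ d ∈ Λ, (σ - τ) d = 0) ∧ (σ - τ) (r p) = 0 := by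
  obtain ⟨a, ha, h1, rfl⟩ := h
  obtain ⟨b, hb, h2, rfl⟩ := h'
  have hab : b.red = a.red := by
    have := h2.trans h1.symm
    rw [red_mul, red_mul] at this
    exact mul_right_cancel_of_mem_grp (red_mem_grp (H.mem x)) this
  have e : dcoef p (a * F x) (F x') - dcoef p (b * F x) (F x') = -dcoef p b a := by
    have h3 := dcoef_mul p hab (rfl : (F x).red = _)
    rw [dcoef_self, add_zero] at h3
    rw [← h3, ← dcoef_add p (b * F x) (a * F x) (F x')]
    abel
  rw [e]
  exact ⟨fun d hd => by rw [AddMonoidHom.neg_apply, dcoef_apply_of_mem hb ha hd, neg_zero],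
    by rw [AddMonoidHom.neg_apply, dcoef_apply_map hb ha hab, neg_zero]⟩

/-- The point where the segment from `x` to `z` meets the hyperplane `n = 0`. -/
def hit (n : DualLat M) (x z : RealSpan M) : RealSpan M :=
  z - (pair n z / (pair n x - pair n z)) • (x - z)

theorem hit_of_segment {s : ℝ} (hs : s ∈ Set.Ioo (0 : ℝ) 1) (n : DualLat M) (x z : RealSpan M) :
    hit n (x + s • (z - x)) z = hit n x z := by
  have h1 : x + s • (z - x) - z = (1 - s) • (x - z) := by module
  have h2 : pair n (x + s • (z - x)) - pair n z = (1 - s) * (pair n x - pair n z) := by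
    simp; ring
  have h3 : 1 - s ≠ 0 := by have := hs.2; linarith
  unfold hit
  rw [h1, h2, smul_smul, div_mul_eq_mul_div, mul_comm (1 - s), mul_div_mul_right _ _ h3]

theorem hit_eq {s : ℝ} (n : DualLat M) (x z : RealSpan M) (h : pair n (x + s • (z - x)) = 0)
    (hne : pair n x - pair n z ≠ 0) : hit n x z = x + s • (z - x) := by
  have h1 : pair n z / (pair n x - pair n z) = s - 1 := by
    rw [div_eq_iff hne]
    simp at h; linarith
  unfold hit
  rw [h1]; module

open Classical in
/-- Transport along a segment, which crosses one hyperplane at a time. -/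
theorem IsLift.transports_segment [Module.Free ℤ M] [Module.Finite ℤ M] (H : IsLift A ℓ F)
    {Λ : AddSubgroup M} {C : Finset (DualLat M)} (hC : IsArr C) (hCA : C ⊆ A)
    (hΛ : ∀ n ∈ C, ∀ d ∈ Λ, n d = 0) (hx : Gen A x) (hz : Gen A z) (hgp : GenPos C x z)
    (hout : ∀ n ∈ A, n ∉ C → SignType.sign (pair n x) = SignType.sign (pair n z)) :
    Transports F p Λ x z
      (∑ n ∈ C.filter fun n => 0 < pair n x ∧ pair n z < 0, defect A ℓ F p n (hit n x z)) := by
  refine segment_induction hC (fun y => Gen A y →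
      (∀ n ∈ A, n ∉ C → SignType.sign (pair n y) = SignType.sign (pair n z)) →
      Transports F p Λ y z
        (∑ n ∈ C.filter fun n => 0 < pair n y ∧ pair n z < 0, defect A ℓ F p n (hit n y z)))
    (hz.mono hCA) ?_ ?_ (hx.mono hCA) hgp hx hout
  · intro y hy hg ho
    have h1 : SameSigns A y z := fun n hn => by
      by_cases hnC : n ∈ C
      exacts [hy n hnC, ho n hn hnC]
    rw [Finset.filter_eq_empty_iff.2, Finset.sum_empty]
    · exact H.transports_of_sameSigns Λ hg h1
    · rintro n hn ⟨h2, h3⟩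
      have := (sign_eq_iff_pos (hy n hn)).1 h2
      linarith
  · rintro n hn y b c hc ⟨s, hs, hb⟩ ⟨s', hs', hc'⟩ hnz ih hg ho
    have hoseg : ∀ n' ∈ A, n' ∉ C → ∀ s ∈ Set.Ioo (0 : ℝ) 1,
        SignType.sign (pair n' (y + s • (z - y))) = SignType.sign (pair n' y) := by
      intro n' hn' hn'C s hs
      rw [map_add, map_smul, map_sub, smul_eq_mul]
      exact sign_segment hs (ho n' hn' hn'C)
    have hcA : IsCross A n y b c := by
      refine ⟨hc.zero, hc.pos, hc.neg, fun n' hn' h1 h2 => ?_⟩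
      by_cases hn'C : n' ∈ C
      · exact hc.other n' hn'C h1 h2
      · have h3 := hoseg n' hn' hn'C s hs
        have h4 := hoseg n' hn' hn'C s' hs'
        rw [← hb] at h3
        rw [← hc'] at h4
        exact ⟨fun h0 => hg n' hn' ((sign_eq_iff_zero h3).1 h0), h3.symm, h4.trans h3.symm⟩
    have h1 := ih hcA.gen_right fun n' hn' hn'C => by
      rw [hc', hoseg n' hn' hn'C s' hs', ho n' hn' hn'C]
    have h2 := (H.transports_of_cross (p := p) (hCA hn) (hΛ n hn) hcA).trans h1
    have hset : C.filter (fun n' => 0 < pair n' y ∧ pair n' z < 0) =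
        insert n (C.filter fun n' => 0 < pair n' c ∧ pair n' z < 0) := by
      ext n'
      simp only [Finset.mem_filter, Finset.mem_insert]
      constructor
      · rintro ⟨h3, h4, h5⟩
        by_cases h6 : n' = n
        · exact Or.inl h6
        · have h7 : n' ≠ -n := by
            rintro rfl; rw [pair_neg] at h5; linarith
          have h8 := (hc.other n' h3 h6 h7).2
          exact Or.inr ⟨h3, (sign_eq_iff_pos (h8.1.trans h8.2.symm)).1 h4, h5⟩
      · rintro (rfl | ⟨h3, h4, h5⟩)
        · exact ⟨hn, hc.pos, hnz⟩
        · have h6 : n' ≠ n := by rintro rfl; linarith [hc.neg]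
          have h7 : n' ≠ -n := by
            rintro rfl; rw [pair_neg] at h5; linarith
          have h8 := (hc.other n' h3 h6 h7).2
          exact ⟨h3, (sign_eq_iff_pos (h8.1.trans h8.2.symm)).2 h4, h5⟩
    have e1 : hit n y z = b := by
      rw [hb]
      exact hit_eq n y z (by rw [← hb]; exact hc.zero) (by linarith [hc.pos])
    have e2 : ∀ n', hit n' c z = hit n' y z := fun n' => by rw [hc', hit_of_segment hs']
    rw [hset, Finset.sum_insert (by simp [hc.neg.le]), e1]
    simpa only [e2] using h2

/-- The homomorphisms `M → k` that vanish on the kernel of `n`. -/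
def normalSub (k : Type*) [Field k] {M : Type v} [AddCommGroup M] (n : DualLat M) :
    AddSubgroup (M →+ k) where
  carrier := {φ | ∀ d, n d = 0 → φ d = 0}
  add_mem' := fun ha hb d hd => by rw [AddMonoidHom.add_apply, ha d hd, hb d hd, add_zero]
  zero_mem' := fun _ _ => rfl
  neg_mem' := fun ha d hd => by rw [AddMonoidHom.neg_apply, ha d hd, neg_zero]

theorem mem_normalSub {φ : M →+ k} : φ ∈ normalSub k n ↔ ∀ d, n d = 0 → φ d = 0 := Iff.rfl

theorem exists_eq_smul_nu [Module.Free ℤ M] [Module.Finite ℤ M] {φ : M →+ k} (hn : n ≠ 0)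
    (h : φ ∈ normalSub k n) :
    ∃ c : k, ∀ d, φ d = c * n d := by
  obtain ⟨m, hm⟩ := exists_pos_of_ne_zero hn
  have hm' : (n m : k) ≠ 0 := by exact_mod_cast hm.ne'
  refine ⟨φ m / n m, fun d => ?_⟩
  have h1 := h (n m • d - n d • m) (by simp; ring)
  rw [map_sub, map_zsmul, map_zsmul, zsmul_eq_mul, zsmul_eq_mul, sub_eq_zero] at h1
  field_simp
  rw [mul_comm, h1]; ring

open Classical in
/-- The condition of `raySum_parallel` holds for the defects: around an intersection of two
hyperplanes, there are two ways of transport from one quadrant to the opposite one. -/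
theorem IsLift.defect_pencil [Module.Free ℤ M] [Module.Finite ℤ M] (H : IsLift A ℓ F)
    {u : RealSpan M} (hm : n (r p) = 0) (hu : 0 < pair n u) (hz : IsPencil A (r p) n z) :
    ∀ᶠ ε in 𝓝[>] (0 : ℝ),
      defect A ℓ F p n (z - ε • incl (r p)) - defect A ℓ F p n (z + ε • incl (r p)) +
        ∑ n' ∈ A.filter fun n' => n' (r p) < 0 ∧ pair n' z = 0,
          (defect A ℓ F p n' (z - ε • foot (r p) n' u) -
            defect A ℓ F p n' (z + ε • foot (r p) n' u)) ∈ normalSub k n := by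
  set m := r p with hmdef
  set C := A.filter fun n' => n' m ≠ 0 ∧ pair n' z = 0 with hC
  have hCarr : IsArr C := ⟨fun n' hn' => H.arr.prim n' (Finset.mem_filter.1 hn').1, fun n' hn' => by
    rw [hC, Finset.mem_filter] at hn' ⊢
    exact ⟨H.arr.neg n' hn'.1, by simpa using hn'.2.1, by simp [hn'.2.2]⟩⟩
  have hCA : C ⊆ A := Finset.filter_subset _ _
  -- the lattice of the intersection of the hyperplanes through `z`
  let Λ : AddSubgroup M :=
    { carrier := {d | ∀ n' ∈ A, pair n' z = 0 → n' d = 0}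
      add_mem' := fun ha hb n' h1 h2 => by rw [map_add, ha n' h1 h2, hb n' h1 h2, add_zero]
      zero_mem' := fun _ _ _ => map_zero _
      neg_mem' := fun ha n' h1 h2 => by rw [map_neg, ha n' h1 h2, neg_zero] }
  have hCne : ∀ n' ∈ C, n' m ≠ 0 := fun n' h => (Finset.mem_filter.1 h).2.1
  have hCz : ∀ n' ∈ C, pair n' z = 0 := fun n' h => (Finset.mem_filter.1 h).2.2
  have hev1 : ∀ᶠ ε in 𝓝[>] (0 : ℝ), ∀ n' ∈ C, Near A z (z + ε • foot m n' u) ∧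
      Near A z (z + ε • -foot m n' u) := by
    rw [Filter.eventually_all_finset]
    exact fun n' _ => (eventually_near A z _).and (eventually_near A z _)
  filter_upwards [hev1, eventually_near A z (incl m), eventually_near A z (-incl m),
    self_mem_nhdsWithin] with ε hfeet hup hdown (hε : 0 < ε)
  rw [smul_neg, ← sub_eq_add_neg] at hdown
  -- a much smaller displacement in the direction of `u`
  have hev2 : ∀ᶠ η in 𝓝[>] (0 : ℝ), ∀ n' ∈ C, Near A z (z + η • foot m n' u) ∧
      Near A z (z + η • -foot m n' u) := by
    rw [Filter.eventually_all_finset]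
    exact fun n' _ => (eventually_near A z _).and (eventually_near A z _)
  obtain ⟨η, ⟨⟨⟨⟨h1, h2⟩, h3⟩, h4⟩, hfeet'⟩, (hη : 0 < η)⟩ :=
    (((((eventually_near A (z - ε • incl m) u).and (eventually_near A (z - ε • incl m) (-u))).and
      (eventually_near A (z + ε • incl m) u)).and (eventually_near A (z + ε • incl m) (-u))).and
      hev2 |>.and self_mem_nhdsWithin).exists
  -- a point on the line `z + ℝ m` other than `z`, and points nearby
  have hline : ∀ s : ℝ, s ≠ 0 → Near A z (z + s • incl m) → OnWall A n (z + s • incl m) := by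
    intro s hs hnear
    refine ⟨by rw [map_add, hz.zero, map_smul, pair_incl, hm]; simp, fun n' hn' h0 => ?_⟩
    by_cases h5 : pair n' z = 0
    · refine hz.unique n' hn' h5 ?_
      rw [map_add, h5, zero_add, map_smul, pair_incl, smul_eq_mul] at h0
      exact_mod_cast (mul_eq_zero.1 h0).resolve_left hs
    · exact absurd ((sign_eq_iff_zero (hnear n' hn' h5)).1 h0) h5
  have hacross : ∀ s : ℝ, s ≠ 0 → Near A z (z + s • incl m) →
      Near A (z + s • incl m) (z + s • incl m + η • u) →
      Near A (z + s • incl m) (z + s • incl m + η • -u) →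
      Gen A (z + s • incl m + η • u) ∧ Gen A (z + s • incl m + η • -u) ∧
      Transports F p Λ (z + s • incl m + η • u) (z + s • incl m + η • -u)
        (defect A ℓ F p n (z + s • incl m)) := by
    intro s hs hnear hp hq
    have hw := hline s hs hnear
    have hc : IsCross A n (z + s • incl m + η • u) (z + s • incl m) (z + s • incl m + η • -u) := by
      refine IsCross.of_near hw hp hq ?_ ?_
      · rw [map_add, hw.1, zero_add, map_smul, smul_eq_mul]; positivity
      · rw [map_add, hw.1, zero_add, map_smul, smul_eq_mul, map_neg]; nlinarith
    refine ⟨hc.gen_left, hc.gen_right, ?_⟩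
    by_cases hnA : n ∈ A
    · exact H.transports_of_cross hnA (fun d hd => hd n hnA hz.zero) hc
    · rw [defect_out hnA]
      refine H.transports_of_sameSigns Λ hc.gen_left fun n' hn' => ?_
      have h5 := (hc.other n' hn' (by rintro rfl; exact hnA hn') (by
        rintro rfl
        have := H.arr.neg _ hn'
        rw [neg_neg] at this
        exact hnA this)).2
      exact h5.1.trans h5.2.symm
  have hsub : z - ε • incl m = z + (-ε) • incl m := by rw [neg_smul, sub_eq_add_neg]
  rw [hsub] at h1 h2 hdown
  obtain ⟨g1, g2, t1⟩ := hacross (-ε) (neg_ne_zero.2 hε.ne') hdown h1 h2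
  obtain ⟨g3, g4, t2⟩ := hacross ε hε.ne' hup h3 h4
  -- transport on the line through `z ± η u`
  have hside : ∀ v : RealSpan M, pair n v ≠ 0 → (∀ n' ∈ C, Near A z (z + η • foot m n' v)) →
      (∀ n' ∈ C, Near A z (z + ε • foot m n' v)) →
      Near A (z + (-ε) • incl m) (z + (-ε) • incl m + η • v) →
      Near A (z + ε • incl m) (z + ε • incl m + η • v) →
      Gen A (z + (-ε) • incl m + η • v) → Gen A (z + ε • incl m + η • v) →
      Transports F p Λ (z + (-ε) • incl m + η • v) (z + ε • incl m + η • v)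
        (∑ n' ∈ A.filter fun n' => n' m < 0 ∧ pair n' z = 0,
          defect A ℓ F p n' (z + ε • foot m n' v)) := by
    intro v hv hn1 hn2 hl hr hgl hgr
    set a := z + (-ε) • incl m + η • v with ha
    set b := z + ε • incl m + η • v with hb
    have hpa : ∀ n', pair n' z = 0 → pair n' a = -ε * n' m + η * pair n' v := by
      intro n' h0; simp [ha, h0]
    have hpb : ∀ n', pair n' z = 0 → pair n' b = ε * n' m + η * pair n' v := by
      intro n' h0; simp [hb, h0]
    have hgp : GenPos C a b := by
      intro n₁ hn₁ n₂ hn₂ hne1 hne2 h0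
      obtain ⟨c, hc⟩ := hz.coplanar n₁ (hCA hn₁) n₂ (hCA hn₂) (hCz n₁ hn₁) (hCz n₂ hn₂)
      have h5 := mul_pair_of_coplanar hc v
      rw [hpa n₁ (hCz n₁ hn₁), hpa n₂ (hCz n₂ hn₂), hpb n₁ (hCz n₁ hn₁), hpb n₂ (hCz n₂ hn₂)] at h0
      have h6 : (2 * ε * η) * (c * pair n v) = 0 := by rw [← h5]; linear_combination -h0
      have h7 : (c : ℝ) = 0 := by
        have := (mul_eq_zero.1 h6).resolve_left (by positivity)
        exact (mul_eq_zero.1 this).resolve_right hv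
      have h8 : c = 0 := by exact_mod_cast h7
      rw [h8, zero_smul, sub_eq_zero] at hc
      rcases (hCarr.prim n₁ hn₁).eq_or_eq_neg (hCarr.prim n₂ hn₂) (hCne n₂ hn₂) hc.symm with h | h
      exacts [hne1 h, hne2 h]
    have hsl : ∀ n' ∈ C, SignType.sign (pair n' a) = SignType.sign (-ε * (n' m : ℝ)) := by
      intro n' hn'
      have h5 : pair n' (z + (-ε) • incl m) = -ε * n' m := by simp [hCz n' hn']
      have h6 : pair n' (z + (-ε) • incl m) ≠ 0 := by
        rw [h5]; exact mul_ne_zero (neg_ne_zero.2 hε.ne') (by exact_mod_cast hCne n' hn')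
      rw [← h5]; exact hl n' (hCA hn') h6
    have hsr : ∀ n' ∈ C, SignType.sign (pair n' b) = SignType.sign (ε * (n' m : ℝ)) := by
      intro n' hn'
      have h5 : pair n' (z + ε • incl m) = ε * n' m := by simp [hCz n' hn']
      have h6 : pair n' (z + ε • incl m) ≠ 0 := by
        rw [h5]; exact mul_ne_zero hε.ne' (by exact_mod_cast hCne n' hn')
      rw [← h5]; exact hr n' (hCA hn') h6
    have hout : ∀ n' ∈ A, n' ∉ C → SignType.sign (pair n' a) = SignType.sign (pair n' b) := by
      intro n' hn' hnC
      by_cases h0 : pair n' z = 0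
      · have h5 : n' m = 0 := by
          by_contra h; exact hnC (Finset.mem_filter.2 ⟨hn', h, h0⟩)
        rw [hpa n' h0, hpb n' h0, h5]; simp
      · rw [(hdown.trans hl) n' hn' h0, (hup.trans hr) n' hn' h0]
    have key := H.transports_segment (p := p) (Λ := Λ) hCarr hCA
      (fun n' hn' d hd => hd n' (hCA hn') (hCz n' hn')) hgl hgr hgp hout
    have hset : C.filter (fun n' => 0 < pair n' a ∧ pair n' b < 0) =
        A.filter fun n' => n' m < 0 ∧ pair n' z = 0 := by
      ext n'
      constructor
      · intro h
        rw [Finset.mem_filter] at h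
        have h5 := (sign_eq_iff_neg (hsr n' h.1)).1 h.2.2
        have h6 : (n' m : ℝ) < 0 := by nlinarith
        exact Finset.mem_filter.2 ⟨hCA h.1, by exact_mod_cast h6, hCz n' h.1⟩
      · intro h
        rw [Finset.mem_filter] at h
        have h5 : n' ∈ C := Finset.mem_filter.2 ⟨h.1, h.2.1.ne, h.2.2⟩
        have h6 : (n' m : ℝ) < 0 := by exact_mod_cast h.2.1
        exact Finset.mem_filter.2 ⟨h5, (sign_eq_iff_pos (hsl n' h5)).2 (by nlinarith),
          (sign_eq_iff_neg (hsr n' h5)).2 (by nlinarith)⟩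
    rw [hset] at key
    convert key using 1
    refine Finset.sum_congr rfl fun n' hn' => ?_
    rw [Finset.mem_filter] at hn'
    have h5 : n' ∈ C := Finset.mem_filter.2 ⟨hn'.1, hn'.2.1.ne, hn'.2.2⟩
    have h6 : (n' m : ℝ) ≠ 0 := by exact_mod_cast hn'.2.1.ne
    have h7 : hit n' a b = z + η • foot m n' v := by
      unfold hit foot
      have e1 : a - b = (-2 * ε) • incl m := by rw [ha, hb]; module
      have e2 : pair n' b / (pair n' a - pair n' b) =
          -(1 / 2 : ℝ) - (η / (2 * ε)) * (pair n' v / n' m) := by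
        rw [hpa n' hn'.2.2, hpb n' hn'.2.2]
        have : -ε * (n' m : ℝ) + η * pair n' v - (ε * n' m + η * pair n' v) = -(2 * ε * n' m) :=
            by ring
        rw [this]
        field_simp
        ring
      rw [e1, e2, smul_smul, hb, smul_sub, smul_smul]
      have e3 : (-(1 / 2 : ℝ) - (η / (2 * ε)) * (pair n' v / n' m)) * (-2 * ε) =
          ε + η * (pair n' v / n' m) := by field_simp; ring
      rw [e3]; module
    rw [h7]
    have h8 : ∀ s :
        ℝ, 0 < s → Near A z (z + s • foot m n' v) → OnWall A n' (z + s • foot m n' v) := by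
      intro s hs hnear
      refine ⟨by rw [map_add, hn'.2.2, map_smul, pair_foot_self hn'.2.1.ne]; simp,
        fun n'' hn'' h0 => ?_⟩
      by_cases h9 : pair n'' z = 0
      · rw [map_add, h9, zero_add, map_smul, smul_eq_mul] at h0
        have h10 := (mul_eq_zero.1 h0).resolve_left hs.ne'
        rcases lt_or_gt_of_ne hv with hv' | hv'
        · refine hz.eq_or_eq_neg (u := -v) H.arr (by rw [map_neg]; linarith) hn'.1 hn'' hn'.2.2 h9
            hn'.2.1.ne ?_
          have : foot m n' (-v) = -foot m n' v := by
            have := foot_smul (m := m) (n := n') (x := v) (-1)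
            simpa using this
          rw [this, map_neg, h10, neg_zero]
        · exact hz.eq_or_eq_neg H.arr hv' hn'.1 hn'' hn'.2.2 h9 hn'.2.1.ne h10
      · exact absurd ((sign_eq_iff_zero (hnear n'' hn'' h9)).1 h0) h9
    refine H.defect_congr hn'.1 _ _ (h8 ε hε (hn2 n' h5)) fun n'' hn'' => ?_
    by_cases h9 : pair n'' z = 0
    · simp only [map_add, h9, zero_add, map_smul, smul_eq_mul]
      rw [sign_mul, sign_mul, sign_pos hε, sign_pos hη]
    · rw [hn1 n' h5 n'' hn'' h9, hn2 n' h5 n'' hn'' h9]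
  have hfneg : ∀ n', foot m n' (-u) = -foot m n' u := fun n' => by
    have := foot_smul (m := m) (n := n') (x := u) (-1)
    simpa using this
  have t3 := hside u hu.ne' (fun n' hn' => (hfeet' n' hn').1) (fun n' hn' => (hfeet n' hn').1)
    h1 h3 g1 g3
  have t4 := hside (-u) (by rw [map_neg]; exact neg_ne_zero.2 hu.ne')
    (fun n' hn' => by rw [hfneg]; exact (hfeet' n' hn').2)
    (fun n' hn' => by rw [hfneg]; exact (hfeet n' hn').2) h2 h4 g2 g4
  -- two ways of transport from `z - ε m + η u` to `z + ε m - η u`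
  have key := H.transports_unique (t1.trans t4) (t3.trans t2)
  have e : defect A ℓ F p n (z - ε • incl m) - defect A ℓ F p n (z + ε • incl m) +
      ∑ n' ∈ A.filter fun n' => n' m < 0 ∧ pair n' z = 0,
        (defect A ℓ F p n' (z - ε • foot m n' u) - defect A ℓ F p n' (z + ε • foot m n' u)) =
      (defect A ℓ F p n (z + (-ε) • incl m) + ∑ n' ∈ A.filter fun n' => n' m < 0 ∧ pair n' z = 0,
        defect A ℓ F p n' (z + ε • foot m n' (-u))) -
      ((∑ n' ∈ A.filter fun n' => n' m < 0 ∧ pair n' z = 0,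
        defect A ℓ F p n' (z + ε • foot m n' u)) + defect A ℓ F p n (z + ε • incl m)) := by
    rw [Finset.sum_sub_distrib, hsub]
    simp only [hfneg, smul_neg, ← sub_eq_add_neg]
    abel
  rw [e, mem_normalSub]
  set κ := (defect A ℓ F p n (z + (-ε) • incl m) +
      ∑ n' ∈ A.filter fun n' => n' m < 0 ∧ pair n' z = 0,
        defect A ℓ F p n' (z + ε • foot m n' (-u))) -
      ((∑ n' ∈ A.filter fun n' => n' m < 0 ∧ pair n' z = 0,
        defect A ℓ F p n' (z + ε • foot m n' u)) + defect A ℓ F p n (z + ε • incl m)) with hκ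
  intro d hd
  -- up to multiples, the kernel of `n` is spanned by `Λ` and `m`, unless `n = 0` is the only
  -- hyperplane through `z`
  by_cases hex : ∃ n' ∈ A, pair n' z = 0 ∧ n' m ≠ 0
  · obtain ⟨n', hn', hz', hm'⟩ := hex
    have h5 : n' m • d - n' d • m ∈ Λ := by
      intro n'' hn'' hz''
      obtain ⟨c, hc⟩ := hz.coplanar n' hn' n'' hn'' hz' hz''
      have := LinearMap.congr_fun hc d
      simp only [LinearMap.sub_apply, LinearMap.smul_apply, smul_eq_mul, hd, mul_zero] at this
      rw [map_sub, map_smul, map_smul, smul_eq_mul, smul_eq_mul]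
      linarith
    have h6 := key.1 _ h5
    rw [map_sub, map_zsmul, map_zsmul, key.2, smul_zero, sub_zero] at h6
    exact (smul_eq_zero.1 h6).resolve_left hm'
  · push Not at hex
    refine key.1 d fun n' hn' hz' => ?_
    rcases hz.unique n' hn' hz' (hex n' hn' hz') with rfl | rfl
    · exact hd
    · rw [LinearMap.neg_apply, hd, neg_zero]

end Defects

/-! ### Correcting a lift -/

section Far

variable {M : Type v} [AddCommGroup M] {A A' : Finset (DualLat M)} {m : M} {n : DualLat M}
  {x y x' : RealSpan M}

/-- A point far away from `x` in the direction `m`. -/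
def far (A : Finset (DualLat M)) (m : M) (x : RealSpan M) : RealSpan M :=
  x + farTime A x • incl m

theorem pair_far (h : n m = 0) : pair n (far A m x) = pair n x := by
  simp [far, h]

theorem sign_pair_far (hn : n ∈ A) (h : n m ≠ 0) :
    SignType.sign (pair n (far A m x)) = SignType.sign (n m : ℝ) := sign_far hn h le_rfl

theorem Gen.far (hx : Gen A x) : Gen A (far A m x) := by
  intro n hn h0
  by_cases h : n m = 0
  · rw [pair_far h] at h0; exact hx n hn h0
  · have := (sign_eq_iff_zero (sign_pair_far (x := x) hn h)).1 h0
    exact h (by exact_mod_cast this)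

theorem sameSigns_far (h : ∀ n ∈ A, n m = 0 → SignType.sign (pair n x) = SignType.sign (pair n y)) :
    SameSigns A (far A m x) (far A m y) := by
  intro n hn
  by_cases hm : n m = 0
  · rw [pair_far hm, pair_far hm, h n hn hm]
  · rw [sign_pair_far hn hm, sign_pair_far hn hm]

/-- A crossing of a hyperplane parallel to `m` remains one far away. -/
theorem IsCross.far (hm : n m = 0) (hc : IsCross A n x y x') :
    IsCross A n (far A m x) (far A m y) (far A m x') := by
  refine ⟨by rw [pair_far hm]; exact hc.zero, by rw [pair_far hm]; exact hc.pos,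
    by rw [pair_far hm]; exact hc.neg, fun n' hn' h1 h2 => ?_⟩
  by_cases h : n' m = 0
  · rw [pair_far h, pair_far h, pair_far h]; exact hc.other n' hn' h1 h2
  · rw [sign_pair_far hn' h, sign_pair_far hn' h, sign_pair_far hn' h]
    refine ⟨fun h0 => h ?_, rfl, rfl⟩
    exact_mod_cast (sign_eq_iff_zero (sign_pair_far (x := y) hn' h)).1 h0

theorem IsCross.sameSigns_of_map_eq_zero (hm : n m ≠ 0) (hc : IsCross A n x y x') :
    ∀ n' ∈ A, n' m = 0 → SignType.sign (pair n' x) = SignType.sign (pair n' x') := by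
  intro n' hn' h0
  have h := (hc.other n' hn' (by rintro rfl; exact hm h0)
      (by rintro rfl; simp at h0; exact hm h0)).2
  exact h.1.trans h.2.symm

theorem IsCross.sameSigns_of_notMem (hA : IsArr A) (hsub : A ⊆ A') (hn : n ∉ A)
    (hc : IsCross A' n x y x') : SameSigns A x x' := by
  intro n' hn'
  have h := (hc.other n' (hsub hn') (by rintro rfl; exact hn hn') (by
    rintro rfl
    have := hA.neg _ hn'
    rw [neg_neg] at this
    exact hn this)).2
  exact h.1.trans h.2.symm

theorem OnWall.gen_of_notMem (hA : IsArr A) (hn : n ∉ A) (hy : OnWall A n y) : Gen A y := by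
  intro n' hn' h0
  rcases hy.2 n' hn' h0 with rfl | rfl
  · exact hn hn'
  · have := hA.neg _ hn'
    rw [neg_neg] at this
    exact hn this

/-- If `m` lies in the closed cell of `y`, moving in the direction `m` does not leave the
open cell. -/
theorem sameSigns_far_of_mem_cell (hA : IsArr A) (h : incl m ∈ cell A y) :
    SameSigns A y (Scattering.far A m y) := by
  intro n hn
  by_cases hm : n m = 0
  · rw [pair_far hm]
  · rw [sign_pair_far hn hm]
    rw [mem_cell] at h
    rcases lt_or_gt_of_ne hm with hm' | hm'
    · have h1 : pair n y < 0 := by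
        by_contra h2
        have := h n hn (not_lt.1 h2)
        rw [pair_incl] at this
        have h3 : (0 : ℤ) ≤ n m := by exact_mod_cast this
        omega
      rw [sign_neg h1, sign_neg (by exact_mod_cast hm')]
    · have h1 : 0 < pair n y := by
        by_contra h2
        have := h (-n) (hA.neg n hn) (by rw [pair_neg]; linarith)
        rw [pair_incl, LinearMap.neg_apply] at this
        have h3 : (0 : ℤ) ≤ -n m := by exact_mod_cast this
        omega
      rw [sign_pos h1, sign_pos (by exact_mod_cast hm')]

open Classical in
/-- Finitely many points represent all relatively open cells of an arrangement. -/
theorem exists_representatives (A : Finset (DualLat M)) : ∃ R : Finset (RealSpan M),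
    (∀ y, ∃ y' ∈ R, SameSigns A y' y) ∧ ∀ y ∈ R, ∀ y' ∈ R, SameSigns A y y' → y = y' := by
  let f : RealSpan M → A → SignType := fun y n => SignType.sign (pair n.1 y)
  let g : Set.range f → RealSpan M := fun s => s.2.choose
  have hg : ∀ s, f (g s) = s.1 := fun s => s.2.choose_spec
  have : Fintype (Set.range f) := Fintype.ofFinite _
  refine ⟨Finset.univ.image g, fun y => ⟨g ⟨f y, y, rfl⟩, by simp, fun n hn => ?_⟩, ?_⟩
  · exact congrFun (hg ⟨f y, y, rfl⟩) ⟨n, hn⟩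
  · intro y hy y' hy' h
    obtain ⟨s, -, rfl⟩ := Finset.mem_image.1 hy
    obtain ⟨s', -, rfl⟩ := Finset.mem_image.1 hy'
    have : s = s' := Subtype.ext (by
      rw [← hg s, ← hg s']; exact funext fun n => h n.1 n.2)
    rw [this]

theorem OnWall.mem_cell_iff (hA : IsArr A) (hn : n ∈ A) (hy : OnWall A n y) {n' : DualLat M}
    (hn' : n' ∈ A) (hy' : OnWall A n' x) : x ∈ cell A y ↔ SameSigns A y x := by
  refine ⟨fun h => ?_, fun h => ((adapted_cell A y).mem_congr h).1 self_mem_cell⟩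
  have hpos : ∀ n₁ ∈ A, 0 < pair n₁ y → 0 < pair n₁ x := by
    intro n₁ hn₁ h1
    refine lt_of_le_of_ne (mem_cell.1 h n₁ hn₁ h1.le) fun h0 => ?_
    have h2 := zero_of_mem_cell hA h hn hy.1
    have h3 : pair n₁ y = 0 := by
      have h4 : pair n' y = 0 := by
        rcases hy'.2 n hn h2 with rfl | rfl
        exacts [hy.1, by simpa using hy.1]
      rcases hy'.2 n₁ hn₁ h0.symm with rfl | rfl
      exacts [h4, by rw [pair_neg, h4, neg_zero]]
    linarith
  intro n₁ hn₁
  rcases lt_trichotomy (pair n₁ y) 0 with h1 | h1 | h1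
  · have := hpos (-n₁) (hA.neg n₁ hn₁) (by rw [pair_neg]; linarith)
    rw [pair_neg] at this
    rw [sign_neg h1, sign_neg (by linarith)]
  · rw [h1, zero_of_mem_cell hA h hn₁ h1]
  · rw [sign_pos h1, sign_pos (hpos n₁ hn₁ h1)]

end Far

section Correction

variable {k : Type*} [Field k] [CharZero k] {P : Type*} [AddCommMonoid P] {M : Type v}
  [AddCommGroup M] {r : P →+ M} {j : ℕ} {A A' : Finset (DualLat M)}
  {ℓ : RealSpan M → aug k P (j + 1)} {F : RealSpan M → Tw k r (j + 1)} {p : P} {n : DualLat M}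
  {x y x' : RealSpan M}

open Tw

/-- `Ψ` is a potential for the coefficients of `z^p` of the wall crossings far away in the
direction `r p`. -/
structure IsFarPotential (A : Finset (DualLat M)) (r : P →+ M) (p : P)
    (ℓ : RealSpan M → aug k P (j + 1)) (Ψ : RealSpan M → M →+ k) : Prop where
  congr : ∀ x x', Gen A x →
    (∀ n ∈ A, n (r p) = 0 → SignType.sign (pair n x) = SignType.sign (pair n x')) → Ψ x = Ψ x'
  map : ∀ x, Ψ x (r p) = 0
  cross : ∀ n ∈ A, n (r p) = 0 → ∀ x y x', IsCross A n x y x' → ∀ d,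
    Ψ x' d = Ψ x d + n d * coef k (j + 1) p (ℓ (far A (r p) y)).1

/-- The value far away of the coefficient of `z^p` in the logarithm of a lift. -/
def farCoef (A' : Finset (DualLat M)) (F : RealSpan M → Tw k r (j + 1)) (p : P) (x : RealSpan M) :
    M →+ k :=
  ((coef k (j + 1) p : Lvl k P (j + 1) →ₗ[k] k) : Lvl k P (j + 1) →+ k).comp
    (F (far A' (r p) x)).log

theorem farCoef_apply (x : RealSpan M) (d : M) :
    farCoef A' F p x d = coef k (j + 1) p ((F (far A' (r p) x)).log d) := rfl

variable [Module.Free ℤ M] [Module.Finite ℤ M]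

/-- Far away in the direction `r p`, only hyperplanes parallel to `r p` separate the chambers, so
transport is by group elements that kill `r p`. -/
theorem IsLift.farCoef_apply_map (H : IsLift A ℓ F) (hsub : A ⊆ A') (hx : Gen A' x)
    (hx' : Gen A' x') : farCoef A' F p x (r p) = farCoef A' F p x' (r p) := by
  have key : ∃ σ, Transports F p (AddSubgroup.zmultiples (r p)) (far A' (r p) x)
      (far A' (r p) x') σ := by
    refine connect (Q := fun a c => ∃ σ, Transports F p (AddSubgroup.zmultiples (r p)) a c σ)
      H.arr (fun a b ha hab => ⟨0, H.transports_of_sameSigns _ ha hab⟩)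
      (fun a b c ⟨σ, h⟩ ⟨τ, h'⟩ => ⟨_, h.trans h'⟩) (hx.far.mono hsub) (hx'.far.mono hsub) ?_
    intro n hn a b c hc hs
    have hm : n (r p) = 0 := by
      by_contra hm
      have h1 := hs n hn (by rw [sign_pair_far (hsub hn) hm, sign_pair_far (hsub hn) hm])
      exact hx.far n (hsub hn) ((sign_eq_iff_zero h1).1 hc.zero)
    refine ⟨_, H.transports_of_cross hn ?_ hc⟩
    rintro d hd
    obtain ⟨a, rfl⟩ := AddSubgroup.mem_zmultiples_iff.1 hd
    rw [map_zsmul, hm, smul_zero]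
  obtain ⟨σ, a, ha, h1, -⟩ := key
  have hmem := AddSubgroup.mem_zmultiples (r p)
  have h2 := dcoef_apply_map (p := p) (mul_mem (grp_mono bot_le ha) (H.mem _)) (H.mem _) h1
  rw [dcoef_apply, map_sub, coef_mul_of_mem_grp ha _ hmem, log_eq_zero_of_mem_grp ha hmem, map_zero,
    zero_add, sub_eq_zero] at h2
  exact h2.symm

/-- The correction of the coefficient of `z^p` for which the new functions on the walls, of
exponent `p`, occur on non-incoming walls only. -/
theorem IsLift.exists_correction (H : IsLift A ℓ F) (hA' : IsArr A') (hsub : A ⊆ A')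
    (hcl : ClosedAlong A A' (r p)) (hℓ : ∀ y, Gen A y → ℓ y = 0) {Ψ : RealSpan M → M →+ k}
    (hΨ : IsFarPotential A' r p ℓ Ψ) :
    ∃ φ : RealSpan M → M →+ k, (∀ x x', Gen A' x → SameSigns A' x x' → φ x = φ x') ∧
      (∀ x, Gen A' x → φ x (r p) = 0) ∧
      ∀ n ∈ A', ∀ x y x', IsCross A' n x y x' → ∃ c : k,
        (∀ d, defect A ℓ F p n y d + φ x' d - φ x d = c * n d) ∧
        (n (r p) ≠ 0 ∨ incl (r p) ∈ cell A' y → c = 0) := by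
  classical
  set m := r p with hm
  set e := defect A ℓ F p with he
  obtain ⟨x₀, hx₀⟩ := exists_gen hA'
  have hcongr : ∀ n ∈ A, ∀ y y', OnWall A n y → SameSigns A y y' → e n y = e n y' :=
    fun n hn y y' hy hs => H.defect_congr hn y y' hy hs
  have hraymap : ∀ x, raySum A m e x m = 0 := by
    intro x
    unfold raySum
    rw [AddMonoidHom.finsetSum_apply]
    exact Finset.sum_eq_zero fun n _ => H.defect_apply_map n _
  -- the ray sum of the defects vanishes far away, where the lift is corrected by `φ'`
  let φ' : RealSpan M → M →+ k := fun x => Ψ x - farCoef A' F p x + farCoef A' F p x₀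
  have hφ'c : ∀ x x', Gen A' x →
      (∀ n ∈ A', n m = 0 → SignType.sign (pair n x) = SignType.sign (pair n x')) →
      φ' x = φ' x' := by
    intro x x' hx h
    have h1 : farCoef A' F p x = farCoef A' F p x' := by
      ext d
      rw [farCoef_apply, farCoef_apply,
        H.congr _ _ (hx.far.mono hsub) ((sameSigns_far h).mono hsub)]
    simp only [φ']
    rw [hΨ.congr x x' hx h, h1]
  -- the correction solves the problem far away
  have hfar : ∀ n ∈ A', n m = 0 → ∀ x y x', IsCross A' n x y x' →
      e n (far A' m y) + φ' x' - φ' x = 0 := by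
    intro n hn hnm x y x' hc
    have hcf := hc.far hnm
    have hφd : ∀ d, φ' x' d - φ' x d = n d * coef k (j + 1) p (ℓ (far A' m y)).1 -
        (farCoef A' F p x' d - farCoef A' F p x d) := by
      intro d
      simp only [φ', AddMonoidHom.add_apply, AddMonoidHom.sub_apply]
      rw [hΨ.cross n hn hnm x y x' hc d]; ring
    ext d
    rw [add_sub_assoc, AddMonoidHom.add_apply, AddMonoidHom.sub_apply, hφd]
    by_cases hnA : n ∈ A
    · have h1 : crossing ℓ n (far A' m y) ∈ grp k r (j + 1) (AddSubgroup.zmultiples m) :=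
        H.crossing_mem hnA (hcf.mono hsub).onWall (by
          rintro d hd
          obtain ⟨a, rfl⟩ := AddSubgroup.mem_zmultiples_iff.1 hd
          rw [map_zsmul, hnm, smul_zero])
      rw [he, H.defect_eq hnA (hcf.mono hsub), dcoef_apply, map_sub,
        coef_mul_of_mem_grp h1 _ (AddSubgroup.mem_zmultiples m), elem_log, nu_apply, map_smul,
        farCoef_apply, farCoef_apply, smul_eq_mul, AddMonoidHom.zero_apply]
      ring
    · rw [he, defect_out hnA, hℓ _ ((hcf.mono hsub).onWall.gen_of_notMem H.arr hnA), farCoef_apply,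
        farCoef_apply, H.congr _ _ (hcf.mono hsub).gen_left
          (hcf.sameSigns_of_notMem H.arr hsub hnA)]
      simp only [AddMonoidHom.zero_apply, ZeroMemClass.coe_zero, map_zero, mul_zero, zero_sub,
        zero_add, neg_eq_zero]
      exact sub_self _
  refine ⟨fun x => raySum A m e x + φ' x, ?_, ?_, ?_⟩
  · intro x x' hx h
    change raySum A m e x + φ' x = raySum A m e x' + φ' x'
    rw [raySum_congr H.arr hsub hcl hx hcongr h, hφ'c x x' hx fun n hn _ => h n hn]
  · intro x hx
    have := H.farCoef_apply_map (p := p) hsub hx hx₀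
    simp only [φ', AddMonoidHom.add_apply, AddMonoidHom.sub_apply]
    rw [hraymap, hΨ.map, this]; ring
  · intro n hn x y x' hc
    have hsum : ∀ d, e n y d + (raySum A m e x' + φ' x') d - (raySum A m e x + φ' x) d =
        (e n y + raySum A m e x' - raySum A m e x) d + (φ' x' - φ' x) d := by
      intro d
      simp only [AddMonoidHom.add_apply, AddMonoidHom.sub_apply]; ring
    by_cases hnm : n m = 0
    · obtain ⟨u, hu⟩ := pair_ne_zero_of_ne (hA'.prim n hn).ne_zero
      have h1 := raySum_parallel (e := e) H.arr hA' hsub hcl hcongr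
        (fun n' _ hn' y _ _ => defect_out hn') hn hnm hc (normalSub k n) hu
        (fun z hz => H.defect_pencil hnm hu hz) (T := farTime A' y) farTime_pos.le (by
          intro n' hn' hlt
          have h2 := sign_pair_far (m := m) (x := y) (hsub hn') hlt.ne
          have h3 := (sign_eq_iff_neg h2).2 (by exact_mod_cast hlt)
          simpa [far] using h3)
      obtain ⟨c, hcc⟩ := exists_eq_smul_nu (hA'.prim n hn).ne_zero h1
      have h4 := hfar n hn hnm x y x' hc
      have hval : ∀ d, e n y d + (raySum A m e x' + φ' x') d - (raySum A m e x + φ' x) d =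
          c * n d := by
        intro d
        rw [← hcc d, hsum]
        have h5 := DFunLike.congr_fun h4 d
        simp only [AddMonoidHom.add_apply, AddMonoidHom.sub_apply, AddMonoidHom.zero_apply,
          far] at h5 ⊢
        linear_combination h5
      refine ⟨c, hval, fun h => ?_⟩
      have hcell := h.resolve_left (not_not.2 hnm)
      -- the ray from `y` stays in the cell of `y`, hence meets no hyperplane transversally
      have hray : ∀ z, Near A' y z → raySum A m e z = 0 := by
        intro z hz
        refine raySum_eq_zero fun n' hn' hlt => ?_
        have h5 := sameSigns_far_of_mem_cell hA' hcell n' (hsub hn')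
        rw [sign_pair_far (hsub hn') hlt.ne] at h5
        have h6 := (sign_eq_iff_neg h5).2 (by exact_mod_cast hlt)
        exact ((sign_eq_iff_neg (hz n' (hsub hn') h6.ne)).2 h6).le
      have hey : e n y = e n (far A' m y) := by
        by_cases hnA : n ∈ A
        · exact hcongr n hnA _ _ (hc.mono hsub).onWall
            ((sameSigns_far_of_mem_cell hA' hcell).mono hsub)
        · rw [he, defect_out hnA, defect_out hnA]
      obtain ⟨d, hd⟩ := exists_pos_of_ne_zero (hA'.prim n hn).ne_zero
      have h7 := hval d
      rw [hsum, hray x hc.near_left, hray x' hc.near_right, hey] at h7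
      have h8 := DFunLike.congr_fun h4 d
      simp only [AddMonoidHom.add_apply, AddMonoidHom.sub_apply, AddMonoidHom.zero_apply] at h7 h8
      have h9 : c * (n d : k) = 0 := by linear_combination h8 - h7
      exact (mul_eq_zero.1 h9).resolve_right (by exact_mod_cast hd.ne')
    · refine ⟨0, fun d => ?_, fun _ => rfl⟩
      have h1 := raySum_cross (e := e) H.arr hA' hsub hcl hcongr
        (fun n hn y hy => H.defect_neg hn y hy) (fun n _ hn' y _ => defect_out hn') hn hnm hc
      rw [hsum, h1, hφ'c x x' hc.gen_left (hc.sameSigns_of_map_eq_zero hnm), sub_self]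
      simp

end Correction

/-! ### From one order to the next -/

section Refinement

variable {k : Type*} [Field k] [CharZero k] {P : Type*} [AddCommMonoid P] {M : Type v}
  [AddCommGroup M] [Module.Free ℤ M] [Module.Finite ℤ M] {r : P →+ M} {j : ℕ}
  {A A' : Finset (DualLat M)}
  {ℓ : RealSpan M → aug k P (j + 1)} {F : RealSpan M → Tw k r (j + 1)} {p : P} {n : DualLat M}
  {x y x' : RealSpan M}

open Tw

theorem finite_defect (A : Finset (DualLat M)) (ℓ : RealSpan M → aug k P (j + 1))
    (F : RealSpan M → Tw k r (j + 1)) (n : DualLat M) (y : RealSpan M) :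
    {p | defect A ℓ F p n y ≠ 0}.Finite := by
  by_cases h : n ∈ A ∧ ∃ q : RealSpan M × RealSpan M, IsCross A n q.1 y q.2
  · obtain ⟨G, hG⟩ := Module.Finite.fg_top (R := ℤ) (M := M)
    refine (G.finite_toSet.biUnion fun d _ => coef_finite
      ((F h.2.choose.2).log d - (crossing ℓ n y * F h.2.choose.1).log d)).subset fun p hp => ?_
    by_contra hcon
    simp only [Set.mem_iUnion, not_exists] at hcon
    apply hp
    rw [defect, dif_pos h]
    ext d
    have hd : d ∈ Submodule.span ℤ (G : Set M) := hG ▸ Submodule.mem_top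
    induction hd using Submodule.span_induction with
    | mem d hd => exact not_not.1 (hcon d hd)
    | zero => exact map_zero _
    | add a b _ _ ha hb => rw [map_add, ha, hb]; exact add_zero _
    | smul a b _ hb => rw [map_zsmul, hb]; exact smul_zero _
  · convert Set.finite_empty
    exact Set.eq_empty_of_forall_notMem fun p hp => hp (dif_neg h)

/-- The differences between the two sides of the crossing conditions involve finitely many
monomials. -/
theorem IsLift.exists_finset (H : IsLift A ℓ F) : ∃ s : Finset P,
    (∀ p ∈ s, p ∈ ordSet P j ∧ r p ≠ 0) ∧ ∀ n ∈ A, ∀ x y x', IsCross A n x y x' → ∀ d,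
      (F x').log d - (crossing ℓ n y * F x).log d =
        ∑ p ∈ s, defect A ℓ F p n y d • zmon k (j + 1) p := by
  classical
  obtain ⟨R, hR, -⟩ := exists_representatives A
  let s : Finset P := A.biUnion fun n => R.biUnion fun y => (finite_defect A ℓ F n y).toFinset
  refine ⟨s, fun p hp => ?_, fun n hn x y x' hc d => ?_⟩
  · simp only [s, Finset.mem_biUnion, Set.Finite.mem_toFinset] at hp
    obtain ⟨n, hn, y, -, hp⟩ := hp
    replace hp : defect A ℓ F p n y ≠ 0 := hp
    refine ⟨by_contra fun hpj => hp ?_, fun h => hp (H.defect_of_map_eq_zero h n y)⟩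
    unfold defect
    split_ifs with h
    · ext d
      exact coef_eq_zero_of_lvlMap hpj (red_eq (H.cross n h.1 _ _ _ h.2.choose_spec).symm d)
    · rfl
  · refine (eq_sum_coef ((F x').log d - (crossing ℓ n y * F x).log d) s ?_).trans
      (Finset.sum_congr rfl fun p _ => ?_)
    rotate_left
    · rw [H.defect_eq hn hc, dcoef_apply]
    · intro p hp
      obtain ⟨y', hy', hs⟩ := hR y
      simp only [s, Finset.mem_biUnion, Set.Finite.mem_toFinset]
      refine ⟨n, hn, y', hy', fun h0 => hp ?_⟩
      rw [← H.defect_congr hn y y' hc.onWall hs.symm, H.defect_eq hn hc] at h0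
      exact DFunLike.congr_fun h0 d

/-- A potential modulo `𝔪_P^j` becomes one modulo `𝔪_P^(j + 1)` after a refinement of the
arrangement, a correction of the lift and the addition of terms `c p y • z^p` to the wall
crossings. These vanish where the direction `r p` points into the cell of `y`. -/
theorem IsLift.exists_refinement (hj : j ≠ 0) (H : IsLift A ℓ F) (hℓ : ∀ y, Gen A y → ℓ y = 0)
    (hΨ : ∀ p, r p ≠ 0 → ∀ A', IsArr A' → A ⊆ A' → ∃ Ψ, IsFarPotential A' r p ℓ Ψ) :
    ∃ (A' : Finset (DualLat M)) (s : Finset P) (c : P → RealSpan M → k)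
      (F' : RealSpan M → Tw k r (j + 1)), IsArr A' ∧ A ⊆ A' ∧
      (∀ p ∈ s, p ∈ ordSet P j ∧ r p ≠ 0) ∧ (∀ x, F' x ∈ grp k r (j + 1) ⊥) ∧
      (∀ x x', Gen A' x → SameSigns A' x x' → F' x = F' x') ∧
      (∀ n ∈ A', ∀ x y x', IsCross A' n x y x' →
        ∀ h : (ℓ y).1 + ∑ p ∈ s, c p y • zmon k (j + 1) p ∈ aug k P (j + 1),
        F' x' = elem r (nu k n) ((ℓ y).1 + ∑ p ∈ s, c p y • zmon k (j + 1) p) h * F' x) ∧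
      (∀ p ∈ s, ∀ n ∈ A', ∀ y, OnWall A' n y → n (r p) ≠ 0 ∨ incl (r p) ∈ cell A' y → c p y = 0) ∧
      ∀ p ∈ s, ∀ n ∈ A', ∀ y y', OnWall A' n y → SameSigns A' y y' → c p y = c p y' := by
  classical
  obtain ⟨s, hs, hD⟩ := H.exists_finset
  obtain ⟨A', hA', hsub, hcl⟩ := exists_closedAlong H.arr (s.image r)
  have key : ∀ p ∈ s, ∃ φ : RealSpan M → M →+ k,
      (∀ x x', Gen A' x → SameSigns A' x x' → φ x = φ x') ∧ (∀ x, Gen A' x → φ x (r p) = 0) ∧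
      ∀ n ∈ A', ∀ x y x', IsCross A' n x y x' → ∃ c : k,
        (∀ d, defect A ℓ F p n y d + φ x' d - φ x d = c * n d) ∧
        (n (r p) ≠ 0 ∨ incl (r p) ∈ cell A' y → c = 0) := fun p hp => by
    obtain ⟨Ψ, h⟩ := hΨ p (hs p hp).2 A' hA' hsub
    exact H.exists_correction hA' hsub (hcl _ (Finset.mem_image_of_mem _ hp)) hℓ h
  choose! φ hφc hφ0 hφ using key
  -- the coefficient does not depend on the choice of the normal vector and of the points beside `y`
  have hc : ∀ p y, ∃ c : k, p ∈ s → ∀ n ∈ A', ∀ x x', IsCross A' n x y x' →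
      ∀ d, defect A ℓ F p n y d + φ p x' d - φ p x d = c * n d := by
    intro p y
    by_cases h : p ∈ s ∧ ∃ n ∈ A', ∃ x x', IsCross A' n x y x'
    · obtain ⟨hp, n, hn, x, x', hc⟩ := h
      obtain ⟨c, h1, -⟩ := hφ p hp n hn x y x' hc
      refine ⟨c, fun _ n' hn' z z' hc' d => ?_⟩
      have hprim := hA'.prim n hn
      rcases hc.onWall.2 n' hn' hc'.zero with rfl | rfl
      · rw [hφc p hp z x hc'.gen_left (hc'.sameSigns_left hprim hc),
          hφc p hp z' x' hc'.gen_right (hc'.sameSigns_right hprim hc), h1]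
      · have hc'' := hc'.symm
        rw [neg_neg] at hc''
        rw [hφc p hp z x' hc'.gen_left (hc''.sameSigns_right hprim hc),
          hφc p hp z' x hc'.gen_right (hc''.sameSigns_left hprim hc)]
        have h2 : defect A ℓ F p (-n) y = -defect A ℓ F p n y := by
          by_cases hnA : n ∈ A
          · exact H.defect_neg hnA y (hc.mono hsub).onWall
          · rw [defect_out hnA, defect_out fun h => hnA (by simpa using H.arr.neg _ h), neg_zero]
        have h3 := h1 d
        rw [h2, AddMonoidHom.neg_apply, LinearMap.neg_apply, Int.cast_neg]
        linear_combination -h3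
    · exact ⟨0, fun hp n hn x x' hc => absurd ⟨hp, n, hn, x, x', hc⟩ h⟩
  choose c hc using hc
  have huniq : ∀ {p y} {a : k} {n x x'}, p ∈ s → n ∈ A' → IsCross A' n x y x' →
      (∀ d, defect A ℓ F p n y d + φ p x' d - φ p x d = a * n d) → c p y = a := by
    intro p y a n x x' hp hn hcr h
    obtain ⟨d, hd⟩ := exists_pos_of_ne_zero (hA'.prim n hn).ne_zero
    have h1 := (hc p y hp n hn x x' hcr d).symm.trans (h d)
    exact mul_right_cancel₀ (by exact_mod_cast hd.ne') h1
  -- the correction of the lift lies in the last step of the filtration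
  have hF' : ∀ x, ∃ b ∈ grp k r (j + 1) ⊥, Gen A' x →
      ∀ d, b.log d = (F x).log d + ∑ p ∈ s, φ p x d • zmon k (j + 1) p := by
    intro x
    by_cases hx : Gen A' x
    · obtain ⟨b, hb, h⟩ := exists_add_central hj (H.mem x) s (fun p => φ p x) fun p hp =>
        ⟨(hs p hp).1, (hs p hp).2, hφ0 p hp x hx⟩
      exact ⟨b, hb, fun _ => h⟩
    · exact ⟨1, one_mem _, fun h => absurd h hx⟩
  choose F' hF'm hF' using hF'
  refine ⟨A', s, c, F', hA', hsub, hs, hF'm, ?_, ?_, ?_, ?_⟩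
  · intro x x' hx h
    refine ext_log fun d => ?_
    rw [hF' x hx, hF' x' (h.gen hx), H.congr x x' (hx.mono hsub) (h.mono hsub)]
    exact congrArg _ (Finset.sum_congr rfl fun p hp => by rw [hφc p hp x x' hx h])
  · intro n hn x y x' hcr h
    have hz : ∀ a : P → k, lvlMap k P j (∑ p ∈ s, a p • zmon k (j + 1) p) = 0 := by
      intro a
      rw [map_sum]
      refine Finset.sum_eq_zero fun p hp => ?_
      rw [map_smul, lvlMap_zmon_eq_zero (hs p hp).1, smul_zero]
    have hbase : ∀ z ∈ aug k P (j + 1),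
        (elem r (nu k n) ((ℓ y).1 + ∑ p ∈ s, c p y • zmon k (j + 1) p) h).base z =
          (crossing ℓ n y : Tw k r (j + 1)).base z := by
      intro z hz'
      refine base_congr ?_ hz'
      rw [red_eq_iff]
      intro d
      rw [elem_log, elem_log, ← smul_sub, map_smul, sub_add_cancel_left, map_neg, hz, neg_zero,
        smul_zero]
    have hdiff : ∀ d, (F x').log d - (crossing ℓ n y * F x).log d =
        ∑ p ∈ s, defect A ℓ F p n y d • zmon k (j + 1) p := by
      intro d
      by_cases hnA : n ∈ A
      · exact hD n hnA x y x' (hcr.mono hsub) d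
      · have h1 : (crossing ℓ n y : Tw k r (j + 1)) = 1 := ext_log fun d => by
          rw [elem_log, one_log, hℓ _ ((hcr.mono hsub).onWall.gen_of_notMem H.arr hnA)]
          exact smul_zero _
        rw [h1, one_mul, H.congr _ _ (hcr.mono hsub).gen_left
          (hcr.sameSigns_of_notMem H.arr hsub hnA), sub_self]
        exact (Finset.sum_eq_zero fun p _ => by
          rw [defect_out hnA, AddMonoidHom.zero_apply, zero_smul]).symm
    refine ext_log fun d => ?_
    have hmem : (∑ p ∈ s, φ p x d • zmon k (j + 1) p) ∈ aug k P (j + 1) :=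
      mem_aug_of_lvlMap hj (hz _)
    rw [mul_log, hF' x hcr.gen_left, hF' x' hcr.gen_right, hbase _
      (Ideal.add_mem _ ((F x).mem d) hmem), map_add, base_of_lvlMap _ (hz _), elem_log, smul_add]
    have h1 := hdiff d
    rw [mul_log, elem_log] at h1
    have h2 : nu k n d • ∑ p ∈ s, c p y • zmon k (j + 1) p =
        ∑ p ∈ s, defect A ℓ F p n y d • zmon k (j + 1) p + ∑ p ∈ s, φ p x' d • zmon k (j + 1) p -
          ∑ p ∈ s, φ p x d • zmon k (j + 1) p := by
      rw [Finset.smul_sum, ← Finset.sum_add_distrib, ← Finset.sum_sub_distrib]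
      refine Finset.sum_congr rfl fun p hp => ?_
      rw [← add_smul, ← sub_smul, smul_smul, hc p y hp n hn x x' hcr d, nu_apply, mul_comm]
    rw [h2, ← h1]
    abel
  · intro p hp n hn y hy h
    obtain ⟨x, x', hcr⟩ := hy.exists_cross (hA'.prim n hn)
    obtain ⟨a, h1, h2⟩ := hφ p hp n hn x y x' hcr
    rw [huniq hp hn hcr h1, h2 h]
  · intro p hp n hn y y' hy hyy
    obtain ⟨x, x', hcr⟩ := hy.exists_cross (hA'.prim n hn)
    refine huniq hp hn hcr fun d => ?_
    have h1 := hc p y' hp n hn x x' (hcr.congr hn hyy) d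
    rw [← h1]
    by_cases hnA : n ∈ A
    · rw [H.defect_congr hnA y y' (hcr.mono hsub).onWall (hyy.mono hsub)]
    · rw [defect_out hnA, defect_out hnA]

end Refinement

/-! ### Construction of the scattering diagram order by order -/

section Stages

variable {k : Type*} [Field k] [CharZero k] {P : Type*} [AddCommMonoid P] {M : Type v}
  [AddCommGroup M] [Module.Free ℤ M] [Module.Finite ℤ M] {r : P →+ M} {j : ℕ}
  {A A' : Finset (DualLat M)} {n : DualLat M} {x y x' : RealSpan M}

open Tw

theorem wallLog_of_gen {w : Wall k r} (h : Adapted A w.cone) (hy : Gen A y) :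
    wallLog j w y = 0 := by
  obtain ⟨n, hn, hn0⟩ := h.exists_normal w.codim_one
  exact if_neg fun hm => hy n hn (hn0 y hm)

theorem sum_wallLog_widget (W : Widget k r) (y : RealSpan M) :
    ∑ i : W.Index, wallLog j (W.wall i) y = W.weightAt y • lg (red j W.func : Lvl k P j) := by
  unfold Widget.weightAt
  rw [Finset.sum_smul]
  refine Finset.sum_congr rfl fun i _ => ?_
  have h : lg (red j (W.wall i).func : Lvl k P j) = W.weight i • lg (red j W.func : Lvl k P j) := by
    change lg (red j (W.func ^ W.weight i) : Lvl k P j) = _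
    rw [map_pow, Units.val_pow_eq_pow_val, lg_pow (red_sub_one_mem W.exponents j)]
  have hcone : (W.wall i).cone = i.1 := rfl
  unfold wallLog
  rw [h, hcone]
  by_cases hy : y ∈ i.1
  · rw [if_pos hy, if_pos hy]
  · rw [if_neg hy, if_neg hy, zero_smul]

/-- The arrangement on which the potential of a widget is defined. -/
def Widget.arr (W : Widget k r) : Finset (DualLat M) := W.exists_potential.choose

/-- The logarithm, modulo `𝔪_P^j`, of the product of the functions of the walls through `y`,
for the walls of the widgets and the walls in a list. -/
def locLog {q : ℕ} (W : Fin q → Widget k r) (j : ℕ) (ws : List (Wall k r)) (y : RealSpan M) :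
    Lvl k P j :=
  (∑ i : (Σ a, (W a).Index), wallLog j ((W i.1).wall i.2) y) + (ws.map fun w => wallLog j w y).sum

/-- The walls in the list `ws`, together with those of the widgets, form a consistent diagram
modulo `𝔪_P^j`: there is a potential `F` on the chambers of the arrangement `A`. -/
structure IsStage {q : ℕ} (W : Fin q → Widget k r) (j : ℕ) (ws : List (Wall k r))
    (A : Finset (DualLat M)) (F : RealSpan M → Tw k r j) : Prop where
  arr : IsArr A
  widget_arr : ∀ a, (W a).arr ⊆ A
  widget_adapted : ∀ a, ∀ i : (W a).Index, Adapted A ((W a).wall i).cone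
  adapted : ∀ w ∈ ws, Adapted A w.cone
  not_incoming : ∀ w ∈ ws, ¬ w.IsIncoming
  mem : ∀ x, F x ∈ grp k r j ⊥
  congr : ∀ x x', Gen A x → SameSigns A x x' → F x = F x'
  cross : ∀ n ∈ A, ∀ x y x', IsCross A n x y x' → ∀ h : locLog W j ws y ∈ aug k P j,
    F x' = elem r (nu k n) (locLog W j ws y) h * F x

variable {q : ℕ} {W : Fin q → Widget k r} {ws : List (Wall k r)} {F : RealSpan M → Tw k r j}

theorem list_sum_mem {B : Type*} [AddCommMonoid B] (S : AddSubmonoid B) {α : Type*} (l : List α)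
    (f : α → B) (h : ∀ a ∈ l, f a ∈ S) : (l.map f).sum ∈ S := by
  refine S.list_sum_mem fun b hb => ?_
  obtain ⟨a, ha, rfl⟩ := List.mem_map.1 hb
  exact h a ha

theorem locLog_mem_aug (W : Fin q → Widget k r) (ws : List (Wall k r)) (y : RealSpan M) :
    locLog W j ws y ∈ aug k P j :=
  Ideal.add_mem _ (Ideal.sum_mem _ fun _ _ => wallLog_mem_aug _ _)
    (list_sum_mem (aug k P j).toAddSubmonoid ws _ fun _ _ => wallLog_mem_aug _ _)

theorem lvlMap_locLog (W : Fin q → Widget k r) (ws : List (Wall k r)) (y : RealSpan M) :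
    lvlMap k P j (locLog W (j + 1) ws y) = locLog W j ws y := by
  unfold locLog
  rw [map_add, map_sum, map_list_sum, List.map_map]
  simp only [lvlMap_wallLog, Function.comp_def]

theorem locLog_append (W : Fin q → Widget k r) (ws ws' : List (Wall k r)) (y : RealSpan M) :
    locLog W j (ws ++ ws') y = locLog W j ws y + (ws'.map fun w => wallLog j w y).sum := by
  simp [locLog, add_assoc]

theorem IsStage.locLog_congr (H : IsStage W j ws A F) {i : ℕ} {y y' : RealSpan M}
    (h : SameSigns A y y') : locLog W i ws y = locLog W i ws y' := by
  unfold locLog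
  congr 1
  · exact Finset.sum_congr rfl fun a _ => wallLog_congr (H.widget_adapted a.1 a.2) h
  · congr 1
    exact List.map_congr_left fun w hw => wallLog_congr (H.adapted w hw) h

theorem IsStage.locLog_of_gen (H : IsStage W j ws A F) {i : ℕ} (h : Gen A y) :
    locLog W i ws y = 0 := by
  unfold locLog
  rw [Finset.sum_eq_zero fun a _ => wallLog_of_gen (H.widget_adapted a.1 a.2) h, zero_add]
  refine List.sum_eq_zero fun b hb => ?_
  obtain ⟨w, hw, rfl⟩ := List.mem_map.1 hb
  exact wallLog_of_gen (H.adapted w hw) h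

theorem IsStage.locLog_mem_slab (H : IsStage W j ws A F) {i : ℕ} (h : OnWall A n y) :
    locLog W i ws y ∈ slab r i (nu k n) :=
  Submodule.add_mem _ (Submodule.sum_mem _ fun a _ => wallLog_mem_slab (H.widget_adapted a.1 a.2) h)
    (list_sum_mem (slab r i (nu k n)).toAddSubmonoid ws _ fun w hw =>
      wallLog_mem_slab (H.adapted w hw) h)

/-- Modulo `𝔪_P` all functions are trivial. -/
theorem exists_stage_one (W : Fin q → Widget k r) :
    ∃ (A : Finset (DualLat M)) (F : RealSpan M → Tw k r 1), IsStage W 1 [] A F := by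
  classical
  have h1 : ∀ a, ∃ A, IsArr A ∧ (W a).arr ⊆ A ∧
      ∀ i : (W a).Index, Adapted A ((W a).wall i).cone := by
    intro a
    obtain ⟨B, hB, h⟩ := exists_adapted_family
      (S := Set.range fun i : (W a).Index => ((W a).wall i).cone) (Set.finite_range _)
      (by rintro _ ⟨i, rfl⟩; exact ((W a).wall i).rational)
    exact ⟨(W a).arr ∪ B, (W a).exists_potential.choose_spec.1.union hB, Finset.subset_union_left,
      fun i => (h _ ⟨i, rfl⟩).mono Finset.subset_union_right⟩
  choose A hA hW had using h1
  have hsub : ∀ a, A a ⊆ Finset.univ.biUnion A := fun a =>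
    Finset.subset_biUnion_of_mem A (Finset.mem_univ a)
  have haug : ∀ z ∈ aug k P 1, z = 0 := by
    intro z hz
    simpa using pow_eq_zero_of_mem_aug hz
  refine ⟨Finset.univ.biUnion A, fun _ => 1, ⟨fun n hn => ?_, fun n hn => ?_⟩,
    fun a => (hW a).trans (hsub a), fun a i => (had a i).mono (hsub a), by simp, by simp,
    fun _ => one_mem _, fun _ _ _ _ => rfl, fun n _ x y x' _ h => ext_log fun d => ?_⟩
  · obtain ⟨a, -, ha⟩ := Finset.mem_biUnion.1 hn
    exact (hA a).prim n ha
  · obtain ⟨a, -, ha⟩ := Finset.mem_biUnion.1 hn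
    exact hsub a ((hA a).neg n ha)
  · rw [mul_one, elem_log, one_log, haug _ h, smul_zero]

/-- Far away in the direction `r p`, the only walls whose functions involve `z^p` are those of the
widgets, whose balancing condition yields a potential. -/
theorem IsStage.exists_farPotential (H : IsStage W j ws A F) (p : P)
    (hsub : A ⊆ A') : ∃ Ψ, IsFarPotential A' r p
      (fun y => (⟨locLog W (j + 1) ws y, locLog_mem_aug W ws y⟩ : aug k P (j + 1))) Ψ := by
  classical
  have : IsAddTorsionFree M := isAddTorsionFree_of_free
  -- the piecewise linear functions of the widgets, on the finer arrangement
  have key : ∀ a, ∃ Ψ : RealSpan M → DualLat M, (∀ x, Ψ x (W a).m₀ = 0) ∧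
      (∀ x x', Gen A' x → (∀ n ∈ A', n (W a).m₀ = 0 →
        SignType.sign (pair n x) = SignType.sign (pair n x')) → Ψ x = Ψ x') ∧
      ∀ n ∈ A', ∀ x y x', IsCross A' n x y x' →
        Ψ x' = Ψ x + (W a).hyp.weightAt (proj (W a).m₀ y) • n := by
    intro a
    obtain ⟨h1, h2, Ψ, h3, h4, h5, h6⟩ := (W a).exists_potential.choose_spec
    have hs : (W a).arr ⊆ A' := (H.widget_arr a).trans hsub
    refine ⟨Ψ, h3, fun x x' hx h => h4 x x' (hx.mono hs) fun n hn => h n (hs hn) (h2 n hn), ?_⟩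
    intro n hn x y x' hc
    by_cases hna : n ∈ (W a).arr
    · exact h5 n hna x y x' (hc.mono hs)
    · rw [h4 x x' (hc.mono hs).gen_left (hc.sameSigns_of_notMem h1 hs hna)]
      have : (W a).hyp.weightAt (proj (W a).m₀ y) = 0 := by
        by_contra h
        obtain ⟨n', hn', h0⟩ := h6 y h
        exact (hc.mono hs).onWall.gen_of_notMem h1 hna n' hn' h0
      rw [this, zero_smul, add_zero]
  choose Ψ hΨ0 hΨc hΨ using key
  -- the coefficient of `z^p` in the logarithm of the function of a widget
  let c : Fin q → k := fun a => coef k (j + 1) p (lg (red (j + 1) (W a).func : Lvl k P (j + 1)))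
  have hdir : ∀ a, c a ≠ 0 → ∃ b : ℕ, 0 < b ∧ r p = b • (W a).m₀ := fun a ha => by
    by_contra h
    exact ha (coef_of_mem_dirSub (lg_red_mem (W a).exponents (j + 1)) h)
  have hmap : ∀ a, c a ≠ 0 → ∀ n : DualLat M, n (W a).m₀ = 0 ↔ n (r p) = 0 := by
    intro a ha n
    obtain ⟨b, hb, h⟩ := hdir a ha
    rw [h, map_nsmul, smul_eq_zero]
    exact ⟨Or.inr, fun h => h.resolve_left hb.ne'⟩
  have happ : ∀ (x : RealSpan M) (d : M),
      (∑ a, (AddMonoidHom.mulLeft (c a)).comp (nu k (Ψ a x))) d =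
      ∑ a, c a * (Ψ a x d : k) := by
    intro x d
    rw [AddMonoidHom.finsetSum_apply]
    rfl
  refine ⟨fun x => ∑ a, (AddMonoidHom.mulLeft (c a)).comp (nu k (Ψ a x)), ?_, ?_, ?_⟩
  · intro x x' hx h
    refine AddMonoidHom.ext fun d => ?_
    rw [happ, happ]
    refine Finset.sum_congr rfl fun a _ => ?_
    by_cases ha : c a = 0
    · rw [ha, zero_mul, zero_mul]
    · rw [hΨc a x x' hx fun n hn h0 => h n hn ((hmap a ha n).1 h0)]
  · intro x
    rw [happ]
    refine Finset.sum_eq_zero fun a _ => ?_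
    by_cases ha : c a = 0
    · rw [ha, zero_mul]
    · rw [(hmap a ha _).1 (hΨ0 a x), Int.cast_zero, mul_zero]
  · intro n hn hnp x y x' hc d
    rw [happ, happ]
    have h1 : coef k (j + 1) p (locLog W (j + 1) ws (far A' (r p) y)) =
        ∑ a, ((W a).hyp.weightAt (proj (W a).m₀ y) : k) * c a := by
      have hfar : ∀ n ∈ A', n (r p) ≠ 0 →
          SignType.sign (pair n (far A' (r p) y)) = SignType.sign (n (r p) : ℝ) :=
        fun n hn h => sign_pair_far hn h
      unfold locLog
      rw [map_add, map_list_sum, List.map_map, List.sum_eq_zero, add_zero, Fintype.sum_sigma,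
        map_sum]
      · refine Finset.sum_congr rfl fun a _ => ?_
        rw [sum_wallLog_widget, map_nsmul, nsmul_eq_mul]
        change _ * c a = _
        by_cases ha : c a = 0
        · rw [ha, mul_zero, mul_zero]
        · obtain ⟨b, hb, hbp⟩ := hdir a ha
          rw [(W a).weightAt_eq (A := A') (fun i => (H.widget_adapted a i).mono hsub)]
          · congr 3
            rw [far, map_add, map_smul, hbp, incl_nsmul, map_smul, proj_incl]
            simp
          · intro n hn h0
            rw [hfar n hn (fun h => h0 ((hmap a ha n).2 h)), hbp, map_nsmul]
            have : (0 : ℝ) < b := by exact_mod_cast hb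
            rw [nsmul_eq_mul, Int.cast_mul, sign_mul]
            simp [hb]
      · intro z hz
        obtain ⟨w, hw, rfl⟩ := List.mem_map.1 hz
        by_contra h0
        exact H.not_incoming w hw (Wall.isIncoming_of_far ((H.adapted w hw).mono hsub) hfar h0)
    change _ = _ + _ * coef k (j + 1) p (locLog W (j + 1) ws (far A' (r p) y))
    rw [h1, Finset.mul_sum, ← Finset.sum_add_distrib]
    refine Finset.sum_congr rfl fun a _ => ?_
    rw [hΨ a n hn x y x' hc, LinearMap.add_apply, LinearMap.smul_apply]
    push_cast [nsmul_eq_mul]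
    ring

/-- Passing from one order to the next by the addition of non-incoming walls. -/
theorem IsStage.exists_succ (hj : j ≠ 0) (H : IsStage W j ws A F) :
    ∃ (new : List (Wall k r)) (A' : Finset (DualLat M)) (F' : RealSpan M → Tw k r (j + 1)),
      IsStage W (j + 1) (ws ++ new) A' F' ∧ ∀ w ∈ new, red j w.func = 1 := by
  classical
  let ℓ : RealSpan M → aug k P (j + 1) := fun y => ⟨locLog W (j + 1) ws y, locLog_mem_aug W ws y⟩
  have hlift : ∀ a : grp k r j ⊥, ∃ b ∈ grp k r (j + 1) ⊥, b.red = a.1 :=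
      fun a => exists_lift_grp a.2
  choose L hLm hL using hlift
  have hlt : IsLift A ℓ (fun x => L ⟨F x, H.mem x⟩) := by
    refine ⟨H.arr, fun x => hLm _, fun x x' hx h => ?_, fun n hn y hy => H.locLog_mem_slab hy,
      fun y y' h => Subtype.ext (H.locLog_congr h), fun n hn x y x' hc => ?_⟩
    · congr 2
      exact H.congr x x' hx h
    · rw [hL, red_mul, hL, red_elem]
      have h1 : ∀ z (hz : z ∈ aug k P j), z = locLog W j ws y →
          F x' = elem r (nu k n) z hz * F x := by
        rintro z hz rfl
        exact H.cross n hn x y x' hc hz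
      exact h1 _ _ (lvlMap_locLog W ws y)
  obtain ⟨A', s, c, F', hA', hsub, hs, hm, hcongr, hcross, hc0, hcc⟩ := hlt.exists_refinement hj
    (fun y hy => Subtype.ext (H.locLog_of_gen hy)) fun p _ A' _ hsub => H.exists_farPotential p hsub
  obtain ⟨R, hR, hRu⟩ := exists_representatives A'
  -- the new walls: one for each cell and each exponent with a nonzero coefficient
  let T : Finset (P × RealSpan M) :=
    (s ×ˢ R).filter fun t => c t.1 t.2 ≠ 0 ∧ ∃ n ∈ A', OnWall A' n t.2
  have hT : ∀ t ∈ T, ∃ w : Wall k r, w.cone = cell A' t.2 ∧ red j w.func = 1 ∧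
      lg (red (j + 1) w.func : Lvl k P (j + 1)) = c t.1 t.2 • zmon k (j + 1) t.1 ∧
      ¬ w.IsIncoming := by
    intro t ht
    obtain ⟨h1, h2, n, hn, hy⟩ := Finset.mem_filter.1 ht
    have h3 := (Finset.mem_product.1 h1).1
    have h4 : ¬ (n (r t.1) ≠ 0 ∨ incl (r t.1) ∈ cell A' t.2) := fun h => h2 (hc0 _ h3 n hn _ hy h)
    push Not at h4
    obtain ⟨w, hw1, hw2, hw3, hw4⟩ :=
        exists_wall hA' hn hy (c t.1 t.2) (hs _ h3).1 hj (hs _ h3).2 h4.1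
    exact ⟨w, hw1, hw2, hw3, fun h => h4.2 (hw4 h)⟩
  choose w hw1 hw2 hw3 hw4 using hT
  let new : List (Wall k r) := T.attach.toList.map fun t => w t.1 t.2
  have hnew : ∀ v ∈ new, ∃ t, ∃ ht : t ∈ T, v = w t ht := by
    intro v hv
    obtain ⟨t, -, rfl⟩ := List.mem_map.1 hv
    exact ⟨t.1, t.2, rfl⟩
  have hloc : ∀ n ∈ A', ∀ y, OnWall A' n y → locLog W (j + 1) (ws ++ new) y =
      (ℓ y).1 + ∑ p ∈ s, c p y • zmon k (j + 1) p := by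
    intro n hn y hy
    rw [locLog_append]
    congr 1
    obtain ⟨y₀, hy₀, hyy⟩ := hR y
    have hy₀w := hy.congr hn hyy.symm
    have h1 : (new.map fun v => wallLog (j + 1) v y).sum =
        ∑ t ∈ T, if y ∈ cell A' t.2 then c t.1 t.2 • zmon k (j + 1) t.1 else 0 := by
      simp only [new, List.map_map]
      rw [Finset.sum_map_toList, ← Finset.sum_attach T]
      refine Finset.sum_congr rfl fun t _ => ?_
      simp only [Function.comp_def, wallLog, hw1, hw3]
    rw [h1, Finset.sum_filter, Finset.sum_product]
    refine Finset.sum_congr rfl fun p hp => ?_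
    rw [Finset.sum_eq_single y₀]
    · have hcy : c p y = c p y₀ := hcc p hp n hn y y₀ hy hyy.symm
      have hmem : y ∈ cell A' y₀ := ((adapted_cell A' y₀).mem_congr hyy).1 self_mem_cell
      by_cases h0 : c p y₀ = 0
      · rw [hcy, h0, zero_smul, ite_self, ite_self]
      · rw [if_pos ⟨h0, n, hn, hy₀w⟩, if_pos hmem, hcy]
    · intro y₁ hy₁ hne
      split_ifs with h2 h3
      · obtain ⟨-, n₁, hn₁, hyw⟩ := h2
        have h4 := (hyw.mem_cell_iff hA' hn₁ hn hy).1 h3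
        exact absurd (hRu _ hy₁ _ hy₀ (h4.trans hyy.symm)) hne
      · rfl
      · rfl
    · exact fun h => absurd hy₀ h
  refine ⟨new, A', F', ⟨hA', fun a => (H.widget_arr a).trans hsub,
    fun a i => (H.widget_adapted a i).mono hsub, ?_, ?_, hm, hcongr, ?_⟩, ?_⟩
  · intro v hv
    rcases List.mem_append.1 hv with h | h
    · exact (H.adapted v h).mono hsub
    · obtain ⟨t, ht, rfl⟩ := hnew v h
      rw [hw1]
      exact adapted_cell _ _
  · intro v hv
    rcases List.mem_append.1 hv with h | h
    · exact H.not_incoming v h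
    · obtain ⟨t, ht, rfl⟩ := hnew v h
      exact hw4 t ht
  · intro n hn x y x' hcr h
    have e := hloc n hn y hcr.onWall
    have h1 : ∀ z (hz : z ∈ aug k P (j + 1)), z = (ℓ y).1 + ∑ p ∈ s, c p y • zmon k (j + 1) p →
          F' x' = elem r (nu k n) z hz * F' x := by
      rintro z hz rfl
      exact hcross n hn x y x' hcr hz
    exact h1 _ h e
  · intro v hv
    obtain ⟨t, ht, rfl⟩ := hnew v hv
    exact hw2 t ht

/-- The walls added to the widgets, order by order. -/
theorem exists_walls (W : Fin q → Widget k r) : ∃ new : ℕ → List (Wall k r), ∀ j,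
    (∀ w ∈ new j, red (j + 1) w.func = 1) ∧ ∃ (A : Finset (DualLat M))
      (F : RealSpan M → Tw k r (j + 1)), IsStage W (j + 1) ((List.range j).flatMap new) A F := by
  let X : ℕ → Type _ := fun j => {ws : List (Wall k r) //
    ∃ (A : Finset (DualLat M)) (F : RealSpan M → Tw k r (j + 1)), IsStage W (j + 1) ws A F}
  have step : ∀ j (S : X j), ∃ new : List (Wall k r), (∃ (A : Finset (DualLat M))
      (F : RealSpan M → Tw k r (j + 2)), IsStage W (j + 2) (S.1 ++ new) A F) ∧
      ∀ w ∈ new, red (j + 1) w.func = 1 := by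
    rintro j ⟨ws, A, F, h⟩
    obtain ⟨new, A', F', h1, h2⟩ := h.exists_succ (Nat.succ_ne_zero j)
    exact ⟨new, ⟨A', F', h1⟩, h2⟩
  choose nw h1 h2 using step
  let st : ∀ j, X j := fun j => Nat.rec ⟨[], exists_stage_one W⟩
    (fun j S => ⟨S.1 ++ nw j S, h1 j S⟩) j
  have hst : ∀ j, (st j).1 = (List.range j).flatMap fun i => nw i (st i) := by
    intro j
    induction j with
    | zero => rfl
    | succ j ih =>
      rw [List.range_succ, List.flatMap_append, ← ih]
      simp [st]
  exact ⟨fun i => nw i (st i), fun j => ⟨h2 j _, by rw [← hst]; exact (st j).2⟩⟩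

end Stages

/-! ### From potentials to consistency -/

section Walls

variable {M : Type v} [AddCommGroup M] [Module.Free ℤ M] [Module.Finite ℤ M]
  {A : Finset (DualLat M)} {n : DualLat M} {x z : RealSpan M} {σ : PointedCone ℝ (RealSpan M)}

/-- A point of the relative interior of a cone of codimension one stays in the cone when it moves
a little in the hyperplane of the cone. -/
theorem Adapted.mem_iff_of_near (h : Adapted A σ) (hd : dim σ + 1 = ambientDim M) (hn : n ≠ 0)
    (hx : x ∈ σ → x ∈ relInt σ ∧ ∀ y ∈ σ, pair n y = 0) (hz : Near A x z) (h0 : pair n z = 0) :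
    z ∈ σ ↔ x ∈ σ := by
  refine ⟨h.mem_of_near hz, fun hxσ => ?_⟩
  obtain ⟨F, hF, hFσ⟩ := h
  obtain ⟨h1, h2⟩ := hx hxσ
  have h3 : z ∈ lin σ := by rw [lin_eq_ker hn h2 hd]; exact h0
  refine (hFσ z).2 fun n' hn' => ?_
  by_cases h4 : pair n' x = 0
  · exact (zero_of_mem_lin (((mem_relInt_iff hFσ).1 h1).2 n' hn' h4) h3).ge
  · exact nonneg_of_sign_eq (hz n' (hF hn') h4).symm ((hFσ x).1 hxσ n' hn')

theorem exists_onWall_near (hA : IsArr A) (hn : n ∈ A) (hx : pair n x = 0) :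
    ∃ z, OnWall A n z ∧ Near A x z := by
  classical
  obtain ⟨m, hm⟩ := exists_pos_of_ne_zero (hA.prim n hn).ne_zero
  obtain ⟨A', hA', -, hcl⟩ := exists_closedAlong hA {m}
  obtain ⟨v, hv⟩ := exists_gen hA'
  have hw := foot_onWall hA (hcl m (by simp)) hn hm.ne' hv
  obtain ⟨ε, h1, h2 : 0 < ε⟩ :=
    ((eventually_near A x (foot m n v)).and self_mem_nhdsWithin).exists
  refine ⟨_, ⟨by rw [map_add, hx, map_smul, hw.1]; simp, fun n' hn' h0 => ?_⟩, h1⟩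
  by_cases h3 : pair n' x = 0
  · rw [map_add, h3, zero_add, map_smul, smul_eq_mul] at h0
    exact hw.2 n' hn' ((mul_eq_zero.1 h0).resolve_left h2.ne')
  · exact absurd ((sign_eq_iff_zero (h1 n' hn' h3)).1 h0) h3

theorem Adapted.mem_normal (hA : IsArr A) (h : Adapted A σ) (hd : dim σ + 1 = ambientDim M)
    (hn : IsPrimitive n) (h0 : ∀ y ∈ σ, pair n y = 0) : n ∈ A := by
  obtain ⟨n', hn', h1⟩ := h.exists_normal hd
  have h2 : ∀ y : RealSpan M, pair n' y = 0 → pair n y = 0 := fun y hy => by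
    have : y ∈ lin σ := by rw [lin_eq_ker (hA.prim n' hn').ne_zero h1 hd]; exact hy
    exact zero_of_mem_lin h0 this
  rcases (hA.prim n' hn').eq_or_eq_neg_of_ker hn h2 with rfl | rfl
  exacts [hn', hA.neg n' hn']

end Walls

section OrderedProducts

/-- A locally constant function on an interval, except for finitely many jumps by multiplication
from the left, changes by the ordered product of the jumps. -/
theorem eq_ordered_prod {G : Type*} [Monoid G] {α : Type*} (f : ℝ → G) (θ : ℝ × α → G) {b : ℝ}
    (L : List (ℝ × α)) : ∀ {a : ℝ}, a ≤ b → L.Pairwise (fun p q => p.1 < q.1) →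
    (∀ p ∈ L, p.1 ∈ Set.Ioo a b) →
    (∀ t ∈ Set.Icc a b, (∀ p ∈ L, p.1 ≠ t) → ∀ᶠ s in 𝓝 t, f s = f t) →
    (∀ p ∈ L, ∃ g, (∀ᶠ s in 𝓝[<] p.1, f s = g) ∧ ∀ᶠ s in 𝓝[>] p.1, f s = θ p * g) →
    f b = (L.map θ).reverse.prod * f a := by
  have hconst : ∀ a c : ℝ, a ≤ c → (∀ t ∈ Set.Icc a c, ∀ᶠ s in 𝓝 t, f s = f t) → f a = f c := by
    intro a c hac h
    have hl : IsLocallyConstant fun t : Set.Icc a c => f t := by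
      rw [IsLocallyConstant.iff_eventually_eq]
      exact fun t => continuous_subtype_val.continuousAt.eventually (h t t.2)
    have : PreconnectedSpace (Set.Icc a c) := Subtype.preconnectedSpace isPreconnected_Icc
    exact hl.apply_eq_of_preconnectedSpace ⟨a, le_rfl, hac⟩ ⟨c, hac, le_rfl⟩
  induction L with
  | nil =>
    intro a hab _ _ h _
    rw [hconst a b hab fun t ht => h t ht (by simp)]
    simp
  | cons p L ih =>
    intro a hab hs hin hloc hj
    rw [List.pairwise_cons] at hs
    obtain ⟨g, h1, h2⟩ := hj p (by simp)
    have hp := hin p (by simp)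
    obtain ⟨s, ⟨h3, h4⟩⟩ := (h1.and (Ioo_mem_nhdsLT hp.1)).exists
    have hnext : ∀ᶠ s in 𝓝[>] p.1, ∀ q ∈ L, s < q.1 := by
      have : ∀ q ∈ L, ∀ᶠ s in 𝓝[>] p.1, s < q.1 := fun q hq =>
        nhdsWithin_le_nhds (gt_mem_nhds (hs.1 q hq))
      clear * - this
      induction L with
      | nil => simp
      | cons a L ih =>
        filter_upwards [this a (by simp), ih fun q hq => this q (by simp [hq])] with s h1 h2
        simpa using ⟨h1, fun a b h => h2 _ h⟩
    obtain ⟨s', ⟨h5, h6⟩, h7⟩ := ((h2.and (Ioo_mem_nhdsGT hp.2)).and hnext).exists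
    have e1 : f a = f s := hconst a s h4.1.le fun t ht => by
      refine hloc t ⟨ht.1, ht.2.trans (h4.2.trans hp.2).le⟩ fun q hq => ?_
      rcases List.mem_cons.1 hq with rfl | hq
      · exact (ht.2.trans_lt h4.2).ne'
      · exact ((ht.2.trans_lt h4.2).trans (hs.1 q hq)).ne'
    have e2 := ih (a := s') h6.2.le hs.2 (fun q hq => ⟨h7 q hq, (hin q (by simp [hq])).2⟩)
      (fun t ht hne => hloc t ⟨(hp.1.trans h6.1).le.trans ht.1, ht.2⟩ fun q hq => by
        rcases List.mem_cons.1 hq with rfl | hq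
        · exact (h6.1.trans_le ht.1).ne
        · exact hne q hq) fun q hq => hj q (by simp [hq])
    rw [e2, h5, e1, h3]
    simp [mul_assoc]

end OrderedProducts

section Consistency

variable {k : Type*} [Field k] [CharZero k] {P : Type*} [AddCommMonoid P] {M : Type v}
  [AddCommGroup M] {r : P →+ M} {j : ℕ} {A : Finset (DualLat M)} {n : DualLat M}
  {x y x' : RealSpan M}

open Tw ScatteringDiagram

variable (D : ScatteringDiagram k r)

/-- The logarithm of the product of the functions of the walls through a point. -/
def ScatteringDiagram.logAt (j : ℕ) (y : RealSpan M) : Lvl k P j := lg (D.funcAt j y : Lvl k P j)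

theorem ScatteringDiagram.logAt_mem_aug (y : RealSpan M) : D.logAt j y ∈ aug k P j := lg_mem _

open Classical in
theorem ScatteringDiagram.funcAt_eq_prod (T : Finset D.ι) (hT : D.active j ⊆ T) (y : RealSpan M) :
    D.funcAt j y = ∏ i ∈ T, if y ∈ (D.wall i).cone then red j (D.wall i).func else 1 := by
  unfold funcAt
  rw [finprod_mem_def, finprod_eq_prod_of_mulSupport_subset]
  · exact Finset.prod_congr rfl fun i _ => by simp [Set.mulIndicator]
  · intro i hi
    refine hT ?_
    rw [Function.mem_mulSupport, Set.mulIndicator_apply] at hi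
    split_ifs at hi with h
    · exact hi
    · exact absurd rfl hi

theorem prod_units {ι : Type*} (T : Finset ι) (f : ι → (Lvl k P j)ˣ)
    (hf : ∀ i, (f i : Lvl k P j) - 1 ∈ aug k P j) :
    ((∏ i ∈ T, f i : (Lvl k P j)ˣ) : Lvl k P j) - 1 ∈ aug k P j ∧
      lg ((∏ i ∈ T, f i : (Lvl k P j)ˣ) : Lvl k P j) = ∑ i ∈ T, lg (f i : Lvl k P j) := by
  classical
  induction T using Finset.induction_on with
  | empty => simp
  | insert i T hi ih =>
    rw [Finset.prod_insert hi, Finset.sum_insert hi, Units.val_mul, ← ih.2]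
    exact ⟨mul_sub_one_mem (hf i) ih.1, lg_mul (hf i) ih.1⟩

theorem ScatteringDiagram.funcAt_sub_one_mem_and (T : Finset D.ι) (hT : D.active j ⊆ T)
    (y : RealSpan M) : (D.funcAt j y : Lvl k P j) - 1 ∈ aug k P j ∧
      D.logAt j y = ∑ i ∈ T, wallLog j (D.wall i) y := by
  classical
  unfold logAt
  rw [D.funcAt_eq_prod T hT y]
  obtain ⟨h1, h2⟩ := prod_units T
    (fun i => if y ∈ (D.wall i).cone then red j (D.wall i).func else 1) fun i => by
      split_ifs
      exacts [red_sub_one_mem (D.wall i).exponents j, by simp]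
  refine ⟨h1, h2.trans (Finset.sum_congr rfl fun i _ => ?_)⟩
  unfold wallLog
  split_ifs
  exacts [rfl, by simp]

theorem ScatteringDiagram.logAt_eq_sum (T : Finset D.ι) (hT : D.active j ⊆ T) (y : RealSpan M) :
    D.logAt j y = ∑ i ∈ T, wallLog j (D.wall i) y := (D.funcAt_sub_one_mem_and T hT y).2

theorem ScatteringDiagram.funcAt_sub_one_mem (y : RealSpan M) :
    (D.funcAt j y : Lvl k P j) - 1 ∈ aug k P j :=
  (D.funcAt_sub_one_mem_and (D.finite j).toFinset (by simp [active]) y).1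

theorem ScatteringDiagram.logAt_congr
    (h : ∀ i ∈ D.active j, x ∈ (D.wall i).cone ↔ y ∈ (D.wall i).cone) :
    D.logAt j x = D.logAt j y := by
  rw [D.logAt_eq_sum (D.finite j).toFinset (by simp [active]),
    D.logAt_eq_sum (D.finite j).toFinset (by simp [active])]
  refine Finset.sum_congr rfl fun i hi => ?_
  have h1 := h i (by simpa [active] using hi)
  unfold wallLog
  by_cases hx : x ∈ (D.wall i).cone
  · rw [if_pos hx, if_pos (h1.1 hx)]
  · rw [if_neg hx, if_neg (fun h => hx (h1.2 h))]

theorem ScatteringDiagram.logAt_eq_zero (h : y ∉ D.supp j) : D.logAt j y = 0 := by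
  rw [D.logAt_eq_sum (D.finite j).toFinset (by simp [active])]
  exact Finset.sum_eq_zero fun i hi => if_neg fun hy => h ⟨i, by simpa [active] using hi, hy⟩

/-- The path-ordered product acts like the product of the group elements of the crossings. -/
theorem ScatteringDiagram.acts_pathProduct (γ : ℝ → RealSpan M) (L : List (ℝ × DualLat M)) :
    Acts (D.pathProduct j γ L) ((L.map fun p =>
      (elem r (nu k p.2) (D.logAt j (γ p.1)) (D.logAt_mem_aug _) : Tw k r j)).reverse.prod) := by
  unfold pathProduct
  induction L with
  | nil => exact acts_one
  | cons p L ih =>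
    simp only [List.map_cons, List.reverse_cons, List.prod_append, List.prod_cons, List.prod_nil,
      mul_one]
    exact ih.mul (acts_wallCross (D.funcAt_sub_one_mem _) p.2)

/-- `F` is a potential for the wall crossings of `D` modulo `𝔪_P^j`. -/
structure IsPotential (j : ℕ) (A : Finset (DualLat M)) (F : RealSpan M → Tw k r j) : Prop where
  arr : IsArr A
  adapted : ∀ i ∈ D.active j, Adapted A (D.wall i).cone
  mem : ∀ x, F x ∈ grp k r j ⊥
  congr : ∀ x x', Gen A x → SameSigns A x x' → F x = F x'
  cross : ∀ n ∈ A, ∀ x y x', IsCross A n x y x' →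
    F x' = elem r (nu k n) (D.logAt j y) (D.logAt_mem_aug _) * F x

variable [Module.Free ℤ M] [Module.Finite ℤ M] {D} {F : RealSpan M → Tw k r j}

theorem elem_eq_one {ν : M →+ k} {ℓ : Lvl k P j} (hℓ : ℓ ∈ aug k P j) (h : ℓ = 0) :
    (elem r ν ℓ hℓ : Tw k r j) = 1 := ext_log fun d => by rw [elem_log, h, smul_zero, one_log]

/-- The potential is constant near `y` as long as no wall is met. -/
theorem IsPotential.eq_of_near (H : IsPotential D j A F) (hx : Gen A x) (hx' : Gen A x')
    (hyx : Near A y x) (hyx' : Near A y x')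
    (hb : ∀ b, Near A y b → (∀ n ∈ A, SignType.sign (pair n x) = SignType.sign (pair n x') →
      SignType.sign (pair n b) = SignType.sign (pair n x)) → b ∉ D.supp j) : F x = F x' := by
  refine connect (Q := fun a c => F a = F c) H.arr (fun a b ha h => H.congr a b ha h)
    (fun a b c h h' => h.trans h') hx hx' fun n hn a b c hc hs => ?_
  have h1 : b ∉ D.supp j := hb b (fun n' hn' h0 => by
    rw [hs n' hn' ((hyx n' hn' h0).trans (hyx' n' hn' h0).symm), hyx n' hn' h0]) hs
  rw [H.cross n hn a b c hc, elem_eq_one _ (D.logAt_eq_zero h1), one_mul]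

theorem IsPotential.notMem_supp (H : IsPotential D j A F) (hy : y ∉ D.supp j) (h : Near A y x) :
    x ∉ D.supp j := fun ⟨i, hi, hx⟩ => hy ⟨i, hi, (H.adapted i hi).mem_of_near h hx⟩

/-- The value of a potential on the chambers at `y`. -/
def chamberValue (A : Finset (DualLat M)) (hA : IsArr A) (F : RealSpan M → Tw k r j)
    (y : RealSpan M) : Tw k r j := F (exists_gen_near hA y).choose

theorem IsPotential.chamberValue_eq (H : IsPotential D j A F) (hy : y ∉ D.supp j) (hx : Gen A x)
    (h : Near A y x) : chamberValue A H.arr F y = F x :=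
  H.eq_of_near (exists_gen_near H.arr y).choose_spec.1 hx (exists_gen_near H.arr y).choose_spec.2 h
    fun _ hb _ => H.notMem_supp hy hb

theorem eventually_near_path {γ : ℝ → RealSpan M} (hγ : ∀ n, Continuous fun t => pair n (γ t))
    (A : Finset (DualLat M)) (t : ℝ) : ∀ᶠ s in 𝓝 t, Near A (γ t) (γ s) := by
  have : ∀ n ∈ A, ∀ᶠ s in 𝓝 t, pair n (γ t) ≠ 0 →
      SignType.sign (pair n (γ s)) = SignType.sign (pair n (γ t)) := by
    intro n _
    rcases lt_trichotomy (pair n (γ t)) 0 with h | h | h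
    · filter_upwards [(hγ n).continuousAt.eventually (gt_mem_nhds h)] with s hs _
      rw [sign_neg hs, sign_neg h]
    · exact Filter.Eventually.of_forall fun s h0 => absurd h h0
    · filter_upwards [(hγ n).continuousAt.eventually (lt_mem_nhds h)] with s hs _
      rw [sign_pos hs, sign_pos h]
  exact (Filter.eventually_all_finset A).2 this

/-- Path-ordered products along paths are differences of values of the potential. -/
theorem IsPotential.pathProduct_mul (H : IsPotential D j A F) {γ : ℝ → RealSpan M}
    (hγ : ∀ n, Continuous fun t => pair n (γ t)) {a b : ℝ} (hab : a ≤ b)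
    {L : List (ℝ × DualLat M)} (hL : D.IsCrossingList j γ a b L) :
    chamberValue A H.arr F (γ b) = (L.map fun p =>
      (elem r (nu k p.2) (D.logAt j (γ p.1)) (D.logAt_mem_aug _) : Tw k r j)).reverse.prod *
        chamberValue A H.arr F (γ a) := by
  refine eq_ordered_prod (fun t => chamberValue A H.arr F (γ t)) _ L hab hL.sorted hL.interior ?_ ?_
  · intro t ht hne
    have h1 : γ t ∉ D.supp j := fun h => by
      obtain ⟨n, hn⟩ := (hL.mem_iff t ht).1 h
      exact hne _ hn rfl
    filter_upwards [eventually_near_path hγ A t] with s hs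
    obtain ⟨x, hx, hsx⟩ := exists_gen_near H.arr (γ s)
    rw [H.chamberValue_eq (H.notMem_supp h1 hs) hx hsx, H.chamberValue_eq h1 hx (hs.trans hsx)]
  · intro p hp
    set y := γ p.1 with hy
    have ht : p.1 ∈ Set.Icc a b := Set.Ioo_subset_Icc_self (hL.interior p hp)
    have hsing := hL.avoids _ ht
    obtain ⟨i₀, hi₀, hyi₀⟩ := (hL.mem_iff _ ht).2 ⟨p.2, hp⟩
    have hcr := hL.crosses p hp
    have hnA : p.2 ∈ A := (H.adapted i₀ hi₀).mem_normal H.arr (D.wall i₀).codim_one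
      (hcr i₀ hi₀ hyi₀).primitive (hcr i₀ hi₀ hyi₀).normal
    have hny : pair p.2 y = 0 := (hcr i₀ hi₀ hyi₀).normal y hyi₀
    -- the walls near `y` all lie in the hyperplane `p.2 = 0`
    have hwalls : ∀ b, Near A y b → b ∈ D.supp j → pair p.2 b = 0 := by
      rintro b hb ⟨i, hi, hbi⟩
      exact (hcr i hi ((H.adapted i hi).mem_of_near hb hbi)).normal b hbi
    obtain ⟨z, hz, hyz⟩ := exists_onWall_near H.arr hnA hny
    obtain ⟨u, u', hc⟩ := hz.exists_cross (H.arr.prim _ hnA)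
    have hlog : D.logAt j z = D.logAt j y := by
      refine D.logAt_congr fun i hi => (H.adapted i hi).mem_iff_of_near (D.wall i).codim_one
        (H.arr.prim _ hnA).ne_zero (fun hyi => ⟨?_, (hcr i hi hyi).normal⟩) hyz hz.1
      by_contra h
      exact hsing (Or.inl ⟨i, hi, hyi, h⟩)
    have hval : ∀ s, Near A y (γ s) → ∀ v, Gen A v → Near A y v →
        SignType.sign (pair p.2 (γ s)) = SignType.sign (pair p.2 v) → pair p.2 v ≠ 0 →
        chamberValue A H.arr F (γ s) = F v := by
      intro s hs v hv hyv hsv hv0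
      have hs0 : pair p.2 (γ s) ≠ 0 := fun h => hv0 ((sign_eq_iff_zero hsv).1 h)
      obtain ⟨x, hx, hsx⟩ := exists_gen_near H.arr (γ s)
      rw [H.chamberValue_eq (fun h => hs0 (hwalls _ hs h)) hx hsx]
      refine H.eq_of_near hx hv (hs.trans hsx) hyv fun b hb hb' h => ?_
      have h1 := hb' _ hnA ((hsx _ hnA hs0).trans hsv)
      exact hx _ hnA ((sign_eq_iff_zero h1).1 (hwalls b hb h))
    obtain ⟨δ, hδ, hbef⟩ := (hcr i₀ hi₀ hyi₀).before
    obtain ⟨δ', hδ', haft⟩ := (hcr i₀ hi₀ hyi₀).after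
    refine ⟨F u, ?_, ?_⟩
    · filter_upwards [nhdsWithin_le_nhds (eventually_near_path hγ A p.1),
        Ioo_mem_nhdsLT (show p.1 - δ < p.1 by linarith)] with s hs hs'
      exact hval s hs u hc.gen_left (hyz.trans hc.near_left)
        (by rw [sign_pos (hbef s hs'), sign_pos hc.pos]) hc.pos.ne'
    · have e : F u' = elem r (nu k p.2) (D.logAt j y) (D.logAt_mem_aug _) * F u := by
        rw [H.cross _ hnA _ _ _ hc]
        congr 1
        exact ext_log fun d => by rw [elem_log, elem_log, hlog]
      rw [← e]
      filter_upwards [nhdsWithin_le_nhds (eventually_near_path hγ A p.1),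
        Ioo_mem_nhdsGT (show p.1 < p.1 + δ' by linarith)] with s hs hs'
      exact hval s hs u' hc.gen_right (hyz.trans hc.near_right)
        (by rw [sign_neg (haft s hs'), sign_neg hc.neg]) hc.neg.ne

theorem continuous_pair_circle (x u w : RealSpan M) (ε : ℝ) (n : DualLat M) :
    Continuous fun t => pair n (circle x u w ε t) := by
  simp only [circle, map_add, map_smul, smul_eq_mul]
  fun_prop

theorem circle_two_pi (x u w : RealSpan M) (ε : ℝ) :
    circle x u w ε (2 * Real.pi) = circle x u w ε 0 := by
  simp [circle]

theorem subsingleton_hom_zero :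
    Subsingleton (AddMonoidAlgebra (Lvl k P 0) M →+* AddMonoidAlgebra (Lvl k P 0) M) := by
  have h1 : Subsingleton (Lvl k P 0) := Ideal.Quotient.subsingleton_iff.2 (by simp)
  have h2 : Subsingleton (AddMonoidAlgebra (Lvl k P 0) M) :=
    subsingleton_of_zero_eq_one (by
      have : (0 : Lvl k P 0) = 1 := Subsingleton.elim _ _
      rw [AddMonoidAlgebra.one_def, ← this, AddMonoidAlgebra.single_zero])
  exact ⟨fun f g => RingHom.ext fun x => Subsingleton.elim _ _⟩

theorem isConsistent_of_potential
    (h : ∀ j, ∃ (A : Finset (DualLat M)) (F : RealSpan M → Tw k r (j + 1)),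
      IsPotential D (j + 1) A F) :
    D.IsConsistent := by
  intro j 𝔧 _ x _ u w _
  refine Filter.Eventually.of_forall fun ε L hL => ?_
  cases j with
  | zero => exact subsingleton_hom_zero.elim _ _
  | succ j =>
    obtain ⟨A, F, H⟩ := h j
    have h1 := H.pathProduct_mul (continuous_pair_circle x u w ε) (by positivity) hL
    rw [circle_two_pi] at h1
    have h2 := mul_right_cancel_of_mem_grp (H.mem _) ((one_mul _).trans h1)
    have h3 := D.acts_pathProduct (j := j + 1) (circle x u w ε) L
    rw [← h2] at h3
    exact h3.unique acts_one

end Consistency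

/-! ### Existence -/

section Existence

variable {k : Type*} [Field k] [CharZero k] {P : Type*} [AddCommMonoid P] {M : Type v}
  [AddCommGroup M] {r : P →+ M} {j : ℕ} {q : ℕ}

theorem red_eq_one_of_le {i j : ℕ} (h : j ≤ i) {u : (Compl k P)ˣ} (hu : red i u = 1) :
    red j u = 1 := by
  induction i, h using Nat.le_induction with
  | base => exact hu
  | succ i _ ih => exact ih (lvlMap_red_eq_one hu)

/-- The scattering diagram of the walls of the widgets and of the walls in the lists `new j`, which
are trivial modulo `𝔪_P^(j + 1)`. -/
def scatter (W : Fin q → Widget k r) (new : ℕ → List (Wall k r))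
    (h : ∀ j, ∀ w ∈ new j, red (j + 1) w.func = 1) : ScatteringDiagram k r where
  ι := (Σ a, (W a).Index) ⊕ ULift.{v} (Σ j, Fin (new j).length)
  wall := Sum.elim (fun i => (W i.1).wall i.2) fun i => (new i.down.1)[i.down.2]
  finite j := by
    refine ((Set.finite_range Sum.inl).union ((Finset.finite_toSet
      ((Finset.range j).sigma fun i => (Finset.univ : Finset (Fin (new i).length)))).image
        fun i => Sum.inr (ULift.up i))).subset ?_
    rintro (i | ⟨i, l⟩) hi
    · exact Or.inl ⟨i, rfl⟩
    · refine Or.inr ⟨⟨i, l⟩, ?_, rfl⟩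
      simp only [Finset.coe_sigma, Set.mem_sigma_iff, Finset.coe_range, Set.mem_Iio,
        Finset.coe_univ,
        Set.mem_univ, and_true]
      by_contra hij
      exact hi (red_eq_one_of_le (by omega) (h i _ (List.getElem_mem _)))

theorem sum_fin_getElem {α B : Type*} [AddCommMonoid B] (l : List α) (f : α → B) :
    ∑ i : Fin l.length, f l[i] = (l.map f).sum := by
  rw [← List.sum_ofFn]
  congr 1
  exact List.ext_getElem (by simp) (by simp)

theorem sum_map_flatMap {α B : Type*} [AddCommMonoid B] (l : ℕ → List α) (f : α → B) (j : ℕ) :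
    (((List.range j).flatMap l).map f).sum = ∑ i ∈ Finset.range j, ((l i).map f).sum := by
  induction j with
  | zero => simp
  | succ j ih =>
    rw [List.range_succ, List.flatMap_append, List.map_append, List.sum_append, ih,
      Finset.sum_range_succ]
    simp

variable [Module.Free ℤ M] [Module.Finite ℤ M]

theorem scatter_logAt (W : Fin q → Widget k r) (new : ℕ → List (Wall k r))
    (h : ∀ j, ∀ w ∈ new j, red (j + 1) w.func = 1) (y : RealSpan M) :
    (scatter W new h).logAt (j + 1) y = locLog W (j + 1) ((List.range j).flatMap new) y := by
  classical
  let T : Finset (scatter W new h).ι := (Finset.univ : Finset (Σ a, (W a).Index)).disjSum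
    (((Finset.range j).sigma fun i => (Finset.univ : Finset (Fin (new i).length))).map
      Equiv.ulift.symm.toEmbedding)
  rw [(scatter W new h).logAt_eq_sum T]
  · refine (Finset.sum_disjSum _ _ _).trans ?_
    rw [locLog, sum_map_flatMap]
    refine congrArg₂ (· + ·) rfl ((Finset.sum_map _ _ _).trans ((Finset.sum_sigma _ _ _).trans ?_))
    exact Finset.sum_congr rfl fun i _ => sum_fin_getElem (new i) fun w => wallLog (j + 1) w y
  · rintro (i | ⟨i, l⟩) hi
    · exact Finset.mem_coe.2 (Finset.inl_mem_disjSum.2 (Finset.mem_univ _))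
    · refine Finset.mem_coe.2 (Finset.inr_mem_disjSum.2 (Finset.mem_map.2 ⟨⟨i, l⟩, ?_, rfl⟩))
      simp only [Finset.mem_sigma, Finset.mem_range, Finset.mem_univ, and_true]
      by_contra hij
      exact hi (red_eq_one_of_le (by omega) (h i _ (List.getElem_mem _)))

theorem IsStage.isPotential {W : Fin q → Widget k r} {new : ℕ → List (Wall k r)}
    (h : ∀ j, ∀ w ∈ new j, red (j + 1) w.func = 1) {A : Finset (DualLat M)}
    {F : RealSpan M → Tw k r (j + 1)} (H : IsStage W (j + 1) ((List.range j).flatMap new) A F) :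
    IsPotential (scatter W new h) (j + 1) A F := by
  refine ⟨H.arr, ?_, H.mem, H.congr, fun n hn x y x' hc => ?_⟩
  · rintro (i | ⟨i, l⟩) hi
    · exact H.widget_adapted i.1 i.2
    · refine H.adapted _ (List.mem_flatMap.2 ⟨i, List.mem_range.2 ?_, List.getElem_mem _⟩)
      by_contra hij
      exact hi (red_eq_one_of_le (by omega) (h i _ (List.getElem_mem _)))
  · rw [H.cross n hn x y x' hc (locLog_mem_aug _ _ _)]
    congr 1
    exact Tw.ext_log fun d => by rw [Tw.elem_log, Tw.elem_log, scatter_logAt]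

/-- The union of the widgets and of the walls constructed order by order is a consistent
completion. -/
theorem exists_isScatter (W : Fin q → Widget k r) :
    ∃ S : ScatteringDiagram k r, (widgetUnion W).IsScatter S := by
  obtain ⟨new, hnew⟩ := exists_walls W
  have h := fun j => (hnew j).1
  refine ⟨scatter W new h, isConsistent_of_potential fun j => ?_,
    ⟨Sum.inl, Sum.inl_injective⟩, fun _ => rfl, ?_⟩
  · obtain ⟨-, A, F, H⟩ := hnew j
    exact ⟨A, F, H.isPotential h⟩
  · rintro (i | ⟨i, l⟩) hi
    · exact absurd ⟨i, rfl⟩ hi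
    · obtain ⟨-, A, F, H⟩ := hnew (i + 1)
      exact H.not_incoming _ (List.mem_flatMap.2 ⟨i, List.mem_range.2 (by omega),
        List.getElem_mem _⟩)

end Existence

/-! ### Small loops around a joint -/

section Loops

variable {M : Type v} [AddCommGroup M] {A : Finset (DualLat M)} {n n' : DualLat M}
  {z u w : RealSpan M} {τ : DualLat M → ℝ} {ε t : ℝ}

theorem exists_angle {a b : ℝ} (ha : a ≠ 0) : ∃ θ ∈ Set.Ioo (0 : ℝ) (2 * Real.pi), ∃ R : ℝ, 0 < R ∧
    a = R * Real.sin θ ∧ b = -(R * Real.cos θ) := by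
  set c : ℂ := ⟨-b, a⟩ with hc
  have hc0 : c ≠ 0 := fun h => ha (congrArg Complex.im h)
  have hpi := Real.pi_pos
  have h1 : ‖c‖ * Real.cos c.arg = -b := Complex.norm_mul_cos_arg c
  have h2 : ‖c‖ * Real.sin c.arg = a := Complex.norm_mul_sin_arg c
  have hR : 0 < ‖c‖ := norm_pos_iff.2 hc0
  have h3 := Complex.neg_pi_lt_arg c
  have h4 := Complex.arg_le_pi c
  rcases lt_trichotomy c.arg 0 with h | h | h
  · refine ⟨c.arg + 2 * Real.pi, ⟨by linarith, by linarith⟩, ‖c‖, hR, ?_, ?_⟩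
    · rw [Real.sin_add_two_pi, h2]
    · rw [Real.cos_add_two_pi, h1, neg_neg]
  · rw [h, Real.sin_zero, mul_zero] at h2
    exact absurd h2.symm ha
  · exact ⟨c.arg, ⟨h, by linarith⟩, ‖c‖, hR, h2.symm, by rw [h1, neg_neg]⟩

/-- A small circle around `z` in the plane of `u` and `w` crosses the hyperplanes of `A` through
`z` one at a time; it passes from the positive to the negative side of `n = 0` at the
time `τ n`. -/
structure IsLoop (A : Finset (DualLat M)) (z u w : RealSpan M) (τ : DualLat M → ℝ) : Prop where
  arr : IsArr A
  gen : ∀ n ∈ A, pair n z = 0 → ∀ n' ∈ A, pair n' z = 0 → n' ≠ n → n' ≠ -n →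
    pair n u * pair n' w - pair n' u * pair n w ≠ 0
  mem : ∀ n ∈ A, pair n z = 0 → τ n ∈ Set.Ioo (0 : ℝ) (2 * Real.pi)
  spec : ∀ n ∈ A, pair n z = 0 → ∃ R : ℝ, 0 < R ∧ pair n u = R * Real.sin (τ n) ∧
    pair n w = -(R * Real.cos (τ n))

theorem eventually_near_circle (A : Finset (DualLat M)) (z u w : RealSpan M) :
    ∀ᶠ ε in 𝓝[>] (0 : ℝ), ∀ t, Near A z (circle z u w ε t) := by
  have h : ∀ n ∈ A, ∀ᶠ ε in 𝓝[>] (0 : ℝ), pair n z ≠ 0 → ∀ t,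
      SignType.sign (pair n (circle z u w ε t)) = SignType.sign (pair n z) := by
    intro n _
    by_cases h0 : pair n z = 0
    · exact Filter.Eventually.of_forall fun ε h => absurd h0 h
    set K := |pair n u| + |pair n w| + 1 with hK
    have hKpos : 0 < K := by positivity
    filter_upwards [Ioo_mem_nhdsGT (show 0 < |pair n z| / K by positivity)] with ε hε _ t
    have h1 : ε * K < |pair n z| := (lt_div_iff₀ hKpos).1 hε.2
    have h2 : |Real.cos t * pair n u + Real.sin t * pair n w| ≤ K := by
      refine (abs_add_le _ _).trans ?_
      rw [abs_mul, abs_mul]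
      have h3 := Real.abs_cos_le_one t
      have h4 := Real.abs_sin_le_one t
      nlinarith [abs_nonneg (pair n u), abs_nonneg (pair n w)]
    have h5 : pair n (circle z u w ε t) =
        pair n z + ε * (Real.cos t * pair n u + Real.sin t * pair n w) := by
      simp only [circle, map_add, map_smul, smul_eq_mul]
    have h6 : |ε * (Real.cos t * pair n u + Real.sin t * pair n w)| < |pair n z| := by
      rw [abs_mul, abs_of_pos hε.1]
      exact (mul_le_mul_of_nonneg_left h2 hε.1.le).trans_lt h1
    rw [abs_lt] at h6
    rw [h5]
    rcases lt_or_gt_of_ne h0 with h7 | h7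
    · rw [abs_of_neg h7] at h6
      rw [sign_neg h7, sign_neg (by linarith [h6.2])]
    · rw [abs_of_pos h7] at h6
      rw [sign_pos h7, sign_pos (by linarith [h6.1])]
  filter_upwards [(Filter.eventually_all_finset A).2 h] with ε hε t n hn h0
  exact hε n hn h0 t

theorem IsLoop.pair_circle (H : IsLoop A z u w τ) (hn : n ∈ A) (hz : pair n z = 0) :
    ∃ R : ℝ, 0 < R ∧ (∀ ε t, pair n (circle z u w ε t) = -(ε * R * Real.sin (t - τ n))) ∧
      pair n u = R * Real.sin (τ n) ∧ pair n w = -(R * Real.cos (τ n)) := by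
  obtain ⟨R, hR, h1, h2⟩ := H.spec n hn hz
  refine ⟨R, hR, fun ε t => ?_, h1, h2⟩
  simp only [circle, map_add, map_smul, smul_eq_mul, hz, h1, h2, Real.sin_sub]
  ring

theorem IsLoop.before (H : IsLoop A z u w τ) (hn : n ∈ A) (hz : pair n z = 0) (hε : 0 < ε) :
    ∀ s ∈ Set.Ioo (τ n - Real.pi) (τ n), 0 < pair n (circle z u w ε s) := by
  obtain ⟨R, hR, h, -⟩ := H.pair_circle hn hz
  intro s hs
  rw [h, Left.neg_pos_iff]
  exact mul_neg_of_pos_of_neg (by positivity)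
    (Real.sin_neg_of_neg_of_neg_pi_lt (by linarith [hs.2]) (by linarith [hs.1]))

theorem IsLoop.after (H : IsLoop A z u w τ) (hn : n ∈ A) (hz : pair n z = 0) (hε : 0 < ε) :
    ∀ s ∈ Set.Ioo (τ n) (τ n + Real.pi), pair n (circle z u w ε s) < 0 := by
  obtain ⟨R, hR, h, -⟩ := H.pair_circle hn hz
  intro s hs
  rw [h, Left.neg_neg_iff]
  exact mul_pos (by positivity)
    (Real.sin_pos_of_pos_of_lt_pi (by linarith [hs.1]) (by linarith [hs.2]))

theorem IsLoop.pair_circle_self (H : IsLoop A z u w τ) (hn : n ∈ A) (hz : pair n z = 0) :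
    pair n (circle z u w ε (τ n)) = 0 := by
  obtain ⟨R, hR, h, -⟩ := H.pair_circle hn hz
  rw [h]; simp

theorem IsLoop.onWall (H : IsLoop A z u w τ) (hn : n ∈ A) (hz : pair n z = 0) (hε : 0 < ε)
    (hnear : Near A z (circle z u w ε (τ n))) : OnWall A n (circle z u w ε (τ n)) := by
  refine ⟨H.pair_circle_self hn hz, fun n' hn' h0 => ?_⟩
  by_cases hz' : pair n' z = 0
  · by_contra! hne
    have h1 := H.pair_circle_self (ε := ε) hn hz
    simp only [circle, map_add, map_smul, smul_eq_mul, hz, hz', zero_add] at h0 h1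
    have h2 := (mul_eq_zero.1 h0).resolve_left hε.ne'
    have h3 := (mul_eq_zero.1 h1).resolve_left hε.ne'
    have h4 := H.gen n hn hz n' hn' hz' hne.1 hne.2
    have h5 := Real.sin_sq_add_cos_sq (τ n)
    apply h4
    have hs : Real.sin (τ n) * (pair n u * pair n' w - pair n' u * pair n w) = 0 := by
      linear_combination pair n u * h2 - pair n' u * h3
    have hc : Real.cos (τ n) * (pair n u * pair n' w - pair n' u * pair n w) = 0 := by
      linear_combination pair n' w * h3 - pair n w * h2
    linear_combination (-(pair n u * pair n' w - pair n' u * pair n w)) * h5 +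
      Real.sin (τ n) * hs + Real.cos (τ n) * hc
  · exact absurd ((sign_eq_iff_zero (hnear n' hn' hz')).1 h0) hz'

theorem IsLoop.sin_cos_neg (H : IsLoop A z u w τ) (hn : n ∈ A) (hz : pair n z = 0) :
    Real.sin (τ (-n)) = -Real.sin (τ n) ∧ Real.cos (τ (-n)) = -Real.cos (τ n) := by
  obtain ⟨R, hR, h1, h2, h3⟩ := H.pair_circle hn hz
  have hz' : pair (-n) z = 0 := by rw [pair_neg, hz, neg_zero]
  obtain ⟨R', hR', h1', h2', h3'⟩ := H.pair_circle (H.arr.neg n hn) hz'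
  rw [pair_neg] at h2' h3'
  have hRR : R = R' := by
    have h4 : R ^ 2 = R' ^ 2 := by
      have e1 : R ^ 2 = (pair n u) ^ 2 + (pair n w) ^ 2 := by
        rw [h2, h3]; linear_combination (-R ^ 2) * Real.sin_sq_add_cos_sq (τ n)
      have e2 : R' ^ 2 = (-pair n u) ^ 2 + (-pair n w) ^ 2 := by
        rw [h2', h3']; linear_combination (-R' ^ 2) * Real.sin_sq_add_cos_sq (τ (-n))
      rw [e1, e2]; ring
    exact (pow_left_inj₀ hR.le hR'.le two_ne_zero).1 h4
  subst hRR
  constructor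
  · have : R * Real.sin (τ (-n)) = R * -Real.sin (τ n) := by rw [← h2', h2]; ring
    exact mul_left_cancel₀ hR.ne' this
  · have : R * Real.cos (τ (-n)) = R * -Real.cos (τ n) := by linarith
    exact mul_left_cancel₀ hR.ne' this

theorem IsLoop.time_eq (H : IsLoop A z u w τ) (hε : 0 < ε) (ht : t ∈ Set.Icc (0 : ℝ) (2 * Real.pi))
    (hnear : Near A z (circle z u w ε t)) (hn : n ∈ A) (h0 : pair n (circle z u w ε t) = 0) :
    pair n z = 0 ∧ (t = τ n ∨ t = τ (-n)) := by
  have hz : pair n z = 0 := by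
    by_contra hz
    exact hz ((sign_eq_iff_zero (hnear n hn hz)).1 h0)
  refine ⟨hz, ?_⟩
  obtain ⟨R, hR, h1, -⟩ := H.pair_circle hn hz
  have hz' : pair (-n) z = 0 := by rw [pair_neg, hz, neg_zero]
  have hm := H.mem n hn hz
  have hm' := H.mem (-n) (H.arr.neg n hn) hz'
  obtain ⟨hsin, hcos⟩ := H.sin_cos_neg hn hz
  have hst : Real.sin (t - τ n) = 0 := by
    have := h1 ε t
    rw [h0] at this
    have h4 : ε * R ≠ 0 := by positivity
    exact (mul_eq_zero.1 (neg_eq_zero.1 this.symm)).resolve_left h4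
  have key : ∀ a : ℝ, Real.sin a = 0 → 0 < Real.cos a → -(2 * Real.pi) < a → a < 2 * Real.pi →
      a = 0 := by
    intro a h1 h2 h3 h4
    have h5 : Real.cos a = 1 := by
      rcases Real.sin_eq_zero_iff_cos_eq.1 h1 with h | h
      · exact h
      · linarith
    exact (Real.cos_eq_one_iff_of_lt_of_lt h3 h4).1 h5
  rcases Real.sin_eq_zero_iff_cos_eq.1 hst with h4 | h4
  · left
    have := key (t - τ n) hst (by rw [h4]; exact one_pos) (by linarith [ht.1, hm.2])
        (by linarith [ht.2, hm.1])
    linarith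
  · right
    have e1 : Real.sin (t - τ (-n)) = 0 := by
      rw [Real.sin_sub, hsin, hcos]
      rw [Real.sin_sub] at hst
      linarith
    have e2 : Real.cos (t - τ (-n)) = 1 := by
      rw [Real.cos_sub, hsin, hcos]
      rw [Real.cos_sub] at h4
      linarith
    have := key (t - τ (-n)) e1 (by rw [e2]; exact one_pos) (by linarith [ht.1, hm'.2])
      (by linarith [ht.2, hm'.1])
    linarith

theorem IsLoop.injOn (H : IsLoop A z u w τ) (hn : n ∈ A) (hz : pair n z = 0) (hn' : n' ∈ A)
    (hz' : pair n' z = 0) (h : τ n = τ n') : n = n' := by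
  obtain ⟨ε, hnear, hε : 0 < ε⟩ :=
    ((eventually_near_circle A z u w).and self_mem_nhdsWithin).exists
  have h0 := H.pair_circle_self (ε := ε) hn' hz'
  rw [← h] at h0
  rcases (H.onWall hn hz hε (hnear _)).2 n' hn' h0 with e | e
  · exact e.symm
  · have hpi := Real.pi_pos
    have h1 := H.before hn hz hε (τ n - Real.pi / 2) ⟨by linarith, by linarith⟩
    have h2 := H.before hn' hz' hε (τ n - Real.pi / 2) ⟨by linarith, by linarith⟩
    rw [e, pair_neg] at h2
    linarith

/-- The hyperplanes through `z` in the order in which they are crossed. -/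
theorem IsLoop.exists_list (H : IsLoop A z u w τ) : ∃ l : List (DualLat M),
    (∀ n, n ∈ l ↔ n ∈ A ∧ pair n z = 0) ∧ l.Nodup ∧ l.Pairwise fun n n' => τ n < τ n' := by
  classical
  let s := (A.filter fun n => pair n z = 0).toList
  have : Std.Total fun n n' : DualLat M => τ n ≤ τ n' := ⟨fun a b => le_total _ _⟩
  have : IsTrans (DualLat M) fun n n' => τ n ≤ τ n' := ⟨fun a b c => le_trans⟩
  let l := s.insertionSort fun n n' => τ n ≤ τ n'
  have hp : l.Perm s := List.perm_insertionSort _ _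
  have hmem : ∀ n, n ∈ l ↔ n ∈ A ∧ pair n z = 0 := fun n => by
    rw [hp.mem_iff]; simp [s]
  have hnd : l.Nodup := hp.nodup_iff.2 (Finset.nodup_toList _)
  refine ⟨l, hmem, hnd, ?_⟩
  have h1 : l.Pairwise fun n n' => τ n ≤ τ n' := List.pairwise_insertionSort _ _
  refine (h1.and hnd).imp_of_mem fun {a b} ha hb h => lt_of_le_of_ne h.1 fun e => h.2 ?_
  exact H.injOn ((hmem a).1 ha).1 ((hmem a).1 ha).2 ((hmem b).1 hb).1 ((hmem b).1 hb).2 e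

variable [Module.Free ℤ M] [Module.Finite ℤ M]

/-- Loops in general position around points of codimension two. -/
theorem exists_isLoop (hA : IsArr A) {n₁ : DualLat M} (hn : n ∈ A) (hz : pair n z = 0)
    (hn₁ : n₁ ∈ A)
    (hz₁ : pair n₁ z = 0) (hne : n₁ ≠ n) (hne' : n₁ ≠ -n)
    (hspan : ∀ n' ∈ A, pair n' z = 0 → ∀ x : RealSpan M, pair n x = 0 → pair n₁ x = 0 →
      pair n' x = 0) :
    ∃ u w τ, IsLoop A z u w τ ∧ IsCompl (lin (cell A z)) (Submodule.span ℝ {u, w}) ∧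
      dim (cell A z) + 2 = ambientDim M := by
  obtain ⟨u, hu⟩ := exists_gen hA
  obtain ⟨w, -, hw⟩ := exists_genPos hA hu hu
  have hτ : ∀ n : DualLat M, ∃ θ, n ∈ A → θ ∈ Set.Ioo (0 : ℝ) (2 * Real.pi) ∧ ∃ R : ℝ, 0 < R ∧
      pair n u = R * Real.sin θ ∧ pair n w = -(R * Real.cos θ) := by
    intro n
    by_cases hn : n ∈ A
    · obtain ⟨θ, h1, h2⟩ := exists_angle (b := pair n w) (hu n hn)
      exact ⟨θ, fun _ => ⟨h1, h2⟩⟩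
    · exact ⟨0, fun h => absurd h hn⟩
  choose τ hτ using hτ
  have hdet := hw n hn n₁ hn₁ hne hne'
  have hcell : ∀ x, x ∈ lin (cell A z) ↔ pair n x = 0 ∧ pair n₁ x = 0 := fun x => by
    rw [mem_lin_cell hA]
    exact ⟨fun h => ⟨h n hn hz, h n₁ hn₁ hz₁⟩, fun h n' hn' hz' => hspan n' hn' hz' x h.1 h.2⟩
  have hsolve : ∀ a b : ℝ, pair n (a • u + b • w) = 0 →
      pair n₁ (a • u + b • w) = 0 → a = 0 ∧ b = 0 := by
    intro a b h1 h2
    simp only [map_add, map_smul, smul_eq_mul] at h1 h2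
    constructor
    · have : a * (pair n u * pair n₁ w - pair n₁ u * pair n w) = 0 := by
        linear_combination pair n₁ w * h1 - pair n w * h2
      exact (mul_eq_zero.1 this).resolve_right hdet
    · have : b * (pair n u * pair n₁ w - pair n₁ u * pair n w) = 0 := by
        linear_combination pair n u * h2 - pair n₁ u * h1
      exact (mul_eq_zero.1 this).resolve_right hdet
  have hcompl : IsCompl (lin (cell A z)) (Submodule.span ℝ {u, w}) := by
    refine ⟨Submodule.disjoint_def.2 fun x hx hx' => ?_,
      codisjoint_iff.2 (eq_top_iff.2 fun x _ => ?_)⟩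
    · obtain ⟨a, b, rfl⟩ := Submodule.mem_span_pair.1 hx'
      obtain ⟨h1, h2⟩ := (hcell _).1 hx
      obtain ⟨rfl, rfl⟩ := hsolve a b h1 h2
      simp
    · set Δ := pair n u * pair n₁ w - pair n₁ u * pair n w with hΔ
      set a := (pair n x * pair n₁ w - pair n₁ x * pair n w) / Δ with ha
      set b := (pair n u * pair n₁ x - pair n₁ u * pair n x) / Δ with hb
      refine Submodule.mem_sup.2 ⟨x - (a • u + b • w), (hcell _).2 ⟨?_, ?_⟩, a • u + b • w,
        Submodule.mem_span_pair.2 ⟨a, b, rfl⟩, by abel⟩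
      · rw [map_sub, map_add, map_smul, map_smul, smul_eq_mul, smul_eq_mul, ha, hb]
        field_simp
        rw [hΔ]; ring
      · rw [map_sub, map_add, map_smul, map_smul, smul_eq_mul, smul_eq_mul, ha, hb]
        field_simp
        rw [hΔ]; ring
  refine ⟨u, w, τ, ⟨hA, fun n hn _ n' hn' _ h1 h2 => hw n hn n' hn' h1 h2,
    fun n hn _ => (hτ n hn).1, fun n hn _ => (hτ n hn).2⟩, hcompl, ?_⟩
  have h1 := Submodule.finrank_add_eq_of_isCompl hcompl
  have h2 : LinearIndependent ℝ ![u, w] := by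
    rw [LinearIndependent.pair_iff]
    exact fun a b h => hsolve a b (by rw [h, map_zero]) (by rw [h, map_zero])
  have h3 := finrank_span_eq_card h2
  rw [Matrix.range_cons_cons_empty, Fintype.card_fin] at h3
  unfold dim ambientDim
  omega

end Loops

/-! ### Path-ordered products along small loops -/

section LoopProducts

variable {k : Type*} [Field k] [CharZero k] {P : Type*} [AddCommMonoid P] {M : Type v}
  [AddCommGroup M] [Module.Free ℤ M] [Module.Finite ℤ M] {r : P →+ M} {j : ℕ}
  {A : Finset (DualLat M)} {n : DualLat M} {x y z u w : RealSpan M} {τ : DualLat M → ℝ} {ε : ℝ}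
  {D : ScatteringDiagram k r}

open Tw ScatteringDiagram

theorem logAt_mem_slab (hD : ∀ i ∈ D.active j, Adapted A (D.wall i).cone) (hy : OnWall A n y) :
    D.logAt j y ∈ slab r j (nu k n) := by
  rw [D.logAt_eq_sum (D.finite j).toFinset (by simp [active])]
  exact Submodule.sum_mem _ fun i hi =>
    wallLog_mem_slab (hD i (by simpa [active] using hi)) hy

theorem logAt_congr_of_sameSigns (hD : ∀ i ∈ D.active j, Adapted A (D.wall i).cone)
    (h : SameSigns A x y) : D.logAt j x = D.logAt j y :=
  D.logAt_congr fun i hi => (hD i hi).mem_congr h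

theorem logAt_of_gen (hD : ∀ i ∈ D.active j, Adapted A (D.wall i).cone) (h : Gen A y) :
    D.logAt j y = 0 := by
  refine D.logAt_eq_zero ?_
  rintro ⟨i, hi, hy⟩
  obtain ⟨n, hn, h0⟩ := (hD i hi).exists_normal (D.wall i).codim_one
  exact h n hn (h0 y hy)

/-- Walls that meet outside of the singular locus span the same hyperplane. -/
theorem lin_eq_of_notMem_sing (hy : y ∉ D.sing j) {i i' : D.ι} (hi : i ∈ D.active j)
    (hi' : i' ∈ D.active j) (hyi : y ∈ (D.wall i).cone) (hyi' : y ∈ (D.wall i').cone) :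
    lin (D.wall i).cone = lin (D.wall i').cone := by
  have h : ¬ dim ((D.wall i).cone ⊓ (D.wall i').cone) + 2 ≤ ambientDim M :=
    fun h => hy (Or.inr ⟨i, hi, i', hi', h, hyi, hyi'⟩)
  have h1 := (D.wall i).codim_one
  have h2 := (D.wall i').codim_one
  have h3 : lin ((D.wall i).cone ⊓ (D.wall i').cone) ≤ lin (D.wall i).cone :=
    Submodule.span_mono fun x hx => hx.1
  have h4 : lin ((D.wall i).cone ⊓ (D.wall i').cone) ≤ lin (D.wall i').cone :=
    Submodule.span_mono fun x hx => hx.2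
  unfold dim at *
  rw [← Submodule.eq_of_le_of_finrank_le h3 (by omega), ← Submodule.eq_of_le_of_finrank_le h4
    (by omega)]

theorem mem_relInt_of_notMem_sing (hy : y ∉ D.sing j) {i : D.ι} (hi : i ∈ D.active j)
    (hyi : y ∈ (D.wall i).cone) : y ∈ relInt (D.wall i).cone := by
  by_contra h
  exact hy (Or.inl ⟨i, hi, hyi, h⟩)

theorem cell_le {σ : PointedCone ℝ (RealSpan M)} (hσ : Adapted A σ)
    (hy : y ∈ σ) : cell A y ≤ σ := by
  obtain ⟨F, hF, hFσ⟩ := hσ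
  exact fun x hx => (hFσ x).2 fun n hn => mem_cell.1 hx n (hF hn) ((hFσ y).1 hy n hn)

/-- Points that lie on only one hyperplane of the arrangement are not singular. -/
theorem OnWall.notMem_sing (hA : IsArr A) (hD : ∀ i ∈ D.active j, Adapted A (D.wall i).cone)
    (hn : n ∈ A) (hy : OnWall A n y) : y ∉ D.sing j := by
  have hn0 := (hA.prim n hn).ne_zero
  have hnormal : ∀ i ∈ D.active j, y ∈ (D.wall i).cone → ∀ x ∈ (D.wall i).cone, pair n x = 0 :=
    fun i hi hyi => (Wall.pair_direction (hD i hi) hy hyi).1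
  rintro (⟨i, hi, hyi, hb⟩ | ⟨i, hi, i', hi', hd, hyi, hyi'⟩)
  · apply hb
    obtain ⟨F, hF, hFσ⟩ := hD i hi
    refine (mem_relInt_iff hFσ).2 ⟨hyi, fun n' hn' h0 x hx => ?_⟩
    rcases hy.2 n' (hF hn') h0 with rfl | rfl
    · exact hnormal i hi hyi x hx
    · rw [pair_neg, hnormal i hi hyi x hx, neg_zero]
  · have h1 : lin (cell A y) = LinearMap.ker (pair n) := by
      ext x
      rw [mem_lin_cell hA, LinearMap.mem_ker]
      refine ⟨fun h => h n hn hy.1, fun h n' hn' h0 => ?_⟩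
      rcases hy.2 n' hn' h0 with rfl | rfl
      · exact h
      · rw [pair_neg, h, neg_zero]
    have h2 := dim_of_lin_eq_ker hn0 h1
    have h3 : dim (cell A y) ≤ dim ((D.wall i).cone ⊓ (D.wall i').cone) :=
      Submodule.finrank_mono (Submodule.span_mono fun x hx =>
        ⟨cell_le (hD i hi) hyi hx, cell_le (hD i' hi') hyi' hx⟩)
    omega

/-- The closed cell of a singular point of codimension two is a joint. -/
theorem isJoint_cell (hA : IsArr A) (hD : ∀ i ∈ D.active j, Adapted A (D.wall i).cone)
    (hdim : dim (cell A z) + 2 = ambientDim M) (hz : z ∈ D.sing j) : D.IsJoint j (cell A z) := by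
  refine ⟨isRational_ineqCone _, hdim, fun x hx => ?_, fun x hx y hy i hi => ?_⟩
  · rcases hz with ⟨i, hi, hzi, hb⟩ | ⟨i, hi, i', hi', hd, hzi, hzi'⟩
    · refine Or.inl ⟨i, hi, cell_le (hD i hi) hzi hx, fun hxr => hb ?_⟩
      obtain ⟨F, hF, hFσ⟩ := hD i hi
      rw [mem_relInt_iff hFσ] at hxr ⊢
      exact ⟨hzi, fun n hn h0 => hxr.2 n hn (zero_of_mem_cell hA hx (hF hn) h0)⟩
    · exact Or.inr ⟨i, hi, i', hi', hd, cell_le (hD i hi) hzi hx, cell_le (hD i' hi') hzi' hx⟩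
  · rw [mem_relInt_cell hA] at hx hy
    exact (hD i hi).mem_congr (hx.symm.trans hy)

/-- The product of the crossings of all hyperplanes along a loop. -/
def loopProd (D : ScatteringDiagram k r) (j : ℕ) (z u w : RealSpan M) (τ : DualLat M → ℝ) (ε : ℝ)
    (l : List (DualLat M)) : Tw k r j :=
  (l.map fun n => (elem r (nu k n) (D.logAt j (circle z u w ε (τ n))) (D.logAt_mem_aug _) :
    Tw k r j)).reverse.prod

theorem list_prod_filter {G α : Type*} [Monoid G] (f : α → G) (q : α → Prop) [DecidablePred q]
    (l : List α) (h : ∀ a ∈ l, ¬ q a → f a = 1) :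
    ((l.filter q).map f).reverse.prod = (l.map f).reverse.prod := by
  induction l with
  | nil => rfl
  | cons a l ih =>
    have ih' := ih fun b hb => h b (List.mem_cons_of_mem _ hb)
    by_cases ha : q a
    · rw [List.filter_cons_of_pos (by simpa using ha)]
      simp [ih']
    · rw [List.filter_cons_of_neg (by simpa using ha), ih']
      simp [h a (by simp) ha]

/-- Around a joint, the product is trivial by consistency. -/
theorem IsLoop.prod_eq_one_of_sing (H : IsLoop A z u w τ)
    (hD : ∀ i ∈ D.active j, Adapted A (D.wall i).cone) (hcons : D.IsConsistent)
    (hcompl : IsCompl (lin (cell A z)) (Submodule.span ℝ {u, w}))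
    (hdim : dim (cell A z) + 2 = ambientDim M) (hz : z ∈ D.sing j) {l : List (DualLat M)}
    (hl : ∀ n, n ∈ l ↔ n ∈ A ∧ pair n z = 0) (hsort : l.Pairwise fun n n' => τ n < τ n') :
    ∀ᶠ ε in 𝓝[>] (0 : ℝ), loopProd D j z u w τ ε l = 1 := by
  classical
  have h1 := hcons j (cell A z) (isJoint_cell H.arr hD hdim hz) z
    ((mem_relInt_cell H.arr).2 (SameSigns.refl A z)) u w hcompl
  filter_upwards [h1, eventually_near_circle A z u w, self_mem_nhdsWithin] with ε hε hnear
    (hpos : 0 < ε)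
  have hpi := Real.pi_pos
  have hwall : ∀ n ∈ A, pair n z = 0 → OnWall A n (circle z u w ε (τ n)) := fun n hn h0 =>
    H.onWall hn h0 hpos (hnear _)
  -- a point of the circle on a wall lies on a hyperplane of the list
  have htime : ∀ t ∈ Set.Icc (0 : ℝ) (2 * Real.pi), ∀ i ∈ D.active j,
      circle z u w ε t ∈ (D.wall i).cone → ∃ n ∈ A, pair n z = 0 ∧ t = τ n := by
    intro t ht i hi hmem
    obtain ⟨n, hn, h0⟩ := (hD i hi).exists_normal (D.wall i).codim_one
    obtain ⟨hz0, h2 | h2⟩ := H.time_eq hpos ht (hnear t) hn (h0 _ hmem)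
    · exact ⟨n, hn, hz0, h2⟩
    · exact ⟨-n, H.arr.neg n hn, by rw [pair_neg, hz0, neg_zero], h2⟩
  set f : DualLat M → ℝ × DualLat M := fun n => (τ n, n) with hf
  set l' := l.filter fun n => circle z u w ε (τ n) ∈ D.supp j with hl'
  have hmem' : ∀ n ∈ l', (n ∈ A ∧ pair n z = 0) ∧ circle z u w ε (τ n) ∈ D.supp j := fun n hn => by
    rw [hl', List.mem_filter] at hn
    exact ⟨(hl n).1 hn.1, by simpa using hn.2⟩
  have hlist : D.IsCrossingList j (circle z u w ε) 0 (2 * Real.pi) (l'.map f) := by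
    refine ⟨fun t ht hs => ?_, ?_, fun t ht => ⟨?_, ?_⟩, ?_, ?_⟩
    · obtain ⟨i, hi, hmem⟩ : ∃ i ∈ D.active j, circle z u w ε t ∈ (D.wall i).cone := by
        rcases hs with ⟨i, hi, h, -⟩ | ⟨i, hi, i', -, -, h, -⟩
        exacts [⟨i, hi, h⟩, ⟨i, hi, h⟩]
      obtain ⟨n, hn, hz0, rfl⟩ := htime t ht i hi hmem
      exact (hwall n hn hz0).notMem_sing H.arr hD hn hs
    · rw [List.pairwise_map]
      exact hsort.filter _
    · rintro ⟨i, hi, hmem⟩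
      obtain ⟨n, hn, hz0, rfl⟩ := htime t ht i hi hmem
      refine ⟨n, List.mem_map.2 ⟨n, ?_, rfl⟩⟩
      rw [hl', List.mem_filter]
      exact ⟨(hl n).2 ⟨hn, hz0⟩, by simpa using ⟨i, hi, hmem⟩⟩
    · rintro ⟨n, hn⟩
      obtain ⟨n', hn', e⟩ := List.mem_map.1 hn
      rw [hf, Prod.mk.injEq] at e
      rw [← e.1]
      exact (hmem' n' hn').2
    · intro p hp
      obtain ⟨n, hn, rfl⟩ := List.mem_map.1 hp
      exact H.mem n (hmem' n hn).1.1 (hmem' n hn).1.2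
    · intro p hp i hi hmem
      obtain ⟨n, hn, rfl⟩ := List.mem_map.1 hp
      obtain ⟨⟨hnA, hz0⟩, -⟩ := hmem' n hn
      exact ⟨hmem, H.arr.prim n hnA, (Wall.pair_direction (hD i hi) (hwall n hnA hz0) hmem).1,
        ⟨Real.pi, hpi, H.before hnA hz0 hpos⟩, ⟨Real.pi, hpi, H.after hnA hz0 hpos⟩⟩
  have h2 := D.acts_pathProduct (j := j) (circle z u w ε) (l'.map f)
  rw [hε _ hlist] at h2
  have h3 := h2.eq_one
  rw [List.map_map] at h3
  rw [← h3]
  refine (list_prod_filter _ _ l fun n _ h => ?_).symm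
  exact elem_eq_one _ (D.logAt_eq_zero h)

/-- Around a nonsingular point, the product is trivial as well: a single hyperplane is crossed
twice, in opposite directions. -/
theorem IsLoop.prod_eq_one_of_notMem_sing (H : IsLoop A z u w τ)
    (hD : ∀ i ∈ D.active j, Adapted A (D.wall i).cone) (hz : z ∉ D.sing j) {l : List (DualLat M)}
    (hl : ∀ n, n ∈ l ↔ n ∈ A ∧ pair n z = 0) (hsort : l.Pairwise fun n n' => τ n < τ n') :
    ∀ᶠ ε in 𝓝[>] (0 : ℝ), loopProd D j z u w τ ε l = 1 := by
  classical
  filter_upwards [eventually_near_circle A z u w, self_mem_nhdsWithin] with ε hnear (hpos : 0 < ε)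
  have hpi := Real.pi_pos
  by_cases hzs : z ∈ D.supp j
  swap
  · unfold loopProd
    refine List.prod_eq_one fun g hg => ?_
    obtain ⟨n, -, rfl⟩ := List.mem_map.1 (List.mem_reverse.1 hg)
    refine elem_eq_one _ (D.logAt_eq_zero ?_)
    rintro ⟨i, hi, h⟩
    exact hzs ⟨i, hi, (hD i hi).mem_of_near (hnear _) h⟩
  obtain ⟨i₀, hi₀, hzi₀⟩ := hzs
  obtain ⟨n₀, hn₀, hn₀i⟩ := (hD i₀ hi₀).exists_normal (D.wall i₀).codim_one
  have hz₀ : pair n₀ z = 0 := hn₀i z hzi₀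
  have hnormal : ∀ i ∈ D.active j, z ∈ (D.wall i).cone → ∀ x ∈ (D.wall i).cone, pair n₀ x = 0 := by
    intro i hi hzi x hx
    refine zero_of_mem_lin hn₀i ?_
    rw [lin_eq_of_notMem_sing hz hi₀ hi hzi₀ hzi]
    exact mem_lin hx
  have hne₀ := (H.arr.prim n₀ hn₀).ne_zero
  have hlog : ∀ x, Near A z x → pair n₀ x = 0 → D.logAt j x = D.logAt j z := fun x hx h0 =>
    D.logAt_congr fun i hi => (hD i hi).mem_iff_of_near (D.wall i).codim_one hne₀
      (fun hzi => ⟨mem_relInt_of_notMem_sing hz hi hzi, hnormal i hi hzi⟩) hx h0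
  have hlog0 : ∀ x, Near A z x → pair n₀ x ≠ 0 → D.logAt j x = 0 := fun x hx h0 =>
    D.logAt_eq_zero fun ⟨i, hi, hxi⟩ => h0 (hnormal i hi ((hD i hi).mem_of_near hx hxi) x hxi)
  have hslab : D.logAt j z ∈ slab r j (nu k n₀) := by
    rw [← hlog _ (hnear (τ n₀)) (H.pair_circle_self hn₀ hz₀)]
    exact logAt_mem_slab hD (H.onWall hn₀ hz₀ hpos (hnear _))
  let g : Tw k r j := elem r (nu k n₀) (D.logAt j z) (D.logAt_mem_aug _)
  -- a potential near `z`, with the values `1` and `g` on the two sides of `n₀ = 0`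
  let G : ℝ → Tw k r j := fun t => if 0 < pair n₀ (circle z u w ε t) then 1 else g
  have hcont := continuous_pair_circle z u w ε n₀
  have hloc : ∀ t, pair n₀ (circle z u w ε t) ≠ 0 → ∀ᶠ s in 𝓝 t, G s = G t := by
    intro t h0
    rcases lt_or_gt_of_ne h0 with h | h
    · filter_upwards [hcont.continuousAt.eventually (gt_mem_nhds h)] with s hs
      simp only [G]
      rw [if_neg (not_lt.2 h.le), if_neg (not_lt.2 (le_of_lt hs))]
    · filter_upwards [hcont.continuousAt.eventually (lt_mem_nhds h)] with s hs
      simp only [G]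
      rw [if_pos h, if_pos hs]
  set f : DualLat M → ℝ × DualLat M := fun n => (τ n, n) with hf
  let θ : ℝ × DualLat M → Tw k r j := fun p =>
    elem r (nu k p.2) (D.logAt j (circle z u w ε p.1)) (D.logAt_mem_aug _)
  have hinv : (elem r (nu k (-n₀)) (D.logAt j z) (D.logAt_mem_aug _) : Tw k r j) * g = 1 := by
    have hslab' : D.logAt j z ∈ slab r j (nu k (-n₀)) := by
      have h0 : pair n₀ (circle z u w ε (τ n₀)) = 0 := H.pair_circle_self hn₀ hz₀
      rw [← hlog _ (hnear (τ n₀)) h0]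
      exact logAt_mem_slab hD (H.onWall hn₀ hz₀ hpos (hnear _)).neg
    refine ext_log fun d => ?_
    rw [mul_log, elem_log, elem_log, map_smul, base_elem_of_mem_slab _ _ hslab', nu_apply, nu_apply,
      LinearMap.neg_apply, Int.cast_neg, neg_smul, neg_add_cancel]
    rfl
  have key := eq_ordered_prod G θ (l.map f) (a := 0) (b := 2 * Real.pi) (by positivity) ?_ ?_ ?_ ?_
  · have h1 : G (2 * Real.pi) = G 0 := by simp only [G, circle_two_pi]
    have hmem : G 0 ∈ grp k r j ⊥ := by
      simp only [G]
      split_ifs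
      exacts [one_mem _, elem_mem_grp hslab (by simp)]
    rw [h1] at key
    have h2 := mul_right_cancel_of_mem_grp hmem ((one_mul _).trans key)
    rw [List.map_map] at h2
    exact h2.symm
  · rw [List.pairwise_map]
    exact hsort
  · intro p hp
    obtain ⟨n, hn, rfl⟩ := List.mem_map.1 hp
    exact H.mem n ((hl n).1 hn).1 ((hl n).1 hn).2
  · intro t ht hne
    refine hloc t fun h0 => ?_
    obtain ⟨-, h1 | h1⟩ := H.time_eq hpos ht (hnear t) hn₀ h0
    · exact hne (f n₀) (List.mem_map_of_mem ((hl n₀).2 ⟨hn₀, hz₀⟩)) h1.symm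
    · exact hne (f (-n₀)) (List.mem_map_of_mem
        ((hl (-n₀)).2 ⟨H.arr.neg n₀ hn₀, by rw [pair_neg, hz₀, neg_zero]⟩)) h1.symm
  · intro p hp
    obtain ⟨n, hn, rfl⟩ := List.mem_map.1 hp
    obtain ⟨hnA, hnz⟩ := (hl n).1 hn
    have hbef := H.before hnA hnz hpos
    have haft := H.after hnA hnz hpos
    have hI : ∀ᶠ s in 𝓝[<] (τ n), s ∈ Set.Ioo (τ n - Real.pi) (τ n) := Ioo_mem_nhdsLT (by linarith)
    have hI' : ∀ᶠ s in 𝓝[>] (τ n), s ∈ Set.Ioo (τ n) (τ n + Real.pi) := Ioo_mem_nhdsGT (by linarith)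
    by_cases h0 : pair n₀ (circle z u w ε (τ n)) = 0
    · have hθ : ∀ ν : DualLat M, n = ν → θ (f n) = elem r (nu k ν) (D.logAt j z)
          (D.logAt_mem_aug _) := by
        rintro ν rfl
        exact ext_log fun d => by rw [elem_log, elem_log, hlog _ (hnear _) h0]
      rcases (H.onWall hnA hnz hpos (hnear _)).2 n₀ hn₀ h0 with e | e
      · refine ⟨1, ?_, ?_⟩
        · filter_upwards [hI] with s hs
          exact if_pos (by rw [e]; exact hbef s hs)
        · filter_upwards [hI'] with s hs
          rw [hθ n₀ e.symm, mul_one]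
          exact if_neg (by rw [e]; exact not_lt.2 (haft s hs).le)
      · have e' : n = -n₀ := by rw [e, neg_neg]
        refine ⟨g, ?_, ?_⟩
        · filter_upwards [hI] with s hs
          have := hbef s hs
          rw [e', pair_neg] at this
          exact if_neg (by linarith)
        · filter_upwards [hI'] with s hs
          have := haft s hs
          rw [e', pair_neg] at this
          rw [hθ _ e', hinv]
          exact if_pos (by linarith)
    · have hθ : θ (f n) = 1 := elem_eq_one _ (hlog0 _ (hnear _) h0)
      refine ⟨G (τ n), nhdsWithin_le_nhds (hloc _ h0), ?_⟩
      rw [hθ, one_mul]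
      exact nhdsWithin_le_nhds (hloc _ h0)

theorem IsLoop.prod_eq_one (H : IsLoop A z u w τ)
    (hD : ∀ i ∈ D.active j, Adapted A (D.wall i).cone) (hcons : D.IsConsistent)
    (hcompl : IsCompl (lin (cell A z)) (Submodule.span ℝ {u, w}))
    (hdim : dim (cell A z) + 2 = ambientDim M) {l : List (DualLat M)}
    (hl : ∀ n, n ∈ l ↔ n ∈ A ∧ pair n z = 0) (hsort : l.Pairwise fun n n' => τ n < τ n') :
    ∀ᶠ ε in 𝓝[>] (0 : ℝ), loopProd D j z u w τ ε l = 1 := by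
  by_cases hz : z ∈ D.sing j
  · exact H.prod_eq_one_of_sing hD hcons hcompl hdim hz hl hsort
  · exact H.prod_eq_one_of_notMem_sing hD hz hl hsort

end LoopProducts

/-! ### Uniqueness -/

section Uniqueness

variable {k : Type*} [Field k] [CharZero k] {P : Type*} [AddCommMonoid P] {M : Type v}
  [AddCommGroup M] [Module.Free ℤ M] [Module.Finite ℤ M] {r : P →+ M} {j : ℕ}
  {A A' : Finset (DualLat M)} {n : DualLat M} {x y z : RealSpan M} {p : P}
  {D S S' : ScatteringDiagram k r}

open Tw ScatteringDiagram

theorem active_subset_succ (D : ScatteringDiagram k r) (j : ℕ) : D.active j ⊆ D.active (j + 1) :=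
  fun _ hi h => hi (lvlMap_red_eq_one h)

theorem lvlMap_logAt (D : ScatteringDiagram k r) (y : RealSpan M) :
    lvlMap k P j (D.logAt (j + 1) y) = D.logAt j y := by
  rw [D.logAt_eq_sum (D.finite (j + 1)).toFinset (by simp [active]), map_sum,
    D.logAt_eq_sum (D.finite (j + 1)).toFinset
      (by rw [Set.Finite.coe_toFinset]; exact active_subset_succ D j)]
  exact Finset.sum_congr rfl fun i _ => lvlMap_wallLog _ _

theorem dcoef_list {α : Type*} (p : P) (a b : α → Tw k r (j + 1)) (l : List α)
    (h : ∀ x ∈ l, (a x).red = (b x).red) :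
    ((l.map a).reverse.prod).red = ((l.map b).reverse.prod).red ∧
      dcoef p (l.map a).reverse.prod (l.map b).reverse.prod =
        (l.map fun x => dcoef p (a x) (b x)).sum := by
  induction l with
  | nil => simp
  | cons x l ih =>
    obtain ⟨h1, h2⟩ := ih fun y hy => h y (List.mem_cons_of_mem _ hy)
    have h3 := h x (by simp)
    simp only [List.map_cons, List.reverse_cons, List.prod_append, List.prod_cons, List.prod_nil,
      mul_one, List.sum_cons]
    exact ⟨by rw [red_mul, red_mul, h1, h3], by rw [dcoef_mul p h1 h3, h2, add_comm]⟩

/-- The difference of the coefficients of `z^p` in the logarithms of the functions of two diagrams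
at a point. -/
def coefDiff (S S' : ScatteringDiagram k r) (j : ℕ) (p : P) (y : RealSpan M) : k :=
  coef k j p (S'.logAt j y) - coef k j p (S.logAt j y)

theorem coefDiff_eq_zero (hS : ∀ i ∈ S.active j, Adapted A (S.wall i).cone)
    (hS' : ∀ i ∈ S'.active j, Adapted A (S'.wall i).cone) (hy : OnWall A n y)
    (h : r p = 0 ∨ n (r p) ≠ 0) : coefDiff S S' j p y = 0 := by
  have h' : r p = 0 ∨ nu k n (r p) ≠ 0 := h.imp id fun h => nu_eq_zero.not.2 h
  unfold coefDiff
  rw [coef_of_mem_slab (logAt_mem_slab hS hy) h', coef_of_mem_slab (logAt_mem_slab hS' hy) h',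
    sub_zero]

theorem coefDiff_congr (hS : ∀ i ∈ S.active j, Adapted A (S.wall i).cone)
    (hS' : ∀ i ∈ S'.active j, Adapted A (S'.wall i).cone) (h : SameSigns A x y) :
    coefDiff S S' j p x = coefDiff S S' j p y := by
  unfold coefDiff
  rw [logAt_congr_of_sameSigns hS h, logAt_congr_of_sameSigns hS' h]

/-- Consistency on a small loop around a point `z` of a hyperplane that contains the direction
`r p`: if two consistent diagrams agree to order `j`, then their coefficients of `z^p` to the next
order differ by the same amount on the two sides of `z`. -/
theorem coefDiff_pencil (hA : IsArr A) (hS : ∀ i ∈ S.active (j + 1), Adapted A (S.wall i).cone)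
    (hS' : ∀ i ∈ S'.active (j + 1), Adapted A (S'.wall i).cone) (hc : S.IsConsistent)
    (hc' : S'.IsConsistent)
    (hred : ∀ n ∈ A, ∀ y, OnWall A n y → S.logAt j y = S'.logAt j y) (hn : n ∈ A)
    (hm : n (r p) = 0) (hz : IsPencil A (r p) n z) :
    ∀ᶠ ε in 𝓝[>] (0 : ℝ), coefDiff S S' (j + 1) p (z - ε • incl (r p)) =
      coefDiff S S' (j + 1) p (z + ε • incl (r p)) := by
  classical
  set m := r p with hmdef
  by_cases hex : ∃ n₁ ∈ A, pair n₁ z = 0 ∧ n₁ m ≠ 0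
  swap
  · push Not at hex
    filter_upwards [eventually_near A z (incl m), eventually_near A z (-incl m)] with ε h1 h2
    rw [smul_neg, ← sub_eq_add_neg] at h2
    refine coefDiff_congr hS hS' fun n' hn' => ?_
    by_cases h0 : pair n' z = 0
    · simp [h0, hex n' hn' h0]
    · rw [h1 n' hn' h0, h2 n' hn' h0]
  obtain ⟨n₁, hn₁, hz₁, hm₁⟩ := hex
  have hm₁' : (n₁ m : ℝ) ≠ 0 := by exact_mod_cast hm₁
  have hne : n₁ ≠ n := by rintro rfl; exact hm₁ hm
  have hne' : n₁ ≠ -n := by rintro rfl; exact hm₁ (by simp [hm])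
  have hprop : ∀ n' ∈ A, pair n' z = 0 → ∀ x : RealSpan M, pair n x = 0 →
      pair n' x = pair n₁ x / n₁ m * n' m := by
    intro n' hn' hz' x hx
    obtain ⟨c, hcc⟩ := hz.coplanar n₁ hn₁ n' hn' hz₁ hz'
    have h1 := mul_pair_of_coplanar hcc x
    rw [hx, mul_zero, sub_eq_zero] at h1
    field_simp
    linarith
  obtain ⟨u, w, τ, H, hcompl, hdim⟩ := exists_isLoop hA hn hz.zero hn₁ hz₁ hne hne'
    fun n' hn' hz' x h1 h2 => by rw [hprop n' hn' hz' x h1, h2]; simp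
  obtain ⟨l, hl, hnd, hsort⟩ := H.exists_list
  obtain ⟨ε, ⟨⟨⟨h1, h2⟩, hnear⟩, hε : 0 < ε⟩⟩ :=
    ((((H.prod_eq_one hS hc hcompl hdim hl hsort).and
      (H.prod_eq_one hS' hc' hcompl hdim hl hsort)).and
      (eventually_near_circle A z u w)).and self_mem_nhdsWithin).exists
  have hwall : ∀ n ∈ A, pair n z = 0 → OnWall A n (circle z u w ε (τ n)) := fun n hn h0 =>
    H.onWall hn h0 hε (hnear _)
  -- the two products differ by the sum of the differences of their factors
  have h3 := (dcoef_list p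
    (fun n => (elem r (nu k n) (S.logAt (j + 1) (circle z u w ε (τ n))) (S.logAt_mem_aug _) :
      Tw k r (j + 1)))
    (fun n => elem r (nu k n) (S'.logAt (j + 1) (circle z u w ε (τ n))) (S'.logAt_mem_aug _)) l
    fun n' hn' => by
      obtain ⟨hn'A, hz'⟩ := (hl n').1 hn'
      rw [red_elem, red_elem]
      refine ext_log fun d => ?_
      rw [elem_log, elem_log, lvlMap_logAt, lvlMap_logAt, hred n' hn'A _ (hwall n' hn'A hz')]).2
  change dcoef p (loopProd S (j + 1) z u w τ ε l) (loopProd S' (j + 1) z u w τ ε l) = _ at h3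
  rw [h1, h2, dcoef_self, ← List.sum_toFinset _ hnd] at h3
  have h4 : ∀ d, ∑ n' ∈ l.toFinset,
      (n' d : k) * coefDiff S S' (j + 1) p (circle z u w ε (τ n')) = 0 := by
    intro d
    have h5 := DFunLike.congr_fun h3 d
    rw [AddMonoidHom.finsetSum_apply, AddMonoidHom.zero_apply] at h5
    rw [h5]
    refine Finset.sum_congr rfl fun n' _ => ?_
    rw [dcoef_apply, elem_log, elem_log, ← smul_sub, map_smul, map_sub, nu_apply, smul_eq_mul]
    rfl
  have hnn : n ≠ -n := by
    intro h
    have h5 : (2 : ℤ) • n = 0 := by rw [two_smul]; nth_rewrite 2 [h]; exact add_neg_cancel n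
    exact (hA.prim n hn).ne_zero ((smul_eq_zero.1 h5).resolve_left two_ne_zero)
  have hzn : pair (-n) z = 0 := by rw [pair_neg, hz.zero, neg_zero]
  have h6 : coefDiff S S' (j + 1) p (circle z u w ε (τ n)) =
      coefDiff S S' (j + 1) p (circle z u w ε (τ (-n))) := by
    obtain ⟨d, hd⟩ := exists_pos_of_ne_zero (hA.prim n hn).ne_zero
    have h7 := h4 d
    rw [← Finset.sum_subset (s₁ := {n, -n}), Finset.sum_pair hnn, LinearMap.neg_apply,
      Int.cast_neg] at h7
    · have h8 : (n d : k) * (coefDiff S S' (j + 1) p (circle z u w ε (τ n)) -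
          coefDiff S S' (j + 1) p (circle z u w ε (τ (-n)))) = 0 := by linear_combination h7
      exact sub_eq_zero.1 ((mul_eq_zero.1 h8).resolve_left (by exact_mod_cast hd.ne'))
    · intro n' hn'
      rw [List.mem_toFinset, hl]
      rcases Finset.mem_insert.1 hn' with rfl | hn'
      · exact ⟨hn, hz.zero⟩
      · rw [Finset.mem_singleton.1 hn']
        exact ⟨hA.neg n hn, hzn⟩
    · intro n' hn' hnot
      obtain ⟨hn'A, hz'⟩ := (hl n').1 (List.mem_toFinset.1 hn')
      rw [coefDiff_eq_zero hS hS' (hwall n' hn'A hz') (Or.inr fun h0 => hnot ?_), mul_zero]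
      rcases hz.unique n' hn'A hz' h0 with rfl | rfl <;> simp
  -- the two half lines of the circle in the hyperplane `n = 0` are those of `z ± ε m`
  set f := Real.cos (τ n) • u + Real.sin (τ n) • w with hf
  obtain ⟨hsin, hcos⟩ := H.sin_cos_neg hn hz.zero
  have e1 : circle z u w ε (τ n) = z + ε • f := rfl
  have e2 : circle z u w ε (τ (-n)) = z + ε • -f := by
    rw [circle, hsin, hcos, hf]; module
  have hfn : pair n f = 0 := by
    have := (hwall n hn hz.zero).1
    rw [e1, map_add, hz.zero, zero_add, map_smul, smul_eq_mul] at this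
    exact (mul_eq_zero.1 this).resolve_left hε.ne'
  have hfn₁ : pair n₁ f ≠ 0 := by
    intro h0
    rcases (hwall n hn hz.zero).2 n₁ hn₁ (by rw [e1, map_add, hz₁, map_smul, h0]; simp) with h | h
    exacts [hne h, hne' h]
  have hsame : ∀ g : RealSpan M, pair n g = 0 → Near A z (z + ε • g) → ∀ a : ℝ,
      0 < a * (pair n₁ g / n₁ m) → Near A z (z + a • incl m) →
      coefDiff S S' (j + 1) p (z + ε • g) = coefDiff S S' (j + 1) p (z + a • incl m) := by
    intro g hg hng a ha hna
    refine coefDiff_congr hS hS' fun n' hn' => ?_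
    by_cases hz' : pair n' z = 0
    · have e3 : pair n' (z + ε • g) = ε * (pair n₁ g / n₁ m * n' m) := by
        rw [map_add (pair n'), hz', zero_add, map_smul, smul_eq_mul, hprop n' hn' hz' g hg]
      have e4 : pair n' (z + a • incl m) = a * (n' m : ℝ) := by
        rw [map_add (pair n'), hz', zero_add, map_smul, pair_incl, smul_eq_mul]
      rw [e3, e4, sign_mul, sign_mul, sign_mul, sign_pos hε, one_mul]
      congr 1
      rcases lt_trichotomy a 0 with h | h | h
      · rw [sign_neg h, sign_neg (by nlinarith)]
      · rw [h, zero_mul] at ha; exact absurd ha (lt_irrefl _)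
      · rw [sign_pos h, sign_pos (pos_of_mul_pos_right ha h.le)]
    · rw [hng n' hn' hz', hna n' hn' hz']
  have hng1 : Near A z (z + ε • f) := hnear (τ n)
  have hng2 : Near A z (z + ε • -f) := e2 ▸ hnear (τ (-n))
  have hfn' : pair n (-f) = 0 := by rw [map_neg, hfn, neg_zero]
  rw [e1, e2] at h6
  have hs0 : pair n₁ f / n₁ m ≠ 0 := div_ne_zero hfn₁ hm₁'
  have hneg : pair n₁ (-f) / n₁ m = -(pair n₁ f / n₁ m) := by rw [map_neg, neg_div]
  filter_upwards [eventually_near A z (incl m), eventually_near A z (-incl m), self_mem_nhdsWithin]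
    with η hp hq (hη : 0 < η)
  rw [smul_neg, ← neg_smul] at hq
  rw [sub_eq_add_neg, ← neg_smul]
  rcases lt_or_gt_of_ne hs0 with h | h
  · rw [← hsame f hfn hng1 (-η) (by nlinarith) hq, h6,
      hsame (-f) hfn' hng2 η (by rw [hneg]; nlinarith) hp]
  · rw [← hsame (-f) hfn' hng2 (-η) (by rw [hneg]; nlinarith) hq, ← h6,
      hsame f hfn hng1 η (by nlinarith) hp]

/-- Far away in the direction `r p`, only incoming walls have functions involving `z^p`, and these
belong to `D`. -/
theorem coef_logAt_far [Fintype D.ι] (h : D.IsScatter S)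
    (hS : ∀ i ∈ S.active j, Adapted A (S.wall i).cone) (y : RealSpan M) :
    coef k j p (S.logAt j (far A (r p) y)) =
      ∑ i, coef k j p (wallLog j (D.wall i) (far A (r p) y)) := by
  classical
  obtain ⟨-, e, he, hout⟩ := h
  rw [S.logAt_eq_sum ((S.finite j).toFinset ∪ Finset.univ.map e)
    (fun i hi => Finset.mem_coe.2 (Finset.mem_union_left _ (by simpa [active] using hi))), map_sum,
    ← Finset.sum_subset (s₁ := Finset.univ.map e) Finset.subset_union_right, Finset.sum_map]
  · simp only [he]
  · intro i hi hi'
    have hact : i ∈ S.active j := by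
      rcases Finset.mem_union.1 hi with h | h
      · simpa [active] using h
      · exact absurd h hi'
    by_contra h0
    refine hout i (fun ⟨a, ha⟩ => hi' (Finset.mem_map.2 ⟨a, Finset.mem_univ _, ha⟩))
      (Wall.isIncoming_of_far (hS i hact) (fun n hn h1 => sign_pair_far hn h1) h0)

/-- The functions of two completions agree at general points of the walls. -/
theorem logAt_eq_of_onWall [Fintype D.ι] (hS : D.IsScatter S) (hS' : D.IsScatter S') :
    ∀ (j : ℕ) (A : Finset (DualLat M)), IsArr A →
      (∀ i ∈ S.active j, Adapted A (S.wall i).cone) →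
      (∀ i ∈ S'.active j, Adapted A (S'.wall i).cone) →
      ∀ n ∈ A, ∀ y, OnWall A n y → S.logAt j y = S'.logAt j y := by
  intro j
  induction j with
  | zero =>
    intro _ _ _ _ _ _ y _
    have : Subsingleton (Lvl k P 0) := Ideal.Quotient.subsingleton_iff.2 (by simp)
    exact Subsingleton.elim _ _
  | succ j ih =>
    intro A hA had had' n hn y hy
    have hred := ih A hA (fun i hi => had i (active_subset_succ S j hi))
      (fun i hi => had' i (active_subset_succ S' j hi))
    refine eq_of_coef fun p _ => ?_
    by_cases hpj : p ∈ ordSet P j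
    swap
    · rw [← coef_lvlMap hpj, ← coef_lvlMap hpj, lvlMap_logAt, lvlMap_logAt, hred n hn y hy]
    suffices h : coefDiff S S' (j + 1) p y = 0 from (sub_eq_zero.1 h).symm
    by_cases hm : r p = 0 ∨ n (r p) ≠ 0
    · exact coefDiff_eq_zero had had' hy hm
    push Not at hm
    obtain ⟨A', hA', hsub, hcl⟩ := exists_closedAlong hA {r p}
    obtain ⟨y', hy', hnear⟩ := exists_onWall_near hA' (hsub hn) hy.1
    have hsame : SameSigns A y y' := fun n' hn' => by
      by_cases h0 : pair n' y = 0
      · rcases hy.2 n' hn' h0 with rfl | rfl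
        · rw [hy.1, hy'.1]
        · rw [pair_neg, pair_neg, hy.1, hy'.1]
      · exact (hnear n' (hsub hn') h0).symm
    rw [coefDiff_congr had had' hsame]
    obtain ⟨x, x', hc⟩ := hy'.exists_cross (hA'.prim n (hsub hn))
    obtain ⟨u, hu⟩ := pair_ne_zero_of_ne (hA.prim n hn).ne_zero
    -- as `e` vanishes on the transversal hyperplanes, its ray sums are zero, and `raySum_parallel`
    -- compares the values of `coefDiff` at `y'` and far away
    let e : DualLat M → RealSpan M → k := fun n' y =>
      if n' (r p) = 0 then coefDiff S S' (j + 1) p y else 0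
    have he0 : ∀ n', n' (r p) < 0 → ∀ y, e n' y = 0 := fun n' h y => if_neg h.ne
    have hen : ∀ y, e n y = coefDiff S S' (j + 1) p y := fun y => if_pos hm.2
    have hray : ∀ x, raySum A (r p) e x = 0 := fun x =>
      Finset.sum_eq_zero fun n' hn' => he0 n' (Finset.mem_filter.1 hn').2.1 _
    have key := raySum_parallel (e := e) hA hA' hsub (hcl _ (by simp))
      (fun n' hn' y y' _ h => by simp only [e, coefDiff_congr had had' h])
      (fun n' _ _ y _ hg => by
        simp only [e, coefDiff, logAt_of_gen had hg, logAt_of_gen had' hg, sub_self, ite_self])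
      (hsub hn) hm.2 hc ⊥ hu
      (fun z hz => by
        filter_upwards [coefDiff_pencil hA had had' hS.1 hS'.1 hred hn hm.2 hz] with ε hε
        rw [hen, hen, hε, sub_self, zero_add]
        rw [Finset.sum_eq_zero fun n' hn' => by
          rw [he0 n' (Finset.mem_filter.1 hn').2.1, he0 n' (Finset.mem_filter.1 hn').2.1, sub_self]]
        exact zero_mem _)
      (T := farTime A y') farTime_pos.le (by
        intro n' hn' hlt
        have h2 := sign_pair_far (m := r p) (x := y') hn' hlt.ne
        have h3 := (sign_eq_iff_neg h2).2 (by exact_mod_cast hlt)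
        simpa [far] using h3)
    rw [hray, hray, hen, hen, AddSubgroup.mem_bot, add_zero, sub_zero, sub_eq_zero] at key
    rw [key]
    change coefDiff S S' (j + 1) p (far A (r p) y') = 0
    rw [coefDiff, coef_logAt_far hS had, coef_logAt_far hS' had', sub_self]

/-- The walls of a diagram through a nonsingular point lie in one hyperplane. -/
theorem exists_normal_of_notMem_sing (hD : ∀ i ∈ D.active j, Adapted A (D.wall i).cone)
    (hx : x ∉ D.sing j) (hxs : x ∈ D.supp j) : ∃ n ∈ A, pair n x = 0 ∧
      ∀ i ∈ D.active j, x ∈ (D.wall i).cone → ∀ y ∈ (D.wall i).cone, pair n y = 0 := by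
  obtain ⟨i₀, hi₀, hx₀⟩ := hxs
  obtain ⟨n, hn, hn₀⟩ := (hD i₀ hi₀).exists_normal (D.wall i₀).codim_one
  refine ⟨n, hn, hn₀ x hx₀, fun i hi hxi y hy => zero_of_mem_lin hn₀ ?_⟩
  rw [lin_eq_of_notMem_sing hx hi₀ hi hx₀ hxi]
  exact mem_lin hy

/-- Two completions of a finite diagram by non-incoming walls are equivalent. -/
theorem ScatteringDiagram.IsScatter.equivalent [Fintype D.ι] (hS : D.IsScatter S)
    (hS' : D.IsScatter S') : S.Equivalent S' := by
  classical
  intro j x hx hx'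
  suffices h : S.logAt j x = S'.logAt j x by
    have h1 := congrArg ex h
    unfold logAt at h1
    rw [ex_lg (S.funcAt_sub_one_mem x), ex_lg (S'.funcAt_sub_one_mem x)] at h1
    exact Units.ext h1
  obtain ⟨A, hA, had⟩ := exists_adapted_family
    (S := (fun i => (S.wall i).cone) '' S.active j ∪ (fun i => (S'.wall i).cone) '' S'.active j)
    (((S.finite j).image _).union ((S'.finite j).image _)) (by
      rintro _ (⟨i, -, rfl⟩ | ⟨i, -, rfl⟩)
      exacts [(S.wall i).rational, (S'.wall i).rational])
  have h1 : ∀ i ∈ S.active j, Adapted A (S.wall i).cone := fun i hi => had _ (Or.inl ⟨i, hi, rfl⟩)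
  have h2 : ∀ i ∈ S'.active j, Adapted A (S'.wall i).cone := fun i hi => had _ (Or.inr ⟨i, hi, rfl⟩)
  have hgen := logAt_eq_of_onWall hS hS' j A hA h1 h2
  -- moving a little in the hyperplane of the walls
  have hmove : ∀ T : ScatteringDiagram k r, (∀ i ∈ T.active j, Adapted A (T.wall i).cone) →
      x ∉ T.sing j → ∀ n ∈ A,
      (∀ i ∈ T.active j, x ∈ (T.wall i).cone → ∀ y ∈ (T.wall i).cone, pair n y = 0) →
      ∀ z, Near A x z → (pair n z = 0 → T.logAt j z = T.logAt j x) ∧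
        (pair n z ≠ 0 → T.logAt j z = 0) := by
    intro T hT hxT n hn hnT z hz
    refine ⟨fun h0 => T.logAt_congr fun i hi => (hT i hi).mem_iff_of_near (T.wall i).codim_one
      (hA.prim n hn).ne_zero (fun hxi => ⟨mem_relInt_of_notMem_sing hxT hi hxi, hnT i hi hxi⟩)
        hz h0,
      fun h0 => T.logAt_eq_zero ?_⟩
    rintro ⟨i, hi, hzi⟩
    exact h0 (hnT i hi ((hT i hi).mem_of_near hz hzi) z hzi)
  have hsame : ∀ n ∈ A, pair n x = 0 →
      (∀ i ∈ S.active j, x ∈ (S.wall i).cone → ∀ y ∈ (S.wall i).cone, pair n y = 0) →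
      (∀ i ∈ S'.active j, x ∈ (S'.wall i).cone → ∀ y ∈ (S'.wall i).cone, pair n y = 0) →
      S.logAt j x = S'.logAt j x := by
    intro n hn hnx h3 h4
    obtain ⟨z, hz, hxz⟩ := exists_onWall_near hA hn hnx
    rw [← (hmove S h1 hx n hn h3 z hxz).1 hz.1, ← (hmove S' h2 hx' n hn h4 z hxz).1 hz.1,
      hgen n hn z hz]
  by_cases hs : x ∈ S.supp j
  · obtain ⟨n, hn, hnx, h3⟩ := exists_normal_of_notMem_sing h1 hx hs
    by_cases hs' : x ∈ S'.supp j
    · obtain ⟨n', hn', hnx', h4⟩ := exists_normal_of_notMem_sing h2 hx' hs'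
      by_cases hnn : n' = n ∨ n' = -n
      · refine hsame n hn hnx h3 fun i hi hxi y hy => ?_
        rcases hnn with rfl | rfl
        · exact h4 i hi hxi y hy
        · simpa using h4 i hi hxi y hy
      · -- the walls of the two diagrams lie in different hyperplanes
        obtain ⟨z, hz, hxz⟩ := exists_onWall_near hA hn hnx
        obtain ⟨z', hz', hxz'⟩ := exists_onWall_near hA hn' hnx'
        have h5 : pair n' z ≠ 0 := fun h => hnn (hz.2 n' hn' h)
        have h6 : pair n z' ≠ 0 := fun h => by
          rcases hz'.2 n hn h with e | e
          · exact hnn (Or.inl e.symm)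
          · exact hnn (Or.inr (by rw [e, neg_neg]))
        rw [← (hmove S h1 hx n hn h3 z hxz).1 hz.1, hgen n hn z hz,
          (hmove S' h2 hx' n' hn' h4 z hxz).2 h5, ← (hmove S' h2 hx' n' hn' h4 z' hxz').1 hz'.1,
          ← hgen n' hn' z' hz', (hmove S h1 hx n hn h3 z' hxz').2 h6]
    · exact hsame n hn hnx h3 fun i hi hxi => absurd ⟨i, hi, hxi⟩ hs'
  · by_cases hs' : x ∈ S'.supp j
    · obtain ⟨n', hn', hnx', h4⟩ := exists_normal_of_notMem_sing h2 hx' hs'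
      exact hsame n' hn' hnx' (fun i hi hxi => absurd ⟨i, hi, hxi⟩ hs) h4
    · rw [S.logAt_eq_zero hs, S'.logAt_eq_zero hs']

end Uniqueness

end Scattering

end

theorem theorem5p4 {k : Type*} [Field k] [CharZero k]
    {P : Type*} [AddCommMonoid P] (hP : Scattering.IsToricMonoid P)
    {M : Type*} [AddCommGroup M] [Module.Free ℤ M] [Module.Finite ℤ M]
    (r : P →+ M) {q : ℕ} (W : Fin q → Scattering.Widget k r) :
    (∃ S : Scattering.ScatteringDiagram k r, (Scattering.widgetUnion W).IsScatter S) ∧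
      ∀ S S' : Scattering.ScatteringDiagram k r, (Scattering.widgetUnion W).IsScatter S →
        (Scattering.widgetUnion W).IsScatter S' → S.Equivalent S' := by
  have : Finite (Scattering.widgetUnion W).ι := inferInstanceAs (Finite (Σ a, (W a).Index))
  have := Fintype.ofFinite (Scattering.widgetUnion W).ι
  exact ⟨Scattering.exists_isScatter W, fun S S' h h' => h.equivalent h'⟩
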